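/- **Setting.** Let $p$ be a prime and $D$ a square-free nonzero integer (the case $D=1$ and negative $D$ are allowed). Let $W_4=\mathbf Q_p^4$ (row vectors) with basis $e_1,e_2,f_1,f_2$, let $J_4=\begin{pmatrix}0&1_2\\-1_2&0\end{pmatrix}$, and $G=\mathrm{GSp}_4(\mathbf Q_p)=\{g\in \mathrm{GL}_4(\mathbf Q_p): gJ_4{}^tg=\nu(g)J_4\}$, acting on $W_4$ on the right, with centre $Z$ and $K=\mathrm{GSp}_4(\mathbf Z_p)$. Let $U$ be the group of matrices $u=\begin{pmatrix}1_2&X\\0&1_2\end{pmatrix}$ in $G$, with $X=\begin{pmatrix}u_{11}&u_{12}\\u_{12}&u_{22}\end{pmatrix}$. Let $\psi$ be an additive character of $\mathbf Q_p$ for which $\mathbf Z_p$ is the largest fractional ideal on which it is trivial, and put $\chi(u)=\psi(-Du_{11}+u_{22})$ if $D\not\equiv1\pmod 4$ and $\chi(u)=\psi(\tfrac{1-D}{4}u_{11}+u_{12}+u_{22})$ if $D\equiv 1\pmod 4$. Let $L_p=\mathbf Q_p[x]/(x^2-D)$; let $\omega$ be the class of $x$ if $D\not\equiv 1\pmod 4$,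 and $\omega=\frac{-1+x}{2}$ if $D\equiv1\pmod 4$. Identify $W_4$ with $L_p^2=L_pc_1\oplus L_pc_2$ by $e_1=c_1,\ e_2=\omega c_1,\ f_1=-\bar\omega c_2,\ f_2=c_2$. This embeds $\mathrm{GL}^*_{2,L}(\mathbf Q_p)=\{h\in\mathrm{GL}_2(L_p):\det h\in\mathbf Q_p^\times\}$ in $G$; let $N$ be the image of the matrices $\begin{pmatrix}1&x\\0&1\end{pmatrix}$, $x\in L_p$. Then $N\subset U$ and $\chi$ is trivial on $N$. Let $V_5\subset\wedge^2W_4\otimes\nu^{-1}$ be the kernel of the symplectic pairing, $V_5(\mathbf Z_p)$ the lattice with basis $c\,(e_1\wedge f_1-e_2\wedge f_2),\ e_1\wedge e_2,\ e_1\wedge f_2,\ e_2\wedge f_1,\ f_1\wedge f_2$, where $c=1$ if $D\not\equiv1\pmod 4$ and $c=\frac12$ if $D\equiv1\pmod4$, and $v_D=De_1\wedge f_2+e_2\wedge f_1$, respectively $v_D=\frac{D-1}4e_1\wedge f_2+\frac12(e_1\wedge f_1-e_2\wedge f_2)+e_2\wedge f_1$. Let $\alpha_p$ and $\Phi_p$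 be the characteristic functions of $V_5(\mathbf Z_p)$ and $W_4(\mathbf Z_p)=\mathbf Z_p^4$, and $$\alpha_{\chi,p}(g)=\int_{N\backslash U}\chi(u)\alpha_p(v_Dug)\,du,\qquad f_p(g,s)=|\nu(g)|^{2s}\int_{\mathbf Q_p^\times}\Phi_p(tf_2g)|t|^{4s}\,d^\times t .$$ The measures on $N\backslash U$, $UZ\backslash G$ and $NZ\backslash\mathrm{GL}^*_{2,L}(\mathbf Q_p)$ are the right invariant ones for which the image of the integral points ($U\cap K$, $K$, $\mathrm{GL}^*_{2,L}(\mathbf Q_p)\cap K$) has volume one, and $\mathbf Z_p^\times$ has volume one. Let $B\subset G$ be the Borel subgroup that is upper triangular in the ordered basis $e_1,e_2,f_2,f_1$, $\delta_B$ its modulus character, $\alpha$ an unramified character of its diagonal torus, and $\pi$, on the space $V$, the unramified irreducible subquotient of $\mathrm{ind}_B^{G}(\delta_B^{1/2}\alpha)$; assume that $\pi$ has trivial central character. With $t$ running over $\mathrm{diag}(p,p,1,1)$, $\mathrm{diag}(p,1,p,1)$, $\mathrm{diag}(1,p,1,p)$, $\mathrm{diag}(1,1,p,p)$ (same ordered basis),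 $L(\pi,\mathrm{Spin},s)=\prod_t(1-\alpha(t)p^{-s})^{-1}$. Let $v_0\in V$ be a nonzero $K$-fixed vector. A $(U,\chi)$-functional is a linear map $\ell:V\to\mathbf C$ with $\ell(\pi(u)v)=\chi(u)\ell(v)$ for all $u\in U$, $v\in V$. Consider the integrals $$I_p(\ell,s)=\int_{UZ\backslash G}f_p(g,s)\alpha_{\chi,p}(g)\ell(\pi(g)v_0)\,dg,\qquad J_p(\ell,s)=\int_{NZ\backslash \mathrm{GL}^*_{2,L}(\mathbf Q_p)}f_p(g,s)\ell(\pi(g)v_0)\,dg .$$ **Theorem.** There is a real number $s_0$ such that for every $(U,\chi)$-functional $\ell$ and every $s\in\mathbf C$ with $\mathrm{Re}(s)>s_0$, $$I_p(\ell,s)=\ell(v_0)\,L(\pi,\mathrm{Spin},2s-\tfrac12)\qquad\text{and}\qquad J_p(\ell,s)=\ell(v_0)\,L(\pi,\mathrm{Spin},2s-\tfrac12),$$ in the following sense. Put $\tau(g)=|\nu(g)|/\|f_2g\|^2$, with the maximum norm on $W_4$, so that $f_p(g,s)$ is a function of $s$ times $\tau(g)^{2s}$. 1. Each integrand is integrable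 on each set $\{\tau=p^k\}$, $k\in\mathbf Z$, and the sum over $k$ of the integrals over these sets converges to $\ell(v_0)L(\pi,\mathrm{Spin},2s-\frac12)$. 2. Whenever one of the integrals converges absolutely at $s$, it equals $\ell(v_0)L(\pi,\mathrm{Spin},2s-\frac12)$. Moreover, both integrals converge absolutely for $\mathrm{Re}(s)$ sufficiently large (depending on $\ell$) if $D$ is not a square in $\mathbf Q_p$, and also if $g\mapsto\ell(\pi(g)v_0)$ has moderate growth, that is, $|\ell(\pi(g)v_0)|\le C\,(\max_{i,j}|g_{ij}|^2/|\nu(g)|)^A$ on $G$ for some constants $C,A$. -/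

import Mathlib

open MeasureTheory
open scoped Matrix

noncomputable section

namespace KohnenSkoruppa

/-! ### Quotients `H \ G` and their invariant measures -/

/-- The space `H \ G` of right cosets `H g`. -/
def RightQuot {G : Type*} [Group G] (H : Subgroup G) : Type _ :=
  Quotient (QuotientGroup.rightRel H)

/-- The coset `H g`. -/
def RightQuot.mk {G : Type*} [Group G] (H : Subgroup G) (g : G) : RightQuot H :=
  Quotient.mk (QuotientGroup.rightRel H) g

/-- A representative of a coset.  A left `H`-invariant function `F` on `G` descends to the function
`x ↦ F x.rep` on `H \ G`, whatever the representatives. -/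
def RightQuot.rep {G : Type*} [Group G] {H : Subgroup G} (x : RightQuot H) : G :=
  Quotient.out x

/-- The quotient topology. -/
instance {G : Type*} [Group G] [TopologicalSpace G] (H : Subgroup G) :
    TopologicalSpace (RightQuot H) :=
  inferInstanceAs (TopologicalSpace (Quotient (QuotientGroup.rightRel H)))

/-- The Borel sigma-algebra. -/
instance {G : Type*} [Group G] [TopologicalSpace G] (H : Subgroup G) :
    MeasurableSpace (RightQuot H) :=
  borel _

/-- Right translation `H x ↦ H x g`. -/
def RightQuot.translate {G : Type*} [Group G] {H : Subgroup G} (g : G) :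
    RightQuot H → RightQuot H :=
  Quotient.map (fun x => x * g) (by
    intro a b hab
    change QuotientGroup.rightRel H _ _
    replace hab : QuotientGroup.rightRel H a b := hab
    rw [QuotientGroup.rightRel_apply] at hab ⊢
    simpa [mul_assoc] using hab)

/-- `μ` is the right `G`-invariant measure on `H \ G` for which the image of the compact open
subgroup `K` has volume one. -/
def IsInvariantMeasure {G : Type*} [Group G] [TopologicalSpace G] (H K : Subgroup G)
    (μ : Measure (RightQuot H)) : Prop :=
  (∀ g : G, MeasurePreserving (RightQuot.translate g) μ μ) ∧
    μ (RightQuot.mk H '' (K : Set G)) = 1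

/-- `F` is integrable on each of the shells `{τ = q ^ k}`, and the sum over `k ∈ ℤ` of the integrals
of `F` over these shells converges, with value `A`. -/
def HasShellIntegral {X : Type*} [MeasurableSpace X] (μ : Measure X) (τ : X → ℝ) (q : ℝ)
    (F : X → ℂ) (A : ℂ) : Prop :=
  (∀ k : ℤ, IntegrableOn F {x | τ x = q ^ k} μ) ∧
    HasSum (fun k : ℤ => ∫ x in {x | τ x = q ^ k}, F x ∂μ) A

/-! ### The group `GSp₄` -/

/-- The index set of the basis `e₁, e₂, f₁, f₂` of `W₄`: `inl 0, inl 1` stand for `e₁, e₂` and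
`inr 0, inr 1` for `f₁, f₂`. -/
abbrev Idx : Type := Fin 2 ⊕ Fin 2

/-- The matrix `J₄` of the symplectic form. -/
def J4 (R : Type*) [CommRing R] : Matrix Idx Idx R := Matrix.fromBlocks 0 1 (-1) 0

variable (p : ℕ) [Fact p.Prime]

/-- `GSp₄(ℚ_p) = {g ∈ GL₄(ℚ_p) | g J₄ ᵗg = ν(g) J₄}`. -/
def GSp4 : Subgroup (GL Idx ℚ_[p]) where
  carrier := {g | ∃ c : ℚ_[p]ˣ,
    (g : Matrix Idx Idx ℚ_[p]) * J4 ℚ_[p] * (g : Matrix Idx Idx ℚ_[p])ᵀ = (c : ℚ_[p]) • J4 ℚ_[p]}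
  one_mem' := ⟨1, by simp⟩
  mul_mem' := by
    rintro a b ⟨c, hc⟩ ⟨d, hd⟩
    refine ⟨d * c, ?_⟩
    have : ((a * b : GL Idx ℚ_[p]) : Matrix Idx Idx ℚ_[p]) * J4 ℚ_[p]
        * ((a * b : GL Idx ℚ_[p]) : Matrix Idx Idx ℚ_[p])ᵀ
        = (a : Matrix Idx Idx ℚ_[p]) * ((b : Matrix Idx Idx ℚ_[p]) * J4 ℚ_[p]
        * (b : Matrix Idx Idx ℚ_[p])ᵀ) * (a : Matrix Idx Idx ℚ_[p])ᵀ := by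
      simp only [Units.val_mul, Matrix.transpose_mul, Matrix.mul_assoc]
    rw [this, hd, Matrix.mul_smul, Matrix.smul_mul, hc, smul_smul]
    simp
  inv_mem' := by
    rintro a ⟨c, hc⟩
    refine ⟨c⁻¹, ?_⟩
    have h1 : ((a⁻¹ : GL Idx ℚ_[p]) : Matrix Idx Idx ℚ_[p]) * (a : Matrix Idx Idx ℚ_[p]) = 1 := by
      rw [← Units.val_mul]; simp
    have h2 : (a : Matrix Idx Idx ℚ_[p])ᵀ * ((a⁻¹ : GL Idx ℚ_[p]) : Matrix Idx Idx ℚ_[p])ᵀ = 1 := by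
      rw [← Matrix.transpose_mul, h1, Matrix.transpose_one]
    have h3 : J4 ℚ_[p] = ((c⁻¹ : ℚ_[p]ˣ) : ℚ_[p]) • ((a : Matrix Idx Idx ℚ_[p]) * J4 ℚ_[p]
        * (a : Matrix Idx Idx ℚ_[p])ᵀ) := by
      rw [hc, smul_smul]; simp
    conv_lhs => rw [h3]
    rw [Matrix.mul_smul, Matrix.smul_mul]
    congr 1
    calc _ = (((a⁻¹ : GL Idx ℚ_[p]) : Matrix Idx Idx ℚ_[p]) * (a : Matrix Idx Idx ℚ_[p])) * J4 ℚ_[p]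
          * ((a : Matrix Idx Idx ℚ_[p])ᵀ * ((a⁻¹ : GL Idx ℚ_[p]) : Matrix Idx Idx ℚ_[p])ᵀ) := by
          simp only [Matrix.mul_assoc]
      _ = _ := by rw [h1, h2]; simp

variable {p}

/-- The underlying `4 × 4` matrix of an element of `GSp₄(ℚ_p)`. -/
def mat (g : GSp4 p) : Matrix Idx Idx ℚ_[p] := ((g : GL Idx ℚ_[p]) : Matrix Idx Idx ℚ_[p])

theorem mat_one : mat (1 : GSp4 p) = 1 := rfl

theorem mat_mul (g h : GSp4 p) : mat (g * h) = mat g * mat h := rfl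

theorem mat_inv (g : GSp4 p) : mat g⁻¹ = (mat g)⁻¹ :=
  Matrix.coe_units_inv (g : GL Idx ℚ_[p])

/-- The similitude `ν(g)`: the `(e₁, f₁)` entry of `g J₄ ᵗg = ν(g) J₄`. -/
def nu (g : GSp4 p) : ℚ_[p] := (mat g * J4 ℚ_[p] * (mat g)ᵀ) (Sum.inl 0) (Sum.inr 0)

variable (p)

/-- `K = GSp₄(ℤ_p)`, the elements of `GSp₄(ℚ_p)` that lie in `GL₄(ℤ_p)`. -/
def maxCompact : Subgroup (GSp4 p) :=
  (Matrix.GeneralLinearGroup.map (n := Idx) (algebraMap ℤ_[p] ℚ_[p])).range.comap (GSp4 p).subtype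

/-- The centre `Z(ℚ_p)` (the scalar matrices). -/
abbrev centre : Subgroup (GSp4 p) := Subgroup.center (GSp4 p)

/-- `U`, the unipotent radical of the Siegel parabolic stabilizing the span of `f₁, f₂`: the
matrices `(1, X; 0, 1)` in `GSp₄(ℚ_p)`. -/
def unipU : Subgroup (GSp4 p) where
  carrier := {g | ∃ X : Matrix (Fin 2) (Fin 2) ℚ_[p], mat g = Matrix.fromBlocks 1 X 0 1}
  one_mem' := ⟨0, by rw [mat_one, Matrix.fromBlocks_one]⟩
  mul_mem' := by
    rintro a b ⟨X, hX⟩ ⟨Y, hY⟩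
    refine ⟨X + Y, ?_⟩
    rw [mat_mul, hX, hY, Matrix.fromBlocks_multiply]
    simp [add_comm]
  inv_mem' := by
    rintro a ⟨X, hX⟩
    refine ⟨-X, ?_⟩
    rw [mat_inv, hX]
    apply Matrix.inv_eq_right_inv
    rw [Matrix.fromBlocks_multiply]
    simp

/-! ### The quadratic algebra `L` and the group `GL*_{2,L}` -/

/-- The coefficient `a` in the equation `ω² = a + b ω` of the generator `ω` of `L`. -/
def coeffA (D : ℤ) : ℚ_[p] := if D % 4 = 1 then ((D : ℚ_[p]) - 1) / 4 else (D : ℚ_[p])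

/-- The coefficient `b` in the equation `ω² = a + b ω` of the generator `ω` of `L`. -/
def coeffB (D : ℤ) : ℚ_[p] := if D % 4 = 1 then -1 else 0

/-- `L ⊗ ℚ_p`, where `L` is the quadratic étale `ℚ`-algebra `ℚ[x] / (x² - D)`: generated by an
element `ω` with `ω² = D` if `D ≢ 1 (mod 4)`, and with `ω² + ω + (1 - D) / 4 = 0` if
`D ≡ 1 (mod 4)`. -/
abbrev LAlg (D : ℤ) : Type := QuadraticAlgebra ℚ_[p] (coeffA p D) (coeffB p D)

/-- The identification `W₄(ℚ_p) ≃ (L ⊗ ℚ_p)²` (row vectors) given by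
`e₁ = c₁, e₂ = ω c₁, f₁ = -ω̄ c₂, f₂ = c₂`. -/
def toL2 (D : ℤ) (w : Idx → ℚ_[p]) : Fin 2 → LAlg p D :=
  ![w (Sum.inl 0) • 1 + w (Sum.inl 1) • QuadraticAlgebra.omega,
    w (Sum.inr 0) • (-star QuadraticAlgebra.omega) + w (Sum.inr 1) • 1]

/-- For a subgroup `S` of `GL₂(L ⊗ ℚ_p)`, the elements of `GSp₄(ℚ_p)` that act on
`W₄ ≃ (L ⊗ ℚ_p)²` through an element of `S` (matrices act on row vectors on the right). -/
def ofGL2L (D : ℤ) (S : Subgroup (GL (Fin 2) (LAlg p D))) : Subgroup (GSp4 p) where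
  carrier := {g | ∃ h ∈ S, ∀ w : Idx → ℚ_[p],
    toL2 p D (w ᵥ* mat g) = toL2 p D w ᵥ* (h : Matrix (Fin 2) (Fin 2) (LAlg p D))}
  one_mem' := ⟨1, S.one_mem, fun w => by simp [mat_one]⟩
  mul_mem' := by
    rintro a b ⟨h, hS, hh⟩ ⟨k, kS, hk⟩
    refine ⟨h * k, S.mul_mem hS kS, fun w => ?_⟩
    rw [mat_mul, ← Matrix.vecMul_vecMul, hk, hh, Matrix.vecMul_vecMul, Units.val_mul]
  inv_mem' := by
    rintro a ⟨h, hS, hh⟩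
    refine ⟨h⁻¹, S.inv_mem hS, fun w => ?_⟩
    have h1 : mat a⁻¹ * mat a = 1 := by rw [← mat_mul, inv_mul_cancel, mat_one]
    have h2 := hh (w ᵥ* mat a⁻¹)
    rw [Matrix.vecMul_vecMul, h1, Matrix.vecMul_one] at h2
    rw [h2, Matrix.vecMul_vecMul, ← Units.val_mul, mul_inv_cancel, Units.val_one,
      Matrix.vecMul_one]

/-- `GL*_{2,L}(ℚ_p)`, the elements of `GL₂(L ⊗ ℚ_p)` with determinant in `ℚ_pˣ`, embedded in
`GSp₄(ℚ_p)`. -/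
def gl2L (D : ℤ) : Subgroup (GSp4 p) :=
  ofGL2L p D
    ((Units.map (algebraMap ℚ_[p] (LAlg p D)).toMonoidHom).range.comap
      Matrix.GeneralLinearGroup.det)

/-- `N`, the unipotent radical of the upper triangular Borel subgroup of `GL*_{2,L}`: the image
of the matrices `(1, x; 0, 1)` with `x ∈ L ⊗ ℚ_p`. -/
def unipN (D : ℤ) : Subgroup (GSp4 p) :=
  ofGL2L p D
    (Matrix.GeneralLinearGroup.upperRightHom (R := LAlg p D)).toMonoidHom.range

variable {p}

/-! ### The character `χ`, the space `V₅` and the function `α_χ` -/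

/-- The additive character `ψ` of `ℚ_p` has conductor one: `ℤ_p` is the largest fractional ideal
on which it is trivial. -/
def HasConductorOne (ψ : AddChar ℚ_[p] ℂ) : Prop :=
  (∀ x : ℚ_[p], ‖x‖ ≤ 1 → ψ x = 1) ∧ ∃ x : ℚ_[p], ‖x‖ ≤ p ∧ ψ x ≠ 1

/-- The character `χ` of `U`, in terms of the entries `u₁₁, u₁₂, u₂₂` of the upper right block. -/
def chi (D : ℤ) (ψ : AddChar ℚ_[p] ℂ) (u : GSp4 p) : ℂ :=
  if D % 4 = 1 then
    ψ ((1 - (D : ℚ_[p])) / 4 * mat u (Sum.inl 0) (Sum.inr 0)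
      + mat u (Sum.inl 0) (Sum.inr 1) + mat u (Sum.inl 1) (Sum.inr 1))
  else
    ψ (-(D : ℚ_[p]) * mat u (Sum.inl 0) (Sum.inr 0) + mat u (Sum.inl 1) (Sum.inr 1))

variable (p)

/-- The exterior square of `W₄(ℚ_p)`, which contains `V₅(ℚ_p)` as the kernel of the symplectic
pairing. -/
abbrev Wedge2 : Type := ↥(⋀[ℚ_[p]]^2 (Idx → ℚ_[p]))

/-- The basis vectors `e₁, e₂` of `W₄`. -/
def basisE (i : Fin 2) : Idx → ℚ_[p] := Pi.single (Sum.inl i) 1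

/-- The basis vectors `f₁, f₂` of `W₄`. -/
def basisF (i : Fin 2) : Idx → ℚ_[p] := Pi.single (Sum.inr i) 1

variable {p}

/-- `x ∧ y`. -/
def wedge (x y : Idx → ℚ_[p]) : Wedge2 p := exteriorPower.ιMulti ℚ_[p] 2 ![x, y]

/-- The right action of `GSp₄` on `∧² W₄ ⊗ ν⁻¹`. -/
def actWedge (v : Wedge2 p) (g : GSp4 p) : Wedge2 p :=
  (nu g)⁻¹ • exteriorPower.map 2 (Matrix.vecMulLinear (mat g)) v

variable (p)

/-- The integral basis of `V₅`. -/
def basisV5 (D : ℤ) : Fin 5 → Wedge2 p :=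
  ![(if D % 4 = 1 then (1 / 2 : ℚ_[p]) else 1) •
      (wedge (basisE p 0) (basisF p 0) - wedge (basisE p 1) (basisF p 1)),
    wedge (basisE p 0) (basisE p 1), wedge (basisE p 0) (basisF p 1),
    wedge (basisE p 1) (basisF p 0), wedge (basisF p 0) (basisF p 1)]

/-- The lattice `V₅(ℤ_p)`. -/
def latticeV5 (D : ℤ) : Set (Wedge2 p) :=
  {v | ∃ c : Fin 5 → ℤ_[p], v = ∑ i, (c i : ℚ_[p]) • basisV5 p D i}

/-- The vector `v_D ∈ V₅`. -/
def vD (D : ℤ) : Wedge2 p :=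
  if D % 4 = 1 then
    (((D : ℚ_[p]) - 1) / 4) • wedge (basisE p 0) (basisF p 1)
      + (1 / 2 : ℚ_[p]) • (wedge (basisE p 0) (basisF p 0) - wedge (basisE p 1) (basisF p 1))
      + wedge (basisE p 1) (basisF p 0)
  else
    (D : ℚ_[p]) • wedge (basisE p 0) (basisF p 1) + wedge (basisE p 1) (basisF p 0)

/-- `α_p`, the characteristic function of `V₅(ℤ_p)`. -/
def alphaFun (D : ℤ) (v : Wedge2 p) : ℂ := (latticeV5 p D).indicator 1 v

variable {p}

/-- `α_χ(g) = ∫_{N \ U} χ(u) α_p(v_D u g) du`, with respect to a given measure on `N \ U`. -/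
def alphaChi (D : ℤ) (ψ : AddChar ℚ_[p] ℂ)
    (μ : Measure (RightQuot ((unipN p D).subgroupOf (unipU p)))) (g : GSp4 p) : ℂ :=
  ∫ x : RightQuot ((unipN p D).subgroupOf (unipU p)),
    chi D ψ (x.rep : GSp4 p) * alphaFun p D (actWedge (vD p D) ((x.rep : GSp4 p) * g)) ∂μ

/-! ### The section `f^Φ` -/

instance : MeasurableSpace ℚ_[p]ˣ := borel _

instance : BorelSpace ℚ_[p]ˣ := ⟨rfl⟩

variable (p)

/-- The Haar measure on `GL₁(ℚ_p) = ℚ_pˣ` for which `ℤ_pˣ` has volume one. -/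
def unitsHaar : Measure ℚ_[p]ˣ :=
  ((Measure.haar : Measure ℚ_[p]ˣ) {t | ‖(t : ℚ_[p])‖ = 1})⁻¹ • Measure.haar

/-- `Φ_p`, the characteristic function of `W₄(ℤ_p)`. -/
def PhiFun (w : Idx → ℚ_[p]) : ℂ := {w : Idx → ℚ_[p] | ∀ i, ‖w i‖ ≤ 1}.indicator 1 w

variable {p}

/-- `f^Φ(g, s) = |ν(g)|^{2s} ∫_{GL₁(ℚ_p)} Φ_p(t f₂ g) |t|^{4s} dt`. -/
def fPhi (g : GSp4 p) (s : ℂ) : ℂ :=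
  (‖nu g‖ : ℂ) ^ (2 * s) *
    ∫ t : ℚ_[p]ˣ, PhiFun p ((t : ℚ_[p]) • (basisF p 1 ᵥ* mat g)) * (‖(t : ℚ_[p])‖ : ℂ) ^ (4 * s)
      ∂(unitsHaar p)

/-- `τ(g) = |ν(g)| / ‖f₂ g‖²`, with the maximum norm on `W₄`; it is left invariant under `U Z` and
under `N Z`, and `f^Φ(g, s)` depends on `g` only through `τ(g)^{2s}`. -/
def tau (g : GSp4 p) : ℝ := ‖nu g‖ / ‖basisF p 1 ᵥ* mat g‖ ^ 2

/-! ### Unramified representations and the Spin `L`-function -/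

/-- The position of a basis vector of `W₄` in the ordered basis `e₁, e₂, f₂, f₁`. -/
def pos : Idx → Fin 4 := Sum.elim ![0, 1] ![3, 2]

variable (p)

/-- The Borel subgroup `B`: upper triangular with respect to the basis `e₁, e₂, f₂, f₁`. -/
def borelB : Subgroup (GSp4 p) where
  carrier := {g | (mat g).BlockTriangular pos}
  one_mem' := Matrix.blockTriangular_one
  mul_mem' := fun ha hb => Matrix.BlockTriangular.mul ha hb
  inv_mem' := by
    intro a ha
    have : Invertible (mat a) := (a : GL Idx ℚ_[p]).invertible
    change (mat a⁻¹).BlockTriangular pos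
    rw [mat_inv]
    exact Matrix.blockTriangular_inv_of_blockTriangular ha

/-- An unramified character of the diagonal torus `T(ℚ_p)`, extended to `B(ℚ_p)`: a character of
`B(ℚ_p)` that is trivial on the unipotent radical and on `B(ℚ_p) ∩ GSp₄(ℤ_p)`. -/
structure UnramifiedCharacter where
  /-- The character. -/
  toHom : borelB p →* ℂˣ
  unipotent : ∀ b : borelB p, (∀ i, mat (b : GSp4 p) i i = 1) → toHom b = 1
  unramified : ∀ b : borelB p, (b : GSp4 p) ∈ maxCompact p → toHom b = 1

variable {p}

/-- The modulus character `δ_B`: if `d₁, d₂, d₃, d₄` are the diagonal entries in the ordered basis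
`e₁, e₂, f₂, f₁`, it is `|d₁ / d₃|³ |d₁ / d₂|`. -/
def deltaB (g : GSp4 p) : ℝ :=
  ‖mat g (Sum.inl 0) (Sum.inl 0) / mat g (Sum.inr 1) (Sum.inr 1)‖ ^ 3 *
    ‖mat g (Sum.inl 0) (Sum.inl 0) / mat g (Sum.inl 1) (Sum.inl 1)‖

variable (p)

/-- The action of `GSp₄(ℚ_p)` on functions on `GSp₄(ℚ_p)` by right translation. -/
def rightTranslation : Representation ℂ (GSp4 p) (GSp4 p → ℂ) where
  toFun g := LinearMap.funLeft ℂ ℂ (fun x => x * g)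
  map_one' := by ext φ x; simp [LinearMap.funLeft_apply]
  map_mul' g h := by ext φ x; simp [LinearMap.funLeft_apply, mul_assoc]

variable {p}

/-- The space of the normalized induced representation `ind_B^G(δ_B^{1/2} α)`: the functions `φ` with
`φ(b g) = δ_B(b)^{1/2} α(b) φ(g)` that are right invariant under some open subgroup. -/
def inducedSpace (α : UnramifiedCharacter p) : Submodule ℂ (GSp4 p → ℂ) where
  carrier := {φ | (∀ (b : borelB p) (g : GSp4 p),
      φ ((b : GSp4 p) * g) = (Real.sqrt (deltaB (b : GSp4 p)) : ℂ) * (α.toHom b : ℂ) * φ g) ∧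
    ∃ K' : OpenSubgroup (GSp4 p), ∀ k ∈ K', ∀ g, φ (g * k) = φ g}
  zero_mem' := ⟨by simp, ⊤, by simp⟩
  add_mem' := by
    rintro a b ⟨ha, K₁, h1⟩ ⟨hb, K₂, h2⟩
    refine ⟨fun c g => ?_, K₁ ⊓ K₂, fun k hk g => ?_⟩
    · simp only [Pi.add_apply, ha, hb, mul_add]
    · simp only [Pi.add_apply, h1 k hk.1, h2 k hk.2]
  smul_mem' := by
    rintro c a ⟨ha, K₁, h1⟩
    refine ⟨fun b g => ?_, K₁, fun k hk g => ?_⟩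
    · simp only [Pi.smul_apply, ha, smul_eq_mul]; ring
    · simp only [Pi.smul_apply, h1 k hk]

/-- `π` is isomorphic to a subquotient of `ind_B^G(δ_B^{1/2} α)`: it is an equivariant quotient of
an invariant subspace `W` of the space of that representation. -/
def IsSubquotientOfInduced {V : Type*} [AddCommGroup V] [Module ℂ V]
    (π : Representation ℂ (GSp4 p) V) (α : UnramifiedCharacter p) : Prop :=
  ∃ (W : Submodule ℂ (GSp4 p → ℂ)) (_ : W ≤ inducedSpace α)
    (hW : ∀ g, ∀ φ ∈ W, rightTranslation p g φ ∈ W) (F : W →ₗ[ℂ] V),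
    Function.Surjective F ∧
      ∀ (g : GSp4 p) (φ : W), F ⟨rightTranslation p g φ, hW g φ φ.2⟩ = π g (F φ)

/-- The diagonal matrix with `e₁, e₂, f₁, f₂` entries `x, y, c / x, c / y`, of similitude `c`. -/
def diagGSp (x y c : ℚ_[p]ˣ) : GSp4 p :=
  ⟨⟨Matrix.diagonal (Sum.elim ![(x : ℚ_[p]), (y : ℚ_[p])]
        ![((c * x⁻¹ : ℚ_[p]ˣ) : ℚ_[p]), ((c * y⁻¹ : ℚ_[p]ˣ) : ℚ_[p])]),
      Matrix.diagonal (Sum.elim ![((x⁻¹ : ℚ_[p]ˣ) : ℚ_[p]), ((y⁻¹ : ℚ_[p]ˣ) : ℚ_[p])]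
        ![((x * c⁻¹ : ℚ_[p]ˣ) : ℚ_[p]), ((y * c⁻¹ : ℚ_[p]ˣ) : ℚ_[p])]),
      by
        rw [Matrix.diagonal_mul_diagonal, ← Matrix.diagonal_one]
        congr 1
        ext i
        rcases i with i | i <;> fin_cases i <;> simp <;> field_simp,
      by
        rw [Matrix.diagonal_mul_diagonal, ← Matrix.diagonal_one]
        congr 1
        ext i
        rcases i with i | i <;> fin_cases i <;> simp <;> field_simp⟩,
    ⟨c, by
      ext i j
      rcases i with i | i <;> rcases j with j | j <;> fin_cases i <;> fin_cases j <;>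
        simp [J4, Matrix.diagonal_transpose, Matrix.mul_diagonal, Matrix.diagonal_mul] <;>
        field_simp⟩⟩

/-- The same element, as an element of the Borel subgroup. -/
def diagB (x y c : ℚ_[p]ˣ) : borelB p :=
  ⟨diagGSp x y c, by
    change (Matrix.diagonal _).BlockTriangular pos
    exact Matrix.blockTriangular_diagonal _⟩

variable (p)

/-- `p` as an element of `ℚ_pˣ`. -/
def pUnit : ℚ_[p]ˣ := Units.mk0 (p : ℚ_[p]) (by exact_mod_cast (Fact.out : p.Prime).ne_zero)

variable {p}

/-- The local Spin `L`-function `∏ (1 - α(t) p^{-s})⁻¹`, where `t` runs through the elements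
`diag(p,p,1,1), diag(p,1,p,1), diag(1,p,1,p), diag(1,1,p,p)` of `T(ℚ_p)`, written in the ordered
basis `e₁, e₂, f₂, f₁`. -/
def spinL (α : UnramifiedCharacter p) (s : ℂ) : ℂ :=
  (1 - (α.toHom (diagB (pUnit p) (pUnit p) (pUnit p)) : ℂ) * (p : ℂ) ^ (-s))⁻¹ *
  (1 - (α.toHom (diagB (pUnit p) 1 (pUnit p)) : ℂ) * (p : ℂ) ^ (-s))⁻¹ *
  (1 - (α.toHom (diagB 1 (pUnit p) (pUnit p)) : ℂ) * (p : ℂ) ^ (-s))⁻¹ *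
  (1 - (α.toHom (diagB 1 1 (pUnit p)) : ℂ) * (p : ℂ) ^ (-s))⁻¹

/-! ### `(U, χ)`-functionals and the local integrals -/

section Functional

variable {V : Type*} [AddCommGroup V] [Module ℂ V]

/-- `ℓ` is a `(U, χ)`-functional on the space of `π`. -/
def IsUChiFunctional (D : ℤ) (ψ : AddChar ℚ_[p] ℂ) (π : Representation ℂ (GSp4 p) V)
    (l : V →ₗ[ℂ] ℂ) : Prop :=
  ∀ u ∈ unipU p, ∀ v : V, l (π u v) = chi D ψ u * l v

/-- The matrix coefficient `g ↦ ℓ(π(g) v)` has moderate growth: it is bounded by a constant times a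
power of the height `(max |g_ij|)² / |ν(g)|`, a function on `GSp₄ / Z`. -/
def HasModerateGrowth (π : Representation ℂ (GSp4 p) V) (l : V →ₗ[ℂ] ℂ) (v : V) : Prop :=
  ∃ C A : ℝ, ∀ g : GSp4 p,
    ‖l (π g v)‖ ≤ C * (‖(fun ij : Idx × Idx => mat g ij.1 ij.2)‖ ^ 2 / ‖nu g‖) ^ A

/-- The integrand `f^Φ(g, s) α_χ(g) ℓ(π(g) v)` of `I_p(ℓ, s)`. -/
def integrandI (D : ℤ) (ψ : AddChar ℚ_[p] ℂ)
    (μ : Measure (RightQuot ((unipN p D).subgroupOf (unipU p))))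
    (π : Representation ℂ (GSp4 p) V) (l : V →ₗ[ℂ] ℂ) (v : V) (s : ℂ) (g : GSp4 p) : ℂ :=
  fPhi g s * alphaChi D ψ μ g * l (π g v)

/-- The integrand `f^Φ(g, s) ℓ(π(g) v)` of `J_p(ℓ, s)`. -/
def integrandJ (π : Representation ℂ (GSp4 p) V) (l : V →ₗ[ℂ] ℂ) (v : V) (s : ℂ)
    (g : GSp4 p) : ℂ :=
  fPhi g s * l (π g v)

end Functional

end KohnenSkoruppa

end

open KohnenSkoruppa

noncomputable section
namespace KohnenSkoruppa

/-! ### Cosets, orbits and invariant measures -/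

section Orbits

open scoped Pointwise

variable {G : Type*} [Group G]

/-! Write W(g) = ℓ(π(g)v₀). Both integrals are expanded over the same representatives m(d,j) =
diag(p^j d̄, d) (`repM`), where d runs through the primitive elements of the maximal order O = ℤ_p +
ℤ_p ω modulo units and j ∈ ℤ. The arithmetic input is that ideals are principal in the explicit form
`exists_generator`: in a subgroup of L with bounded norms, an element whose norm is largest in
absolute value divides all the others. This yields the Iwasawa decomposition of GL*_{2,L}
(`exists_iwasawa_gl2L`). It also handles the support of α_χ: v_D u g can lie in V₅(ℤ_p) only if
multiplication by ω, conjugated by the Levi part A of g, is integral (`actWedge_vD_mem_lattice`),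
and then A is multiplication by an element of L times a matrix in GL₂(ℤ_p) (`eq_mulGL_mul`).
Negative j do not contribute, since ψ has conductor one and W(m(d,j)) = 0 for them
(`IsSphericalWhittaker.eq_zero_of_neg`).

Let c(d) be the valuation of N(d). For j ≥ 0 the double coset of m(d,j) has volume p^{3j} in UZ\G
and p^{2j} in NZ\GL*_{2,L}, while α_χ(m(d,j)) = p^{-j}; so both integrals receive the same
contribution `coeffW` from (d,j). Volumes are found by comparing indices of lattices
(`measure_orbit_of_hom`). Moreover f^Φ = (1 - p^{-4s})⁻¹ τ^{2s} and τ(m(d,j)) = p^{-(j+c(d))}, so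
that the shell τ = p^{-n} meets the support in the finitely many cosets with j + c(d) = n. This is
why the sum over shells makes sense for every ℓ, without any growth condition.

The shell sum is a Hecke operator in disguise. The cosets gK of integral elements with similitude of
valuation n are listed by a Hermite matrix A and a class of symmetric matrices. For fixed A the sum
of W is a character sum over a finite group. It vanishes unless χ is trivial on the lattice, which
singles out the cosets of the m(d,j) with j + c(d) = n, each with multiplicity p^{n+2j}
(`IsSphericalWhittaker.sum_heckeRep`). So the n-th shell gives (1 - p^{-4s})⁻¹ p^{-(2s+1)n} times
the eigenvalue of T(p^n) times ℓ(v₀). The same list of cosets, applied to a K-invariant function in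
the principal series, computes the eigenvalue (`sum_heckeRep_of_equivariant`). Its generating series
is (1 - p^{-4s}) L(π, Spin, 2s - 1/2), with a numerator that the factor from f^Φ cancels
(`hasSum_heckeEig`).

For absolute convergence a bound for W(m(d,j)) exponential in j + c(d) suffices (`summable_coeffW`).
Moderate growth gives it directly. If D is not a square in ℚ_p, there are only finitely many classes
d, and the Hecke relations determine W(m(d,j)) recursively from smaller j
(`IsSphericalWhittaker.exists_bound`). -/

theorem RightQuot.mk_eq_mk_iff {H : Subgroup G} {x y : G} :
    RightQuot.mk H x = RightQuot.mk H y ↔ y * x⁻¹ ∈ H := by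
  have : RightQuot.mk H x = RightQuot.mk H y ↔ QuotientGroup.rightRel H x y := Quotient.eq
  rw [this, QuotientGroup.rightRel_apply]

theorem RightQuot.mk_rep {H : Subgroup G} (x : RightQuot H) : RightQuot.mk H x.rep = x :=
  Quotient.out_eq x

theorem RightQuot.exists_mk {H : Subgroup G} (x : RightQuot H) : ∃ g, RightQuot.mk H g = x :=
  ⟨x.rep, x.mk_rep⟩

theorem RightQuot.translate_mk {H : Subgroup G} (g x : G) :
    RightQuot.translate g (RightQuot.mk H x) = RightQuot.mk H (x * g) := rfl

theorem RightQuot.exists_rep_mk {H : Subgroup G} (g : G) :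
    ∃ h ∈ H, (RightQuot.mk H g).rep = h * g := by
  refine ⟨(RightQuot.mk H g).rep * g⁻¹, ?_, by simp⟩
  rw [← RightQuot.mk_eq_mk_iff, RightQuot.mk_rep]

/-- The `K`-orbit of the coset `H m` in `H \ G`. -/
def orbit (H K : Subgroup G) (m : G) : Set (RightQuot H) :=
  {x | ∃ k ∈ K, x = RightQuot.mk H (m * k)}

theorem mk_mem_orbit {H K : Subgroup G} {m g : G} :
    RightQuot.mk H g ∈ orbit H K m ↔ ∃ h ∈ H, ∃ k ∈ K, g = h * m * k := by
  constructor
  · rintro ⟨k, hk, e⟩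
    rw [RightQuot.mk_eq_mk_iff] at e
    exact ⟨_, H.inv_mem e, k, hk, by group⟩
  · rintro ⟨h, hh, k, hk, rfl⟩
    refine ⟨k, hk, ?_⟩
    rw [RightQuot.mk_eq_mk_iff]
    simpa [mul_assoc] using hh

theorem mk_image_eq_orbit (H K : Subgroup G) : RightQuot.mk H '' (K : Set G) = orbit H K 1 := by
  ext x
  constructor
  · rintro ⟨k, hk, rfl⟩; exact ⟨k, hk, by simp⟩
  · rintro ⟨k, hk, rfl⟩; exact ⟨k, hk, by simp⟩

theorem rep_eq_of_mk {H : Subgroup G} {F : G → ℂ} (hF : ∀ h ∈ H, ∀ g, F (h * g) = F g) (g : G) :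
    F (RightQuot.mk H g).rep = F g := by
  obtain ⟨h, hh, e⟩ := RightQuot.exists_rep_mk (H := H) g
  rw [e, hF h hh]

theorem rep_eq_of_mk_real {H : Subgroup G} {F : G → ℝ} (hF : ∀ h ∈ H, ∀ g, F (h * g) = F g)
    (g : G) : F (RightQuot.mk H g).rep = F g := by
  obtain ⟨h, hh, e⟩ := RightQuot.exists_rep_mk (H := H) g
  rw [e, hF h hh]

theorem mem_conj_smul {K : Subgroup G} {m x : G} : x ∈ MulAut.conj m • K ↔ m⁻¹ * x * m ∈ K := by
  rw [Subgroup.mem_pointwise_smul_iff_inv_smul_mem]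
  simp [MulAut.smul_def, ← map_inv]

theorem conj_smul_eq_self {K : Subgroup G} {k : G} (hk : k ∈ K) : MulAut.conj k • K = K := by
  ext x
  rw [mem_conj_smul]
  constructor
  · intro h
    have := K.mul_mem (K.mul_mem hk h) (K.inv_mem hk)
    simpa [mul_assoc] using this
  · intro h
    exact K.mul_mem (K.mul_mem (K.inv_mem hk) h) hk

/-- The two indices of `K ∩ m K m⁻¹` agree when `m⁻¹` is `K`-conjugate to `m` modulo the centre. -/
theorem relIndex_conj_symm {K : Subgroup G} {m z k : G} (hz : z ∈ Subgroup.center G) (hk : k ∈ K)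
    (hm : m⁻¹ = z * k * m * k⁻¹) :
    K.relIndex (MulAut.conj m • K) = (MulAut.conj m • K).relIndex K := by
  -- The central factor conjugates trivially and k normalizes K, so m⁻¹Km is the conjugate of mKm⁻¹
  -- by k. Conjugating the pair (K, mKm⁻¹) by m⁻¹ therefore exchanges the roles of the two groups.
  have h1 : MulAut.conj m⁻¹ • K = MulAut.conj k • (MulAut.conj m • K) := by
    ext x
    rw [mem_conj_smul, mem_conj_smul, mem_conj_smul, show m⁻¹⁻¹ * x * m⁻¹ =
      (z * k * m * k⁻¹)⁻¹ * x * (z * k * m * k⁻¹) by rw [← hm]]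
    have hz' : ∀ y, z * y = y * z := fun y => (Subgroup.mem_center_iff.1 hz y).symm
    have : (z * k * m * k⁻¹)⁻¹ * x * (z * k * m * k⁻¹) = k * (m⁻¹ * (k⁻¹ * x * k) * m) * k⁻¹ := by
      have : x * z = z * x := (hz' x).symm
      calc (z * k * m * k⁻¹)⁻¹ * x * (z * k * m * k⁻¹)
          = k * m⁻¹ * k⁻¹ * z⁻¹ * (x * z) * k * m * k⁻¹ := by group
        _ = _ := by rw [this]; group
    rw [this]
    constructor
    · intro h
      have := K.mul_mem (K.mul_mem (K.inv_mem hk) h) hk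
      simpa [mul_assoc] using this
    · intro h
      exact K.mul_mem (K.mul_mem hk h) (K.inv_mem hk)
  rw [← Subgroup.relIndex_pointwise_smul (MulAut.conj m⁻¹) K (MulAut.conj m • K), smul_smul,
    ← map_mul, inv_mul_cancel, map_one, one_smul, h1]
  conv_lhs => rw [← conj_smul_eq_self hk]
  rw [Subgroup.relIndex_pointwise_smul]
  congr 1
  rw [conj_smul_eq_self hk]

/-- The factors z already lie in L, so dropping them does not change the cosets modulo L. This
reduces indices in a group U Z or N Z to indices in the unipotent part. -/
theorem relIndex_eq_of_central {L A A' Z : Subgroup G} (hA : A' ≤ A)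
    (h : ∀ x ∈ A, ∃ u ∈ A', ∃ z ∈ Z, z ∈ L ∧ x = u * z) : L.relIndex A = L.relIndex A' := by
  symm
  unfold Subgroup.relIndex Subgroup.index
  refine Nat.card_congr (Equiv.ofBijective
    (Quotient.map (fun x : A' => (⟨x.1, hA x.2⟩ : A)) ?_) ⟨?_, ?_⟩)
  · intro x y hxy
    change QuotientGroup.leftRel _ _ _ at hxy
    change QuotientGroup.leftRel _ _ _
    rw [QuotientGroup.leftRel_apply, Subgroup.mem_subgroupOf] at hxy ⊢
    exact hxy
  · intro x y
    induction x using Quotient.inductionOn with | _ x => ?_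
    induction y using Quotient.inductionOn with | _ y => ?_
    intro e
    rw [Quotient.map_mk, Quotient.map_mk] at e
    have e := Quotient.exact e
    apply Quotient.sound
    change QuotientGroup.leftRel _ _ _ at e
    change QuotientGroup.leftRel _ _ _
    rw [QuotientGroup.leftRel_apply, Subgroup.mem_subgroupOf] at e ⊢
    exact e
  · intro x
    induction x using Quotient.inductionOn with | _ x => ?_
    obtain ⟨u, hu, z, hz, hzL, e⟩ := h x.1 x.2
    refine ⟨Quotient.mk _ ⟨u, hu⟩, ?_⟩
    rw [Quotient.map_mk]
    apply Quotient.sound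
    change QuotientGroup.leftRel _ _ _
    rw [QuotientGroup.leftRel_apply, Subgroup.mem_subgroupOf]
    simpa [e] using hzL

variable [TopologicalSpace G] [IsTopologicalGroup G]

/-- The preimage in G is a union of cosets gK with K open. All measurability in the quotients rests
on this. -/
theorem isOpen_of_invariant {H K : Subgroup G} (hK : IsOpen (K : Set G)) {S : Set (RightQuot H)}
    (hS : ∀ g, ∀ k ∈ K, RightQuot.mk H g ∈ S → RightQuot.mk H (g * k) ∈ S) : IsOpen S := by
  have : IsOpen (RightQuot.mk H ⁻¹' S) := by
    rw [isOpen_iff_mem_nhds]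
    intro g hg
    have h1 : (fun x => g⁻¹ * x) ⁻¹' (K : Set G) ∈ nhds g := by
      apply (hK.preimage (continuous_const_mul g⁻¹)).mem_nhds
      simp [K.one_mem]
    filter_upwards [h1] with x hx
    have := hS g _ hx hg
    simpa using this
  exact this

theorem orbit_isOpen {H K : Subgroup G} (hK : IsOpen (K : Set G)) (m : G) :
    IsOpen (orbit H K m) := by
  apply isOpen_of_invariant hK
  rintro g k hk hg
  rw [mk_mem_orbit] at hg ⊢
  obtain ⟨h, hh, k', hk', rfl⟩ := hg
  exact ⟨h, hh, k' * k, K.mul_mem hk' hk, by group⟩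

instance (H : Subgroup G) : BorelSpace (RightQuot H) := ⟨rfl⟩

theorem orbit_measurableSet {H K : Subgroup G} (hK : IsOpen (K : Set G)) (m : G) :
    MeasurableSet (orbit H K m) := (orbit_isOpen hK m).measurableSet

theorem measurableSet_rep_real {H K : Subgroup G} (hK : IsOpen (K : Set G)) {F : G → ℝ}
    (hH : ∀ h ∈ H, ∀ g, F (h * g) = F g) (hF : ∀ k ∈ K, ∀ g, F (g * k) = F g) (c : ℝ) :
    MeasurableSet {x : RightQuot H | F x.rep = c} := by
  apply IsOpen.measurableSet
  apply isOpen_of_invariant hK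
  intro g k hk hg
  simp only [Set.mem_ofPred_eq, rep_eq_of_mk_real hH] at hg ⊢
  rw [hF k hk, hg]

open Classical in
-- The translates of H\HK' by representatives of K/K' have equal measure and cover H\HK with
-- constant multiplicity [H ∩ K : H ∩ K']. Integrating the sum of their indicators gives the
-- identity.
theorem relIndex_mul_measure {H K K' : Subgroup G} (hK' : IsOpen (K' : Set G))
    (hK : IsOpen (K : Set G)) (hle : K' ≤ K) (hfin : K'.relIndex K ≠ 0)
    {μ : Measure (RightQuot H)} (hμ : ∀ g : G, MeasurePreserving (RightQuot.translate g) μ μ) :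
    (K'.relIndex K : ENNReal) * μ (orbit H K' 1) = (K'.relIndex (H ⊓ K) : ENNReal) *
      μ (orbit H K 1) := by
  have : Finite (K ⧸ K'.subgroupOf K) := (Nat.card_ne_zero.1 hfin).2
  have : Fintype (K ⧸ K'.subgroupOf K) := Fintype.ofFinite _
  let E : K ⧸ K'.subgroupOf K → Set (RightQuot H) := fun q =>
    RightQuot.translate ((q.out : K) : G) ⁻¹' (orbit H K' 1)
  have hE : ∀ q, μ (E q) = μ (orbit H K' 1) := fun q =>
    (hμ _).measure_preimage (orbit_measurableSet hK' 1).nullMeasurableSet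
  have hEm : ∀ q, MeasurableSet (E q) := fun q =>
    (hμ _).measurable (orbit_measurableSet hK' 1)
  have hmem : ∀ g q, RightQuot.mk H g ∈ E q ↔ ∃ h ∈ H, h * g * ((q.out : K) : G) ∈ K' := by
    intro g q
    change RightQuot.mk H (g * _) ∈ orbit H K' 1 ↔ _
    rw [mk_mem_orbit]
    constructor
    · rintro ⟨h, hh, k, hk, e⟩
      refine ⟨h⁻¹, H.inv_mem hh, ?_⟩
      rw [mul_assoc, e]
      simpa using hk
    · rintro ⟨h, hh, hk⟩
      exact ⟨h⁻¹, H.inv_mem hh, _, hk, by group⟩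
  have hcount : ∀ x, ∑ q, (E q).indicator (1 : RightQuot H → ENNReal) x
      = (K'.relIndex (H ⊓ K) : ENNReal) * (orbit H K 1).indicator 1 x := by
    intro x
    obtain ⟨g, rfl⟩ := x.exists_mk
    by_cases hg : RightQuot.mk H g ∈ orbit H K 1
    · obtain ⟨k, hk, e⟩ := hg
      rw [one_mul] at e
      rw [e]
      have hin : RightQuot.mk H k ∈ orbit H K 1 := ⟨k, hk, by simp⟩
      rw [Set.indicator_of_mem hin, Pi.one_apply, mul_one]
      simp only [Set.indicator_apply, Pi.one_apply]
      rw [Finset.sum_boole]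
      congr 1
      have hc : {q | RightQuot.mk H k ∈ E q}.ncard = (Finset.univ.filter
          fun q => RightQuot.mk H k ∈ E q).card := by
        rw [← Set.ncard_coe_finset]
        congr 1
        ext q; simp
      rw [← hc]
      symm
      -- The point Hk lies in the translate of index q when hkq ∈ K' for some h ∈ H; such an h lies
      -- in K. These q are the image of (H ∩ K)/(H ∩ K') under the injection h ↦ k⁻¹h.
      let f : (↥(H ⊓ K) ⧸ K'.subgroupOf (H ⊓ K)) → K ⧸ K'.subgroupOf K :=
        Quotient.map (fun h : ↥(H ⊓ K) => (⟨k, hk⟩ : K)⁻¹ * ⟨h.1, h.2.2⟩) (by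
          intro x y hxy
          change QuotientGroup.leftRel _ _ _ at hxy
          change QuotientGroup.leftRel _ _ _
          rw [QuotientGroup.leftRel_apply, Subgroup.mem_subgroupOf] at hxy ⊢
          simpa [mul_assoc] using hxy)
      have hf : Function.Injective f := by
        intro x y
        induction x using Quotient.inductionOn with | _ x => ?_
        induction y using Quotient.inductionOn with | _ y => ?_
        intro e
        have e := Quotient.exact e
        apply Quotient.sound
        change QuotientGroup.leftRel _ _ _ at e
        change QuotientGroup.leftRel _ _ _
        rw [QuotientGroup.leftRel_apply, Subgroup.mem_subgroupOf] at e ⊢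
        simpa [mul_assoc] using e
      have hr : Set.range f = {q | RightQuot.mk H k ∈ E q} := by
        ext q
        rw [Set.mem_ofPred_eq, hmem]
        constructor
        · rintro ⟨x, rfl⟩
          induction x using Quotient.inductionOn with | _ x => ?_
          refine ⟨x.1⁻¹, H.inv_mem x.2.1, ?_⟩
          have e : QuotientGroup.mk (s := K'.subgroupOf K) ((⟨k, hk⟩ : K)⁻¹ * ⟨x.1, x.2.2⟩) =
            QuotientGroup.mk (f (Quotient.mk _ x)).out := by
            rw [QuotientGroup.out_eq']; rfl
          rw [QuotientGroup.eq, Subgroup.mem_subgroupOf] at e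
          simpa [mul_assoc] using e
        · rintro ⟨h, hh, hq⟩
          have hhK : h ∈ K := by
            have h1 := K.mul_mem (K.mul_mem (hle hq) (K.inv_mem q.out.2)) (K.inv_mem hk)
            simpa [mul_assoc] using h1
          refine ⟨QuotientGroup.mk ⟨h⁻¹, H.inv_mem hh, K.inv_mem hhK⟩, ?_⟩
          rw [← QuotientGroup.out_eq' q]
          change QuotientGroup.mk _ = _
          rw [QuotientGroup.eq, Subgroup.mem_subgroupOf]
          simpa [mul_assoc] using hq
      rw [← hr]
      exact (Nat.card_range_of_injective hf).symm
    · rw [Set.indicator_of_notMem hg, mul_zero]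
      apply Finset.sum_eq_zero
      intro q _
      apply Set.indicator_of_notMem
      rw [hmem]
      rintro ⟨h, hh, hq⟩
      apply hg
      rw [mk_mem_orbit]
      refine ⟨h⁻¹, H.inv_mem hh, h * g, ?_, by group⟩
      have h1 := K.mul_mem (hle hq) (K.inv_mem q.out.2)
      simpa [mul_assoc] using h1
  have h1 : ∑ q, μ (E q) = (K'.relIndex (H ⊓ K) : ENNReal) * μ (orbit H K 1) := by
    calc ∑ q, μ (E q) = ∑ q, ∫⁻ x, (E q).indicator 1 x ∂μ := by
          simp_rw [lintegral_indicator_one (hEm _)]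
      _ = ∫⁻ x, ∑ q, (E q).indicator (1 : RightQuot H → ENNReal) x ∂μ := by
          rw [lintegral_finsetSum]
          intro q _
          exact measurable_one.indicator (hEm q)
      _ = _ := by
          simp_rw [hcount]
          rw [lintegral_const_mul _ (measurable_one.indicator (orbit_measurableSet hK 1)),
            lintegral_indicator_one (orbit_measurableSet hK 1)]
  rw [← h1]
  simp_rw [hE]
  rw [Finset.sum_const, nsmul_eq_mul, Finset.card_univ, ← Nat.card_eq_fintype_card]
  rfl

/-- The measure of a `K`-orbit in `H \ G`, in terms of the indices of `H ∩ K ∩ m K m⁻¹` in `H ∩ K`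
and in `H ∩ m K m⁻¹`. -/
theorem relIndex_mul_measure_orbit {H K : Subgroup G} (hK : IsOpen (K : Set G)) (m : G)
    (hfin : (MulAut.conj m • K).relIndex K ≠ 0)
    (hsymm : K.relIndex (MulAut.conj m • K) = (MulAut.conj m • K).relIndex K)
    {μ : Measure (RightQuot H)} (hμ : ∀ g : G, MeasurePreserving (RightQuot.translate g) μ μ) :
    ((MulAut.conj m • K).relIndex (H ⊓ K) : ENNReal) * μ (orbit H K 1) =
      (K.relIndex (H ⊓ MulAut.conj m • K) : ENNReal) * μ (orbit H K m) := by
  set P := MulAut.conj m • K with hP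
  have hPo : IsOpen (P : Set G) := by
    have : (P : Set G) = (fun x => m⁻¹ * x * m) ⁻¹' (K : Set G) := by
      ext x; exact mem_conj_smul
    rw [this]
    exact hK.preimage (by fun_prop)
  have hKP : IsOpen ((K ⊓ P : Subgroup G) : Set G) := hK.inter hPo
  -- Both K and P = mKm⁻¹ are compared with K ∩ P; by the symmetry hypothesis the two identities
  -- have the same left side. The orbit of m under K is the right translate by m of the orbit of 1
  -- under P.
  have e1 := relIndex_mul_measure hKP hK inf_le_left
    (by rwa [Subgroup.inf_relIndex_left]) hμ
  have e2 := relIndex_mul_measure hKP hPo inf_le_right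
    (by rw [Subgroup.inf_relIndex_right, hsymm]; exact hfin) hμ
  rw [Subgroup.inf_relIndex_left] at e1
  rw [Subgroup.inf_relIndex_right, hsymm, e1] at e2
  have h1 : (K ⊓ P).relIndex (H ⊓ K) = P.relIndex (H ⊓ K) := by
    rw [← Subgroup.inf_relIndex_right, ← Subgroup.inf_relIndex_right P]
    congr 1
    ext x; simp only [Subgroup.mem_inf]; tauto
  have h2 : (K ⊓ P).relIndex (H ⊓ P) = K.relIndex (H ⊓ P) := by
    rw [← Subgroup.inf_relIndex_right, ← Subgroup.inf_relIndex_right K]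
    congr 1
    ext x; simp only [Subgroup.mem_inf]; tauto
  have h3 : μ (orbit H P 1) = μ (orbit H K m) := by
    rw [← (hμ m⁻¹).measure_preimage (orbit_measurableSet hPo 1).nullMeasurableSet]
    congr 1
    ext x
    obtain ⟨g, rfl⟩ := x.exists_mk
    rw [Set.mem_preimage, RightQuot.translate_mk, mk_mem_orbit, mk_mem_orbit]
    constructor
    · rintro ⟨h, hh, k, hk, e⟩
      refine ⟨h, hh, m⁻¹ * k * m, mem_conj_smul.1 hk, ?_⟩
      rw [mul_inv_eq_iff_eq_mul] at e
      rw [e]; group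
    · rintro ⟨h, hh, k, hk, rfl⟩
      refine ⟨h, hh, m * k * m⁻¹, ?_, by group⟩
      rw [hP, mem_conj_smul]
      simpa [mul_assoc] using hk
  rw [h1, h2, h3] at e2
  exact e2

end Orbits

/-- No measurability of F is assumed: it is a countable combination of indicators of the pieces. The
lemma serves for the integral over ℚ_pˣ, for single shells and for the whole quotients. -/
theorem integrable_and_hasSum_of_countable_pieces {X ι : Type*} [MeasurableSpace X] [Countable ι]
    {μ : Measure X} {O : ι → Set X} (hO : ∀ i, MeasurableSet (O i))
    (hd : Pairwise (Function.onFun Disjoint O)) {F : X → ℂ} {c : ι → ℂ}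
    (hF : ∀ i, ∀ x ∈ O i, F x = c i) (hsupp : ∀ x, F x ≠ 0 → ∃ i, x ∈ O i)
    (hfin : ∀ i, μ (O i) ≠ ⊤) (hs : Summable fun i => (μ (O i)).toReal * ‖c i‖) :
    Integrable F μ ∧ HasSum (fun i => ((μ (O i)).toReal : ℂ) * c i) (∫ x, F x ∂μ) := by
  have hi : ∀ i, IntegrableOn F (O i) μ := fun i =>
    (integrableOn_const (C := c i) (hfin i)).congr_fun (fun x hx => (hF i x hx).symm) (hO i)
  have hn : ∀ i, ∫ x in O i, ‖F x‖ ∂μ = (μ (O i)).toReal * ‖c i‖ := by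
    intro i
    rw [setIntegral_congr_fun (hO i) (fun x hx => by rw [hF i x hx]), setIntegral_const]
    rfl
  have h1 : IntegrableOn F (⋃ i, O i) μ := by
    apply integrableOn_iUnion_of_summable_integral_norm hi
    simpa only [hn] using hs
  have hsub : Function.support F ⊆ ⋃ i, O i := fun x hx => Set.mem_iUnion.2 (hsupp x hx)
  refine ⟨(integrableOn_iff_integrable_of_support_subset hsub).1 h1, ?_⟩
  have h2 := hasSum_integral_iUnion hO hd h1
  rw [setIntegral_eq_integral_of_forall_compl_eq_zero
    (fun x hx => by by_contra h; exact hx (hsub h))] at h2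
  refine h2.congr_fun fun i => ?_
  rw [setIntegral_congr_fun (hO i) (fun x hx => by rw [hF i x hx]), setIntegral_const]
  simp [Measure.real]

end KohnenSkoruppa
end

noncomputable section
namespace KohnenSkoruppa

/-! ### Integral matrices, boxes and the Smith normal form -/

variable {p : ℕ} [Fact p.Prime]

theorem prime_cast_ne_zero : (p : ℚ_[p]) ≠ 0 := by exact_mod_cast (Fact.out : p.Prime).ne_zero

theorem one_lt_prime_real : (1 : ℝ) < p := by exact_mod_cast (Fact.out : p.Prime).one_lt

theorem prime_real_pos : (0 : ℝ) < p := by exact_mod_cast (Fact.out : p.Prime).pos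

theorem norm_prime_zpow (n : ℤ) : ‖(p : ℚ_[p]) ^ n‖ = (p : ℝ) ^ (-n) := Padic.norm_p_zpow n

theorem norm_add_le_of_le {x y : ℚ_[p]} {r : ℝ} (hx : ‖x‖ ≤ r) (hy : ‖y‖ ≤ r) : ‖x + y‖ ≤ r :=
  (Padic.nonarchimedean x y).trans (max_le hx hy)

theorem norm_sub_le_of_le {x y : ℚ_[p]} {r : ℝ} (hx : ‖x‖ ≤ r) (hy : ‖y‖ ≤ r) : ‖x - y‖ ≤ r := by
  rw [sub_eq_add_neg]; exact norm_add_le_of_le hx (by rwa [norm_neg])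

theorem norm_sum_le_of_le {ι : Type*} (s : Finset ι) {f : ι → ℚ_[p]} {r : ℝ} (hr : 0 ≤ r)
    (h : ∀ i ∈ s, ‖f i‖ ≤ r) : ‖∑ i ∈ s, f i‖ ≤ r := by
  classical
  induction s using Finset.induction_on with
  | empty => simpa using hr
  | insert i s hi ih =>
    rw [Finset.sum_insert hi]
    exact norm_add_le_of_le (h i (Finset.mem_insert_self _ _))
      (ih fun j hj => h j (Finset.mem_insert_of_mem hj))

theorem norm_mul_le_one {x y : ℚ_[p]} (hx : ‖x‖ ≤ 1) (hy : ‖y‖ ≤ 1) : ‖x * y‖ ≤ 1 := by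
  rw [norm_mul]; exact mul_le_one₀ hx (norm_nonneg _) hy

/-- Every nonzero `p`-adic number is a unit times a power of `p`. -/
theorem exists_zpow_mul_unit {x : ℚ_[p]} (hx : x ≠ 0) :
    ∃ (n : ℤ) (u : ℚ_[p]), ‖u‖ = 1 ∧ x = (p : ℚ_[p]) ^ n * u := by
  refine ⟨x.valuation, (p : ℚ_[p]) ^ (-x.valuation) * x, ?_, ?_⟩
  · rw [norm_mul, norm_prime_zpow, Padic.norm_eq_zpow_neg_valuation hx, neg_neg,
      ← zpow_add₀ prime_real_pos.ne', add_neg_cancel, zpow_zero]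
  · rw [← mul_assoc, ← zpow_add₀ prime_cast_ne_zero, add_neg_cancel, zpow_zero, one_mul]

theorem norm_eq_zpow {x : ℚ_[p]} (hx : x ≠ 0) : ∃ n : ℤ, ‖x‖ = (p : ℝ) ^ (-n) :=
  ⟨_, Padic.norm_eq_zpow_neg_valuation hx⟩

theorem zpow_prime_inj {m n : ℤ} : (p : ℝ) ^ m = (p : ℝ) ^ n ↔ m = n :=
  zpow_right_inj₀ prime_real_pos one_lt_prime_real.ne'

theorem zpow_prime_le {m n : ℤ} : (p : ℝ) ^ m ≤ (p : ℝ) ^ n ↔ m ≤ n :=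
  zpow_le_zpow_iff_right₀ one_lt_prime_real

theorem norm_le_zpow_of_lt {x : ℚ_[p]} {n : ℤ} (h : ‖x‖ < (p : ℝ) ^ (n + 1)) :
    ‖x‖ ≤ (p : ℝ) ^ n := (Padic.norm_le_pow_iff_norm_lt_pow_add_one x n).2 h

/-- A matrix with entries in `ℤ_p`. -/
def IsInt {m n : Type*} (M : Matrix m n ℚ_[p]) : Prop := ∀ i j, ‖M i j‖ ≤ 1

section IsInt

variable {l m n : Type*}

theorem IsInt.add {M N : Matrix m n ℚ_[p]} (hM : IsInt M) (hN : IsInt N) : IsInt (M + N) :=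
  fun i j => norm_add_le_of_le (hM i j) (hN i j)

theorem IsInt.neg {M : Matrix m n ℚ_[p]} (hM : IsInt M) : IsInt (-M) :=
  fun i j => by simpa using hM i j

theorem IsInt.sub {M N : Matrix m n ℚ_[p]} (hM : IsInt M) (hN : IsInt N) : IsInt (M - N) :=
  fun i j => norm_sub_le_of_le (hM i j) (hN i j)

theorem IsInt.mul [Fintype m] {M : Matrix l m ℚ_[p]} {N : Matrix m n ℚ_[p]} (hM : IsInt M)
    (hN : IsInt N) : IsInt (M * N) := fun i j => by
  rw [Matrix.mul_apply]
  exact norm_sum_le_of_le _ zero_le_one fun k _ => norm_mul_le_one (hM i k) (hN k j)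

theorem IsInt.transpose {M : Matrix m n ℚ_[p]} (hM : IsInt M) : IsInt Mᵀ := fun i j => hM j i

theorem isInt_transpose {M : Matrix m n ℚ_[p]} : IsInt Mᵀ ↔ IsInt M := ⟨fun h i j => h j i, fun h i j => h j i⟩

theorem IsInt.smul {M : Matrix m n ℚ_[p]} {c : ℚ_[p]} (hc : ‖c‖ ≤ 1) (hM : IsInt M) :
    IsInt (c • M) := fun i j => norm_mul_le_one hc (hM i j)

theorem isInt_one [DecidableEq n] : IsInt (1 : Matrix n n ℚ_[p]) := fun i j => by
  rw [Matrix.one_apply]; split_ifs <;> simp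

theorem isInt_smul_unit {M : Matrix m n ℚ_[p]} {c : ℚ_[p]} (hc : ‖c‖ = 1) :
    IsInt (c • M) ↔ IsInt M := by
  unfold IsInt
  simp [norm_mul, hc]

end IsInt

theorem isInt_fin_two {M : Matrix (Fin 2) (Fin 2) ℚ_[p]} :
    IsInt M ↔ ‖M 0 0‖ ≤ 1 ∧ ‖M 0 1‖ ≤ 1 ∧ ‖M 1 0‖ ≤ 1 ∧ ‖M 1 1‖ ≤ 1 := by
  constructor
  · intro h; exact ⟨h _ _, h _ _, h _ _, h _ _⟩
  · rintro ⟨h1, h2, h3, h4⟩ i j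
    fin_cases i <;> fin_cases j <;> assumption

variable (p) in
/-- `GL_n(ℤ_p)` in `GL_n(ℚ_p)`. -/
def intGL (n : Type*) [Fintype n] [DecidableEq n] : Subgroup (GL n ℚ_[p]) where
  carrier := {g | IsInt (g : Matrix n n ℚ_[p]) ∧ IsInt ((g⁻¹ : GL n ℚ_[p]) : Matrix n n ℚ_[p])}
  one_mem' := ⟨isInt_one, by rw [inv_one]; exact isInt_one⟩
  mul_mem' := fun ha hb => ⟨ha.1.mul hb.1, by rw [mul_inv_rev]; exact hb.2.mul ha.2⟩
  inv_mem' := fun ha => ⟨ha.2, by rw [inv_inv]; exact ha.1⟩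

theorem isInt_mul_left_iff {n l : Type*} [Fintype n] [DecidableEq n] {k : GL n ℚ_[p]}
    (hk : k ∈ intGL p n) {M : Matrix n l ℚ_[p]} : IsInt (k.val * M) ↔ IsInt M := by
  constructor
  · intro h
    have := hk.2.mul h
    rwa [← Matrix.mul_assoc, ← Units.val_mul, inv_mul_cancel, Units.val_one, Matrix.one_mul] at this
  · exact fun h => hk.1.mul h

theorem isInt_mul_right_iff {n l : Type*} [Fintype n] [DecidableEq n] {k : GL n ℚ_[p]}
    (hk : k ∈ intGL p n) {M : Matrix l n ℚ_[p]} : IsInt (M * k.val) ↔ IsInt M := by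
  constructor
  · intro h
    have := h.mul hk.2
    rwa [Matrix.mul_assoc, ← Units.val_mul, mul_inv_cancel, Units.val_one, Matrix.mul_one] at this
  · exact fun h => h.mul hk.1

theorem isInt_mul_transpose_iff {n l : Type*} [Fintype n] [DecidableEq n] {k : GL n ℚ_[p]}
    (hk : k ∈ intGL p n) {M : Matrix l n ℚ_[p]} : IsInt (M * k.valᵀ) ↔ IsInt M := by
  rw [← isInt_transpose, Matrix.transpose_mul, Matrix.transpose_transpose, isInt_mul_left_iff hk,
    isInt_transpose]

/-- An element of `GL₂` with prescribed entries. -/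
def gl2 (a b c d : ℚ_[p]) (h : a * d - b * c ≠ 0) : GL (Fin 2) ℚ_[p] :=
  Matrix.GeneralLinearGroup.mkOfDetNeZero !![a, b; c, d] (by rwa [Matrix.det_fin_two_of])

@[simp] theorem gl2_val (a b c d : ℚ_[p]) (h : a * d - b * c ≠ 0) :
    (gl2 a b c d h).val = !![a, b; c, d] := rfl

theorem inv_val_fin_two (g : GL (Fin 2) ℚ_[p]) : (g⁻¹).val = (g.val.det)⁻¹ • g.val.adjugate := by
  rw [Matrix.coe_units_inv, Matrix.inv_def, Ring.inverse_eq_inv']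

theorem det_ne_zero (g : GL (Fin 2) ℚ_[p]) : g.val.det ≠ 0 :=
  (Matrix.GeneralLinearGroup.det g).ne_zero

theorem mem_intGL_fin_two {g : GL (Fin 2) ℚ_[p]} :
    g ∈ intGL p (Fin 2) ↔ IsInt g.val ∧ ‖g.val.det‖ = 1 := by
  constructor
  · rintro ⟨h1, h2⟩
    refine ⟨h1, le_antisymm ?_ ?_⟩
    · rw [Matrix.det_fin_two]
      exact norm_sub_le_of_le (norm_mul_le_one (h1 _ _) (h1 _ _))
        (norm_mul_le_one (h1 _ _) (h1 _ _))
    · have h3 : ‖(g⁻¹).val.det‖ ≤ 1 := by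
        rw [Matrix.det_fin_two]
        exact norm_sub_le_of_le (norm_mul_le_one (h2 _ _) (h2 _ _))
          (norm_mul_le_one (h2 _ _) (h2 _ _))
      have h4 : ‖(g⁻¹).val.det‖ * ‖g.val.det‖ = 1 := by
        rw [← norm_mul, ← Matrix.det_mul, ← Units.val_mul]; simp
      nlinarith [norm_nonneg (g.val.det)]
  · rintro ⟨h1, h2⟩
    refine ⟨h1, ?_⟩
    rw [inv_val_fin_two]
    apply IsInt.smul (by rw [norm_inv, h2, inv_one])
    rw [Matrix.adjugate_fin_two, isInt_fin_two]
    simpa using ⟨h1 1 1, h1 0 1, h1 1 0, h1 0 0⟩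

/-- Smith normal form in `GL₂(ℚ_p)`. -/
theorem exists_smith (A : GL (Fin 2) ℚ_[p]) : ∃ k₁ ∈ intGL p (Fin 2), ∃ k₂ ∈ intGL p (Fin 2),
    ∃ α β : ℤ, α ≤ β ∧
      A.val = k₁.val * !![(p : ℚ_[p]) ^ α, 0; 0, (p : ℚ_[p]) ^ β] * k₂.val := by
  let w : GL (Fin 2) ℚ_[p] := gl2 0 1 1 0 (by norm_num)
  have hw : w ∈ intGL p (Fin 2) := by
    rw [mem_intGL_fin_two, isInt_fin_two]
    simp [w, Matrix.det_fin_two_of]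
  have hww : w * w = 1 := by
    apply Units.ext
    ext i j
    fin_cases i <;> fin_cases j <;> simp [w, Matrix.mul_apply]
  -- the case where the upper left entry has the largest norm
  have key : ∀ A : GL (Fin 2) ℚ_[p], (∀ i j, ‖A.val i j‖ ≤ ‖A.val 0 0‖) →
      ∃ k₁ ∈ intGL p (Fin 2), ∃ k₂ ∈ intGL p (Fin 2), ∃ α β : ℤ, α ≤ β ∧
      A.val = k₁.val * !![(p : ℚ_[p]) ^ α, 0; 0, (p : ℚ_[p]) ^ β] * k₂.val := by
    intro A hA
    have hdet := det_ne_zero A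
    rw [Matrix.det_fin_two] at hdet
    have h0 : A.val 0 0 ≠ 0 := by
      intro h
      have : ∀ i j, A.val i j = 0 := fun i j => by
        have := hA i j; rw [h, norm_zero] at this; exact norm_le_zero_iff.1 this
      simp [this] at hdet
    set a := A.val 0 0
    set b := A.val 0 1
    set c := A.val 1 0
    set d := A.val 1 1
    have hquot : ∀ i j, ‖A.val i j / a‖ ≤ 1 := fun i j => by
      rw [norm_div]; exact div_le_one_of_le₀ (hA i j) (norm_nonneg _)
    have hd : d - b * c / a ≠ 0 := by
      intro h; apply hdet; field_simp at h; linear_combination h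
    obtain ⟨α, u, hu, eu⟩ := exists_zpow_mul_unit h0
    obtain ⟨β, v, hv, ev⟩ := exists_zpow_mul_unit hd
    have hu0 : u ≠ 0 := by rw [← norm_ne_zero_iff, hu]; norm_num
    have hv0 : v ≠ 0 := by rw [← norm_ne_zero_iff, hv]; norm_num
    -- Elimination with the pivot a of largest norm: the quotients b/a and c/a are integral, and the
    -- unit parts of a and of the Schur complement d - bc/a go into the right factor.
    refine ⟨gl2 1 0 (c / a) 1 (by simp), ?_, gl2 u (u * (b / a)) 0 v (by simp [hu0, hv0]), ?_,
      α, β, ?_, ?_⟩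
    · rw [mem_intGL_fin_two, isInt_fin_two]
      simpa [Matrix.det_fin_two_of] using hquot 1 0
    · rw [mem_intGL_fin_two, isInt_fin_two]
      refine ⟨⟨by simp [hu], ?_, by simp, by simp [hv]⟩, by simp [Matrix.det_fin_two_of, hu, hv]⟩
      simpa [hu] using hquot 0 1
    · have h1 : ‖d - b * c / a‖ ≤ ‖a‖ := by
        apply norm_sub_le_of_le (hA 1 1)
        rw [mul_div_assoc, norm_mul]
        exact (mul_le_of_le_one_right (norm_nonneg _) (hquot 1 0)).trans (hA 0 1)
      rw [ev, eu, norm_mul, norm_mul, hu, hv, norm_prime_zpow, norm_prime_zpow, mul_one, mul_one,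
        zpow_prime_le] at h1
      omega
    · have e : ∀ x : ℚ_[p], (p : ℚ_[p]) ^ α * (u * x) = a * x := fun x => by rw [eu]; ring
      ext i j
      fin_cases i <;> fin_cases j <;> simp [Matrix.mul_apply, Fin.sum_univ_two]
      · exact eu
      · change b = _
        rw [e]; field_simp
      · change c = _
        rw [mul_assoc, ← eu]; field_simp
      · change d = _
        rw [← ev, mul_assoc, e]; field_simp; ring
  obtain ⟨⟨i₀, j₀⟩, -, hmax⟩ := Finset.exists_max_image (Finset.univ : Finset (Fin 2 × Fin 2))
    (fun q => ‖A.val q.1 q.2‖) Finset.univ_nonempty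
  have hmax' : ∀ i j, ‖A.val i j‖ ≤ ‖A.val i₀ j₀‖ := fun i j => hmax (i, j) (Finset.mem_univ _)
  -- Permutations of rows and columns bring an entry of largest norm to the upper left corner.
  have hperm : ∃ w₁ ∈ intGL p (Fin 2), ∃ w₂ ∈ intGL p (Fin 2),
      ∀ i j, ‖(w₁⁻¹ * A * w₂⁻¹).val i j‖ ≤ ‖(w₁⁻¹ * A * w₂⁻¹).val 0 0‖ := by
    have hwi : w⁻¹ = w := inv_eq_of_mul_eq_one_left hww
    fin_cases i₀ <;> fin_cases j₀
    · exact ⟨1, one_mem _, 1, one_mem _, by simpa using hmax'⟩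
    · refine ⟨1, one_mem _, w, hw, ?_⟩
      rw [hwi]
      intro i j
      fin_cases i <;> fin_cases j <;> simp [w, Matrix.mul_apply,
        Fin.sum_univ_two] <;> exact hmax' _ _
    · refine ⟨w, hw, 1, one_mem _, ?_⟩
      rw [hwi]
      intro i j
      fin_cases i <;> fin_cases j <;> simp [w, Matrix.mul_apply,
        Fin.sum_univ_two] <;> exact hmax' _ _
    · refine ⟨w, hw, w, hw, ?_⟩
      rw [hwi]
      intro i j
      fin_cases i <;> fin_cases j <;> simp [w, Matrix.mul_apply, Matrix.vecMul, dotProduct,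
        Fin.sum_univ_two] <;> exact hmax' _ _
  obtain ⟨w₁, hw₁, w₂, hw₂, h⟩ := hperm
  obtain ⟨k₁, hk₁, k₂, hk₂, α, β, hαβ, e⟩ := key _ h
  refine ⟨w₁ * k₁, mul_mem hw₁ hk₁, k₂ * w₂, mul_mem hk₂ hw₂, α, β, hαβ, ?_⟩
  calc A.val = (w₁ * (w₁⁻¹ * A * w₂⁻¹) * w₂).val := by congr 1; group
    _ = w₁.val * (w₁⁻¹ * A * w₂⁻¹).val * w₂.val := rfl
    _ = _ := by rw [e]; simp only [Units.val_mul, Matrix.mul_assoc]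

variable (p) in
/-- The box `∏ p^{e i} ℤ_p`. -/
def box {ι : Type*} (e : ι → ℤ) : AddSubgroup (ι → ℚ_[p]) where
  carrier := {x | ∀ i, ‖x i‖ ≤ (p : ℝ) ^ (-e i)}
  zero_mem' := fun i => by simpa using (zpow_pos prime_real_pos _).le
  add_mem' := fun hx hy i => norm_add_le_of_le (hx i) (hy i)
  neg_mem' := fun hx i => by simpa using hx i

theorem mem_box {ι : Type*} {e : ι → ℤ} {x : ι → ℚ_[p]} :
    x ∈ box p e ↔ ∀ i, ‖x i‖ ≤ (p : ℝ) ^ (-e i) := Iff.rfl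

/-- Scaling by p^{e_i} turns the larger box into ∏ ℤ_p and the intersection into the kernel of
reduction onto ∏ ℤ/p^{(f_i - e_i)⁺}. The truncation to `toNat` is right because neither box is
assumed to contain the other. -/
theorem relIndex_box {ι : Type*} [Fintype ι] (e f : ι → ℤ) :
    (box p f).relIndex (box p e) = p ^ (∑ i, (f i - e i).toNat) := by
  let Ψ : (ι → ℤ_[p]) →+ (ι → ℚ_[p]) :=
    { toFun := fun z i => (p : ℚ_[p]) ^ e i * (z i : ℚ_[p])
      map_zero' := by ext; simp
      map_add' := fun x y => by ext; simp [mul_add] }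
  have hrange : (⊤ : AddSubgroup (ι → ℤ_[p])).map Ψ = box p e := by
    ext x
    rw [AddSubgroup.mem_map]
    constructor
    · rintro ⟨z, -, rfl⟩ i
      change ‖(p : ℚ_[p]) ^ e i * (z i : ℚ_[p])‖ ≤ _
      rw [norm_mul, norm_prime_zpow]
      exact mul_le_of_le_one_right (zpow_pos prime_real_pos _).le (z i).2
    · intro hx
      refine ⟨fun i => ⟨(p : ℚ_[p]) ^ (-e i) * x i, ?_⟩, trivial, ?_⟩
      · rw [norm_mul, norm_prime_zpow, neg_neg]
        calc _ ≤ (p : ℝ) ^ (e i) * (p : ℝ) ^ (-e i) :=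
              mul_le_mul_of_nonneg_left (hx i) (zpow_pos prime_real_pos _).le
          _ = 1 := by rw [← zpow_add₀ prime_real_pos.ne', add_neg_cancel, zpow_zero]
      · ext i
        change (p : ℚ_[p]) ^ e i * ((p : ℚ_[p]) ^ (-e i) * x i) = x i
        rw [← mul_assoc, ← zpow_add₀ prime_cast_ne_zero, add_neg_cancel, zpow_zero, one_mul]
  let Θ : (ι → ℤ_[p]) →+ (∀ i, ZMod (p ^ (f i - e i).toNat)) :=
    { toFun := fun z i => PadicInt.toZModPow (f i - e i).toNat (z i)
      map_zero' := by ext; simp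
      map_add' := fun x y => by ext; simp }
  have hker : (box p f).comap Ψ = Θ.ker := by
    ext z
    rw [AddSubgroup.mem_comap, AddMonoidHom.mem_ker, funext_iff]
    refine forall_congr' fun i => ?_
    change ‖(p : ℚ_[p]) ^ e i * (z i : ℚ_[p])‖ ≤ _ ↔ PadicInt.toZModPow _ (z i) = 0
    rw [← RingHom.mem_ker, PadicInt.ker_toZModPow, ← PadicInt.norm_le_pow_iff_mem_span_pow,
      norm_mul, norm_prime_zpow]
    have h1 : (p : ℝ) ^ (-e i) * ‖(z i : ℚ_[p])‖ ≤ (p : ℝ) ^ (-f i) ↔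
        ‖z i‖ ≤ (p : ℝ) ^ (-(f i - e i)) := by
      rw [← le_div_iff₀' (zpow_pos prime_real_pos _), ← zpow_sub₀ prime_real_pos.ne',
        show -f i - -e i = -(f i - e i) by ring]
      rfl
    rw [h1]
    rcases le_total 0 (f i - e i) with h | h
    · rw [Int.toNat_of_nonneg h]
    · rw [Int.toNat_of_nonpos h]
      simp only [Nat.cast_zero, neg_zero, zpow_zero, PadicInt.norm_le_one, iff_true]
      refine (z i).norm_le_one.trans ?_
      exact one_le_zpow₀ one_lt_prime_real.le (by omega)
  have hsurj : Function.Surjective Θ := by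
    intro y
    choose z hz using fun i => ZMod.ringHom_surjective (PadicInt.toZModPow (f i - e i).toNat) (y i)
    exact ⟨z, funext hz⟩
  rw [← hrange, ← AddSubgroup.relIndex_comap, hker, AddSubgroup.relIndex_top_right,
    AddSubgroup.index_ker, AddMonoidHom.range_eq_top.2 hsurj]
  rw [Nat.card_congr AddSubgroup.topEquiv.toEquiv, Nat.card_pi]
  simp [Finset.prod_pow_eq_pow_sum]

end KohnenSkoruppa
end

noncomputable section
namespace KohnenSkoruppa

/-! ### Lattices of symmetric matrices and their indices -/

variable {p : ℕ} [Fact p.Prime]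

/-- The symmetric matrix with entries `x 0, x 1, x 2`. -/
def symM (x : Fin 3 → ℚ_[p]) : Matrix (Fin 2) (Fin 2) ℚ_[p] := !![x 0, x 1; x 1, x 2]

theorem symM_transpose (x : Fin 3 → ℚ_[p]) : (symM x)ᵀ = symM x := by
  ext i j; fin_cases i <;> fin_cases j <;> rfl

theorem symM_add (x y : Fin 3 → ℚ_[p]) : symM (x + y) = symM x + symM y := by
  ext i j; fin_cases i <;> fin_cases j <;> rfl

theorem symM_neg (x : Fin 3 → ℚ_[p]) : symM (-x) = -symM x := by
  ext i j; fin_cases i <;> fin_cases j <;> rfl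

theorem symM_zero : symM (0 : Fin 3 → ℚ_[p]) = 0 := by
  ext i j; fin_cases i <;> fin_cases j <;> rfl

/-- The coordinates of a symmetric matrix. -/
def symC (X : Matrix (Fin 2) (Fin 2) ℚ_[p]) : Fin 3 → ℚ_[p] := ![X 0 0, X 0 1, X 1 1]

theorem symM_symC {X : Matrix (Fin 2) (Fin 2) ℚ_[p]} (h : Xᵀ = X) : symM (symC X) = X := by
  have h10 : X 0 1 = X 1 0 := congrFun (congrFun h 1) 0
  ext i j; fin_cases i <;> fin_cases j <;> simp [symM, symC, h10]

theorem symM_injective : Function.Injective (symM : (Fin 3 → ℚ_[p]) → _) := by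
  intro x y h
  have h1 := congrFun (congrFun h 0) 0
  have h2 := congrFun (congrFun h 0) 1
  have h3 := congrFun (congrFun h 1) 1
  ext i; fin_cases i
  · exact h1
  · exact h2
  · exact h3

/-- The congruence action `X ↦ k X ᵗk`. -/
def symAct (k : Matrix (Fin 2) (Fin 2) ℚ_[p]) : (Fin 3 → ℚ_[p]) →+ (Fin 3 → ℚ_[p]) where
  toFun x := symC (k * symM x * kᵀ)
  map_zero' := by rw [symM_zero]; ext i; fin_cases i <;> simp [symC]
  map_add' x y := by
    rw [symM_add, Matrix.mul_add, Matrix.add_mul]; ext i; fin_cases i <;> simp [symC]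

theorem symM_symAct (k : Matrix (Fin 2) (Fin 2) ℚ_[p]) (x : Fin 3 → ℚ_[p]) :
    symM (symAct k x) = k * symM x * kᵀ := by
  apply symM_symC
  simp only [Matrix.transpose_mul, Matrix.transpose_transpose, symM_transpose, Matrix.mul_assoc]

theorem symAct_surjective (k : GL (Fin 2) ℚ_[p]) : Function.Surjective (symAct k.val) := by
  intro x
  refine ⟨symAct (k⁻¹).val x, symM_injective ?_⟩
  rw [symM_symAct, symM_symAct]
  have h1 : k.val * (k⁻¹).val = 1 := by rw [← Units.val_mul]; simp
  calc _ = (k.val * (k⁻¹).val) * symM x * (k.val * (k⁻¹).val)ᵀ := by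
        rw [Matrix.transpose_mul]; simp only [Matrix.mul_assoc]
    _ = _ := by rw [h1]; simp

/-- The lattice of symmetric `X` with `ν A⁻¹ X ᵗA⁻¹` integral. -/
def latM (A : GL (Fin 2) ℚ_[p]) (ν : ℚ_[p]) : AddSubgroup (Fin 3 → ℚ_[p]) where
  carrier := {x | IsInt (ν • ((A⁻¹).val * symM x * ((A⁻¹).val)ᵀ))}
  zero_mem' := by simp [symM_zero, IsInt]
  add_mem' := fun {x y} hx hy => by
    simp only [Set.mem_ofPred_eq] at *
    rw [symM_add, Matrix.mul_add, Matrix.add_mul, smul_add]; exact hx.add hy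
  neg_mem' := fun {x} hx => by
    simp only [Set.mem_ofPred_eq] at *
    rw [symM_neg, Matrix.mul_neg, Matrix.neg_mul, smul_neg]; exact hx.neg

/-- The lattice of symmetric `X` with `ν X ᵗA⁻¹` integral. -/
def latI (A : GL (Fin 2) ℚ_[p]) (ν : ℚ_[p]) : AddSubgroup (Fin 3 → ℚ_[p]) where
  carrier := {x | IsInt (ν • (symM x * ((A⁻¹).val)ᵀ))}
  zero_mem' := by simp [symM_zero, IsInt]
  add_mem' := fun {x y} hx hy => by
    simp only [Set.mem_ofPred_eq] at *
    rw [symM_add, Matrix.add_mul, smul_add]; exact hx.add hy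
  neg_mem' := fun {x} hx => by
    simp only [Set.mem_ofPred_eq] at *
    rw [symM_neg, Matrix.neg_mul, smul_neg]; exact hx.neg

theorem mem_latM {A : GL (Fin 2) ℚ_[p]} {ν : ℚ_[p]} {x : Fin 3 → ℚ_[p]} :
    x ∈ latM A ν ↔ IsInt (ν • ((A⁻¹).val * symM x * ((A⁻¹).val)ᵀ)) := Iff.rfl

theorem mem_latI {A : GL (Fin 2) ℚ_[p]} {ν : ℚ_[p]} {x : Fin 3 → ℚ_[p]} :
    x ∈ latI A ν ↔ IsInt (ν • (symM x * ((A⁻¹).val)ᵀ)) := Iff.rfl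

theorem relIndex_comap_comap {E E' : Type*} [AddGroup E] [AddGroup E'] {T : E →+ E'}
    (hT : Function.Surjective T) (H K : AddSubgroup E') :
    (H.comap T).relIndex (K.comap T) = H.relIndex K := by
  rw [AddSubgroup.relIndex_comap, AddSubgroup.map_comap_eq, AddMonoidHom.range_eq_top.2 hT,
    top_inf_eq]

theorem norm_mul_zpow_le_one {ν x : ℚ_[p]} {v e : ℤ} (hv : ‖ν‖ = (p : ℝ) ^ (-v)) :
    ‖ν * ((p : ℚ_[p]) ^ (-e) * x)‖ ≤ 1 ↔ ‖x‖ ≤ (p : ℝ) ^ (-(e - v)) := by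
  rw [norm_mul, norm_mul, hv, norm_prime_zpow, neg_neg, ← mul_assoc,
    ← zpow_add₀ prime_real_pos.ne', ← le_div_iff₀' (zpow_pos prime_real_pos _), one_div,
    ← zpow_neg]
  congr! 2
  ring

theorem smith_inv {A k₁ k₂ : GL (Fin 2) ℚ_[p]} {α β : ℤ}
    (hA : A.val = k₁.val * !![(p : ℚ_[p]) ^ α, 0; 0, (p : ℚ_[p]) ^ β] * k₂.val) :
    (A⁻¹).val = (k₂⁻¹).val * !![(p : ℚ_[p]) ^ (-α), 0; 0, (p : ℚ_[p]) ^ (-β)] * (k₁⁻¹).val := by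
  have hp : (p : ℚ_[p]) ≠ 0 := prime_cast_ne_zero
  let Δ : GL (Fin 2) ℚ_[p] := gl2 (p ^ α) 0 0 (p ^ β) (by
    simpa using ⟨zpow_ne_zero _ hp, zpow_ne_zero _ hp⟩)
  let Δ' : GL (Fin 2) ℚ_[p] := gl2 (p ^ (-α)) 0 0 (p ^ (-β)) (by
    simpa using ⟨zpow_ne_zero _ hp, zpow_ne_zero _ hp⟩)
  have h1 : A = k₁ * Δ * k₂ := Units.ext hA
  have h2 : Δ⁻¹ = Δ' := by
    apply inv_eq_of_mul_eq_one_right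
    apply Units.ext
    ext i j
    fin_cases i <;> fin_cases j <;>
      simp [Δ, Δ', Matrix.mul_apply, Fin.sum_univ_two, zpow_ne_zero, hp]
  rw [h1, mul_inv_rev, mul_inv_rev, h2, ← mul_assoc]
  rfl

/-- With A = k₁ diag(p^α, p^β) k₂, the change of variable X ↦ k₁⁻¹ X ᵗk₁⁻¹ turns all three lattices
into boxes at once, so their relative indices become sums of exponents. In `latI` the off-diagonal
coordinate is subject to two conditions, of which the one with β is stronger as α ≤ β. -/
theorem lat_eq_box {A k₁ k₂ : GL (Fin 2) ℚ_[p]} (hk₁ : k₁ ∈ intGL p (Fin 2))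
    (hk₂ : k₂ ∈ intGL p (Fin 2)) {α β : ℤ} (hαβ : α ≤ β)
    (hA : A.val = k₁.val * !![(p : ℚ_[p]) ^ α, 0; 0, (p : ℚ_[p]) ^ β] * k₂.val)
    {ν : ℚ_[p]} {v : ℤ} (hv : ‖ν‖ = (p : ℝ) ^ (-v)) :
    latM A ν = (box p ![2 * α - v, α + β - v, 2 * β - v]).comap (symAct (k₁⁻¹).val) ∧
    latI A ν = (box p ![α - v, β - v, β - v]).comap (symAct (k₁⁻¹).val) ∧
    latM 1 1 = (box p (0 : Fin 3 → ℤ)).comap (symAct (k₁⁻¹).val) := by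
  have hp : (p : ℚ_[p]) ≠ 0 := prime_cast_ne_zero
  have hAi := smith_inv hA
  have hk₁' := inv_mem hk₁
  have hk₂' := inv_mem hk₂
  refine ⟨?_, ?_, ?_⟩
  · ext x
    rw [mem_latM, AddSubgroup.mem_comap, mem_box, hAi]
    set y := symAct (k₁⁻¹).val x with hy
    have hsy := symM_symAct (k₁⁻¹).val x
    rw [← hy] at hsy
    set Δ : Matrix (Fin 2) (Fin 2) ℚ_[p] := !![(p : ℚ_[p]) ^ (-α), 0; 0, (p : ℚ_[p]) ^ (-β)]
    have e : ν • ((k₂⁻¹).val * Δ * (k₁⁻¹).val * symM x * ((k₂⁻¹).val * Δ * (k₁⁻¹).val)ᵀ)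
        = (k₂⁻¹).val * (ν • (Δ * symM y * Δᵀ)) * ((k₂⁻¹).val)ᵀ := by
      rw [hsy]
      simp only [Matrix.transpose_mul, Matrix.mul_assoc, Matrix.mul_smul, Matrix.smul_mul]
    rw [e, isInt_mul_transpose_iff hk₂', isInt_mul_left_iff hk₂']
    have e2 : ν • (Δ * symM y * Δᵀ) = !![ν * (p ^ (-(2 * α)) * y 0), ν * (p ^ (-(α + β)) * y 1);
        ν * (p ^ (-(α + β)) * y 1), ν * (p ^ (-(2 * β)) * y 2)] := by
      have h1 : (p : ℚ_[p]) ^ (-(2 * α)) = p ^ (-α) * p ^ (-α) := by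
        rw [← zpow_add₀ hp]; ring_nf
      have h2 : (p : ℚ_[p]) ^ (-(α + β)) = p ^ (-α) * p ^ (-β) := by
        rw [← zpow_add₀ hp]; ring_nf
      have h3 : (p : ℚ_[p]) ^ (-(2 * β)) = p ^ (-β) * p ^ (-β) := by
        rw [← zpow_add₀ hp]; ring_nf
      have hΔ : Δᵀ = Δ := by ext i j; fin_cases i <;> fin_cases j <;> rfl
      rw [h1, h2, h3, hΔ]
      ext i j
      fin_cases i <;> fin_cases j <;> simp [Δ, symM, -mul_eq_mul_left_iff] <;> ring
    rw [e2, isInt_fin_two]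
    simp only [Matrix.of_apply, Matrix.cons_val_zero, Matrix.cons_val_one, Matrix.cons_val',
      Matrix.cons_val_fin_one, norm_mul_zpow_le_one hv, Fin.forall_fin_succ, IsEmpty.forall_iff,
      Fin.succ_zero_eq_one, Matrix.cons_val_succ, Matrix.cons_val_zero]
    tauto
  · ext x
    rw [mem_latI, AddSubgroup.mem_comap, mem_box, hAi]
    set y := symAct (k₁⁻¹).val x with hy
    have hsy := symM_symAct (k₁⁻¹).val x
    rw [← hy] at hsy
    set Δ : Matrix (Fin 2) (Fin 2) ℚ_[p] := !![(p : ℚ_[p]) ^ (-α), 0; 0, (p : ℚ_[p]) ^ (-β)]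
    have e : ν • (symM x * ((k₂⁻¹).val * Δ * (k₁⁻¹).val)ᵀ)
        = k₁.val * (ν • (symM y * Δᵀ)) * ((k₂⁻¹).val)ᵀ := by
      rw [hsy]
      have h1 : k₁.val * (k₁⁻¹).val = 1 := by rw [← Units.val_mul]; simp
      calc _ = ν • ((k₁.val * (k₁⁻¹).val) * symM x * ((k₂⁻¹).val * Δ * (k₁⁻¹).val)ᵀ) := by
            rw [h1, Matrix.one_mul]
        _ = _ := by
          simp only [Matrix.transpose_mul, Matrix.mul_assoc, Matrix.mul_smul, Matrix.smul_mul]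
    rw [e, isInt_mul_transpose_iff hk₂', isInt_mul_left_iff hk₁]
    have e2 : ν • (symM y * Δᵀ) = !![ν * (p ^ (-α) * y 0), ν * (p ^ (-β) * y 1);
        ν * (p ^ (-α) * y 1), ν * (p ^ (-β) * y 2)] := by
      have hΔ : Δᵀ = Δ := by ext i j; fin_cases i <;> fin_cases j <;> rfl
      rw [hΔ]
      ext i j
      fin_cases i <;> fin_cases j <;> simp [Δ, symM, -mul_eq_mul_left_iff] <;> ring
    rw [e2, isInt_fin_two]
    simp only [Matrix.of_apply, Matrix.cons_val_zero, Matrix.cons_val_one, Matrix.cons_val',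
      Matrix.cons_val_fin_one, norm_mul_zpow_le_one hv, Fin.forall_fin_succ, IsEmpty.forall_iff,
      Fin.succ_zero_eq_one, Matrix.cons_val_succ, Matrix.cons_val_zero]
    have : (p : ℝ) ^ (-(β - v)) ≤ (p : ℝ) ^ (-(α - v)) := zpow_prime_le.2 (by omega)
    constructor
    · rintro ⟨h1, h2, h3, h4⟩; exact ⟨h1, h2, h4, trivial⟩
    · rintro ⟨h1, h2, h4, -⟩; exact ⟨h1, h2, h2.trans this, h4⟩
  · ext x
    rw [mem_latM, AddSubgroup.mem_comap, mem_box, inv_one, Units.val_one, Matrix.one_mul,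
      Matrix.transpose_one, Matrix.mul_one, one_smul]
    set y := symAct (k₁⁻¹).val x with hy
    have hsy := symM_symAct (k₁⁻¹).val x
    rw [← hy] at hsy
    have : IsInt (symM x) ↔ IsInt (symM y) := by
      rw [hsy, isInt_mul_transpose_iff hk₁', isInt_mul_left_iff hk₁']
    rw [this, isInt_fin_two]
    simp only [symM, Matrix.of_apply, Matrix.cons_val_zero, Matrix.cons_val_one, Matrix.cons_val',
      Matrix.cons_val_fin_one, Fin.forall_fin_succ, IsEmpty.forall_iff, Pi.zero_apply, neg_zero,
      zpow_zero, Fin.succ_zero_eq_one, Fin.succ_one_eq_two]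
    tauto

theorem norm_det_smith {A k₁ k₂ : GL (Fin 2) ℚ_[p]} (hk₁ : k₁ ∈ intGL p (Fin 2))
    (hk₂ : k₂ ∈ intGL p (Fin 2)) {α β : ℤ}
    (hA : A.val = k₁.val * !![(p : ℚ_[p]) ^ α, 0; 0, (p : ℚ_[p]) ^ β] * k₂.val) :
    ‖A.val.det‖ = (p : ℝ) ^ (-(α + β)) := by
  rw [hA, Matrix.det_mul, Matrix.det_mul, norm_mul, norm_mul, (mem_intGL_fin_two.1 hk₁).2,
    (mem_intGL_fin_two.1 hk₂).2, Matrix.det_fin_two_of, mul_zero, sub_zero, one_mul, mul_one,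
    ← zpow_add₀ prime_cast_ne_zero, norm_prime_zpow]

/-- This is m⁺ = m⁻ + m in the exponent. It compares the two relative indices of a pair of lattices
neither of which contains the other. -/
theorem toNat_pow_ratio (m : ℤ) : ((p : ℝ) ^ m.toNat) = (p : ℝ) ^ (-m).toNat * (p : ℝ) ^ m := by
  rw [← zpow_natCast, ← zpow_natCast, ← zpow_add₀ prime_real_pos.ne']
  congr 1
  omega

/-- The generalized index of `latM A ν` in the lattice of integral symmetric matrices. -/
theorem relIndex_latM (A : GL (Fin 2) ℚ_[p]) {ν : ℚ_[p]} (hν : ν ≠ 0) :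
    (latM 1 1).relIndex (latM A ν) ≠ 0 ∧
    ((latM A ν).relIndex (latM 1 1) : ℝ) =
      (latM 1 1).relIndex (latM A ν) * (‖ν‖ / ‖A.val.det‖) ^ 3 := by
  obtain ⟨k₁, hk₁, k₂, hk₂, α, β, hαβ, hA⟩ := exists_smith A
  obtain ⟨v, hv⟩ := norm_eq_zpow hν
  obtain ⟨h1, -, h3⟩ := lat_eq_box hk₁ hk₂ hαβ hA hv
  have hT := symAct_surjective (k₁⁻¹)
  rw [h1, h3, relIndex_comap_comap hT, relIndex_comap_comap hT, relIndex_box, relIndex_box]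
  refine ⟨pow_ne_zero _ (Fact.out : p.Prime).ne_zero, ?_⟩
  rw [norm_det_smith hk₁ hk₂ hA, hv, ← zpow_sub₀ prime_real_pos.ne', ← zpow_natCast, ← zpow_mul]
  push_cast
  simp only [Fin.sum_univ_three, Pi.zero_apply, sub_zero, zero_sub, pow_add,
    Matrix.cons_val_zero, Matrix.cons_val_one, Matrix.cons_val]
  rw [toNat_pow_ratio (2 * α - v), toNat_pow_ratio (α + β - v), toNat_pow_ratio (2 * β - v)]
  have : (p : ℝ) ^ ((-v - -(α + β)) * 3) =
      (p : ℝ) ^ (2 * α - v) * (p : ℝ) ^ (α + β - v) * (p : ℝ) ^ (2 * β - v) := by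
    rw [← zpow_add₀ prime_real_pos.ne', ← zpow_add₀ prime_real_pos.ne']; congr 1; ring
  rw [this]; ring

/-- Multiplication by integral invertible matrices does not change the largest norm of an entry, and
for diag(p^α, p^β) with α ≤ β it is p^{-α}. -/
theorem norm_max_smith {A k₁ k₂ : GL (Fin 2) ℚ_[p]} (hk₁ : k₁ ∈ intGL p (Fin 2))
    (hk₂ : k₂ ∈ intGL p (Fin 2)) {α β : ℤ} (hαβ : α ≤ β)
    (hA : A.val = k₁.val * !![(p : ℚ_[p]) ^ α, 0; 0, (p : ℚ_[p]) ^ β] * k₂.val) {r : ℝ}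
    (h1 : ∀ i j, ‖A.val i j‖ ≤ r) (h2 : ∃ i j, ‖A.val i j‖ = r) : r = (p : ℝ) ^ (-α) := by
  have hp : (p : ℚ_[p]) ≠ 0 := prime_cast_ne_zero
  have h3 : IsInt ((p : ℚ_[p]) ^ (-α) • A.val) := by
    rw [hA, ← Matrix.smul_mul, ← Matrix.mul_smul, isInt_mul_right_iff hk₂, isInt_mul_left_iff hk₁,
      isInt_fin_two]
    simp only [Matrix.smul_apply, smul_eq_mul, Matrix.of_apply, Matrix.cons_val_zero,
      Matrix.cons_val_one, Matrix.cons_val', Matrix.cons_val_fin_one, mul_zero, norm_zero,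
      zero_le_one, true_and, ← zpow_add₀ hp, norm_prime_zpow]
    constructor
    · simp
    · exact zpow_le_one_of_nonpos₀ one_lt_prime_real.le (by omega)
  apply le_antisymm
  · obtain ⟨i, j, e⟩ := h2
    have := h3 i j
    rw [Matrix.smul_apply, smul_eq_mul, norm_mul, e, norm_prime_zpow, neg_neg,
      ← le_div_iff₀' (zpow_pos prime_real_pos _), one_div, ← zpow_neg] at this
    exact this
  · by_contra hlt
    push Not at hlt
    have hr : r ≤ (p : ℝ) ^ (-α - 1) := by
      obtain ⟨i, j, e⟩ := h2
      rw [← e] at hlt ⊢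
      exact norm_le_zpow_of_lt (by rwa [sub_add_cancel])
    have h4 : IsInt ((p : ℚ_[p]) ^ (-α - 1) • A.val) := fun i j => by
      rw [Matrix.smul_apply, smul_eq_mul, norm_mul, norm_prime_zpow,
        ← le_div_iff₀' (zpow_pos prime_real_pos _), one_div, ← zpow_neg, neg_neg]
      exact (h1 i j).trans hr
    rw [hA, ← Matrix.smul_mul, ← Matrix.mul_smul, isInt_mul_right_iff hk₂, isInt_mul_left_iff hk₁,
      isInt_fin_two] at h4
    have h5 := h4.1
    simp only [Matrix.smul_apply, smul_eq_mul, Matrix.of_apply, Matrix.cons_val_zero,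
      Matrix.cons_val', Matrix.cons_val_fin_one, ← zpow_add₀ hp, norm_prime_zpow] at h5
    have h6 : (p : ℝ) ^ (-(-α - 1 + α)) = p := by
      rw [show -(-α - 1 + α) = 1 by ring, zpow_one]
    rw [h6] at h5
    exact absurd h5 (not_le.2 one_lt_prime_real)

/-- The exponents of the two boxes differ by α, α and β, whose sum is (α + β) + α. The hypothesis r
≤ 1 says that A is integral, so α ≥ 0 and `toNat` truncates nothing. -/
theorem relIndex_latM_latI {A : GL (Fin 2) ℚ_[p]} {ν : ℚ_[p]} (hν : ν ≠ 0) {r : ℝ} (hr : r ≤ 1)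
    (h1 : ∀ i j, ‖A.val i j‖ ≤ r) (h2 : ∃ i j, ‖A.val i j‖ = r) :
    ((latM A ν).relIndex (latI A ν) : ℝ) = ‖A.val.det‖⁻¹ * r⁻¹ := by
  obtain ⟨k₁, hk₁, k₂, hk₂, α, β, hαβ, hA⟩ := exists_smith A
  obtain ⟨v, hv⟩ := norm_eq_zpow hν
  obtain ⟨e1, e2, -⟩ := lat_eq_box hk₁ hk₂ hαβ hA hv
  have hT := symAct_surjective (k₁⁻¹)
  have hrα := norm_max_smith hk₁ hk₂ hαβ hA h1 h2
  have hα : 0 ≤ α := by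
    by_contra h
    push Not at h
    have : (1 : ℝ) < (p : ℝ) ^ (-α) := one_lt_zpow₀ one_lt_prime_real (by omega)
    linarith
  rw [e1, e2, relIndex_comap_comap hT, relIndex_box, norm_det_smith hk₁ hk₂ hA, hrα, ← zpow_neg,
    ← zpow_neg, ← zpow_add₀ prime_real_pos.ne']
  push_cast
  rw [← zpow_natCast]
  congr 1
  simp only [Fin.sum_univ_three, Matrix.cons_val_zero, Matrix.cons_val_one, Matrix.cons_val]
  omega

/-- The lattice of `x` with `B x` integral. -/
def latV (B : GL (Fin 2) ℚ_[p]) : AddSubgroup (Fin 2 → ℚ_[p]) where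
  carrier := {x | ∀ i, ‖(B.val *ᵥ x) i‖ ≤ 1}
  zero_mem' := by simp
  add_mem' := fun {x y} hx hy i => by
    rw [Matrix.mulVec_add]; exact norm_add_le_of_le (hx i) (hy i)
  neg_mem' := fun {x} hx i => by
    rw [Matrix.mulVec_neg, Pi.neg_apply, norm_neg]; exact hx i

theorem mem_latV {B : GL (Fin 2) ℚ_[p]} {x : Fin 2 → ℚ_[p]} :
    x ∈ latV B ↔ ∀ i, ‖(B.val *ᵥ x) i‖ ≤ 1 := Iff.rfl

theorem mulVec_int_iff {k : GL (Fin 2) ℚ_[p]} (hk : k ∈ intGL p (Fin 2)) {x : Fin 2 → ℚ_[p]} :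
    (∀ i, ‖(k.val *ᵥ x) i‖ ≤ 1) ↔ ∀ i, ‖x i‖ ≤ 1 := by
  have := isInt_mul_left_iff hk (M := Matrix.of fun i (_ : Unit) => x i)
  constructor
  · intro h i
    exact this.1 (fun i _ => h i) i ()
  · intro h i
    exact this.2 (fun i _ => h i) i ()

/-- The counterpart of `relIndex_latM` for the two-dimensional group N, again by elementary
divisors. -/
theorem relIndex_latV (B : GL (Fin 2) ℚ_[p]) :
    (latV 1).relIndex (latV B) ≠ 0 ∧
    ((latV B).relIndex (latV 1) : ℝ) = (latV 1).relIndex (latV B) * ‖B.val.det‖ := by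
  obtain ⟨k₁, hk₁, k₂, hk₂, α, β, hαβ, hB⟩ := exists_smith B
  let T : (Fin 2 → ℚ_[p]) →+ (Fin 2 → ℚ_[p]) := (Matrix.mulVecLin k₂.val).toAddMonoidHom
  have hT : Function.Surjective T := by
    intro x
    refine ⟨(k₂⁻¹).val *ᵥ x, ?_⟩
    change k₂.val *ᵥ ((k₂⁻¹).val *ᵥ x) = x
    rw [Matrix.mulVec_mulVec, ← Units.val_mul]; simp
  have e1 : latV B = (box p ![-α, -β]).comap T := by
    ext x
    rw [mem_latV, hB, ← Matrix.mulVec_mulVec, ← Matrix.mulVec_mulVec, mulVec_int_iff hk₁,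
      AddSubgroup.mem_comap, mem_box]
    change _ ↔ ∀ i, ‖(k₂.val *ᵥ x) i‖ ≤ _
    set y := k₂.val *ᵥ x
    simp only [Fin.forall_fin_two, Matrix.cons_val_zero, Matrix.cons_val_one, neg_neg,
      Matrix.mulVec, dotProduct, Fin.sum_univ_two, Matrix.of_apply, Matrix.cons_val',
      Matrix.cons_val_fin_one, zero_mul, add_zero, zero_add, norm_mul, norm_prime_zpow]
    rw [← le_div_iff₀' (zpow_pos prime_real_pos _), ← le_div_iff₀' (zpow_pos prime_real_pos _),
      one_div, one_div, ← zpow_neg, ← zpow_neg, neg_neg, neg_neg]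
  have e2 : latV 1 = (box p (0 : Fin 2 → ℤ)).comap T := by
    ext x
    rw [mem_latV, Units.val_one, Matrix.one_mulVec, AddSubgroup.mem_comap, mem_box]
    rw [← mulVec_int_iff hk₂]
    simp [T]
  rw [e1, e2, relIndex_comap_comap hT, relIndex_comap_comap hT, relIndex_box, relIndex_box]
  refine ⟨pow_ne_zero _ (Fact.out : p.Prime).ne_zero, ?_⟩
  rw [norm_det_smith hk₁ hk₂ hB]
  push_cast
  simp only [Fin.sum_univ_two, Pi.zero_apply, sub_zero, zero_sub, neg_neg, pow_add,
    Matrix.cons_val_zero, Matrix.cons_val_one]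
  rw [toNat_pow_ratio (-α), toNat_pow_ratio (-β), neg_neg, neg_neg]
  have : (p : ℝ) ^ (-(α + β)) = (p : ℝ) ^ (-α) * (p : ℝ) ^ (-β) := by
    rw [← zpow_add₀ prime_real_pos.ne']; congr 1; ring
  rw [this]; ring

end KohnenSkoruppa
end

noncomputable section
namespace KohnenSkoruppa

/-! ### The group `GSp₄` -/

variable {p : ℕ} [Fact p.Prime]

theorem J4_mul_J4 : J4 ℚ_[p] * J4 ℚ_[p] = -1 := by
  rw [J4, Matrix.fromBlocks_multiply, ← Matrix.fromBlocks_one, Matrix.fromBlocks_neg]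
  simp

theorem J4_isInt : IsInt (J4 ℚ_[p]) := by
  intro i j
  rcases i with i | i <;> rcases j with j | j <;> fin_cases i <;> fin_cases j <;> simp [J4]

theorem mat_J4 (g : GSp4 p) : mat g * J4 ℚ_[p] * (mat g)ᵀ = nu g • J4 ℚ_[p] := by
  obtain ⟨c, hc⟩ := g.2
  have h1 : nu g = c := by
    unfold nu
    change ((g : GL Idx ℚ_[p]).val * J4 ℚ_[p] * (g : GL Idx ℚ_[p]).valᵀ) _ _ = _
    rw [hc]
    simp [J4]
  rw [h1]; exact hc

theorem nu_eq_of {g : GSp4 p} {c : ℚ_[p]}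
    (h : mat g * J4 ℚ_[p] * (mat g)ᵀ = c • J4 ℚ_[p]) : nu g = c := by
  unfold nu; rw [h]; simp [J4]

theorem nu_ne_zero (g : GSp4 p) : nu g ≠ 0 := by
  obtain ⟨c, hc⟩ := g.2
  have h1 : nu g = c := nu_eq_of hc
  rw [h1]; exact c.ne_zero

theorem nu_one : nu (1 : GSp4 p) = 1 := nu_eq_of (by simp [mat_one])

theorem nu_mul (g h : GSp4 p) : nu (g * h) = nu g * nu h := by
  apply nu_eq_of
  have : mat (g * h) * J4 ℚ_[p] * (mat (g * h))ᵀ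
      = mat g * (mat h * J4 ℚ_[p] * (mat h)ᵀ) * (mat g)ᵀ := by
    rw [mat_mul, Matrix.transpose_mul]; simp only [Matrix.mul_assoc]
  rw [this, mat_J4, Matrix.mul_smul, Matrix.smul_mul, mat_J4, smul_smul, mul_comm]

theorem nu_inv (g : GSp4 p) : nu g⁻¹ = (nu g)⁻¹ := by
  have : nu g⁻¹ * nu g = 1 := by rw [← nu_mul, inv_mul_cancel, nu_one]
  exact eq_inv_of_mul_eq_one_left this

theorem mat_injective : Function.Injective (mat : GSp4 p → _) := fun _ _ h =>
  Subtype.ext (Units.ext h)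

theorem mat_mul_inv (g : GSp4 p) : mat g * mat g⁻¹ = 1 := by
  rw [← mat_mul, mul_inv_cancel, mat_one]

theorem mat_inv_mul (g : GSp4 p) : mat g⁻¹ * mat g = 1 := by
  rw [← mat_mul, inv_mul_cancel, mat_one]

/-- The similitude equation gives an explicit right inverse. -/
theorem similitude_mul_inv {M : Matrix Idx Idx ℚ_[p]} {c : ℚ_[p]} (hc : c ≠ 0)
    (h : M * J4 ℚ_[p] * Mᵀ = c • J4 ℚ_[p]) :
    M * (-c⁻¹ • (J4 ℚ_[p] * Mᵀ * J4 ℚ_[p])) = 1 := by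
  have : M * (-c⁻¹ • (J4 ℚ_[p] * Mᵀ * J4 ℚ_[p])) = -c⁻¹ • ((M * J4 ℚ_[p] * Mᵀ) * J4 ℚ_[p]) := by
    rw [Matrix.mul_smul]; simp only [Matrix.mul_assoc]
  rw [this, h, Matrix.smul_mul, J4_mul_J4, smul_smul]
  simp [hc]

/-- The element of `GSp₄` with a given matrix. -/
def ofMat (M : Matrix Idx Idx ℚ_[p]) (c : ℚ_[p]) (hc : c ≠ 0)
    (h : M * J4 ℚ_[p] * Mᵀ = c • J4 ℚ_[p]) : GSp4 p :=
  ⟨⟨M, -c⁻¹ • (J4 ℚ_[p] * Mᵀ * J4 ℚ_[p]), similitude_mul_inv hc h,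
    mul_eq_one_comm.1 (similitude_mul_inv hc h)⟩, Units.mk0 c hc, h⟩

@[simp] theorem mat_ofMat (M : Matrix Idx Idx ℚ_[p]) (c : ℚ_[p]) (hc : c ≠ 0)
    (h : M * J4 ℚ_[p] * Mᵀ = c • J4 ℚ_[p]) : mat (ofMat M c hc h) = M := rfl

theorem nu_ofMat (M : Matrix Idx Idx ℚ_[p]) (c : ℚ_[p]) (hc : c ≠ 0)
    (h : M * J4 ℚ_[p] * Mᵀ = c • J4 ℚ_[p]) : nu (ofMat M c hc h) = c := nu_eq_of h

theorem mat_inv_eq (g : GSp4 p) :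
    mat g⁻¹ = -(nu g)⁻¹ • (J4 ℚ_[p] * (mat g)ᵀ * J4 ℚ_[p]) := by
  have h := similitude_mul_inv (nu_ne_zero g) (mat_J4 g)
  rw [mat_inv]
  exact Matrix.inv_eq_right_inv h

theorem mem_maxCompact_iff {g : GSp4 p} :
    g ∈ maxCompact p ↔ IsInt (mat g) ∧ IsInt (mat g⁻¹) := by
  constructor
  · rintro ⟨k, hk⟩
    have e1 : mat g = (k : Matrix Idx Idx ℤ_[p]).map (algebraMap ℤ_[p] ℚ_[p]) := by
      have := congrArg Units.val hk
      exact this.symm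
    have e2 : mat g⁻¹ = ((k⁻¹ : GL Idx ℤ_[p]) : Matrix Idx Idx ℤ_[p]).map
        (algebraMap ℤ_[p] ℚ_[p]) := by
      have h2 : Matrix.GeneralLinearGroup.map (n := Idx) (algebraMap ℤ_[p] ℚ_[p]) k⁻¹ =
          ((g⁻¹ : GSp4 p) : GL Idx ℚ_[p]) := by
        rw [map_inv, hk]; rfl
      have := congrArg Units.val h2
      exact this.symm
    rw [e1, e2]
    exact ⟨fun i j => PadicInt.norm_le_one _, fun i j => PadicInt.norm_le_one _⟩
  · rintro ⟨h1, h2⟩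
    let M : Matrix Idx Idx ℤ_[p] := fun i j => ⟨mat g i j, h1 i j⟩
    let N : Matrix Idx Idx ℤ_[p] := fun i j => ⟨mat g⁻¹ i j, h2 i j⟩
    have hinj : Function.Injective
        (fun X : Matrix Idx Idx ℤ_[p] => X.map (algebraMap ℤ_[p] ℚ_[p])) :=
      Matrix.map_injective Subtype.val_injective
    have hM : M.map (algebraMap ℤ_[p] ℚ_[p]) = mat g := rfl
    have hN : N.map (algebraMap ℤ_[p] ℚ_[p]) = mat g⁻¹ := rfl
    have hMN : M * N = 1 := by
      apply hinj
      change (M * N).map _ = (1 : Matrix Idx Idx ℤ_[p]).map _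
      rw [Matrix.map_mul, hM, hN, mat_mul_inv, Matrix.map_one _ (map_zero _) (map_one _)]
    refine ⟨⟨M, N, hMN, mul_eq_one_comm.1 hMN⟩, ?_⟩
    apply Units.ext
    rfl

/-- The inverse is -ν⁻¹ J ᵗg J, so it is integral as soon as g is integral and ν is a unit.
Membership thus needs no look at the inverse. -/
theorem mem_maxCompact {g : GSp4 p} : g ∈ maxCompact p ↔ IsInt (mat g) ∧ ‖nu g‖ = 1 := by
  have hle : ∀ g : GSp4 p, IsInt (mat g) → ‖nu g‖ ≤ 1 := fun g hg =>
    ((hg.mul J4_isInt).mul hg.transpose) _ _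
  rw [mem_maxCompact_iff]
  constructor
  · rintro ⟨h1, h2⟩
    refine ⟨h1, le_antisymm (hle g h1) ?_⟩
    have h3 := hle _ h2
    rw [nu_inv, norm_inv] at h3
    have hpos : 0 < ‖nu g‖ := norm_pos_iff.2 (nu_ne_zero g)
    exact (inv_le_one₀ hpos).1 h3
  · rintro ⟨h1, h2⟩
    refine ⟨h1, ?_⟩
    rw [mat_inv_eq]
    exact IsInt.smul (by rw [norm_neg, norm_inv, h2, inv_one])
      ((J4_isInt.mul h1.transpose).mul J4_isInt)

theorem continuous_mat : Continuous (mat : GSp4 p → Matrix Idx Idx ℚ_[p]) :=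
  Units.continuous_val.comp continuous_subtype_val

theorem continuous_nu : Continuous (nu : GSp4 p → ℚ_[p]) := by
  have : Continuous fun g : GSp4 p => mat g * J4 ℚ_[p] * (mat g)ᵀ :=
    (continuous_mat.matrix_mul continuous_const).matrix_mul continuous_mat.matrix_transpose
  exact (continuous_apply_apply (Sum.inl 0) (Sum.inr 0)).comp this

theorem isOpen_norm_le_one : IsOpen {x : ℚ_[p] | ‖x‖ ≤ 1} := by
  have : {x : ℚ_[p] | ‖x‖ ≤ 1} = Metric.closedBall 0 1 := by ext; simp
  rw [this]; exact IsUltrametricDist.isOpen_closedBall _ one_ne_zero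

theorem maxCompact_isOpen : IsOpen (maxCompact p : Set (GSp4 p)) := by
  have : (maxCompact p : Set (GSp4 p)) = (⋂ i, ⋂ j, (fun g : GSp4 p => mat g i j) ⁻¹'
      {x | ‖x‖ ≤ 1}) ∩ ⋂ i, ⋂ j, (fun g : GSp4 p => mat g⁻¹ i j) ⁻¹' {x | ‖x‖ ≤ 1} := by
    ext g
    simp only [SetLike.mem_coe, mem_maxCompact_iff, IsInt, Set.mem_inter_iff, Set.mem_iInter,
      Set.mem_preimage, Set.mem_ofPred_eq]
  rw [this]
  refine IsOpen.inter ?_ ?_ <;> refine isOpen_iInter_of_finite fun i =>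
    isOpen_iInter_of_finite fun j => isOpen_norm_le_one.preimage ?_
  · exact (continuous_apply_apply i j).comp continuous_mat
  · exact (continuous_apply_apply i j).comp (continuous_mat.comp continuous_inv)

/-- GSp₄ is closed in GL₄, and K is the preimage of the image of the compact group GL₄(ℤ_p). -/
theorem maxCompact_isCompact : IsCompact (maxCompact p : Set (GSp4 p)) := by
  have hcl : IsClosed ((GSp4 p : Subgroup (GL Idx ℚ_[p])) : Set (GL Idx ℚ_[p])) := by
    have hc : Continuous fun g : GL Idx ℚ_[p] => g.val * J4 ℚ_[p] * g.valᵀ :=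
      (Units.continuous_val.matrix_mul continuous_const).matrix_mul
        Units.continuous_val.matrix_transpose
    have : ((GSp4 p : Subgroup (GL Idx ℚ_[p])) : Set (GL Idx ℚ_[p])) =
        {g | g.val * J4 ℚ_[p] * g.valᵀ =
          (g.val * J4 ℚ_[p] * g.valᵀ) (Sum.inl 0) (Sum.inr 0) • J4 ℚ_[p]} := by
      ext g
      constructor
      · intro hg
        exact mat_J4 (⟨g, hg⟩ : GSp4 p)
      · intro hg
        rw [Set.mem_ofPred_eq] at hg
        have h0 : (g.val * J4 ℚ_[p] * g.valᵀ) (Sum.inl 0) (Sum.inr 0) ≠ 0 := by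
          intro h0
          rw [h0, zero_smul] at hg
          have hJ : J4 ℚ_[p] = g⁻¹.val * (g.val * J4 ℚ_[p] * g.valᵀ) * g⁻¹.valᵀ := by
            have h1 : g⁻¹.val * g.val = 1 := by rw [← Units.val_mul]; simp
            calc J4 ℚ_[p] = (g⁻¹.val * g.val) * J4 ℚ_[p] * (g⁻¹.val * g.val)ᵀ := by
                  rw [h1]; simp
              _ = _ := by rw [Matrix.transpose_mul]; simp only [Matrix.mul_assoc]
          rw [hg] at hJ
          have := congrFun (congrFun hJ (Sum.inl 0)) (Sum.inr 0)
          simp [J4] at this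
        exact ⟨Units.mk0 _ h0, hg⟩
    rw [this]
    exact isClosed_eq hc ((((continuous_apply_apply (Sum.inl 0) (Sum.inr 0)).comp hc)).smul
      continuous_const)
  have hemb : Topology.IsClosedEmbedding (Subtype.val : GSp4 p → GL Idx ℚ_[p]) :=
    hcl.isClosedEmbedding_subtypeVal
  have hrange : IsCompact (Set.range
      (Matrix.GeneralLinearGroup.map (n := Idx) (algebraMap ℤ_[p] ℚ_[p]))) := by
    have : CompactSpace (Matrix Idx Idx ℤ_[p]) :=
      inferInstanceAs (CompactSpace (Idx → Idx → ℤ_[p]))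
    have : T2Space (Matrix Idx Idx ℤ_[p]) := inferInstanceAs (T2Space (Idx → Idx → ℤ_[p]))
    have : CompactSpace (GL Idx ℤ_[p]) := inferInstanceAs (CompactSpace (Matrix Idx Idx ℤ_[p])ˣ)
    apply isCompact_range
    apply Continuous.units_map
    exact continuous_id.matrix_map continuous_subtype_val
  exact hemb.isCompact_preimage hrange

theorem relIndex_ne_zero_of_isCompact {G : Type*} [Group G] [TopologicalSpace G]
    [IsTopologicalGroup G] {K P : Subgroup G} (hK : IsCompact (K : Set G))
    (hP : IsOpen (P : Set G)) : P.relIndex K ≠ 0 := by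
  have : CompactSpace K := isCompact_iff_compactSpace.1 hK
  have h1 : IsOpen ((P.subgroupOf K : Subgroup K) : Set K) := hP.preimage continuous_subtype_val
  have : Finite (K ⧸ P.subgroupOf K) := Subgroup.quotient_finite_of_isOpen _ h1
  exact Nat.card_ne_zero.2 ⟨inferInstance, this⟩

section Elements

/-- The element `diag(A, ν ᵗA⁻¹)` of the Siegel Levi subgroup. -/
def levi (A : GL (Fin 2) ℚ_[p]) (ν : ℚ_[p]ˣ) : GSp4 p :=
  ofMat (Matrix.fromBlocks A.val 0 0 ((ν : ℚ_[p]) • (A⁻¹.val)ᵀ)) ν ν.ne_zero (by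
    have h1 : A.val * A⁻¹.val = 1 := by rw [← Units.val_mul]; simp
    have h2 : (A⁻¹.val)ᵀ * A.valᵀ = 1 := by rw [← Matrix.transpose_mul, h1, Matrix.transpose_one]
    rw [J4, Matrix.fromBlocks_transpose, Matrix.fromBlocks_multiply, Matrix.fromBlocks_multiply,
      Matrix.fromBlocks_smul]
    simp only [Matrix.transpose_zero, Matrix.mul_zero, Matrix.zero_mul, Matrix.mul_one,
      Matrix.mul_neg, Matrix.transpose_smul, Matrix.transpose_transpose, Matrix.mul_smul,
      Matrix.smul_mul, h1, h2, add_zero, zero_add, smul_zero, neg_zero, smul_neg, Matrix.neg_mul])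

theorem mat_levi (A : GL (Fin 2) ℚ_[p]) (ν : ℚ_[p]ˣ) :
    mat (levi A ν) = Matrix.fromBlocks A.val 0 0 ((ν : ℚ_[p]) • (A⁻¹.val)ᵀ) := rfl

theorem nu_levi (A : GL (Fin 2) ℚ_[p]) (ν : ℚ_[p]ˣ) : nu (levi A ν) = ν := nu_ofMat _ _ _ _

theorem levi_mul (A B : GL (Fin 2) ℚ_[p]) (ν μ : ℚ_[p]ˣ) :
    levi (A * B) (ν * μ) = levi A ν * levi B μ := by
  apply mat_injective
  rw [mat_mul, mat_levi, mat_levi, mat_levi, Matrix.fromBlocks_multiply]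
  simp only [Units.val_mul, mul_inv_rev, Matrix.transpose_mul, Matrix.mul_zero, Matrix.zero_mul,
    add_zero, zero_add, Matrix.mul_smul, Matrix.smul_mul, smul_smul, smul_zero]
  rw [mul_comm (μ : ℚ_[p])]

theorem levi_one : levi (1 : GL (Fin 2) ℚ_[p]) 1 = 1 := by
  apply mat_injective
  rw [mat_levi, mat_one, ← Matrix.fromBlocks_one]
  simp

theorem levi_inv (A : GL (Fin 2) ℚ_[p]) (ν : ℚ_[p]ˣ) : (levi A ν)⁻¹ = levi A⁻¹ ν⁻¹ := by
  apply inv_eq_of_mul_eq_one_right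
  rw [← levi_mul, mul_inv_cancel, mul_inv_cancel, levi_one]

/-- The element `(1, X; 0, 1)` of `U`. -/
def uni (x : Fin 3 → ℚ_[p]) : GSp4 p :=
  ofMat (Matrix.fromBlocks 1 (symM x) 0 1) 1 one_ne_zero (by
    rw [J4, Matrix.fromBlocks_transpose, Matrix.fromBlocks_multiply, Matrix.fromBlocks_multiply]
    simp [symM_transpose])

theorem mat_uni (x : Fin 3 → ℚ_[p]) : mat (uni x) = Matrix.fromBlocks 1 (symM x) 0 1 := rfl

theorem nu_uni (x : Fin 3 → ℚ_[p]) : nu (uni x) = 1 := nu_ofMat _ _ _ _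

theorem uni_add (x y : Fin 3 → ℚ_[p]) : uni (x + y) = uni x * uni y := by
  apply mat_injective
  rw [mat_mul, mat_uni, mat_uni, mat_uni, Matrix.fromBlocks_multiply, symM_add]
  simp [add_comm]

theorem uni_zero : uni (0 : Fin 3 → ℚ_[p]) = 1 := by
  apply mat_injective
  rw [mat_uni, symM_zero, mat_one, Matrix.fromBlocks_one]

theorem uni_neg (x : Fin 3 → ℚ_[p]) : uni (-x) = (uni x)⁻¹ := by
  symm
  apply inv_eq_of_mul_eq_one_right
  rw [← uni_add, add_neg_cancel, uni_zero]

/-- `uni` as a homomorphism. -/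
def uniHom : Multiplicative (Fin 3 → ℚ_[p]) →* GSp4 p where
  toFun x := uni x.toAdd
  map_one' := uni_zero
  map_mul' _ _ := uni_add _ _

theorem uni_mem (x : Fin 3 → ℚ_[p]) : uni x ∈ unipU p := ⟨symM x, rfl⟩

theorem mem_unipU {g : GSp4 p} : g ∈ unipU p ↔ ∃ x, g = uni x := by
  constructor
  · rintro ⟨X, hX⟩
    have h := mat_J4 g
    rw [hX, J4, Matrix.fromBlocks_transpose, Matrix.fromBlocks_multiply,
      Matrix.fromBlocks_multiply, Matrix.fromBlocks_smul, Matrix.fromBlocks_inj] at h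
    have h1 := h.1
    simp only [Matrix.one_mul, Matrix.mul_zero, Matrix.mul_neg, Matrix.mul_one, zero_add, smul_zero,
      Matrix.transpose_one, add_zero] at h1
    have hs : Xᵀ = X := by
      rw [neg_add_eq_zero] at h1; exact h1.symm
    refine ⟨symC X, mat_injective ?_⟩
    rw [hX, mat_uni, symM_symC hs]
  · rintro ⟨x, rfl⟩; exact uni_mem x

theorem levi_mul_uni (A : GL (Fin 2) ℚ_[p]) (ν : ℚ_[p]ˣ) (x : Fin 3 → ℚ_[p]) :
    levi A ν * uni x = uni ((ν : ℚ_[p])⁻¹ • symAct A.val x) * levi A ν := by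
  apply mat_injective
  have h2 : A.valᵀ * (A⁻¹.val)ᵀ = 1 := by
    rw [← Matrix.transpose_mul, ← Units.val_mul]; simp
  have h3 : symM ((ν : ℚ_[p])⁻¹ • symAct A.val x) = (ν : ℚ_[p])⁻¹ • (A.val * symM x * A.valᵀ) := by
    rw [← symM_symAct]
    ext i j; fin_cases i <;> fin_cases j <;> rfl
  rw [mat_mul, mat_mul, mat_levi, mat_uni, mat_uni, Matrix.fromBlocks_multiply,
    Matrix.fromBlocks_multiply, h3]
  simp only [Matrix.mul_one, Matrix.one_mul, Matrix.mul_zero, Matrix.zero_mul, add_zero, zero_add]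
  congr 1
  rw [Matrix.smul_mul, Matrix.mul_smul, smul_smul, inv_mul_cancel₀ ν.ne_zero, one_smul,
    Matrix.mul_assoc, h2, Matrix.mul_one]

/-- The scalar matrix `z`. -/
def scal (z : ℚ_[p]ˣ) : GSp4 p :=
  ofMat ((z : ℚ_[p]) • 1) ((z : ℚ_[p]) * z) (mul_ne_zero z.ne_zero z.ne_zero) (by
    simp [smul_smul])

theorem mat_scal (z : ℚ_[p]ˣ) : mat (scal z) = (z : ℚ_[p]) • 1 := rfl

theorem nu_scal (z : ℚ_[p]ˣ) : nu (scal z) = (z : ℚ_[p]) * z := nu_ofMat _ _ _ _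

theorem scal_mem (z : ℚ_[p]ˣ) : scal z ∈ centre p := by
  rw [Subgroup.mem_center_iff]
  intro g
  apply mat_injective
  rw [mat_mul, mat_mul, mat_scal]
  simp

/-- Commuting with diag(p, p², p⁻¹, p⁻²), whose eigenvalues are distinct, forces g to be diagonal;
commuting with U makes its diagonal entries equal. -/
theorem mem_centre {g : GSp4 p} : g ∈ centre p ↔ ∃ z, g = scal z := by
  constructor
  · intro hg
    have hcomm : ∀ h : GSp4 p, mat h * mat g = mat g * mat h := fun h => by
      rw [← mat_mul, ← mat_mul, Subgroup.mem_center_iff.1 hg h]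
    have hp : (p : ℚ_[p]) ≠ 0 := prime_cast_ne_zero
    -- commutation with the diagonal torus
    have hpw : ∀ m n : ℤ, (p : ℚ_[p]) ^ m = (p : ℚ_[p]) ^ n → m = n := by
      intro m n h
      have := congrArg norm h
      rw [norm_prime_zpow, norm_prime_zpow, zpow_prime_inj] at this
      omega
    let e : Idx → ℤ := Sum.elim ![1, 2] ![-1, -2]
    have hdiag : mat (diagGSp (pUnit p) (pUnit p ^ 2) 1) = Matrix.diagonal fun i => (p : ℚ_[p]) ^ e i := by
      change Matrix.diagonal _ = _
      congr 1
      ext i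
      rcases i with i | i <;> fin_cases i <;> simp [e, pUnit]
    have hoff : ∀ i j, i ≠ j → mat g i j = 0 := by
      intro i j hij
      have h := congrFun (congrFun (hcomm (diagGSp (pUnit p) (pUnit p ^ 2) 1)) i) j
      rw [hdiag, Matrix.diagonal_mul, Matrix.mul_diagonal] at h
      by_contra hne
      have h2 : (p : ℚ_[p]) ^ e i = (p : ℚ_[p]) ^ e j := by
        apply mul_right_cancel₀ hne; rw [h, mul_comm]
      have h3 := hpw _ _ h2
      apply hij
      rcases i with i | i <;> rcases j with j | j <;> fin_cases i <;> fin_cases j <;>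
        simp [e] at h3 ⊢
    have hu : ∀ x : Fin 3 → ℚ_[p], ∀ i j : Fin 2, symM x i j * mat g (Sum.inr j) (Sum.inr j) =
        mat g (Sum.inl i) (Sum.inl i) * symM x i j := by
      intro x i j
      have h := congrFun (congrFun (hcomm (uni x)) (Sum.inl i)) (Sum.inr j)
      rw [Matrix.mul_apply, Matrix.mul_apply, Fintype.sum_sum_type, Fintype.sum_sum_type,
        mat_uni] at h
      rw [Finset.sum_eq_zero (fun k _ => by rw [hoff (Sum.inl k) (Sum.inr j) (by simp), mul_zero]),
        Finset.sum_eq_single j (fun k _ hk => by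
          rw [hoff (Sum.inr k) (Sum.inr j) (by simpa using hk), mul_zero]) (by simp),
        Finset.sum_eq_single i (fun k _ hk => by
          rw [hoff (Sum.inl i) (Sum.inl k) (by simpa using Ne.symm hk), zero_mul]) (by simp),
        Finset.sum_eq_zero (s := Finset.univ) (fun k _ => by
          rw [hoff (Sum.inl i) (Sum.inr k) (by simp), zero_mul])] at h
      simpa using h
    have h00 := hu ![1, 0, 0] 0 0
    have h01 := hu ![0, 1, 0] 0 1
    have h10 := hu ![0, 1, 0] 1 0
    simp [symM] at h00 h01 h10
    have hall : ∀ i, mat g i i = mat g (Sum.inl 0) (Sum.inl 0) := by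
      intro i
      rcases i with i | i <;> fin_cases i
      · rfl
      · exact h10.symm.trans h00
      · exact h00
      · exact h01
    have hz : mat g (Sum.inl 0) (Sum.inl 0) ≠ 0 := by
      intro h0
      have h1 : mat g = 0 := by
        ext i j
        by_cases hij : i = j
        · rw [hij, hall, h0]; rfl
        · exact hoff i j hij
      have h2 := mat_mul_inv g
      rw [h1, Matrix.zero_mul] at h2
      have := congrFun (congrFun h2 (Sum.inl 0)) (Sum.inl 0)
      simp at this
    refine ⟨Units.mk0 _ hz, mat_injective ?_⟩
    ext i j
    rw [mat_scal, Matrix.smul_apply, Matrix.one_apply, Units.val_mk0]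
    split_ifs with hij
    · rw [hij, hall]; simp
    · rw [hoff i j hij]; simp
  · rintro ⟨z, rfl⟩; exact scal_mem z

theorem scal_mem_maxCompact {z : ℚ_[p]ˣ} (hz : ‖(z : ℚ_[p])‖ = 1) : scal z ∈ maxCompact p := by
  rw [mem_maxCompact, mat_scal, nu_scal, isInt_smul_unit hz]
  exact ⟨isInt_one, by rw [norm_mul, hz, mul_one]⟩

theorem isInt_fromBlocks {A B C D : Matrix (Fin 2) (Fin 2) ℚ_[p]} :
    IsInt (Matrix.fromBlocks A B C D) ↔ IsInt A ∧ IsInt B ∧ IsInt C ∧ IsInt D := by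
  constructor
  · intro h
    exact ⟨fun i j => h (Sum.inl i) (Sum.inl j), fun i j => h (Sum.inl i) (Sum.inr j),
      fun i j => h (Sum.inr i) (Sum.inl j), fun i j => h (Sum.inr i) (Sum.inr j)⟩
  · rintro ⟨h1, h2, h3, h4⟩ (i | i) (j | j)
    · exact h1 i j
    · exact h2 i j
    · exact h3 i j
    · exact h4 i j

theorem levi_mem_maxCompact {A : GL (Fin 2) ℚ_[p]} {ν : ℚ_[p]ˣ} :
    levi A ν ∈ maxCompact p ↔ A ∈ intGL p (Fin 2) ∧ ‖(ν : ℚ_[p])‖ = 1 := by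
  rw [mem_maxCompact, nu_levi, mat_levi, isInt_fromBlocks]
  constructor
  · rintro ⟨⟨h1, -, -, h2⟩, hν⟩
    exact ⟨⟨h1, by rwa [isInt_smul_unit hν, isInt_transpose] at h2⟩, hν⟩
  · rintro ⟨h1, hν⟩
    refine ⟨⟨h1.1, fun _ _ => by simp, fun _ _ => by simp, ?_⟩, hν⟩
    rw [isInt_smul_unit hν, isInt_transpose]; exact h1.2

theorem uni_mem_maxCompact {x : Fin 3 → ℚ_[p]} : uni x ∈ maxCompact p ↔ IsInt (symM x) := by
  rw [mem_maxCompact, nu_uni, mat_uni, isInt_fromBlocks]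
  simp only [norm_one, and_true]
  exact ⟨fun h => h.2.1, fun h => ⟨isInt_one, h, fun _ _ => by simp, isInt_one⟩⟩

theorem scal_eq_levi (z : ℚ_[p]ˣ) :
    scal z = levi (gl2 z 0 0 z (by simp)) (z * z) := by
  apply mat_injective
  rw [mat_scal, mat_levi, inv_val_fin_two, ← Matrix.fromBlocks_one, Matrix.fromBlocks_smul]
  have hz := z.ne_zero
  congr 1
  · ext i j; fin_cases i <;> fin_cases j <;> simp
  · simp
  · simp
  · ext i j
    fin_cases i <;> fin_cases j <;> simp [Matrix.adjugate_fin_two, Matrix.det_fin_two_of]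

end Elements

end KohnenSkoruppa
end

noncomputable section
namespace KohnenSkoruppa

/-! ### The Iwasawa decomposition of `GSp₄` -/

variable {p : ℕ} [Fact p.Prime]

theorem exists_parabolic {g : GSp4 p} (h : ∀ i j, mat g (Sum.inr i) (Sum.inl j) = 0) :
    ∃ (x : Fin 3 → ℚ_[p]) (A : GL (Fin 2) ℚ_[p]) (ν : ℚ_[p]ˣ), g = uni x * levi A ν := by
  set a := (mat g).toBlocks₁₁ with ha
  set b := (mat g).toBlocks₁₂ with hb
  set d := (mat g).toBlocks₂₂ with hd
  have hg : mat g = Matrix.fromBlocks a b 0 d := by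
    rw [← Matrix.fromBlocks_toBlocks (mat g)]
    congr 1
    ext i j; exact h i j
  have hJ := mat_J4 g
  rw [hg, J4, Matrix.fromBlocks_transpose, Matrix.fromBlocks_multiply,
    Matrix.fromBlocks_multiply, Matrix.fromBlocks_smul, Matrix.fromBlocks_inj] at hJ
  have h1 : a * dᵀ = nu g • 1 := by
    have := hJ.2.1
    simpa using this
  have hν := nu_ne_zero g
  have hdet : a.det ≠ 0 := by
    intro h0
    have := congrArg Matrix.det h1
    rw [Matrix.det_mul, h0, zero_mul, Matrix.det_smul, Matrix.det_one, mul_one] at this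
    exact pow_ne_zero _ hν this.symm
  let A : GL (Fin 2) ℚ_[p] := Matrix.GeneralLinearGroup.mkOfDetNeZero a hdet
  have hA : A.val = a := rfl
  have hAi : A⁻¹.val * a = 1 := by rw [← hA, ← Units.val_mul]; simp
  have hd2 : d = nu g • (A⁻¹.val)ᵀ := by
    have : dᵀ = nu g • A⁻¹.val := by
      calc dᵀ = (A⁻¹.val * a) * dᵀ := by rw [hAi, Matrix.one_mul]
        _ = _ := by rw [Matrix.mul_assoc, h1]; simp
    rw [← Matrix.transpose_transpose d, this, Matrix.transpose_smul]
  let ν : ℚ_[p]ˣ := Units.mk0 _ hν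
  have hmem : g * (levi A ν)⁻¹ ∈ unipU p := by
    refine ⟨b * ((ν⁻¹ : ℚ_[p]ˣ) : ℚ_[p]) • ((A⁻¹)⁻¹.val)ᵀ, ?_⟩
    rw [levi_inv, mat_mul, hg, mat_levi, Matrix.fromBlocks_multiply]
    congr 1
    · simp only [Matrix.mul_zero, add_zero]
      rw [← hA, ← Units.val_mul]; simp
    · simp
    · simp
    · rw [hd2, inv_inv, Matrix.mul_zero, zero_add, Matrix.smul_mul, Matrix.mul_smul, smul_smul,
        ← Matrix.transpose_mul, ← Units.val_mul]
      simp [ν, hν]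
  obtain ⟨x, hx⟩ := mem_unipU.1 hmem
  exact ⟨x, A, ν, by rw [← hx]; group⟩

/-- Dividing by the entry of larger norm keeps the multiplier integral. This one-step elimination
drives the Iwasawa decomposition. -/
theorem exists_sl2_kill (x y : ℚ_[p]) : ∃ α β γ δ : ℚ_[p], ‖α‖ ≤ 1 ∧ ‖β‖ ≤ 1 ∧ ‖γ‖ ≤ 1 ∧
    ‖δ‖ ≤ 1 ∧ α * δ - β * γ = 1 ∧ x * α + y * γ = 0 := by
  rcases le_or_gt ‖x‖ ‖y‖ with h | h
  · by_cases hy : y = 0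
    · subst hy
      have hx : x = 0 := by rw [norm_zero] at h; exact norm_le_zero_iff.1 h
      exact ⟨1, 0, 0, 1, by simp, by simp, by simp, by simp, by simp, by simp [hx]⟩
    · refine ⟨1, 0, -x / y, 1, by simp, by simp, ?_, by simp, by simp, by field_simp; ring⟩
      rw [norm_div, norm_neg]; exact div_le_one_of_le₀ h (norm_nonneg _)
  · have hx : x ≠ 0 := by intro h0; rw [h0, norm_zero] at h; exact absurd h (not_lt.2 (norm_nonneg _))
    refine ⟨-y / x, -1, 1, 0, ?_, by simp, by simp, by simp, by simp, by field_simp; ring⟩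
    rw [norm_div, norm_neg]; exact div_le_one_of_le₀ h.le (norm_nonneg _)

/-- `SL₂ × SL₂` in `Sp₄`. -/
def sl2Block (α β γ δ : Fin 2 → ℚ_[p]) (h : ∀ i, α i * δ i - β i * γ i = 1) : GSp4 p :=
  ofMat (Matrix.fromBlocks (Matrix.diagonal α) (Matrix.diagonal β) (Matrix.diagonal γ)
    (Matrix.diagonal δ)) 1 one_ne_zero (by
    rw [J4, Matrix.fromBlocks_transpose, Matrix.fromBlocks_multiply, Matrix.fromBlocks_multiply,
      one_smul]
    simp only [Matrix.diagonal_transpose,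
      Matrix.diagonal_mul_diagonal, ← Matrix.diagonal_one,
      Matrix.diagonal_neg, Matrix.diagonal_add, ← Matrix.diagonal_zero]
    congr 2
    all_goals
      funext i
      first
        | ring1
        | linear_combination h i
        | linear_combination -h i)

theorem sl2Block_mem {α β γ δ : Fin 2 → ℚ_[p]} (h : ∀ i, α i * δ i - β i * γ i = 1)
    (hα : ∀ i, ‖α i‖ ≤ 1) (hβ : ∀ i, ‖β i‖ ≤ 1) (hγ : ∀ i, ‖γ i‖ ≤ 1) (hδ : ∀ i, ‖δ i‖ ≤ 1) :
    sl2Block α β γ δ h ∈ maxCompact p := by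
  have hd : ∀ a : Fin 2 → ℚ_[p], (∀ i, ‖a i‖ ≤ 1) → IsInt (Matrix.diagonal a) := by
    intro a ha i j
    rw [Matrix.diagonal_apply]; split_ifs
    · exact ha _
    · simp
  rw [mem_maxCompact]
  refine ⟨isInt_fromBlocks.2 ⟨hd _ hα, hd _ hβ, hd _ hγ, hd _ hδ⟩, ?_⟩
  rw [sl2Block, nu_ofMat, norm_one]

theorem mat_mul_sl2Block_inl {α β γ δ : Fin 2 → ℚ_[p]} (h : ∀ i, α i * δ i - β i * γ i = 1)
    (g : GSp4 p) (r : Idx) (i : Fin 2) : mat (g * sl2Block α β γ δ h) r (Sum.inl i) =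
      mat g r (Sum.inl i) * α i + mat g r (Sum.inr i) * γ i := by
  rw [mat_mul, Matrix.mul_apply, Fintype.sum_sum_type]
  simp [sl2Block, Matrix.diagonal_apply]

theorem mat_mul_sl2Block_inr {α β γ δ : Fin 2 → ℚ_[p]} (h : ∀ i, α i * δ i - β i * γ i = 1)
    (g : GSp4 p) (r : Idx) (i : Fin 2) : mat (g * sl2Block α β γ δ h) r (Sum.inr i) =
      mat g r (Sum.inl i) * β i + mat g r (Sum.inr i) * δ i := by
  rw [mat_mul, Matrix.mul_apply, Fintype.sum_sum_type]
  simp [sl2Block, Matrix.diagonal_apply]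

/-- The Iwasawa decomposition: `GSp₄ = B K`. -/
theorem exists_iwasawa (g : GSp4 p) : ∃ (x : Fin 3 → ℚ_[p]) (A : GL (Fin 2) ℚ_[p])
    (ν : ℚ_[p]ˣ), ∃ k ∈ maxCompact p, A.val 1 0 = 0 ∧ g = uni x * levi A ν * k := by
  -- first make the row of `f₁` a combination of `f₁, f₂`
  choose α β γ δ h1 h2 h3 h4 h5 h6 using fun i : Fin 2 =>
    exists_sl2_kill (mat g (Sum.inr 0) (Sum.inl i)) (mat g (Sum.inr 0) (Sum.inr i))
  set g₁ := g * sl2Block α β γ δ h5 with hg₁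
  have hk₁ := sl2Block_mem h5 h1 h2 h3 h4
  have e1 : ∀ i, mat g₁ (Sum.inr 0) (Sum.inl i) = 0 := fun i => by
    rw [hg₁, mat_mul_sl2Block_inl]; exact h6 i
  -- then a multiple of `f₁`
  obtain ⟨α', β', γ', δ', i1, i2, i3, i4, i5, i6⟩ :=
    exists_sl2_kill (mat g₁ (Sum.inr 0) (Sum.inr 1)) (mat g₁ (Sum.inr 0) (Sum.inr 0))
  let A' : GL (Fin 2) ℚ_[p] := gl2 α' (-β') (-γ') δ' (by
    rw [neg_mul_neg, i5]; exact one_ne_zero)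
  have hA'i : A'⁻¹.val = !![δ', β'; γ', α'] := by
    have : A'.val.det = 1 := by
      simp only [A', gl2_val, Matrix.det_fin_two_of]; linear_combination i5
    rw [inv_val_fin_two, this, inv_one, one_smul, Matrix.adjugate_fin_two]
    simp [A']
  have hk₂ : levi A' 1 ∈ maxCompact p := by
    rw [levi_mem_maxCompact]
    refine ⟨⟨?_, ?_⟩, by simp⟩
    · rw [isInt_fin_two]; simpa [A'] using ⟨i1, i2, i3, i4⟩
    · rw [hA'i, isInt_fin_two]; simpa using ⟨i4, i2, i3, i1⟩
  set g₂ := g₁ * levi A' 1 with hg₂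
  have e2 : ∀ i, mat g₂ (Sum.inr 0) (Sum.inl i) = 0 := by
    intro i
    rw [hg₂, mat_mul, Matrix.mul_apply, Fintype.sum_sum_type]
    simp [e1, mat_levi]
  have e3 : mat g₂ (Sum.inr 0) (Sum.inr 1) = 0 := by
    rw [hg₂, mat_mul, Matrix.mul_apply, Fintype.sum_sum_type, mat_levi, hA'i]
    simp [e1, Fin.sum_univ_two]
    linear_combination i6
  have e4 : mat g₂ (Sum.inr 0) (Sum.inr 0) ≠ 0 := by
    intro h0
    have := congrFun (congrFun (mat_mul_inv g₂) (Sum.inr 0)) (Sum.inr 0)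
    rw [Matrix.mul_apply, Fintype.sum_sum_type] at this
    simp [e2, e3, h0, Fin.sum_univ_two] at this
  -- The rows of f₁ and f₂ are orthogonal for the symplectic form, and the first is now a nonzero
  -- multiple of f₁; so the e₁-entry of the second vanishes.
  have e5 : mat g₂ (Sum.inr 1) (Sum.inl 0) = 0 := by
    have := congrFun (congrFun (mat_J4 g₂) (Sum.inr 1)) (Sum.inr 0)
    rw [Matrix.mul_apply, Fintype.sum_sum_type] at this
    simp [Matrix.mul_apply, e2, e3, e4, Fin.sum_univ_two, J4, Matrix.one_apply] at this
    exact this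
  -- finally kill the `e₂`-entry of the row of `f₂`
  obtain ⟨α'', β'', γ'', δ'', j1, j2, j3, j4, j5, j6⟩ :=
    exists_sl2_kill (mat g₂ (Sum.inr 1) (Sum.inl 1)) (mat g₂ (Sum.inr 1) (Sum.inr 1))
  have hdet : ∀ i : Fin 2, ![1, α''] i * ![1, δ''] i - ![0, β''] i * ![0, γ''] i = 1 := by
    intro i; fin_cases i
    · simp
    · simpa using j5
  have hk₃ : sl2Block ![1, α''] ![0, β''] ![0, γ''] ![1, δ''] hdet ∈ maxCompact p := by
    apply sl2Block_mem <;> intro i <;> fin_cases i <;> simp [j1, j2, j3, j4]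
  set g₃ := g₂ * sl2Block ![1, α''] ![0, β''] ![0, γ''] ![1, δ''] hdet with hg₃
  have e6 : ∀ i j, mat g₃ (Sum.inr i) (Sum.inl j) = 0 := by
    intro i j
    rw [hg₃, mat_mul_sl2Block_inl]
    fin_cases i <;> fin_cases j <;> simp [e2, e3, e5, j6]
  have e7 : mat g₃ (Sum.inr 0) (Sum.inr 1) = 0 := by
    rw [hg₃, mat_mul_sl2Block_inr]
    simp [e2, e3]
  obtain ⟨x, A, ν, e⟩ := exists_parabolic e6
  -- The lower right block is ν ᵗA⁻¹, whose upper right entry is -ν/det A times the lower left entry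
  -- of A.
  have e8 : A.val 1 0 = 0 := by
    rw [e, mat_mul, mat_uni, mat_levi, Matrix.fromBlocks_multiply] at e7
    simp only [Matrix.fromBlocks_apply₂₂, Matrix.zero_mul, Matrix.one_mul, zero_add] at e7
    rw [inv_val_fin_two, Matrix.adjugate_fin_two] at e7
    simpa [det_ne_zero] using e7
  refine ⟨x, A, ν, (sl2Block ![1, α''] ![0, β''] ![0, γ''] ![1, δ''] hdet)⁻¹ *
    ((levi A' 1)⁻¹ * (sl2Block α β γ δ h5)⁻¹), mul_mem (inv_mem hk₃)
      (mul_mem (inv_mem hk₂) (inv_mem hk₁)), e8, ?_⟩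
  rw [← e, hg₃, hg₂, hg₁]
  group

theorem uni_mul_levi_mem_borelB (x : Fin 3 → ℚ_[p]) {A : GL (Fin 2) ℚ_[p]} (ν : ℚ_[p]ˣ)
    (h : A.val 1 0 = 0) : uni x * levi A ν ∈ borelB p := by
  change (mat (uni x * levi A ν)).BlockTriangular pos
  rw [mat_mul, mat_uni, mat_levi, Matrix.fromBlocks_multiply]
  have hi : A⁻¹.val 1 0 = 0 := by
    rw [inv_val_fin_two, Matrix.adjugate_fin_two]; simp [h]
  intro i j hij
  rcases i with i | i <;> rcases j with j | j <;> fin_cases i <;> fin_cases j <;>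
    simp_all [pos, Matrix.transpose_apply]

end KohnenSkoruppa
end

noncomputable section
namespace KohnenSkoruppa

/-! ### Integral elements of the quadratic algebra -/

variable {p : ℕ} [Fact p.Prime] {D : ℤ}

theorem norm_coeffA_le : ‖coeffA p D‖ ≤ 1 := by
  unfold coeffA
  split_ifs with h
  · obtain ⟨k, hk⟩ : ∃ k : ℤ, D = 4 * k + 1 := ⟨D / 4, by omega⟩
    have : ((D : ℚ_[p]) - 1) / 4 = (k : ℚ_[p]) := by
      rw [hk]; push_cast; field_simp; ring
    rw [this]; exact Padic.norm_int_le_one k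
  · exact Padic.norm_int_le_one D

theorem norm_coeffB_le : ‖coeffB p D‖ ≤ 1 := by
  unfold coeffB; split_ifs <;> simp

/-- As p² does not divide D, |D| > p⁻²; a non-integral v has |v| ≥ p, and then |Dv²| > 1. -/
theorem norm_le_one_of_squarefree (hD : Squarefree D) {v : ℚ_[p]}
    (h : ‖(D : ℚ_[p]) * (v * v)‖ ≤ 1) : ‖v‖ ≤ 1 := by
  by_contra hv
  push Not at hv
  have h1 : ¬ ‖(D : ℚ_[p])‖ ≤ (p : ℝ) ^ (-(2 : ℕ) : ℤ) := by
    rw [Padic.norm_int_le_pow_iff_dvd]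
    intro hdvd
    have h2 : ((p : ℤ) * p) ∣ D := by rw [← sq]; exact_mod_cast hdvd
    have := hD _ h2
    rw [Int.isUnit_iff] at this
    have := (Fact.out : p.Prime).one_lt
    omega
  push Not at h1
  have h3 : (p : ℝ) ≤ ‖v‖ := by
    by_contra h4
    push Not at h4
    have : ‖v‖ ≤ (p : ℝ) ^ (0 : ℤ) := norm_le_zpow_of_lt (by simpa using h4)
    rw [zpow_zero] at this; linarith
  rw [norm_mul, norm_mul] at h
  have hp := prime_real_pos (p := p)
  have h5 : (p : ℝ) ^ (-(2 : ℕ) : ℤ) * (p * p) = 1 := by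
    rw [zpow_neg, zpow_natCast]; field_simp
  have h6 : (p : ℝ) * p ≤ ‖v‖ * ‖v‖ := mul_le_mul h3 h3 hp.le (norm_nonneg _)
  have h7 : (p : ℝ) ^ (-(2 : ℕ) : ℤ) * (p * p) < ‖(D : ℚ_[p])‖ * (‖v‖ * ‖v‖) :=
    mul_lt_mul h1 h6 (by positivity) (norm_nonneg _)
  linarith

/-- Integral elements of `L`: those of `ℤ_p + ℤ_p ω`. -/
def IsO (z : LAlg p D) : Prop := ‖z.re‖ ≤ 1 ∧ ‖z.im‖ ≤ 1

/-- Modulo 4 the congruence u² ≡ Dv² with D ≡ 2, 3 has only solutions with u and v even. This is the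
dyadic part of the maximality of ℤ_p + ℤ_p ω. -/
theorem two_adic_even {u v : ℤ_[2]} (hD : D % 4 = 2 ∨ D % 4 = 3)
    (h : ‖u * u - D * (v * v)‖ ≤ (2 : ℝ) ^ (-(2 : ℕ) : ℤ)) :
    ‖u‖ ≤ (2 : ℝ) ^ (-(1 : ℕ) : ℤ) ∧ ‖v‖ ≤ (2 : ℝ) ^ (-(1 : ℕ) : ℤ) := by
  have hmem : ∀ (x : ℤ_[2]) (n : ℕ), ‖x‖ ≤ (2 : ℝ) ^ (-n : ℤ) ↔
      PadicInt.toZModPow n x = 0 := by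
    intro x n
    rw [← RingHom.mem_ker, PadicInt.ker_toZModPow, ← PadicInt.norm_le_pow_iff_mem_span_pow]
    norm_num
  rw [hmem] at h
  simp only [map_sub, map_mul, map_intCast] at h
  have hD4 : ((D : ℤ) : ZMod 4) = 2 ∨ ((D : ℤ) : ZMod 4) = 3 := by
    rcases hD with h | h
    · left
      have := (ZMod.intCast_eq_intCast_iff' D 2 4).2 (by simpa using h)
      simpa using this
    · right
      have := (ZMod.intCast_eq_intCast_iff' D 3 4).2 (by simpa using h)
      simpa using this
  have key : ∀ d x y : ZMod 4, (d = 2 ∨ d = 3) → x * x - d * (y * y) = 0 →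
      2 * x = 0 ∧ 2 * y = 0 := by decide
  have h2 := key _ _ _ hD4 h
  have conv : ∀ x : ℤ_[2], 2 * (PadicInt.toZModPow 2 x : ZMod (2 ^ 2)) = 0 →
      ‖x‖ ≤ (2 : ℝ) ^ (-(1 : ℕ) : ℤ) := by
    intro x hx
    have h3 : PadicInt.toZModPow 2 (2 * x) = 0 := by
      rw [map_mul, map_ofNat]; exact hx
    rw [← hmem, norm_mul] at h3
    have : ‖(2 : ℤ_[2])‖ = 2⁻¹ := by simpa using PadicInt.norm_p (p := 2)
    rw [this] at h3
    norm_num at h3 ⊢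
    linarith
  exact ⟨conv u h2.1, conv v h2.2⟩

/-- If D ≡ 1 (mod 4), then Dv² = T² - 4N bounds v, and the quadratic equation then bounds u.
Otherwise T = 2u, which settles u for odd p, and Dv² = u² - N bounds v. For p = 2 the same argument
bounds only 2u and 2v, and `two_adic_even` supplies the missing factor 2. -/
theorem norm_le_one_of_norm_trace (hD : Squarefree D) {u v : ℚ_[p]}
    (hN : ‖u * u + coeffB p D * u * v - coeffA p D * v * v‖ ≤ 1)
    (hT : ‖2 * u + coeffB p D * v‖ ≤ 1) : ‖u‖ ≤ 1 ∧ ‖v‖ ≤ 1 := by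
  by_cases h1 : D % 4 = 1
  · have ha : coeffA p D = ((D : ℚ_[p]) - 1) / 4 := by simp [coeffA, h1]
    have hb : coeffB p D = -1 := by simp [coeffB, h1]
    have h4 : ‖(4 : ℚ_[p])‖ ≤ 1 := by exact_mod_cast Padic.norm_int_le_one (p := p) 4
    have hv : ‖v‖ ≤ 1 := by
      apply norm_le_one_of_squarefree hD
      have e : (D : ℚ_[p]) * (v * v) = (2 * u + coeffB p D * v) *
          (2 * u + coeffB p D * v) - 4 * (u * u + coeffB p D * u * v -
          coeffA p D * v * v) := by
        rw [ha, hb]; field_simp; ring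
      rw [e]
      exact norm_sub_le_of_le (norm_mul_le_one hT hT) (norm_mul_le_one h4 hN)
    refine ⟨?_, hv⟩
    by_contra hu
    push Not at hu
    have e : u * u = ((u * u + coeffB p D * u * v -
          coeffA p D * v * v) + coeffA p D * v * v) + u * v := by
      rw [hb]; ring
    have : ‖u * u‖ ≤ ‖u‖ := by
      rw [e]
      apply norm_add_le_of_le
      · apply norm_add_le_of_le (hN.trans hu.le)
        exact (norm_mul_le_one (norm_mul_le_one norm_coeffA_le hv) hv).trans hu.le
      · rw [norm_mul]; exact mul_le_of_le_one_right (norm_nonneg _) hv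
    rw [norm_mul] at this
    nlinarith
  · have ha : coeffA p D = D := by simp [coeffA, h1]
    have hb : coeffB p D = 0 := by simp [coeffB, h1]
    rw [ha, hb] at hN
    rw [hb] at hT
    simp only [zero_mul, add_zero] at hN hT
    by_cases hp2 : p = 2
    · subst hp2
      have hD4 : D % 4 = 2 ∨ D % 4 = 3 := by
        have : D % 4 ≠ 0 := by
          intro h0
          have h2 : (2 : ℤ) * 2 ∣ D := by norm_num; omega
          have := hD _ h2
          rw [Int.isUnit_iff] at this; omega
        omega
      have e4 : (D : ℚ_[2]) * ((2 * v) * (2 * v)) = (2 * u) * (2 * u) -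
          4 * (u * u - D * v * v) := by ring
      have h4 : ‖(4 : ℚ_[2])‖ ≤ 1 := by exact_mod_cast Padic.norm_int_le_one (p := 2) 4
      have hv : ‖2 * v‖ ≤ 1 := by
        apply norm_le_one_of_squarefree hD
        rw [e4]
        exact norm_sub_le_of_le (norm_mul_le_one hT hT) (norm_mul_le_one h4 hN)
      have n2 : ‖(2 : ℚ_[2])‖ = 2⁻¹ := by simpa using Padic.norm_p (p := 2)
      have key := two_adic_even (u := ⟨2 * u, hT⟩) (v := ⟨2 * v, hv⟩) hD4 (by
        change ‖(2 * u) * (2 * u) - (((D : ℤ_[2]) : ℤ_[2]) : ℚ_[2]) *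
          ((2 * v) * (2 * v))‖ ≤ _
        have : (((D : ℤ_[2]) : ℤ_[2]) : ℚ_[2]) = D := by simp
        rw [this, show (2 * u) * (2 * u) - (D : ℚ_[2]) * ((2 * v) * (2 * v)) =
          2 * (2 * (u * u - D * v * v)) by ring, norm_mul, norm_mul, n2]
        norm_num
        linarith)
      have k1 : ‖2 * u‖ ≤ (2 : ℝ) ^ (-(1 : ℕ) : ℤ) := key.1
      have k2 : ‖2 * v‖ ≤ (2 : ℝ) ^ (-(1 : ℕ) : ℤ) := key.2
      rw [norm_mul, n2] at k1 k2
      norm_num at k1 k2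
      exact ⟨k1, k2⟩
    · have n2 : ‖(2 : ℚ_[p])‖ = 1 := by
        have h3 : ¬ (p : ℤ) ∣ 2 := by
          intro h
          have h4 : p ∣ 2 := by exact_mod_cast h
          exact hp2 ((Nat.prime_dvd_prime_iff_eq Fact.out Nat.prime_two).1 h4)
        have h5 : ¬ ‖((2 : ℤ) : ℚ_[p])‖ ≤ (p : ℝ) ^ (-(1 : ℕ) : ℤ) := by
          rw [Padic.norm_int_le_pow_iff_dvd]; simpa using h3
        apply le_antisymm
        · exact_mod_cast Padic.norm_int_le_one (p := p) 2
        · by_contra hlt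
          push Not at hlt
          apply h5
          apply norm_le_zpow_of_lt
          simpa using hlt
      rw [norm_mul, n2, one_mul] at hT
      refine ⟨hT, norm_le_one_of_squarefree hD ?_⟩
      have : (D : ℚ_[p]) * (v * v) = u * u - (u * u - D * v * v) := by ring
      rw [this]
      exact norm_sub_le_of_le (norm_mul_le_one hT hT) hN

/-- `ℤ_p + ℤ_p ω` is the maximal order. -/
theorem isO_of_norm_trace (hD : Squarefree D) {z : LAlg p D} (hN : ‖QuadraticAlgebra.norm z‖ ≤ 1)
    (hT : ‖QuadraticAlgebra.trace z‖ ≤ 1) : IsO z := by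
  rw [QuadraticAlgebra.norm_def] at hN
  rw [QuadraticAlgebra.trace_def] at hT
  exact norm_le_one_of_norm_trace hD hN hT

theorem IsO.add {z w : LAlg p D} (hz : IsO z) (hw : IsO w) : IsO (z + w) :=
  ⟨norm_add_le_of_le hz.1 hw.1, norm_add_le_of_le hz.2 hw.2⟩

theorem IsO.neg {z : LAlg p D} (hz : IsO z) : IsO (-z) := by
  simpa [IsO] using hz

theorem IsO.mul {z w : LAlg p D} (hz : IsO z) (hw : IsO w) : IsO (z * w) := by
  unfold IsO
  rw [QuadraticAlgebra.re_mul, QuadraticAlgebra.im_mul]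
  exact ⟨norm_add_le_of_le (norm_mul_le_one hz.1 hw.1)
      (norm_mul_le_one (norm_mul_le_one norm_coeffA_le hz.2) hw.2),
    norm_add_le_of_le (norm_add_le_of_le (norm_mul_le_one hz.1 hw.2) (norm_mul_le_one hz.2 hw.1))
      (norm_mul_le_one (norm_mul_le_one norm_coeffB_le hz.2) hw.2)⟩

theorem IsO.star {z : LAlg p D} (hz : IsO z) : IsO (star z) := by
  unfold IsO
  rw [QuadraticAlgebra.re_star, QuadraticAlgebra.im_star, norm_neg]
  exact ⟨norm_add_le_of_le hz.1 (norm_mul_le_one norm_coeffB_le hz.2), hz.2⟩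

theorem IsO.smul {c : ℚ_[p]} {z : LAlg p D} (hc : ‖c‖ ≤ 1) (hz : IsO z) : IsO (c • z) :=
  ⟨norm_mul_le_one hc hz.1, norm_mul_le_one hc hz.2⟩

theorem isO_zero : IsO (0 : LAlg p D) := by simp [IsO]

theorem re_one_L : (1 : LAlg p D).re = 1 := rfl

theorem im_one_L : (1 : LAlg p D).im = 0 := rfl

theorem isO_one : IsO (1 : LAlg p D) := by simp [IsO, re_one_L, im_one_L]

theorem IsO.norm_le {z : LAlg p D} (hz : IsO z) : ‖QuadraticAlgebra.norm z‖ ≤ 1 := by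
  rw [QuadraticAlgebra.norm_def]
  exact norm_sub_le_of_le (norm_add_le_of_le (norm_mul_le_one hz.1 hz.1)
    (norm_mul_le_one (norm_mul_le_one norm_coeffB_le hz.1) hz.2))
    (norm_mul_le_one (norm_mul_le_one norm_coeffA_le hz.2) hz.2)

theorem norm_smul_L (c : ℚ_[p]) (z : LAlg p D) :
    QuadraticAlgebra.norm (c • z) = c * c * QuadraticAlgebra.norm z := by
  simp only [QuadraticAlgebra.norm_def, QuadraticAlgebra.re_smul, QuadraticAlgebra.im_smul,
    smul_eq_mul]
  ring

/-- The inverse of an element of `L` of nonzero norm. -/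
def linv (z : LAlg p D) : LAlg p D := (QuadraticAlgebra.norm z)⁻¹ • star z

theorem mul_linv {z : LAlg p D} (hz : QuadraticAlgebra.norm z ≠ 0) : z * linv z = 1 := by
  unfold linv
  rw [mul_smul_comm, ← QuadraticAlgebra.algebraMap_norm_eq_mul_star, Algebra.algebraMap_eq_smul_one,
    smul_smul, inv_mul_cancel₀ hz, one_smul]

theorem norm_linv {z : LAlg p D} (hz : QuadraticAlgebra.norm z ≠ 0) :
    QuadraticAlgebra.norm (linv z) = (QuadraticAlgebra.norm z)⁻¹ := by
  apply eq_inv_of_mul_eq_one_right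
  rw [← map_mul, mul_linv hz, map_one]

/-- A subgroup of `L` with bounded norms has an element `t` with `Λ ⊆ t O`. -/
theorem exists_generator (hD : Squarefree D) (Λ : AddSubgroup (LAlg p D))
    (hb : ∃ C : ℝ, ∀ z ∈ Λ, ‖QuadraticAlgebra.norm z‖ ≤ C)
    (h0 : ∃ z ∈ Λ, QuadraticAlgebra.norm z ≠ 0) :
    ∃ t ∈ Λ, QuadraticAlgebra.norm t ≠ 0 ∧ ∀ z ∈ Λ, IsO (z * linv t) := by
  obtain ⟨C, hC⟩ := hb
  obtain ⟨z₀, hz₀, hn₀⟩ := h0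
  obtain ⟨n₀, hn⟩ := norm_eq_zpow hn₀
  -- The values of |N| are powers of p, so boundedness provides an element t with |N(t)| maximal.
  obtain ⟨m, ⟨t, ht, htm⟩, hmax⟩ := Int.exists_greatest_of_bdd
    (P := fun m => ∃ z ∈ Λ, ‖QuadraticAlgebra.norm z‖ = (p : ℝ) ^ m) (by
      obtain ⟨N, hN⟩ := pow_unbounded_of_one_lt C (one_lt_prime_real (p := p))
      refine ⟨N, fun m ⟨z, hz, e⟩ => ?_⟩
      rw [← zpow_prime_le (p := p), ← e, zpow_natCast]
      exact (hC z hz).trans hN.le) ⟨-n₀, z₀, hz₀, hn⟩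
  have ht0 : QuadraticAlgebra.norm t ≠ 0 := by
    rw [← norm_ne_zero_iff, htm]; exact (zpow_pos prime_real_pos _).ne'
  have hle : ∀ z ∈ Λ, ‖QuadraticAlgebra.norm (z * linv t)‖ ≤ 1 := by
    intro z hz
    rw [map_mul, norm_linv ht0, norm_mul, norm_inv, htm]
    apply mul_inv_le_one_of_le₀ _ (zpow_pos prime_real_pos _).le
    by_cases h : QuadraticAlgebra.norm z = 0
    · rw [h, norm_zero]; exact (zpow_pos prime_real_pos _).le
    · obtain ⟨k, hk⟩ := norm_eq_zpow h
      rw [hk, zpow_prime_le]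
      exact hmax _ ⟨z, hz, hk⟩
  refine ⟨t, ht, ht0, fun z hz => isO_of_norm_trace hD (hle z hz) ?_⟩
  -- With w = z/t the trace is N(w + 1) - N(w) - 1, and w + 1 = (z + t)/t is again a quotient of an
  -- element of Λ by t. So the maximality of |N(t)| bounds the trace as well as the norm.
  have h1 := hle _ (Λ.add_mem hz ht)
  rw [add_mul, mul_linv ht0] at h1
  set w := z * linv t
  have e : QuadraticAlgebra.trace w = QuadraticAlgebra.norm (w + 1) - QuadraticAlgebra.norm w - 1 := by
    simp [QuadraticAlgebra.trace_def, QuadraticAlgebra.norm_def, re_one_L, im_one_L]; ring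
  rw [e]
  exact norm_sub_le_of_le (norm_sub_le_of_le h1 (hle z hz)) (by simp)

/-! ### Multiplication matrices -/

/-- The matrix of multiplication by `z` on row vectors in the basis `1, ω`. -/
def mulMat (z : LAlg p D) : Matrix (Fin 2) (Fin 2) ℚ_[p] :=
  !![z.re, z.im; coeffA p D * z.im, z.re + coeffB p D * z.im]

theorem mulMat_mul (z w : LAlg p D) : mulMat (z * w) = mulMat z * mulMat w := by
  ext i j
  fin_cases i <;> fin_cases j <;> simp [mulMat] <;> ring

theorem mulMat_one : mulMat (1 : LAlg p D) = 1 := by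
  ext i j
  fin_cases i <;> fin_cases j <;> simp [mulMat, re_one_L, im_one_L]

theorem mulMat_add (z w : LAlg p D) : mulMat (z + w) = mulMat z + mulMat w := by
  ext i j
  fin_cases i <;> fin_cases j <;> simp [mulMat] <;> ring

theorem mulMat_neg (z : LAlg p D) : mulMat (-z) = -mulMat z := by
  ext i j
  fin_cases i <;> fin_cases j <;> simp [mulMat] <;> ring

theorem mulMat_smul (c : ℚ_[p]) (z : LAlg p D) : mulMat (c • z) = c • mulMat z := by
  ext i j
  fin_cases i <;> fin_cases j <;> simp [mulMat] <;> ring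

theorem mulMat_zero : mulMat (0 : LAlg p D) = 0 := by
  ext i j
  fin_cases i <;> fin_cases j <;> simp [mulMat]

theorem mulMat_algebraMap (c : ℚ_[p]) : mulMat (algebraMap ℚ_[p] (LAlg p D) c) = c • 1 := by
  rw [Algebra.algebraMap_eq_smul_one, mulMat_smul, mulMat_one]

theorem det_mulMat (z : LAlg p D) : (mulMat z).det = QuadraticAlgebra.norm z := by
  simp [mulMat, Matrix.det_fin_two_of, QuadraticAlgebra.norm_def]; ring

theorem isInt_mulMat {z : LAlg p D} : IsInt (mulMat z) ↔ IsO z := by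
  rw [isInt_fin_two]
  simp only [mulMat, Matrix.of_apply, Matrix.cons_val_zero, Matrix.cons_val_one, Matrix.cons_val',
      Matrix.cons_val_fin_one]
  constructor
  · rintro ⟨h1, h2, -⟩; exact ⟨h1, h2⟩
  · rintro ⟨h1, h2⟩
    exact ⟨h1, h2, norm_mul_le_one norm_coeffA_le h2,
      norm_add_le_of_le h1 (norm_mul_le_one norm_coeffB_le h2)⟩

/-- `mulMat z` as an element of `GL₂`. -/
def mulGL (z : LAlg p D) (hz : QuadraticAlgebra.norm z ≠ 0) : GL (Fin 2) ℚ_[p] :=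
  Matrix.GeneralLinearGroup.mkOfDetNeZero (mulMat z) (by rwa [det_mulMat])

@[simp] theorem mulGL_val (z : LAlg p D) (hz : QuadraticAlgebra.norm z ≠ 0) :
    (mulGL z hz).val = mulMat z := rfl

theorem mulGL_inv_val (z : LAlg p D) (hz : QuadraticAlgebra.norm z ≠ 0) :
    ((mulGL z hz)⁻¹).val = mulMat (linv z) := by
  have h : mulGL z hz * mulGL (linv z) (by rw [norm_linv hz]; exact inv_ne_zero hz) = 1 := by
    apply Units.ext
    change mulMat z * mulMat (linv z) = 1
    rw [← mulMat_mul, mul_linv hz, mulMat_one]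
  rw [inv_eq_of_mul_eq_one_right h]; rfl

variable (p D) in
/-- The Gram matrix relating the two bases `1, ω` and `-ω̄, 1` of `L`. -/
def gramQ : Matrix (Fin 2) (Fin 2) ℚ_[p] := !![0, 1; 1, coeffB p D]

variable (p D) in
/-- The inverse of `gramQ`. -/
def gramQi : Matrix (Fin 2) (Fin 2) ℚ_[p] := !![-coeffB p D, 1; 1, 0]

theorem gramQ_mul_gramQi : gramQ p D * gramQi p D = 1 := by
  ext i j; fin_cases i <;> fin_cases j <;> simp [gramQ, gramQi]

theorem gramQi_mul_gramQ : gramQi p D * gramQ p D = 1 := by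
  ext i j; fin_cases i <;> fin_cases j <;> simp [gramQ, gramQi]

theorem gramQ_transpose : (gramQ p D)ᵀ = gramQ p D := by
  ext i j; fin_cases i <;> fin_cases j <;> rfl

theorem gramQi_transpose : (gramQi p D)ᵀ = gramQi p D := by
  ext i j; fin_cases i <;> fin_cases j <;> rfl

theorem isInt_gramQ : IsInt (gramQ p D) := by
  rw [isInt_fin_two]; simpa [gramQ] using norm_coeffB_le

theorem isInt_gramQi : IsInt (gramQi p D) := by
  rw [isInt_fin_two]; simpa [gramQi] using norm_coeffB_le

/-- `gramQ` is the Gram matrix of the symmetric form sending (x, y) to the ω-coefficient of xy, for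
which every multiplication is self-adjoint. -/
theorem mulMat_transpose (z : LAlg p D) : (mulMat z)ᵀ = gramQi p D * mulMat z * gramQ p D := by
  ext i j
  fin_cases i <;> fin_cases j <;>
    simp [mulMat, gramQ, gramQi, Matrix.mul_apply, Fin.sum_univ_two] <;>
    ring

/-- The `4 × 4` matrix of a `2 × 2` matrix over `L`. -/
def embM (h : Matrix (Fin 2) (Fin 2) (LAlg p D)) : Matrix Idx Idx ℚ_[p] :=
  Matrix.fromBlocks (mulMat (h 0 0)) (mulMat (h 0 1) * gramQ p D)
    (gramQi p D * mulMat (h 1 0)) (mulMat (h 1 1))ᵀ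

theorem embM_mul (g h : Matrix (Fin 2) (Fin 2) (LAlg p D)) : embM (g * h) = embM g * embM h := by
  have e1 : gramQ p D * gramQi p D = 1 := gramQ_mul_gramQi
  have k : ∀ X : Matrix (Fin 2) (Fin 2) ℚ_[p], gramQ p D * (gramQi p D * X) = X := fun X => by
    rw [← Matrix.mul_assoc, e1, Matrix.one_mul]
  unfold embM
  rw [Matrix.fromBlocks_multiply]
  rw [mulMat_transpose, mulMat_transpose, mulMat_transpose]
  simp only [Matrix.mul_apply, Fin.sum_univ_two, mulMat_add, mulMat_mul,
    Matrix.add_mul, Matrix.mul_add, Matrix.mul_assoc, k]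

theorem toL2_vecMul_embM (h : Matrix (Fin 2) (Fin 2) (LAlg p D)) (w : Idx → ℚ_[p]) :
    toL2 p D (w ᵥ* embM h) = toL2 p D w ᵥ* h := by
  ext i <;> fin_cases i <;>
    simp [toL2, embM, Matrix.vecMul, dotProduct, Fintype.sum_sum_type, Fin.sum_univ_two, mulMat,
      gramQ, gramQi, QuadraticAlgebra.omega, QuadraticAlgebra.star_mk, re_one_L,
      im_one_L] <;> ring

theorem toL2_injective : Function.Injective (toL2 p D) := by
  intro v w h
  have h0 := congrFun h 0
  have h1 := congrFun h 1
  simp only [toL2, Matrix.cons_val_zero, Matrix.cons_val_one] at h0 h1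
  have h2 := congrArg QuadraticAlgebra.re h0
  have h3 := congrArg QuadraticAlgebra.im h0
  have h4 := congrArg QuadraticAlgebra.re h1
  have h5 := congrArg QuadraticAlgebra.im h1
  simp [QuadraticAlgebra.omega, re_one_L, im_one_L] at h2 h3 h4 h5
  rw [h5] at h4
  ext i
  rcases i with i | i <;> fin_cases i
  · exact h2
  · exact h3
  · exact h5
  · exact add_left_cancel h4

theorem mem_ofGL2L {S : Subgroup (GL (Fin 2) (LAlg p D))} {g : GSp4 p} :
    g ∈ ofGL2L p D S ↔ ∃ h ∈ S, mat g = embM h.val := by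
  constructor
  · rintro ⟨h, hS, hh⟩
    refine ⟨h, hS, ?_⟩
    ext i j
    have h1 := hh (Pi.single i 1)
    rw [← toL2_vecMul_embM] at h1
    have h2 := congrFun (toL2_injective h1) j
    simpa using h2
  · rintro ⟨h, hS, hh⟩
    exact ⟨h, hS, fun w => by rw [hh, toL2_vecMul_embM]⟩

/-- After all transposes are removed by `mulMat_transpose`, the blocks are products of commuting
multiplication matrices with `gramQ` and its inverse, and the similitude equation becomes h₀₀h₁₁ -
h₀₁h₁₀ = c. -/
theorem embM_J4 {h : Matrix (Fin 2) (Fin 2) (LAlg p D)} {c : ℚ_[p]}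
    (hdet : h.det = algebraMap ℚ_[p] (LAlg p D) c) :
    embM h * J4 ℚ_[p] * (embM h)ᵀ = c • J4 ℚ_[p] := by
  rw [Matrix.det_fin_two] at hdet
  have hc := congrArg (mulMat (p := p) (D := D)) hdet
  rw [sub_eq_add_neg, mulMat_add, mulMat_neg, mulMat_mul, mulMat_mul, mulMat_algebraMap,
    ← sub_eq_add_neg] at hc
  have e1 : gramQ p D * gramQi p D = 1 := gramQ_mul_gramQi
  have k : ∀ X : Matrix (Fin 2) (Fin 2) ℚ_[p], gramQ p D * (gramQi p D * X) = X := fun X => by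
    rw [← Matrix.mul_assoc, e1, Matrix.one_mul]
  have cm : ∀ x y : LAlg p D, mulMat x * mulMat y = mulMat y * mulMat x := fun x y => by
    rw [← mulMat_mul, mul_comm, mulMat_mul]
  have cm' : ∀ (x y : LAlg p D) X, mulMat x * (mulMat y * X) = mulMat y * (mulMat x * X) := by
    intro x y X; rw [← Matrix.mul_assoc, cm, Matrix.mul_assoc]
  have hc2 : mulMat (h 1 0) * mulMat (h 0 1) = mulMat (h 0 0) * mulMat (h 1 1) - c • 1 := by
    rw [← hc, cm (h 1 0)]; abel
  unfold embM
  rw [J4, Matrix.fromBlocks_transpose, Matrix.fromBlocks_multiply, Matrix.fromBlocks_multiply,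
    Matrix.fromBlocks_smul]
  simp only [Matrix.transpose_mul, gramQ_transpose, gramQi_transpose,
    mulMat_transpose, Matrix.mul_zero, Matrix.mul_one, Matrix.mul_neg, zero_add, add_zero,
    Matrix.mul_assoc, k, Matrix.neg_mul, e1, smul_zero, smul_neg]
  congr 1
  · rw [cm' (h 0 1)]; abel
  · rw [cm (h 0 1), ← cm (h 0 1), ← hc]; abel
  · rw [cm' (h 1 1), ← Matrix.mul_assoc (mulMat (h 1 0)), hc2, Matrix.sub_mul, Matrix.mul_sub]
    simp only [Matrix.mul_assoc, Matrix.smul_mul, Matrix.one_mul, Matrix.mul_smul,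
      gramQi_mul_gramQ]
    abel
  · rw [cm (h 1 1)]; abel

end KohnenSkoruppa
end

noncomputable section
namespace KohnenSkoruppa

/-! ### The group `GL*_{2,L}` and its unipotent subgroup inside `GSp₄` -/

variable {p : ℕ} [Fact p.Prime] {D : ℤ}

theorem det_embM_unit {h : Matrix (Fin 2) (Fin 2) (LAlg p D)} {c : ℚ_[p]} (hc : c ≠ 0)
    (hdet : h.det = algebraMap ℚ_[p] (LAlg p D) c) : IsUnit h.det := by
  rw [hdet]; exact (Ne.isUnit hc).map _

theorem mem_gl2L {g : GSp4 p} :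
    g ∈ gl2L p D ↔ ∃ h : Matrix (Fin 2) (Fin 2) (LAlg p D),
      h.det = algebraMap ℚ_[p] (LAlg p D) (nu g) ∧ mat g = embM h := by
  unfold gl2L
  rw [mem_ofGL2L]
  constructor
  · rintro ⟨h, ⟨c, hc⟩, hg⟩
    have hdet : h.val.det = algebraMap ℚ_[p] (LAlg p D) c := (congrArg Units.val hc).symm
    have hn : nu g = c := nu_eq_of (by rw [hg, embM_J4 hdet])
    exact ⟨h.val, by rw [hn, hdet], hg⟩
  · rintro ⟨h, hdet, hg⟩
    refine ⟨Matrix.GeneralLinearGroup.mk'' h (det_embM_unit (nu_ne_zero g) hdet),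
      ⟨Units.mk0 _ (nu_ne_zero g), ?_⟩, hg⟩
    apply Units.ext
    exact hdet.symm

/-- The element of `GSp₄` given by a `2 × 2` matrix over `L` with determinant in `ℚ_pˣ`. -/
def emb (h : Matrix (Fin 2) (Fin 2) (LAlg p D)) (c : ℚ_[p]) (hc : c ≠ 0)
    (hdet : h.det = algebraMap ℚ_[p] (LAlg p D) c) : GSp4 p :=
  ofMat (embM h) c hc (embM_J4 hdet)

theorem mat_emb (h : Matrix (Fin 2) (Fin 2) (LAlg p D)) (c : ℚ_[p]) (hc : c ≠ 0)
    (hdet : h.det = algebraMap ℚ_[p] (LAlg p D) c) : mat (emb h c hc hdet) = embM h := rfl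

theorem nu_emb (h : Matrix (Fin 2) (Fin 2) (LAlg p D)) (c : ℚ_[p]) (hc : c ≠ 0)
    (hdet : h.det = algebraMap ℚ_[p] (LAlg p D) c) : nu (emb h c hc hdet) = c := nu_ofMat _ _ _ _

theorem emb_mem (h : Matrix (Fin 2) (Fin 2) (LAlg p D)) (c : ℚ_[p]) (hc : c ≠ 0)
    (hdet : h.det = algebraMap ℚ_[p] (LAlg p D) c) : emb h c hc hdet ∈ gl2L p D :=
  mem_gl2L.2 ⟨h, by rw [nu_emb, hdet], mat_emb _ _ _ _⟩

theorem isInt_embM {h : Matrix (Fin 2) (Fin 2) (LAlg p D)} (hh : ∀ i j, IsO (h i j)) :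
    IsInt (embM h) :=
  isInt_fromBlocks.2 ⟨isInt_mulMat.2 (hh _ _), (isInt_mulMat.2 (hh _ _)).mul isInt_gramQ,
    isInt_gramQi.mul (isInt_mulMat.2 (hh _ _)), (isInt_mulMat.2 (hh _ _)).transpose⟩

/-- The coordinates of the upper right block of the image of `(1, z; 0, 1)`. -/
def coordN (z : LAlg p D) : Fin 3 → ℚ_[p] :=
  ![z.im, z.re + coeffB p D * z.im, coeffA p D * z.im + coeffB p D * (z.re + coeffB p D * z.im)]

theorem symM_coordN (z : LAlg p D) : symM (coordN z) = mulMat z * gramQ p D := by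
  ext i j
  fin_cases i <;> fin_cases j <;>
    simp [symM, coordN, mulMat, gramQ, Matrix.mul_apply, Fin.sum_univ_two, mul_comm]

theorem mat_uni_coordN (z : LAlg p D) : mat (uni (coordN z)) = embM !![1, z; 0, 1] := by
  rw [mat_uni, symM_coordN]
  simp [embM, mulMat_one, mulMat_zero]

variable (D) in
/-- The linear form whose composition with `ψ` is `χ`. -/
def yForm : (Fin 3 → ℚ_[p]) →+ ℚ_[p] where
  toFun x := x 2 - coeffB p D * x 1 - coeffA p D * x 0
  map_zero' := by simp
  map_add' x y := by simp only [Pi.add_apply]; ring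

theorem yForm_apply (x : Fin 3 → ℚ_[p]) :
    yForm D x = x 2 - coeffB p D * x 1 - coeffA p D * x 0 := rfl

/-- Inside U the subgroup N is the kernel of the linear form defining χ. Hence χ is trivial on N,
and N\U is identified with ℚ_p. -/
theorem yForm_eq_zero {x : Fin 3 → ℚ_[p]} : yForm D x = 0 ↔ ∃ z : LAlg p D, x = coordN z := by
  rw [yForm_apply]
  constructor
  · intro h
    refine ⟨⟨x 1 - coeffB p D * x 0, x 0⟩, ?_⟩
    ext i
    fin_cases i
    · simp [coordN]
    · simp [coordN]
    · simp [coordN]; linear_combination h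
  · rintro ⟨z, rfl⟩
    simp [coordN]

/-- The coordinates decompose as an element of `N` and a multiple of the last elementary matrix. -/
theorem coord_decomp (x : Fin 3 → ℚ_[p]) :
    x = coordN (⟨x 1 - coeffB p D * x 0, x 0⟩ : LAlg p D) + ![0, 0, yForm D x] := by
  ext i
  fin_cases i
  · simp [coordN]
  · simp [coordN]
  · simp [coordN, yForm_apply]; ring

theorem mem_unipN {g : GSp4 p} : g ∈ unipN p D ↔ ∃ x, yForm D x = 0 ∧ g = uni x := by
  unfold unipN
  rw [mem_ofGL2L]
  constructor
  · rintro ⟨h, ⟨z, hz⟩, hg⟩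
    refine ⟨coordN z.toAdd, yForm_eq_zero.2 ⟨_, rfl⟩, mat_injective ?_⟩
    rw [hg, mat_uni_coordN, ← hz]; rfl
  · rintro ⟨x, hx, rfl⟩
    obtain ⟨z, rfl⟩ := yForm_eq_zero.1 hx
    exact ⟨_, ⟨Multiplicative.ofAdd z, rfl⟩, mat_uni_coordN z⟩

theorem unipN_le_unipU : unipN p D ≤ unipU p := by
  intro g hg
  obtain ⟨x, -, rfl⟩ := mem_unipN.1 hg
  exact uni_mem x

theorem unipN_le_gl2L : unipN p D ≤ gl2L p D := by
  intro g hg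
  obtain ⟨x, hx, rfl⟩ := mem_unipN.1 hg
  obtain ⟨z, rfl⟩ := yForm_eq_zero.1 hx
  exact mem_gl2L.2 ⟨_, by rw [nu_uni]; simp [Matrix.det_fin_two_of], mat_uni_coordN z⟩

theorem chi_uni (ψ : AddChar ℚ_[p] ℂ) (x : Fin 3 → ℚ_[p]) :
    chi D ψ (uni x) = ψ (yForm D x) := by
  rw [yForm_apply]
  unfold chi
  simp only [mat_uni, Matrix.fromBlocks_apply₁₂, symM, Matrix.of_apply, Matrix.cons_val_zero,
    Matrix.cons_val_one, Matrix.cons_val', Matrix.cons_val_fin_one, coeffA, coeffB]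
  split_ifs <;> congr 1 <;> ring

/-- On a rank one matrix ᵗc c the form takes the value N(c₁ - c₀ω), and the action multiplies c₁ -
c₀ω by z̄. So the diagonal part of GL*_{2,L} acts on χ through norms. -/
theorem yForm_symAct (z : LAlg p D) (x : Fin 3 → ℚ_[p]) :
    yForm D (symAct (mulMat z) x) = QuadraticAlgebra.norm z * yForm D x := by
  have h := symM_symAct (mulMat z) x
  have h0 := congrFun (congrFun h 0) 0
  have h1 := congrFun (congrFun h 0) 1
  have h2 := congrFun (congrFun h 1) 1
  simp [symM, Matrix.mul_apply, Fin.sum_univ_two] at h0 h1 h2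
  simp only [mulMat, Matrix.of_apply, Matrix.cons_val_zero, Matrix.cons_val_one, Matrix.cons_val',
    Matrix.cons_val_fin_one] at h0 h1 h2
  have e : symAct (mulMat z) = symAct !![z.re, z.im; coeffA p D * z.im, z.re + coeffB p D * z.im] :=
    rfl
  rw [e, yForm_apply, yForm_apply, h0, h1, h2, QuadraticAlgebra.norm_def]
  ring

theorem yForm_smul (c : ℚ_[p]) (x : Fin 3 → ℚ_[p]) : yForm D (c • x) = c * yForm D x := by
  simp only [yForm_apply, Pi.smul_apply, smul_eq_mul]; ring

/-! ### Diagonal elements of `GL*_{2,L}` -/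

theorem mat_levi_mulGL (z : LAlg p D) (hz : QuadraticAlgebra.norm z ≠ 0) (ν : ℚ_[p]ˣ) :
    mat (levi (mulGL z hz) ν) = embM !![z, 0; 0, (ν : ℚ_[p]) • linv z] := by
  rw [mat_levi, mulGL_inv_val]
  simp [embM, mulMat_zero, mulMat_smul]

theorem levi_mulGL_mem (z : LAlg p D) (hz : QuadraticAlgebra.norm z ≠ 0) (ν : ℚ_[p]ˣ) :
    levi (mulGL z hz) ν ∈ gl2L p D := by
  refine mem_gl2L.2 ⟨_, ?_, mat_levi_mulGL z hz ν⟩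
  rw [nu_levi, Matrix.det_fin_two_of, mul_smul_comm, mul_linv hz, Algebra.algebraMap_eq_smul_one]
  simp

theorem exists_smul_isO (h : Matrix (Fin 2) (Fin 2) (LAlg p D)) :
    ∃ c : ℚ_[p], c ≠ 0 ∧ ∀ i j, IsO (c • h i j) := by
  obtain ⟨N, hN⟩ := pow_unbounded_of_one_lt (∑ i, ∑ j, (‖(h i j).re‖ + ‖(h i j).im‖))
    (one_lt_prime_real (p := p))
  refine ⟨(p : ℚ_[p]) ^ N, pow_ne_zero _ prime_cast_ne_zero, fun i j => ?_⟩
  have h1 : ‖(h i j).re‖ + ‖(h i j).im‖ ≤ (p : ℝ) ^ N := by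
    refine le_trans ?_ hN.le
    refine le_trans ?_ (Finset.single_le_sum (f := fun i => ∑ j, (‖(h i j).re‖ + ‖(h i j).im‖))
      (fun i _ => by positivity) (Finset.mem_univ i))
    exact Finset.single_le_sum (f := fun j => ‖(h i j).re‖ + ‖(h i j).im‖)
      (fun i _ => by positivity) (Finset.mem_univ j)
  have h2 : ‖(p : ℚ_[p]) ^ N‖ = ((p : ℝ) ^ N)⁻¹ := by
    rw [norm_pow, Padic.norm_p, inv_pow]
  have h3 : (0 : ℝ) < (p : ℝ) ^ N := pow_pos prime_real_pos _
  have key : ∀ x : ℚ_[p], ‖x‖ ≤ (p : ℝ) ^ N → ‖(p : ℚ_[p]) ^ N * x‖ ≤ 1 := by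
    intro x hx
    rw [norm_mul, h2, ← div_eq_inv_mul]
    exact (div_le_one h3).2 hx
  exact ⟨key _ (by linarith [norm_nonneg (h i j).im]), key _ (by linarith [norm_nonneg (h i j).re])⟩

/-- The Iwasawa decomposition of `GL*_{2,L}`. -/
theorem exists_iwasawa_gl2L (hD : Squarefree D) {g : GSp4 p} (hg : g ∈ gl2L p D) :
    ∃ (x : Fin 3 → ℚ_[p]) (z : LAlg p D) (hz : QuadraticAlgebra.norm z ≠ 0) (ν : ℚ_[p]ˣ),
      ∃ k ∈ maxCompact p, k ∈ gl2L p D ∧ yForm D x = 0 ∧ g = uni x * levi (mulGL z hz) ν * k := by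
  obtain ⟨h, hdet, hmat⟩ := mem_gl2L.1 hg
  set r := h 1 0 with hr
  set s := h 1 1 with hs
  obtain ⟨c, hc, hcO⟩ := exists_smul_isO h
  have hd : h 0 0 * s - h 0 1 * r = algebraMap ℚ_[p] (LAlg p D) (nu g) := by
    rw [← hdet, Matrix.det_fin_two]
  -- The fractional ideal generated by the bottom row. Its generator t becomes the lower right entry
  -- of the diagonal factor.
  let Λ : AddSubgroup (LAlg p D) :=
    { carrier := {w | ∃ x y : LAlg p D, IsO x ∧ IsO y ∧ w = x * r + y * s}
      zero_mem' := ⟨0, 0, isO_zero, isO_zero, by simp⟩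
      add_mem' := by
        rintro _ _ ⟨x, y, hx, hy, rfl⟩ ⟨x', y', hx', hy', rfl⟩
        exact ⟨x + x', y + y', hx.add hx', hy.add hy', by ring⟩
      neg_mem' := by
        rintro _ ⟨x, y, hx, hy, rfl⟩
        exact ⟨-x, -y, hx.neg, hy.neg, by ring⟩ }
  obtain ⟨t, ⟨x0, y0, hx0, hy0, ht⟩, ht0, htΛ⟩ := exists_generator hD Λ (by
    refine ⟨‖c * c‖⁻¹, ?_⟩
    rintro w ⟨x, y, hx, hy, rfl⟩
    have h1 : IsO (c • (x * r + y * s)) := by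
      rw [smul_add, ← mul_smul_comm, ← mul_smul_comm]
      exact (hx.mul (hcO 1 0)).add (hy.mul (hcO 1 1))
    have h2 := h1.norm_le
    rw [norm_smul_L, norm_mul] at h2
    have h3 : 0 < ‖c * c‖ := norm_pos_iff.2 (mul_ne_zero hc hc)
    rw [← one_div, le_div_iff₀ h3, mul_comm]
    exact h2) (by
    refine ⟨c • algebraMap ℚ_[p] (LAlg p D) (nu g), ⟨-(c • h 0 1), c • h 0 0, ?_, ?_, ?_⟩, ?_⟩
    · exact (hcO 0 1).neg
    · exact hcO 0 0
    · rw [← hd, smul_sub, smul_mul_assoc, neg_mul, smul_mul_assoc]; ring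
    · rw [norm_smul_L, QuadraticAlgebra.norm_algebraMap]
      have := nu_ne_zero g
      positivity)
  have hr' := htΛ r ⟨1, 0, isO_one, isO_zero, by ring⟩
  have hs' := htΛ s ⟨0, 1, isO_zero, isO_one, by ring⟩
  have htt := mul_linv ht0
  set t' := linv t with ht'
  -- Since t = x₀r + y₀s, the integral row (r/t, s/t) is completed to an integral matrix of
  -- determinant one.
  have hk1 : (!![y0, -x0; r * t', s * t'] : Matrix (Fin 2) (Fin 2) (LAlg p D)).det
      = algebraMap ℚ_[p] (LAlg p D) 1 := by
    rw [Matrix.det_fin_two_of, map_one]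
    linear_combination htt - t' * ht
  set z := h 0 0 * (s * t') - h 0 1 * (r * t') with hz
  have hzt : z * t = algebraMap ℚ_[p] (LAlg p D) (nu g) := by
    rw [hz]; linear_combination hd + (h 0 0 * s - h 0 1 * r) * htt
  have hz0 : QuadraticAlgebra.norm z ≠ 0 := by
    intro h0
    have := congrArg QuadraticAlgebra.norm hzt
    rw [map_mul, h0, zero_mul, QuadraticAlgebra.norm_algebraMap] at this
    exact pow_ne_zero 2 (nu_ne_zero g) this.symm
  have ht2 : nu g • linv z = t := by
    have h1 := mul_linv hz0
    rw [Algebra.smul_def, ← hzt]; linear_combination t * h1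
  refine ⟨coordN ((h 0 0 * x0 + h 0 1 * y0) * t'), z, hz0, Units.mk0 _ (nu_ne_zero g),
    emb _ 1 one_ne_zero hk1, ?_, emb_mem _ _ _ _, yForm_eq_zero.2 ⟨_, rfl⟩, mat_injective ?_⟩
  · rw [mem_maxCompact, nu_emb, mat_emb]
    refine ⟨isInt_embM fun i j => ?_, by simp⟩
    fin_cases i <;> fin_cases j
    · exact hy0
    · exact hx0.neg
    · exact hr'
    · exact hs'
  · rw [mat_mul, mat_mul, mat_uni_coordN, mat_levi_mulGL, mat_emb, ← embM_mul, ← embM_mul, hmat]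
    congr 1
    rw [Units.val_mk0, ht2]
    ext1 i j
    fin_cases i <;> fin_cases j <;>
      simp [Matrix.mul_apply, Fin.sum_univ_two]
    · linear_combination (-(h 0 0 * x0 + h 0 1 * y0) * r * t' - h 0 0) * htt + h 0 0 * t' * ht
    · linear_combination (-(h 0 0 * x0 + h 0 1 * y0) * s * t' - h 0 1) * htt + h 0 1 * t' * ht
    · linear_combination -h 1 0 * htt
    · linear_combination -h 1 1 * htt

end KohnenSkoruppa
end

noncomputable section
namespace KohnenSkoruppa

/-! ### Primitive elements of the maximal order modulo units -/

variable {p : ℕ} [Fact p.Prime] {D : ℤ}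

/-- Units of the maximal order. -/
def IsUnitO (z : LAlg p D) : Prop := IsO z ∧ ‖QuadraticAlgebra.norm z‖ = 1

theorem IsUnitO.norm_ne {z : LAlg p D} (hz : IsUnitO z) : QuadraticAlgebra.norm z ≠ 0 := by
  rw [← norm_ne_zero_iff, hz.2]; exact one_ne_zero

theorem isUnitO_one : IsUnitO (1 : LAlg p D) := ⟨isO_one, by simp⟩

theorem IsUnitO.mul {z w : LAlg p D} (hz : IsUnitO z) (hw : IsUnitO w) : IsUnitO (z * w) :=
  ⟨hz.1.mul hw.1, by rw [map_mul, norm_mul, hz.2, hw.2, one_mul]⟩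

theorem IsUnitO.linv {z : LAlg p D} (hz : IsUnitO z) : IsUnitO (linv z) :=
  ⟨hz.1.star.smul (by rw [norm_inv, hz.2, inv_one]), by
    rw [norm_linv hz.norm_ne, norm_inv, hz.2, inv_one]⟩

theorem IsUnitO.smul {c : ℚ_[p]} {z : LAlg p D} (hc : ‖c‖ = 1) (hz : IsUnitO z) :
    IsUnitO (c • z) :=
  ⟨hz.1.smul hc.le, by rw [norm_smul_L, norm_mul, norm_mul, hc, hz.2]; simp⟩

theorem norm_star_L (z : LAlg p D) : QuadraticAlgebra.norm (star z) = QuadraticAlgebra.norm z := by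
  simp only [QuadraticAlgebra.norm_def, QuadraticAlgebra.re_star, QuadraticAlgebra.im_star]; ring

theorem star_smul_L (c : ℚ_[p]) (z : LAlg p D) : star (c • z) = c • star z := by
  ext
  · simp only [QuadraticAlgebra.re_star, QuadraticAlgebra.re_smul, QuadraticAlgebra.im_smul,
      smul_eq_mul]; ring
  · simp

theorem IsUnitO.star {z : LAlg p D} (hz : IsUnitO z) : IsUnitO (star z) :=
  ⟨hz.1.star, by rw [norm_star_L, hz.2]⟩

theorem norm_smul_ne_zero {c : ℚ_[p]} {z : LAlg p D} (hc : c ≠ 0)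
    (hz : QuadraticAlgebra.norm z ≠ 0) : QuadraticAlgebra.norm (c • z) ≠ 0 := by
  rw [norm_smul_L]; exact mul_ne_zero (mul_ne_zero hc hc) hz

theorem IsUnitO.mulGL_mem {z : LAlg p D} (hz : IsUnitO z) :
    mulGL z hz.norm_ne ∈ intGL p (Fin 2) := by
  rw [mem_intGL_fin_two, mulGL_val, det_mulMat, isInt_mulMat]; exact hz

variable (p D) in
/-- Primitive elements of the maximal order, of nonzero norm. -/
structure PrimElt where
  /-- The element. -/
  val : LAlg p D
  isO : IsO val
  prim : ¬ IsO ((p : ℚ_[p])⁻¹ • val)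
  norm_ne : QuadraticAlgebra.norm val ≠ 0

instance : Setoid (PrimElt p D) where
  r d e := ∃ ε, IsUnitO ε ∧ d.val = ε * e.val
  iseqv :=
    { refl := fun d => ⟨1, isUnitO_one, by rw [one_mul]⟩
      symm := by
        rintro d e ⟨ε, hε, h⟩
        refine ⟨linv ε, hε.linv, ?_⟩
        have := mul_linv hε.norm_ne
        rw [h]; linear_combination -e.val * this
      trans := by
        rintro d e f ⟨ε, hε, h⟩ ⟨δ, hδ, h'⟩
        exact ⟨ε * δ, hε.mul hδ, by rw [h, h', mul_assoc]⟩ }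

variable (p D) in
/-- Classes of primitive elements modulo units. -/
def PrimClass : Type := Quotient (inferInstance : Setoid (PrimElt p D))

/-- A chosen primitive element of a class. -/
def PrimClass.elt (d : PrimClass p D) : LAlg p D := (Quotient.out d : PrimElt p D).val

theorem PrimClass.isO (d : PrimClass p D) : IsO d.elt := (Quotient.out d : PrimElt p D).isO

theorem PrimClass.prim (d : PrimClass p D) : ¬ IsO ((p : ℚ_[p])⁻¹ • d.elt) :=
  (Quotient.out d : PrimElt p D).prim

theorem PrimClass.norm_ne (d : PrimClass p D) : QuadraticAlgebra.norm d.elt ≠ 0 :=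
  (Quotient.out d : PrimElt p D).norm_ne

theorem PrimClass.exists_cond (d : PrimClass p D) :
    ∃ c : ℕ, ‖QuadraticAlgebra.norm d.elt‖ = (p : ℝ) ^ (-(c : ℤ)) := by
  obtain ⟨n, hn⟩ := norm_eq_zpow d.norm_ne
  have h := d.isO.norm_le
  rw [hn, ← zpow_zero (p : ℝ), zpow_prime_le] at h
  exact ⟨n.toNat, by rw [hn, Int.toNat_of_nonneg (by omega)]⟩

/-- The valuation of the norm of a primitive class. -/
def PrimClass.cond (d : PrimClass p D) : ℕ := d.exists_cond.choose

theorem PrimClass.norm_norm (d : PrimClass p D) :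
    ‖QuadraticAlgebra.norm d.elt‖ = (p : ℝ) ^ (-(d.cond : ℤ)) := d.exists_cond.choose_spec

theorem norm_lt_one_iff_exists {c : ℚ_[p]} (h : ‖c‖ < 1) : ∃ c', ‖c'‖ ≤ 1 ∧ c = p * c' := by
  have hp := prime_cast_ne_zero (p := p)
  refine ⟨(p : ℚ_[p])⁻¹ * c, ?_, by field_simp⟩
  have h1 : ‖c‖ ≤ (p : ℝ) ^ (-1 : ℤ) := norm_le_zpow_of_lt (by simpa using h)
  rw [norm_mul, norm_inv, Padic.norm_p, inv_inv]
  calc (p : ℝ) * ‖c‖ ≤ p * (p : ℝ) ^ (-1 : ℤ) := by gcongr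
    _ = 1 := by rw [zpow_neg_one]; exact mul_inv_cancel₀ prime_real_pos.ne'

theorem norm_ge_one_of_prim {z w ε : LAlg p D} {c : ℚ_[p]} (hz : ¬ IsO ((p : ℚ_[p])⁻¹ • z))
    (hw : IsO w) (hε : IsUnitO ε) (h : z = c • (ε * w)) : 1 ≤ ‖c‖ := by
  by_contra hc
  push Not at hc
  obtain ⟨c', h1, rfl⟩ := norm_lt_one_iff_exists hc
  apply hz
  rw [h, smul_smul, ← mul_assoc, inv_mul_cancel₀ prime_cast_ne_zero, one_mul]
  exact (hε.1.mul hw).smul h1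

/-- Primitivity of the left side gives |c| ≥ 1, and primitivity of the right side gives |c⁻¹| ≥ 1.
This uniqueness separates the double cosets. -/
theorem PrimClass.eq_of_smul {d e : PrimClass p D} {ε : LAlg p D} {c : ℚ_[p]} (hε : IsUnitO ε)
    (h : d.elt = c • (ε * e.elt)) : d = e ∧ ‖c‖ = 1 := by
  have h1 := norm_ge_one_of_prim d.prim e.isO hε h
  have hc : c ≠ 0 := by rintro rfl; simp at h1; linarith
  have hi := mul_linv hε.norm_ne
  have h' : e.elt = c⁻¹ • (linv ε * d.elt) := by
    rw [h, mul_smul_comm, smul_smul, inv_mul_cancel₀ hc, one_smul]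
    linear_combination -e.elt * hi
  have h2 := norm_ge_one_of_prim e.prim d.isO hε.linv h'
  rw [norm_inv] at h2
  have h3 : ‖c‖ ≤ 1 := by
    rw [one_le_inv₀ (by linarith)] at h2; exact h2
  have hc1 : ‖c‖ = 1 := le_antisymm h3 h1
  refine ⟨?_, hc1⟩
  rw [← Quotient.out_eq d, ← Quotient.out_eq e]
  apply Quotient.sound
  exact ⟨c • ε, hε.smul hc1, by rw [smul_mul_assoc]; exact h⟩

/-- The exponent k is the largest one with p^{-k}t integral. It exists because N(t) ≠ 0 bounds it,
and its maximality makes p^{-k}t primitive. -/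
theorem PrimClass.exists_eq {t : LAlg p D} (ht : QuadraticAlgebra.norm t ≠ 0) :
    ∃ (d : PrimClass p D) (k : ℤ) (ε : LAlg p D), IsUnitO ε ∧ t = (p : ℚ_[p]) ^ k • (ε * d.elt) := by
  have hp := prime_cast_ne_zero (p := p)
  obtain ⟨N, hN⟩ := pow_unbounded_of_one_lt (‖t.re‖ + ‖t.im‖) (one_lt_prime_real (p := p))
  obtain ⟨k, hk, hmax⟩ := Int.exists_greatest_of_bdd
    (P := fun k : ℤ => IsO ((p : ℚ_[p]) ^ (-k) • t)) (by
      obtain ⟨n, hn⟩ := norm_eq_zpow ht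
      obtain ⟨b, hb⟩ : ∃ b : ℤ, n ≤ 2 * b := ⟨n.natAbs, by omega⟩
      refine ⟨b, fun k hk => ?_⟩
      have h := hk.norm_le
      rw [norm_smul_L, norm_mul, norm_mul, norm_prime_zpow, hn, neg_neg,
        ← zpow_add₀ prime_real_pos.ne', ← zpow_add₀ prime_real_pos.ne', ← zpow_zero (p : ℝ),
        zpow_prime_le] at h
      omega) (by
      refine ⟨-N, ?_⟩
      have key : ∀ x : ℚ_[p], ‖x‖ ≤ (p : ℝ) ^ N → ‖(p : ℚ_[p]) ^ (-(-N : ℤ)) * x‖ ≤ 1 := by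
        intro x hx
        rw [norm_mul, norm_prime_zpow, neg_neg, zpow_neg, zpow_natCast, ← div_eq_inv_mul]
        exact (div_le_one (pow_pos prime_real_pos _)).2 hx
      exact ⟨key _ (by linarith [norm_nonneg t.im]), key _ (by linarith [norm_nonneg t.re])⟩)
  let e : PrimElt p D :=
    { val := (p : ℚ_[p]) ^ (-k) • t
      isO := hk
      prim := fun h => by
        have := hmax (k + 1) (by
          rw [smul_smul] at h
          convert h using 2
          rw [neg_add, zpow_add₀ hp, zpow_neg_one, mul_comm])
        omega
      norm_ne := norm_smul_ne_zero (zpow_ne_zero _ hp) ht }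
  have h1 : (Quotient.mk _ e : PrimClass p D).out ≈ e := Quotient.mk_out (s := inferInstance) e
  obtain ⟨ε, hε, h2⟩ := Setoid.symm h1
  refine ⟨Quotient.mk _ e, k, ε, hε, ?_⟩
  change t = (p : ℚ_[p]) ^ k • (ε * ((Quotient.mk _ e : PrimClass p D).out).val)
  rw [← h2]
  change t = (p : ℚ_[p]) ^ k • ((p : ℚ_[p]) ^ (-k) • t)
  rw [smul_smul, ← zpow_add₀ hp, add_neg_cancel, zpow_zero, one_smul]

/-! ### Representatives of the relevant double cosets -/

theorem star_norm_ne (d : PrimClass p D) (j : ℤ) :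
    QuadraticAlgebra.norm ((p : ℚ_[p]) ^ j • star d.elt) ≠ 0 :=
  norm_smul_ne_zero (zpow_ne_zero _ prime_cast_ne_zero) (by rw [norm_star_L]; exact d.norm_ne)

/-- The Levi part of the representative of a double coset. -/
def repA (d : PrimClass p D) (j : ℤ) : GL (Fin 2) ℚ_[p] :=
  mulGL ((p : ℚ_[p]) ^ j • star d.elt) (star_norm_ne d j)

/-- The similitude of the representative of a double coset. -/
def repNu (d : PrimClass p D) (j : ℤ) : ℚ_[p]ˣ :=
  Units.mk0 ((p : ℚ_[p]) ^ j * QuadraticAlgebra.norm d.elt)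
    (mul_ne_zero (zpow_ne_zero _ prime_cast_ne_zero) d.norm_ne)

/-- The representative `diag(p ^ j d̄, d)` of a double coset. -/
def repM (d : PrimClass p D) (j : ℤ) : GSp4 p := levi (repA d j) (repNu d j)

theorem norm_repNu (d : PrimClass p D) (j : ℤ) :
    ‖(repNu d j : ℚ_[p])‖ = (p : ℝ) ^ (-(j + d.cond)) := by
  change ‖(p : ℚ_[p]) ^ j * QuadraticAlgebra.norm d.elt‖ = _
  rw [norm_mul, norm_prime_zpow, d.norm_norm, ← zpow_add₀ prime_real_pos.ne', neg_add]

theorem norm_det_repA (d : PrimClass p D) (j : ℤ) :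
    ‖(repA d j).val.det‖ = (p : ℝ) ^ (-(2 * j + d.cond)) := by
  rw [repA, mulGL_val, det_mulMat, norm_smul_L, norm_star_L, norm_mul, norm_mul, norm_prime_zpow,
    d.norm_norm, ← zpow_add₀ prime_real_pos.ne', ← zpow_add₀ prime_real_pos.ne']
  congr 1; ring

theorem repNu_linv (d : PrimClass p D) (j : ℤ) :
    (repNu d j : ℚ_[p]) • linv ((p : ℚ_[p]) ^ j • star d.elt) = d.elt := by
  have h1 := mul_linv (star_norm_ne d j)
  have h2 := QuadraticAlgebra.algebraMap_norm_eq_mul_star d.elt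
  have h3 : ((p : ℚ_[p]) ^ j • star d.elt) * d.elt =
      algebraMap ℚ_[p] (LAlg p D) (repNu d j) := by
    change _ = algebraMap ℚ_[p] (LAlg p D) ((p : ℚ_[p]) ^ j * QuadraticAlgebra.norm d.elt)
    rw [map_mul, h2, ← Algebra.smul_def, smul_mul_assoc, mul_comm]
  rw [Algebra.smul_def, ← h3]
  linear_combination d.elt * h1

theorem mat_repM (d : PrimClass p D) (j : ℤ) :
    mat (repM d j) = embM !![(p : ℚ_[p]) ^ j • star d.elt, 0; 0, d.elt] := by
  rw [repM, repA, mat_levi_mulGL, repNu_linv]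

theorem repM_mem (d : PrimClass p D) (j : ℤ) : repM d j ∈ gl2L p D := levi_mulGL_mem _ _ _

theorem embM_smul (c : ℚ_[p]) (h : Matrix (Fin 2) (Fin 2) (LAlg p D)) :
    embM (c • h) = c • embM h := by
  unfold embM
  rw [Matrix.fromBlocks_smul]
  simp only [Matrix.smul_apply, mulMat_smul, Matrix.smul_mul, Matrix.mul_smul, Matrix.transpose_smul]

theorem scal_mem_gl2L (c : ℚ_[p]ˣ) : scal c ∈ gl2L p D := by
  refine mem_gl2L.2 ⟨(c : ℚ_[p]) • 1, ?_, ?_⟩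
  · rw [nu_scal, Matrix.det_fin_two, Algebra.algebraMap_eq_smul_one]
    simp [smul_smul]
  · rw [mat_scal, embM_smul]
    congr 1
    simp [embM, mulMat_one, mulMat_zero]

/-- Every diagonal element is a representative up to the centre and integral points. -/
theorem levi_eq_repM (z : LAlg p D) (hz : QuadraticAlgebra.norm z ≠ 0) (ν : ℚ_[p]ˣ) :
    ∃ (d : PrimClass p D) (j : ℤ) (c : ℚ_[p]ˣ), ∃ k ∈ maxCompact p, k ∈ gl2L p D ∧
      levi (mulGL z hz) ν = scal c * repM d j * k := by
  have hp := prime_cast_ne_zero (p := p)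
  have hi := mul_linv hz
  have hlz : QuadraticAlgebra.norm (linv z) ≠ 0 := by rw [norm_linv hz]; exact inv_ne_zero hz
  obtain ⟨d, k, ε, hε, ht⟩ := PrimClass.exists_eq (norm_smul_ne_zero ν.ne_zero hlz)
  have hx : (ν : ℚ_[p]) * (p : ℚ_[p]) ^ (-(2 * k)) / QuadraticAlgebra.norm d.elt ≠ 0 :=
    div_ne_zero (mul_ne_zero ν.ne_zero (zpow_ne_zero _ hp)) d.norm_ne
  obtain ⟨j, hj⟩ := norm_eq_zpow hx
  -- The unit left over from ν p^{-2k} / N(d) after the power p^j has been removed; it becomes the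
  -- similitude of the factor in K.
  set u : ℚ_[p] := (ν : ℚ_[p]) * (p : ℚ_[p]) ^ (-(2 * k)) / QuadraticAlgebra.norm d.elt *
    (p : ℚ_[p]) ^ (-j) with hu
  have hu1 : ‖u‖ = 1 := by
    rw [hu, norm_mul, hj, norm_prime_zpow, ← zpow_add₀ prime_real_pos.ne']; simp
  have hu0 : u ≠ 0 := by rw [← norm_ne_zero_iff, hu1]; exact one_ne_zero
  have hν : (ν : ℚ_[p]) = (p : ℚ_[p]) ^ k * ((p : ℚ_[p]) ^ k * ((p : ℚ_[p]) ^ j * u *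
      QuadraticAlgebra.norm d.elt)) := by
    have hdn := d.norm_ne
    rw [hu, mul_comm (2 : ℤ), zpow_neg, zpow_mul, zpow_neg]
    have := zpow_ne_zero k hp
    have := zpow_ne_zero j hp
    field_simp
  set w := u • linv ε with hw
  have hwu : IsUnitO w := hε.linv.smul hu1
  have hεi := mul_linv hε.norm_ne
  have hwε : u • linv w = ε := by
    have h1 := mul_linv hwu.norm_ne
    rw [Algebra.smul_def]
    rw [hw, Algebra.smul_def] at h1 ⊢
    linear_combination ε * h1 - (algebraMap ℚ_[p] (LAlg p D) u) *
      linv (algebraMap ℚ_[p] (LAlg p D) u * linv ε) * hεi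
  refine ⟨d, j, Units.mk0 _ (zpow_ne_zero k hp), levi (mulGL w hwu.norm_ne) (Units.mk0 u hu0),
    levi_mem_maxCompact.2 ⟨hwu.mulGL_mem, hu1⟩, levi_mulGL_mem _ _ _, mat_injective ?_⟩
  rw [mat_mul, mat_mul, mat_repM, mat_levi_mulGL, mat_levi_mulGL, mat_scal, Units.val_mk0,
    Units.val_mk0, hwε, Matrix.smul_mul, Matrix.one_mul, Matrix.smul_mul, ← embM_mul, ← embM_smul]
  congr 1
  have hzz : z = (p : ℚ_[p]) ^ k • ((p : ℚ_[p]) ^ j • star d.elt * w) := by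
    have e1 : (ν : ℚ_[p]) • (1 : LAlg p D) = z * ((ν : ℚ_[p]) • linv z) := by
      rw [mul_smul_comm, hi]
    have h2 := QuadraticAlgebra.algebraMap_norm_eq_mul_star d.elt
    have e2 : ((p : ℚ_[p]) ^ k • ((p : ℚ_[p]) ^ j • star d.elt * w)) * ((ν : ℚ_[p]) • linv z) =
        (ν : ℚ_[p]) • (1 : LAlg p D) := by
      rw [ht, hw]
      conv_rhs => rw [hν]
      rw [← Algebra.algebraMap_eq_smul_one]
      simp only [map_mul, h2, Algebra.smul_def]
      linear_combination (algebraMap ℚ_[p] (LAlg p D) ((p : ℚ_[p]) ^ k)) ^ 2 *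
        algebraMap ℚ_[p] (LAlg p D) ((p : ℚ_[p]) ^ j) * algebraMap ℚ_[p] (LAlg p D) u * d.elt *
        star d.elt * hεi
    have e3 : ((ν : ℚ_[p]) • linv z) * ((ν : ℚ_[p])⁻¹ • z) = 1 := by
      rw [smul_mul_smul_comm, mul_inv_cancel₀ ν.ne_zero, one_smul, mul_comm, hi]
    calc z = z * (((ν : ℚ_[p]) • linv z) * ((ν : ℚ_[p])⁻¹ • z)) := by rw [e3, mul_one]
      _ = _ := by rw [← mul_assoc, ← e1, ← e2, mul_assoc, e3, mul_one]
  ext1 i j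
  fin_cases i <;> fin_cases j <;> simp
  · conv_lhs => rw [hzz]
    simp
  · rw [ht, mul_comm]

theorem mat_uni_mul_levi (x : Fin 3 → ℚ_[p]) (A : GL (Fin 2) ℚ_[p]) (ν : ℚ_[p]ˣ) :
    mat (uni x * levi A ν) = Matrix.fromBlocks A.val (symM x * ((ν : ℚ_[p]) • (A⁻¹.val)ᵀ)) 0
      ((ν : ℚ_[p]) • (A⁻¹.val)ᵀ) := by
  rw [mat_mul, mat_uni, mat_levi, Matrix.fromBlocks_multiply]
  simp

theorem of_uni_mul_levi_mem {x : Fin 3 → ℚ_[p]} {A : GL (Fin 2) ℚ_[p]} {ν : ℚ_[p]ˣ}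
    (h : uni x * levi A ν ∈ maxCompact p) : A ∈ intGL p (Fin 2) ∧ ‖(ν : ℚ_[p])‖ = 1 := by
  rw [mem_maxCompact, mat_uni_mul_levi, nu_mul, nu_uni, nu_levi, one_mul, isInt_fromBlocks] at h
  obtain ⟨⟨h1, -, -, h2⟩, hν⟩ := h
  exact ⟨⟨h1, by rwa [isInt_smul_unit hν, isInt_transpose] at h2⟩, hν⟩

/-- Two Levi elements in the same double coset of `U` and `K`. -/
theorem of_levi_eq {x : Fin 3 → ℚ_[p]} {A B : GL (Fin 2) ℚ_[p]} {ν μ : ℚ_[p]ˣ} {k : GSp4 p}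
    (hk : k ∈ maxCompact p) (h : levi A ν = uni x * levi B μ * k) :
    B⁻¹ * A ∈ intGL p (Fin 2) ∧ ‖(ν : ℚ_[p])‖ = ‖(μ : ℚ_[p])‖ := by
  have h1 : k = uni ((((μ⁻¹ : ℚ_[p]ˣ) : ℚ_[p]))⁻¹ • symAct B⁻¹.val (-x)) *
      levi (B⁻¹ * A) (μ⁻¹ * ν) := by
    rw [levi_mul, ← mul_assoc, ← levi_mul_uni, h, ← levi_inv, uni_neg]
    group
  rw [h1] at hk
  obtain ⟨h2, h3⟩ := of_uni_mul_levi_mem hk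
  refine ⟨h2, ?_⟩
  rw [Units.val_mul, Units.val_inv_eq_inv_val, norm_mul, norm_inv] at h3
  have := norm_ne_zero_iff.2 μ.ne_zero
  field_simp at h3
  exact h3

theorem scal_mul_levi (c : ℚ_[p]ˣ) (A : GL (Fin 2) ℚ_[p]) (ν : ℚ_[p]ˣ) :
    scal c * levi A ν = levi (gl2 c 0 0 c (by simp) * A) (c * c * ν) := by
  rw [scal_eq_levi, levi_mul]

theorem gl2_scalar_val (c : ℚ_[p]ˣ) (A : GL (Fin 2) ℚ_[p]) :
    (gl2 (c : ℚ_[p]) 0 0 c (by simp) * A).val = (c : ℚ_[p]) • A.val := by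
  rw [Units.val_mul, gl2_val]
  have : (!![(c : ℚ_[p]), 0; 0, (c : ℚ_[p])] : Matrix (Fin 2) (Fin 2) ℚ_[p]) = (c : ℚ_[p]) • 1 := by
    ext i j; fin_cases i <;> fin_cases j <;> simp
  rw [this, Matrix.smul_mul, Matrix.one_mul]

/-- The representatives lie in different double cosets. -/
theorem repM_disjoint {d e : PrimClass p D} {i j : ℤ} {x : Fin 3 → ℚ_[p]} {c : ℚ_[p]ˣ}
    {k : GSp4 p} (hk : k ∈ maxCompact p) (h : repM d i = uni x * scal c * repM e j * k) :
    d = e ∧ i = j := by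
  have hp := prime_cast_ne_zero (p := p)
  rw [mul_assoc (uni x), repM, repM, scal_mul_levi] at h
  obtain ⟨h1, h2⟩ := of_levi_eq hk h
  have e1 : gl2 (c : ℚ_[p]) 0 0 c (by simp) * repA e j =
      mulGL ((c : ℚ_[p]) • ((p : ℚ_[p]) ^ j • star e.elt))
        (norm_smul_ne_zero c.ne_zero (star_norm_ne e j)) := by
    apply Units.ext
    rw [gl2_scalar_val, mulGL_val, mulMat_smul (c : ℚ_[p])]; rfl
  rw [e1, mem_intGL_fin_two, Units.val_mul, mulGL_inv_val, repA, mulGL_val, ← mulMat_mul,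
    isInt_mulMat, det_mulMat] at h1
  set t := (c : ℚ_[p]) • ((p : ℚ_[p]) ^ j • star e.elt) with ht
  have hti := mul_linv (norm_smul_ne_zero c.ne_zero (star_norm_ne e j))
  rw [← ht] at hti
  set w := linv t * ((p : ℚ_[p]) ^ i • star d.elt) with hw
  have hwu : IsUnitO w := h1
  have h3 : (p : ℚ_[p]) ^ i • star d.elt = t * w := by
    rw [hw]; linear_combination -((p : ℚ_[p]) ^ i • star d.elt) * hti
  have h4 : d.elt = ((p : ℚ_[p]) ^ (-i) * c * (p : ℚ_[p]) ^ j) • (star w * e.elt) := by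
    have h5 := congrArg (fun z => (p : ℚ_[p]) ^ (-i) • star z) h3
    simp only [star_smul_L, star_star, ht, star_mul, smul_smul] at h5
    rw [← zpow_add₀ hp] at h5
    simp only [neg_add_cancel, zpow_zero, one_smul] at h5
    rw [h5]
    simp only [mul_smul_comm, smul_smul]
    congr 1; ring
  obtain ⟨rfl, h6⟩ := PrimClass.eq_of_smul hwu.star h4
  refine ⟨rfl, ?_⟩
  rw [Units.val_mul, Units.val_mul, norm_mul, norm_mul, norm_repNu, norm_repNu] at h2
  rw [norm_mul, norm_mul, norm_prime_zpow, norm_prime_zpow, neg_neg] at h6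
  obtain ⟨n, hn⟩ := norm_eq_zpow c.ne_zero
  have hp0 := (prime_real_pos (p := p)).ne'
  rw [hn, ← zpow_add₀ hp0, ← zpow_add₀ hp0, zpow_prime_inj] at h2
  rw [hn, ← zpow_add₀ hp0, ← zpow_add₀ hp0, ← zpow_zero (p : ℝ), zpow_prime_inj] at h6
  -- With |c| = p^{-n}, the similitudes give i = j + 2n and the comparison of the primitive elements
  -- gives i = j + n; hence n = 0.
  omega

end KohnenSkoruppa
end

noncomputable section
namespace KohnenSkoruppa

/-! ### The function `τ` and the section `f^Φ` -/

variable {p : ℕ} [Fact p.Prime] {D : ℤ}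

theorem basisF_vecMul_mul (g h : GSp4 p) :
    basisF p 1 ᵥ* mat (g * h) = (basisF p 1 ᵥ* mat g) ᵥ* mat h := by
  rw [mat_mul, Matrix.vecMul_vecMul]

theorem basisF_vecMul_uni (x : Fin 3 → ℚ_[p]) : basisF p 1 ᵥ* mat (uni x) = basisF p 1 := by
  ext i
  rw [basisF, Matrix.single_one_vecMul, mat_uni]
  rcases i with i | i
  · simp
  · simp [Matrix.one_apply, Pi.single_apply, eq_comm]

theorem basisF_vecMul_scal (z : ℚ_[p]ˣ) :
    basisF p 1 ᵥ* mat (scal z) = (z : ℚ_[p]) • basisF p 1 := by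
  rw [mat_scal, Matrix.vecMul_smul, Matrix.vecMul_one]

theorem norm_vecMul_le {k : GSp4 p} (hk : IsInt (mat k)) (w : Idx → ℚ_[p]) :
    ‖w ᵥ* mat k‖ ≤ ‖w‖ := by
  rw [pi_norm_le_iff_of_nonneg (norm_nonneg _)]
  intro j
  change ‖∑ i, w i * mat k i j‖ ≤ ‖w‖
  apply norm_sum_le_of_le _ (norm_nonneg _)
  intro i _
  rw [norm_mul]
  exact (mul_le_of_le_one_right (norm_nonneg _) (hk i j)).trans (norm_le_pi_norm w i)

theorem norm_vecMul_eq {k : GSp4 p} (hk : k ∈ maxCompact p) (w : Idx → ℚ_[p]) :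
    ‖w ᵥ* mat k‖ = ‖w‖ := by
  obtain ⟨h1, h2⟩ := mem_maxCompact_iff.1 hk
  refine le_antisymm (norm_vecMul_le h1 w) ?_
  have := norm_vecMul_le h2 (w ᵥ* mat k)
  rwa [Matrix.vecMul_vecMul, mat_mul_inv, Matrix.vecMul_one] at this

theorem tau_uni_mul (x : Fin 3 → ℚ_[p]) (g : GSp4 p) : tau (uni x * g) = tau g := by
  rw [tau, tau, nu_mul, nu_uni, one_mul, basisF_vecMul_mul, basisF_vecMul_uni]

theorem tau_scal_mul (z : ℚ_[p]ˣ) (g : GSp4 p) : tau (scal z * g) = tau g := by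
  rw [tau, tau, nu_mul, nu_scal, basisF_vecMul_mul, basisF_vecMul_scal, Matrix.smul_vecMul,
    norm_smul, norm_mul, norm_mul]
  have := norm_ne_zero_iff.2 z.ne_zero
  field_simp

theorem tau_mul {k : GSp4 p} (hk : k ∈ maxCompact p) (g : GSp4 p) : tau (g * k) = tau g := by
  rw [tau, tau, nu_mul, basisF_vecMul_mul, norm_vecMul_eq hk, norm_mul, (mem_maxCompact.1 hk).2,
    mul_one]

/-- The bottom row consists of zeros and the coordinates of d in the basis -ω̄, 1 of O. Their
maximum norm is 1 because d is integral and primitive. -/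
theorem PrimClass.norm_bottom (d : PrimClass p D) (j : ℤ) : ‖basisF p 1 ᵥ* mat (repM d j)‖ = 1 := by
  have e : ∀ i, (basisF p 1 ᵥ* mat (repM d j)) i =
      (Sum.elim ![0, 0] ![d.elt.im, d.elt.re + coeffB p D * d.elt.im] : Idx → ℚ_[p]) i := by
    intro i
    rw [basisF, Matrix.single_one_vecMul, mat_repM]
    rcases i with i | i <;> fin_cases i <;> simp [embM, mulMat, Matrix.mul_apply]
  rw [funext e]
  have him := d.isO.2
  have hre := norm_add_le_of_le d.isO.1 (norm_mul_le_one (norm_coeffB_le (p := p) (D := D)) him)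
  apply le_antisymm
  · rw [pi_norm_le_iff_of_nonneg zero_le_one]
    rintro (i | i) <;> fin_cases i
    · simp
    · simp
    · exact him
    · exact hre
  · by_contra hlt
    push Not at hlt
    have h1 : ‖d.elt.im‖ < 1 := lt_of_le_of_lt (norm_le_pi_norm
      (Sum.elim ![0, 0] ![d.elt.im, d.elt.re + coeffB p D * d.elt.im] : Idx → ℚ_[p])
      (Sum.inr 0)) hlt
    have h2 : ‖d.elt.re + coeffB p D * d.elt.im‖ < 1 := lt_of_le_of_lt (norm_le_pi_norm
      (Sum.elim ![0, 0] ![d.elt.im, d.elt.re + coeffB p D * d.elt.im] : Idx → ℚ_[p])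
      (Sum.inr 1)) hlt
    have hp := prime_cast_ne_zero (p := p)
    obtain ⟨a, ha, ea⟩ := norm_lt_one_iff_exists h1
    obtain ⟨b, hb, eb⟩ := norm_lt_one_iff_exists h2
    apply d.prim
    have e1 : (p : ℚ_[p])⁻¹ * d.elt.im = a := by rw [ea]; field_simp
    have e2 : (p : ℚ_[p])⁻¹ * d.elt.re = b - coeffB p D * a := by
      have : d.elt.re = p * b - coeffB p D * d.elt.im := by rw [← eb]; ring
      rw [this, ea]; field_simp
    constructor
    · change ‖(p : ℚ_[p])⁻¹ * d.elt.re‖ ≤ 1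
      rw [e2]; exact norm_sub_le_of_le hb (norm_mul_le_one norm_coeffB_le ha)
    · change ‖(p : ℚ_[p])⁻¹ * d.elt.im‖ ≤ 1
      rw [e1]; exact ha

theorem tau_repM (d : PrimClass p D) (j : ℤ) : tau (repM d j) = (p : ℝ) ^ (-(j + d.cond)) := by
  rw [tau, d.norm_bottom j, repM, nu_levi, norm_repNu]; simp

theorem basisF_vecMul_ne_zero (g : GSp4 p) : basisF p 1 ᵥ* mat g ≠ 0 := by
  intro h
  have := congrArg (fun w => w ᵥ* mat g⁻¹) h
  simp only [Matrix.vecMul_vecMul, mat_mul_inv, Matrix.vecMul_one, Matrix.zero_vecMul] at this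
  have := congrFun this (Sum.inr 1)
  simp [basisF] at this

/-- The shell of elements of `ℚ_pˣ` of a given absolute value. -/
def unitShell (p : ℕ) [Fact p.Prime] (k : ℤ) : Set ℚ_[p]ˣ := {t | ‖(t : ℚ_[p])‖ = (p : ℝ) ^ (-k)}

theorem unitShell_isOpen (k : ℤ) : IsOpen (unitShell p k) := by
  have h : IsOpen {x : ℚ_[p] | ‖x‖ = (p : ℝ) ^ (-k)} := by
    have : {x : ℚ_[p] | ‖x‖ = (p : ℝ) ^ (-k)} = Metric.sphere 0 ((p : ℝ) ^ (-k)) := by ext; simp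
    rw [this]
    exact IsUltrametricDist.isOpen_sphere _ (zpow_pos prime_real_pos _).ne'
  exact h.preimage Units.continuous_val

theorem unitShell_isCompact : IsCompact (unitShell p 0) := by
  have hemb : Topology.IsClosedEmbedding (Units.embedProduct ℚ_[p]) :=
    Units.isClosedEmbedding_embedProduct
  have hc : IsCompact (Metric.closedBall (0 : ℚ_[p]) 1 ×ˢ
      (MulOpposite.opHomeomorph.symm ⁻¹' Metric.closedBall (0 : ℚ_[p]) 1)) :=
    (isCompact_closedBall _ _).prod
      (MulOpposite.opHomeomorph.symm.isCompact_preimage.2 (isCompact_closedBall _ _))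
  convert hemb.isCompact_preimage hc using 1
  ext t
  simp only [unitShell, neg_zero, zpow_zero, Set.mem_ofPred_eq, Set.mem_preimage, Set.mem_prod,
    Units.embedProduct_apply, Metric.mem_closedBall, dist_zero_right,
    MulOpposite.opHomeomorph_symm_apply, MulOpposite.unop_op, Units.val_inv_eq_inv_val, norm_inv]
  have ht : 0 < ‖(t : ℚ_[p])‖ := norm_pos_iff.2 t.ne_zero
  rw [inv_le_one₀ ht]
  exact ⟨fun h => ⟨h.le, h.ge⟩, fun h => le_antisymm h.1 h.2⟩

theorem unitsHaar_shell (k : ℤ) : unitsHaar p (unitShell p k) = 1 := by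
  have h0 : {t : ℚ_[p]ˣ | ‖(t : ℚ_[p])‖ = 1} = unitShell p 0 := by simp [unitShell]
  have hne : (Measure.haar : Measure ℚ_[p]ˣ) (unitShell p 0) ≠ 0 :=
    ((unitShell_isOpen 0).measure_pos _ ⟨1, by simp [unitShell]⟩).ne'
  have htop : (Measure.haar : Measure ℚ_[p]ˣ) (unitShell p 0) ≠ ⊤ :=
    unitShell_isCompact.measure_lt_top.ne
  rw [unitsHaar, h0, Measure.smul_apply, smul_eq_mul]
  have hk : (Measure.haar : Measure ℚ_[p]ˣ) (unitShell p k) =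
      (Measure.haar : Measure ℚ_[p]ˣ) (unitShell p 0) := by
    rw [← measure_preimage_mul Measure.haar (Units.mk0 _ (zpow_ne_zero k prime_cast_ne_zero))
      (unitShell p k)]
    congr 1
    ext t
    simp only [unitShell, Set.mem_preimage, Set.mem_ofPred_eq, Units.val_mul, Units.val_mk0,
      norm_mul, norm_prime_zpow, neg_zero, zpow_zero]
    exact mul_eq_left₀ (zpow_pos prime_real_pos _).ne'
  rw [hk]
  exact ENNReal.inv_mul_cancel hne htop

/-- The Euler factor that relates `f^Φ` to a power of `τ`. -/
def zetaFactor (p : ℕ) (s : ℂ) : ℂ := (1 - (p : ℂ) ^ (-(4 * s)))⁻¹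

theorem norm_prime_cpow_lt_one {w : ℂ} (hw : 0 < w.re) : ‖(p : ℂ) ^ (-w)‖ < 1 := by
  rw [Complex.norm_natCast_cpow_of_pos (Fact.out : p.Prime).pos]
  exact Real.rpow_lt_one_of_one_lt_of_neg one_lt_prime_real (by simpa using hw)

theorem prime_zpow_cpow (k : ℤ) (s : ℂ) :
    (((p : ℝ) ^ k : ℝ) : ℂ) ^ s = ((p : ℂ) ^ s) ^ k := by
  have hp : (0 : ℝ) < p := prime_real_pos
  have h1 : (((p : ℝ) ^ k : ℝ) : ℂ) ≠ 0 := by exact_mod_cast (zpow_pos hp k).ne'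
  have h2 : ((p : ℕ) : ℂ) ≠ 0 := by exact_mod_cast (Fact.out : p.Prime).ne_zero
  rw [Complex.cpow_def_of_ne_zero h1, Complex.cpow_def_of_ne_zero h2, ← Complex.exp_int_mul,
    ← Complex.ofReal_log (zpow_pos hp k).le, Real.log_zpow, Complex.ofReal_mul,
    Complex.ofReal_log hp.le]
  push_cast
  congr 1; ring

/-- With w = f₂g, the integrand is |t|^{4s} on the set |t| ≤ ‖w‖⁻¹, and summing over the shells |t|
= p^{-k} gives a geometric series with value ‖w‖^{-4s}(1 - p^{-4s})⁻¹. -/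
theorem fPhi_eq (g : GSp4 p) {s : ℂ} (hs : 0 < s.re) :
    fPhi g s = zetaFactor p s * (tau g : ℂ) ^ (2 * s) := by
  set w := basisF p 1 ᵥ* mat g with hw
  have hw0 : w ≠ 0 := basisF_vecMul_ne_zero g
  have hp0 := (prime_real_pos (p := p)).ne'
  obtain ⟨n, hn⟩ : ∃ n : ℤ, ‖w‖ = (p : ℝ) ^ (-n) := by
    obtain ⟨i, -, hi⟩ := Finset.exists_max_image Finset.univ (fun i => ‖w i‖)
      ⟨Sum.inl 0, Finset.mem_univ _⟩
    have h1 : ‖w‖ = ‖w i‖ := le_antisymm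
      ((pi_norm_le_iff_of_nonneg (norm_nonneg _)).2 fun j => hi j (Finset.mem_univ _))
      (norm_le_pi_norm w i)
    have h2 : w i ≠ 0 := by
      intro h0; rw [h0, norm_zero, norm_eq_zero] at h1; exact hw0 h1
    rw [h1]; exact norm_eq_zpow h2
  set q : ℂ := (p : ℂ) ^ (4 * s) with hq
  have hPhi : ∀ t : ℚ_[p]ˣ, PhiFun p ((t : ℚ_[p]) • w) =
      if ‖(t : ℚ_[p])‖ ≤ (p : ℝ) ^ n then 1 else 0 := by
    intro t
    have : (∀ i, ‖((t : ℚ_[p]) • w) i‖ ≤ 1) ↔ ‖(t : ℚ_[p])‖ ≤ (p : ℝ) ^ n := by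
      rw [← pi_norm_le_iff_of_nonneg zero_le_one, norm_smul, hn,
        ← le_div_iff₀ (zpow_pos prime_real_pos _), one_div, ← zpow_neg, neg_neg]
    by_cases h : ‖(t : ℚ_[p])‖ ≤ (p : ℝ) ^ n
    · rw [if_pos h]; exact Set.indicator_of_mem (s := {w : Idx → ℚ_[p] | ∀ i, ‖w i‖ ≤ 1})
        (this.2 h) _
    · rw [if_neg h]; exact Set.indicator_of_notMem (s := {w : Idx → ℚ_[p] | ∀ i, ‖w i‖ ≤ 1})
        (fun h' => h (this.1 h')) _
  have hlt : ‖(p : ℂ) ^ (-(4 * s))‖ < 1 := norm_prime_cpow_lt_one (by simpa using hs)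
  have hqne : q ≠ 0 := by
    rw [hq, Ne, Complex.cpow_eq_zero_iff]
    have := (Fact.out : p.Prime).ne_zero
    simp [this]
  have hqinv : (p : ℂ) ^ (-(4 * s)) = q⁻¹ := Complex.cpow_neg _ _
  have hint := (integrable_and_hasSum_of_countable_pieces (μ := unitsHaar p)
    (O := fun i : ℕ => unitShell p (i - n))
    (F := fun t => PhiFun p ((t : ℚ_[p]) • w) * (‖(t : ℚ_[p])‖ : ℂ) ^ (4 * s))
    (c := fun i : ℕ => q ^ (n - i : ℤ)) (fun i => (unitShell_isOpen _).measurableSet) (by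
      intro i j hij
      rw [Function.onFun, Set.disjoint_left]
      intro t h1 h2
      have h3 : (p : ℝ) ^ (-((i : ℤ) - n)) = (p : ℝ) ^ (-((j : ℤ) - n)) := h1.symm.trans h2
      rw [zpow_prime_inj] at h3
      omega) (by
      intro i t ht
      have ht' : ‖(t : ℚ_[p])‖ = (p : ℝ) ^ (-((i : ℤ) - n)) := ht
      rw [hPhi, ht', if_pos (zpow_prime_le.2 (by omega)), one_mul, prime_zpow_cpow, neg_sub]) (by
      intro t ht
      rw [hPhi] at ht
      obtain ⟨k, hk⟩ := norm_eq_zpow t.ne_zero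
      have h1 : ‖(t : ℚ_[p])‖ ≤ (p : ℝ) ^ n := by
        by_contra h; rw [if_neg h, zero_mul] at ht; exact ht rfl
      rw [hk, zpow_prime_le] at h1
      refine ⟨(k + n).toNat, ?_⟩
      change ‖(t : ℚ_[p])‖ = _
      rw [hk]; congr 2; omega) (by intro i; rw [unitsHaar_shell]; simp) (by
      simp only [unitsHaar_shell, ENNReal.toReal_one, one_mul]
      have : ∀ i : ℕ, ‖q ^ (n - i : ℤ)‖ = ‖q ^ n‖ * ‖(p : ℂ) ^ (-(4 * s))‖ ^ i := by
        intro i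
        rw [zpow_sub₀ hqne, zpow_natCast, hqinv, norm_div, norm_inv, norm_pow, inv_pow,
          div_eq_mul_inv]
      simp only [this]
      exact (summable_geometric_of_lt_one (norm_nonneg _) hlt).mul_left _)).2
  have hsum : HasSum (fun i : ℕ => ((unitsHaar p (unitShell p (i - n))).toReal : ℂ) *
      q ^ (n - i : ℤ)) (q ^ n * zetaFactor p s) := by
    have : ∀ i : ℕ, ((unitsHaar p (unitShell p (i - n))).toReal : ℂ) * q ^ (n - i : ℤ) =
        q ^ n * ((p : ℂ) ^ (-(4 * s))) ^ i := by
      intro i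
      rw [unitsHaar_shell, zpow_sub₀ hqne, zpow_natCast, hqinv, inv_pow, div_eq_mul_inv]; simp
    simp only [this]
    exact (hasSum_geometric_of_norm_lt_one hlt).mul_left _
  rw [fPhi, ← hw, hint.unique hsum, tau, ← hw, hn]
  have hν := norm_eq_zpow (nu_ne_zero g)
  obtain ⟨m, hm⟩ := hν
  rw [hm, ← zpow_natCast, ← zpow_mul, ← zpow_sub₀ hp0, prime_zpow_cpow, prime_zpow_cpow]
  have hq2 : q = ((p : ℂ) ^ (2 * s)) ^ 2 := by
    rw [hq, ← Complex.cpow_nat_mul]; congr 1; push_cast; ring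
  have hr : (p : ℂ) ^ (2 * s) ≠ 0 := by
    intro h; rw [hq2, h] at hqne; simp at hqne
  rw [hq2, ← zpow_natCast, ← zpow_mul, ← mul_assoc, ← zpow_add₀ hr, mul_comm]
  congr 2
  push_cast; ring

end KohnenSkoruppa
end

noncomputable section
namespace KohnenSkoruppa

/-! ### Bivectors as skew matrices -/

variable {p : ℕ} [Fact p.Prime] {D : ℤ}

variable (p) in
/-- The alternating map `(x, y) ↦ ᵗx y - ᵗy x`. -/
def skewAlt : (Idx → ℚ_[p]) [⋀^Fin 2]→ₗ[ℚ_[p]] Matrix Idx Idx ℚ_[p] where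
  toFun v := Matrix.vecMulVec (v 0) (v 1) - Matrix.vecMulVec (v 1) (v 0)
  map_update_add' := by
    intro _ v i x y
    ext a b
    fin_cases i <;> simp [Function.update, Matrix.vecMulVec_apply] <;> ring
  map_update_smul' := by
    intro _ v i c x
    ext a b
    fin_cases i <;> simp [Function.update, Matrix.vecMulVec_apply] <;> ring
  map_eq_zero_of_eq' := by
    intro v i j h hij
    have : v 0 = v 1 := by fin_cases i <;> fin_cases j <;> simp_all
    rw [this, sub_self]

variable (p) in
/-- The skew matrix of a bivector. -/
def skew : Wedge2 p →ₗ[ℚ_[p]] Matrix Idx Idx ℚ_[p] :=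
  exteriorPower.alternatingMapLinearEquiv (skewAlt p)

theorem skew_wedge (x y : Idx → ℚ_[p]) :
    skew p (wedge x y) = Matrix.vecMulVec x y - Matrix.vecMulVec y x := by
  rw [skew, wedge, exteriorPower.alternatingMapLinearEquiv_apply_ιMulti]
  rfl

theorem wedge_swap (x y : Idx → ℚ_[p]) : wedge y x = -wedge x y := by
  have h := (exteriorPower.ιMulti ℚ_[p] 2 (M := Idx → ℚ_[p])).map_swap ![x, y]
    (i := 0) (j := 1) (by decide)
  rw [wedge, wedge, ← h]
  congr 1
  ext i; fin_cases i <;> simp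

/-- The wedge product with a fixed second factor. -/
def wedgeLeft (y : Idx → ℚ_[p]) : (Idx → ℚ_[p]) →ₗ[ℚ_[p]] Wedge2 p where
  toFun x := wedge x y
  map_add' x x' := by
    have h := (exteriorPower.ιMulti ℚ_[p] 2 (M := Idx → ℚ_[p])).map_update_add ![0, y] 0 x x'
    have e : ∀ z, Function.update ![0, y] 0 z = ![z, y] := fun z => by
      ext1 i; fin_cases i <;> rfl
    rwa [e, e, e] at h
  map_smul' c x := by
    have h := (exteriorPower.ιMulti ℚ_[p] 2 (M := Idx → ℚ_[p])).map_update_smul ![0, y] 0 c x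
    have e : ∀ z, Function.update ![0, y] 0 z = ![z, y] := fun z => by
      ext1 i; fin_cases i <;> rfl
    rwa [e, e] at h

theorem wedge_eq_sum_left (x y : Idx → ℚ_[p]) :
    wedge x y = ∑ i, x i • wedge (Pi.single i 1) y := by
  have h := congrArg (wedgeLeft y) (pi_eq_sum_univ' x)
  rw [map_sum] at h
  simp only [map_smul] at h
  refine h.trans (Finset.sum_congr rfl fun i _ => ?_)
  refine congrArg (fun z => x i • wedge z y) ?_
  ext j
  simp [Pi.single_apply, eq_comm]

theorem wedge_eq_sum (x y : Idx → ℚ_[p]) :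
    wedge x y = ∑ i, ∑ j, (x i * y j) • wedge (Pi.single i 1) (Pi.single j 1) := by
  rw [wedge_eq_sum_left]
  refine Finset.sum_congr rfl fun i _ => ?_
  rw [wedge_swap y, wedge_eq_sum_left, ← Finset.sum_neg_distrib, Finset.smul_sum]
  refine Finset.sum_congr rfl fun j _ => ?_
  rw [wedge_swap (Pi.single i 1)]
  module

/-- A left inverse is N ↦ ½ Σ N_ij e_i ∧ e_j. Bivectors may therefore be handled as skew matrices,
on which g acts by N ↦ ν⁻¹ ᵗg N g. -/
theorem skew_injective : Function.Injective (skew p) := by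
  let T : Matrix Idx Idx ℚ_[p] →ₗ[ℚ_[p]] Wedge2 p :=
    { toFun := fun N => (1 / 2 : ℚ_[p]) • ∑ i, ∑ j, N i j • wedge (Pi.single i 1) (Pi.single j 1)
      map_add' := fun M N => by
        simp only [Matrix.add_apply, add_smul, Finset.sum_add_distrib, smul_add]
      map_smul' := fun c N => by
        simp only [Matrix.smul_apply, smul_eq_mul, mul_smul, Finset.smul_sum, RingHom.id_apply]
        refine Finset.sum_congr rfl fun i _ => Finset.sum_congr rfl fun j _ => ?_
        rw [smul_comm] }
  have h : T ∘ₗ skew p = LinearMap.id := by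
    apply exteriorPower.linearMap_ext
    ext1 v
    have hv : exteriorPower.ιMulti ℚ_[p] 2 v = wedge (v 0) (v 1) := by
      rw [wedge]; congr 1; ext i; fin_cases i <;> rfl
    change T (skew p (exteriorPower.ιMulti ℚ_[p] 2 v)) = exteriorPower.ιMulti ℚ_[p] 2 v
    rw [hv, skew_wedge]
    change (1 / 2 : ℚ_[p]) • ∑ i, ∑ j, (v 0 i * v 1 j - v 1 i * v 0 j) •
      wedge (Pi.single i 1) (Pi.single j 1) = _
    have e : ∑ i, ∑ j, (v 0 i * v 1 j - v 1 i * v 0 j) • wedge (p := p) (Pi.single i 1)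
        (Pi.single j 1) = wedge (v 0) (v 1) - wedge (v 1) (v 0) := by
      rw [wedge_eq_sum (v 0), wedge_eq_sum (v 1), ← Finset.sum_sub_distrib]
      refine Finset.sum_congr rfl fun i _ => ?_
      rw [← Finset.sum_sub_distrib]
      exact Finset.sum_congr rfl fun j _ => by module
    rw [e, wedge_swap (v 0) (v 1), sub_neg_eq_add, ← two_smul ℚ_[p],
      smul_smul]
    norm_num
  intro v w hvw
  have := congrArg T hvw
  rwa [← LinearMap.comp_apply, ← LinearMap.comp_apply, h] at this

theorem skew_transpose (v : Wedge2 p) : (skew p v)ᵀ = -skew p v := by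
  have h : (Matrix.transposeLinearEquiv Idx Idx ℚ_[p] ℚ_[p]).toLinearMap ∘ₗ skew p = -skew p := by
    apply exteriorPower.linearMap_ext
    ext1 v
    change (skew p (exteriorPower.ιMulti ℚ_[p] 2 v))ᵀ = -skew p (exteriorPower.ιMulti ℚ_[p] 2 v)
    have hv : exteriorPower.ιMulti ℚ_[p] 2 v = wedge (v 0) (v 1) := by
      rw [wedge]; congr 1; ext i; fin_cases i <;> rfl
    rw [hv, skew_wedge, Matrix.transpose_sub, Matrix.transpose_vecMulVec,
      Matrix.transpose_vecMulVec, neg_sub]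
  exact LinearMap.congr_fun h v

theorem skew_actWedge (v : Wedge2 p) (g : GSp4 p) :
    skew p (actWedge v g) = (nu g)⁻¹ • ((mat g)ᵀ * skew p v * mat g) := by
  have h : skew p ∘ₗ exteriorPower.map 2 (Matrix.vecMulLinear (mat g)) =
      (LinearMap.mulRight ℚ_[p] (mat g) ∘ₗ LinearMap.mulLeft ℚ_[p] (mat g)ᵀ) ∘ₗ skew p := by
    apply exteriorPower.linearMap_ext
    ext1 v
    have hv : exteriorPower.ιMulti ℚ_[p] 2 v = wedge (v 0) (v 1) := by
      rw [wedge]; congr 1; ext i; fin_cases i <;> rfl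
    change skew p (exteriorPower.map 2 (Matrix.vecMulLinear (mat g))
      (exteriorPower.ιMulti ℚ_[p] 2 v)) =
      (mat g)ᵀ * skew p (exteriorPower.ιMulti ℚ_[p] 2 v) * mat g
    have hv2 : exteriorPower.map 2 (Matrix.vecMulLinear (mat g))
        (exteriorPower.ιMulti ℚ_[p] 2 v) = wedge (v 0 ᵥ* mat g) (v 1 ᵥ* mat g) := by
      rw [exteriorPower.map_apply_ιMulti, wedge]
      congr 1
      ext1 i; fin_cases i <;> rfl
    rw [hv2, hv, skew_wedge, skew_wedge, Matrix.mul_sub, Matrix.sub_mul,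
      Matrix.mul_vecMulVec, Matrix.mul_vecMulVec, Matrix.vecMulVec_mul, Matrix.vecMulVec_mul,
      Matrix.mulVec_transpose, Matrix.mulVec_transpose]
  rw [actWedge, map_smul]
  exact congrArg _ (LinearMap.congr_fun h v)

theorem actWedge_mul (v : Wedge2 p) (g h : GSp4 p) :
    actWedge v (g * h) = actWedge (actWedge v g) h := by
  apply skew_injective
  rw [skew_actWedge, skew_actWedge, skew_actWedge, nu_mul, mat_mul, Matrix.transpose_mul,
    Matrix.mul_smul, Matrix.smul_mul, smul_smul, mul_inv_rev]
  simp only [Matrix.mul_assoc]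

theorem actWedge_scal (v : Wedge2 p) (z : ℚ_[p]ˣ) : actWedge v (scal z) = v := by
  apply skew_injective
  rw [skew_actWedge, nu_scal, mat_scal]
  have := z.ne_zero
  simp only [Matrix.transpose_smul, Matrix.transpose_one, Matrix.smul_mul, Matrix.one_mul,
    Matrix.mul_smul, Matrix.mul_one, smul_smul]
  rw [inv_mul_cancel₀ (mul_ne_zero this this), one_smul]

theorem J4_mat (g : GSp4 p) : (mat g)ᵀ * J4 ℚ_[p] * mat g = nu g • J4 ℚ_[p] := by
  have h := mat_inv_mul g
  rw [mat_inv_eq, Matrix.smul_mul] at h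
  have h2 := congrArg (fun M => nu g • (J4 ℚ_[p] * M)) h
  simp only [Matrix.mul_smul, mul_neg, neg_smul,
    Matrix.mul_one] at h2
  have h3 : J4 ℚ_[p] * (J4 ℚ_[p] * (mat g)ᵀ * J4 ℚ_[p] * mat g) =
      -((mat g)ᵀ * J4 ℚ_[p] * mat g) := by
    simp only [← Matrix.mul_assoc, J4_mul_J4, Matrix.neg_mul, Matrix.one_mul]
  rw [h3] at h2
  simpa [smul_smul, nu_ne_zero g] using h2

/-! ### The lattice `V₅(ℤ_p)` in terms of skew matrices -/

variable (p D) in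
/-- The shifts by multiples of the symplectic form allowed in the lattice. -/
def shiftSet : Set ℚ_[p] := {t | ‖t‖ ≤ 1 ∧ (D % 4 = 1 ∨ t = 0)}

theorem coeffB_mem_shiftSet : coeffB p D ∈ shiftSet p D := by
  refine ⟨norm_coeffB_le, ?_⟩
  unfold coeffB; split_ifs with h
  · exact Or.inl h
  · exact Or.inr rfl

theorem skew_basisV5 (c : Fin 5 → ℚ_[p]) : skew p (∑ i, c i • basisV5 p D i) =
    Matrix.fromBlocks !![0, c 1; -c 1, 0]
      !![(if D % 4 = 1 then 1 / 2 else 1) * c 0, c 2; c 3, -((if D % 4 = 1 then 1 / 2 else 1) * c 0)]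
      !![-((if D % 4 = 1 then 1 / 2 else 1) * c 0), -c 3;
        -c 2, (if D % 4 = 1 then 1 / 2 else 1) * c 0]
      !![0, c 4; -c 4, 0] := by
  rw [map_sum]
  simp only [map_smul, Fin.sum_univ_five, basisV5, Matrix.cons_val_zero, Matrix.cons_val_one,
    Matrix.cons_val, map_sub, skew_wedge]
  generalize (if D % 4 = 1 then (1 / 2 : ℚ_[p]) else 1) = κ
  ext i j
  rcases i with i | i <;> rcases j with j | j <;> fin_cases i <;> fin_cases j <;>
    simp [Matrix.vecMulVec_apply, basisE, basisF, mul_comm]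

/-- The first condition is orthogonality to the symplectic form. If D ≡ 1 (mod 4), the basis vector
½(e₁∧f₁ - e₂∧f₂) has half-integral entries, which adding (t/2)J with t ∈ ℤ_p makes integral. In this
form the lattice is visibly stable under K. -/
theorem mem_latticeV5 {v : Wedge2 p} : v ∈ latticeV5 p D ↔
    skew p v (Sum.inl 0) (Sum.inr 0) + skew p v (Sum.inl 1) (Sum.inr 1) = 0 ∧
      ∃ t ∈ shiftSet p D, IsInt (skew p v + (t / 2) • J4 ℚ_[p]) := by
  constructor
  · rintro ⟨c, rfl⟩
    rw [skew_basisV5 (fun i => (c i : ℚ_[p]))]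
    have hc : ∀ i, ‖(c i : ℚ_[p])‖ ≤ 1 := fun i => (c i).2
    have hc' : ∀ i, ‖c i‖ ≤ 1 := hc
    refine ⟨by simp, ?_⟩
    by_cases hD : D % 4 = 1
    · refine ⟨c 0, ⟨hc 0, Or.inl hD⟩, ?_⟩
      rw [J4, Matrix.fromBlocks_smul, Matrix.fromBlocks_add, isInt_fromBlocks]
      simp only [isInt_fin_two]
      simp [hD, hc']
      refine ⟨?_, ?_, ?_⟩ <;> ring_nf <;> simp [hc']
    · refine ⟨0, ⟨by simp, Or.inr rfl⟩, ?_⟩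
      rw [zero_div, zero_smul, add_zero, isInt_fromBlocks]
      simp only [isInt_fin_two]
      simp [hD, hc']
  · rintro ⟨h0, t, ⟨ht, htD⟩, hint⟩
    set N := skew p v with hN
    have hsym : ∀ i j, N j i = -N i j := fun i j => congrFun (congrFun (skew_transpose v) i) j
    have hdiag : ∀ i, N i i = 0 := fun i => by
      have := hsym i i
      linear_combination this / 2
    have h1 := hint (Sum.inl 0) (Sum.inl 1)
    have h2 := hint (Sum.inl 0) (Sum.inr 1)
    have h3 := hint (Sum.inl 1) (Sum.inr 0)
    have h4 := hint (Sum.inr 0) (Sum.inr 1)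
    have h5 := hint (Sum.inl 0) (Sum.inr 0)
    have h6 := hint (Sum.inl 1) (Sum.inr 1)
    simp only [J4, Matrix.add_apply, Matrix.smul_apply, Matrix.fromBlocks_apply₁₁,
      Matrix.fromBlocks_apply₁₂, Matrix.fromBlocks_apply₂₂, Matrix.zero_apply,
      Matrix.one_apply, smul_eq_mul] at h1 h2 h3 h4 h5 h6
    simp at h1 h2 h3 h4 h5 h6
    have h7 : ‖(if D % 4 = 1 then (2 : ℚ_[p]) else 1) * N (Sum.inl 0) (Sum.inr 0)‖ ≤ 1 := by
      split_ifs with hD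
      · have := norm_sub_le_of_le h5 h6
        have e : 2 * N (Sum.inl 0) (Sum.inr 0) = N (Sum.inl 0) (Sum.inr 0) + t / 2 -
            (N (Sum.inl 1) (Sum.inr 1) + t / 2) := by linear_combination h0
        rwa [e]
      · rcases htD with h | rfl
        · exact absurd h hD
        · simpa using h5
    refine ⟨![⟨_, h7⟩, ⟨_, h1⟩, ⟨_, h2⟩, ⟨_, h3⟩, ⟨_, h4⟩], skew_injective ?_⟩
    rw [skew_basisV5 (fun i => ((![⟨_, h7⟩, ⟨_, h1⟩, ⟨_, h2⟩, ⟨_, h3⟩, ⟨_, h4⟩] :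
      Fin 5 → ℤ_[p]) i : ℚ_[p])), ← hN]
    have h8 : N (Sum.inl 1) (Sum.inr 1) = -N (Sum.inl 0) (Sum.inr 0) := by linear_combination h0
    have l1 := hsym (Sum.inl 0) (Sum.inl 1)
    have l2 := hsym (Sum.inl 0) (Sum.inr 0)
    have l3 := hsym (Sum.inl 0) (Sum.inr 1)
    have l4 := hsym (Sum.inl 1) (Sum.inr 0)
    have l5 := hsym (Sum.inl 1) (Sum.inr 1)
    have l6 := hsym (Sum.inr 0) (Sum.inr 1)
    ext i j
    rcases i with i | i <;> rcases j with j | j <;> fin_cases i <;> fin_cases j <;>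
      simp [hdiag, h8, l1, l2, l3, l4, l5, l6]
    all_goals split_ifs <;> ring

end KohnenSkoruppa
end

noncomputable section
namespace KohnenSkoruppa

/-! ### The translates of `v_D` that lie in `V₅(ℤ_p)` -/

variable {p : ℕ} [Fact p.Prime] {D : ℤ}

theorem trace_J4_mul_skew (v : Wedge2 p) : (J4 ℚ_[p] * skew p v).trace =
    -2 * (skew p v (Sum.inl 0) (Sum.inr 0) + skew p v (Sum.inl 1) (Sum.inr 1)) := by
  have h : ∀ i j, skew p v j i = -skew p v i j := fun i j =>
    congrFun (congrFun (skew_transpose v) i) j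
  simp only [Matrix.trace, Matrix.diag, Matrix.mul_apply, J4, Fintype.sum_sum_type,
    Fin.sum_univ_two]
  simp
  rw [h (Sum.inl 0) (Sum.inr 0), h (Sum.inl 1) (Sum.inr 1)]
  ring

/-- Because ᵗk J k = ν J, the same shift t works after acting by k, and the pairing with J is
preserved. -/
theorem actWedge_mem_lattice {v : Wedge2 p} (hv : v ∈ latticeV5 p D) {k : GSp4 p}
    (hk : k ∈ maxCompact p) : actWedge v k ∈ latticeV5 p D := by
  obtain ⟨hk1, hk2⟩ := mem_maxCompact.1 hk
  rw [mem_latticeV5] at hv ⊢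
  obtain ⟨h0, t, ht, hint⟩ := hv
  refine ⟨?_, t, ht, ?_⟩
  · have h1 := trace_J4_mul_skew (actWedge v k)
    have h2 : (J4 ℚ_[p] * skew p (actWedge v k)).trace = 0 := by
      rw [skew_actWedge, Matrix.mul_smul, Matrix.trace_smul, ← Matrix.mul_assoc,
        Matrix.trace_mul_comm, ← Matrix.mul_assoc, ← Matrix.mul_assoc, mat_J4, Matrix.smul_mul,
        Matrix.trace_smul, trace_J4_mul_skew, h0]
      simp
    rw [h2] at h1
    linear_combination h1 / 2
  · have e : skew p (actWedge v k) + (t / 2) • J4 ℚ_[p] =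
        (nu k)⁻¹ • ((mat k)ᵀ * (skew p v + (t / 2) • J4 ℚ_[p]) * mat k) := by
      rw [Matrix.mul_add, Matrix.add_mul, Matrix.mul_smul, Matrix.smul_mul, J4_mat, smul_add,
        skew_actWedge, smul_smul, smul_smul]
      congr 2
      have := nu_ne_zero k
      field_simp
    rw [e]
    exact ((hk1.transpose.mul hint).mul hk1).smul (by rw [norm_inv, hk2, inv_one])

theorem actWedge_mem_lattice_iff {v : Wedge2 p} {k : GSp4 p} (hk : k ∈ maxCompact p) :
    actWedge v k ∈ latticeV5 p D ↔ v ∈ latticeV5 p D := by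
  refine ⟨fun h => ?_, fun h => actWedge_mem_lattice h hk⟩
  have h1 := actWedge_mem_lattice h ((maxCompact p).inv_mem hk)
  rw [← actWedge_mul, mul_inv_cancel] at h1
  have : actWedge v (1 : GSp4 p) = v := by
    apply skew_injective
    rw [skew_actWedge, nu_one, mat_one]; simp
  rwa [this] at h1

/-- Up to a multiple of J, the vector v_D is the matrix Ω of multiplication by ω. All computations
with v_D reduce to this Ω. -/
theorem skew_vD : skew p (vD p D) + (coeffB p D / 2) • J4 ℚ_[p] =
    Matrix.fromBlocks 0 (mulMat (⟨0, 1⟩ : LAlg p D))ᵀ (-mulMat (⟨0, 1⟩ : LAlg p D)) 0 := by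
  unfold vD coeffB
  by_cases hD : D % 4 = 1
  · simp only [hD, if_true, map_add, map_smul, map_sub, skew_wedge]
    ext i j
    rcases i with i | i <;> rcases j with j | j <;> fin_cases i <;> fin_cases j <;>
      simp [Matrix.vecMulVec_apply, basisE, basisF, J4, mulMat, coeffA, coeffB, hD] <;> norm_num
  · simp only [hD, if_false, map_add, map_smul, skew_wedge]
    ext i j
    rcases i with i | i <;> rcases j with j | j <;> fin_cases i <;> fin_cases j <;>
      simp [Matrix.vecMulVec_apply, basisE, basisF, J4, mulMat, coeffA, coeffB, hD]

theorem skew_vD_apply_zero : skew p (vD p D) (Sum.inl 0) (Sum.inr 0) +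
    skew p (vD p D) (Sum.inl 1) (Sum.inr 1) = 0 := by
  have h1 := congrFun (congrFun (skew_vD (p := p) (D := D)) (Sum.inl 0)) (Sum.inr 0)
  have h2 := congrFun (congrFun (skew_vD (p := p) (D := D)) (Sum.inl 1)) (Sum.inr 1)
  simp [J4, mulMat] at h1 h2
  linear_combination h1 + h2

/-- The off-diagonal blocks are conjugates of Ω by A. The last block depends on x only through X ᵗΩ
- ΩX, which is skew of size two, equal to -y(X)(0, 1; -1, 0) for the form y = `yForm`; conjugation
by A⁻¹ scales it by det A⁻¹. -/
theorem conj_skew_block (x : Fin 3 → ℚ_[p]) (A : GL (Fin 2) ℚ_[p]) (ν : ℚ_[p]ˣ) :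
    (ν : ℚ_[p])⁻¹ • ((mat (uni x * levi A ν))ᵀ *
      Matrix.fromBlocks 0 (mulMat (⟨0, 1⟩ : LAlg p D))ᵀ (-mulMat (⟨0, 1⟩ : LAlg p D)) 0 *
      mat (uni x * levi A ν)) =
    Matrix.fromBlocks 0 (A⁻¹.val * mulMat (⟨0, 1⟩ : LAlg p D) * A.val)ᵀ
      (-(A⁻¹.val * mulMat (⟨0, 1⟩ : LAlg p D) * A.val))
      ((-(yForm D x * ν / A.val.det)) • !![0, 1; -1, 0]) := by
  have hν := ν.ne_zero
  rw [mat_uni_mul_levi, Matrix.fromBlocks_transpose, Matrix.fromBlocks_multiply,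
    Matrix.fromBlocks_multiply, Matrix.fromBlocks_smul]
  set Ω := mulMat (⟨0, 1⟩ : LAlg p D) with hΩ
  have hx : symM x * Ωᵀ - Ω * symM x = (-yForm D x) • !![0, 1; -1, 0] := by
    rw [yForm_apply]
    ext i j
    fin_cases i <;> fin_cases j <;>
      simp [symM, mulMat, hΩ, Fin.sum_univ_two, Matrix.vecMul, dotProduct] <;> ring
  have hJ : ∀ B : Matrix (Fin 2) (Fin 2) ℚ_[p], B * !![0, 1; -1, 0] * Bᵀ =
      B.det • !![0, 1; -1, 0] := by
    intro B
    ext i j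
    fin_cases i <;> fin_cases j <;>
      simp [Matrix.mul_apply, Fin.sum_univ_two, Matrix.det_fin_two] <;> ring
  have hdet : A⁻¹.val.det = A.val.det⁻¹ := by
    apply eq_inv_of_mul_eq_one_right
    rw [← Matrix.det_mul, ← Units.val_mul, mul_inv_cancel, Units.val_one, Matrix.det_one]
  congr 1
  · simp
  · simp only [Matrix.transpose_zero, Matrix.mul_zero, Matrix.zero_mul, Matrix.mul_neg, neg_zero,
      add_zero, zero_add, Matrix.mul_smul, smul_smul, Matrix.transpose_mul, Matrix.mul_assoc,
      smul_zero]
    rw [inv_mul_cancel₀ hν, one_smul]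
  · simp only [Matrix.mul_zero, Matrix.mul_neg,
      add_zero, zero_add, Matrix.transpose_smul, Matrix.smul_mul, Matrix.transpose_transpose,
      Matrix.neg_mul, smul_neg, smul_smul]
    rw [inv_mul_cancel₀ hν, one_smul]
  · have e : ∀ S : Matrix (Fin 2) (Fin 2) ℚ_[p], (S * ((ν : ℚ_[p]) • (A⁻¹.val)ᵀ))ᵀ =
        (ν : ℚ_[p]) • (A⁻¹.val * Sᵀ) := by
      intro S
      rw [Matrix.mul_smul, Matrix.transpose_smul, Matrix.transpose_mul, Matrix.transpose_transpose]
    rw [e, symM_transpose]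
    have hcalc : (ν : ℚ_[p]) • A⁻¹.val * (symM x * Ωᵀ - Ω * symM x) *
        ((ν : ℚ_[p]) • (A⁻¹.val)ᵀ) = ((ν : ℚ_[p]) * ν * (-yForm D x) * A.val.det⁻¹) •
          !![0, 1; -1, 0] := by
      rw [hx, Matrix.mul_smul, Matrix.mul_smul, Matrix.smul_mul, Matrix.smul_mul, Matrix.smul_mul,
        hJ, hdet, smul_smul, smul_smul, smul_smul]
      congr 1; ring
    have hcalc2 : ((ν : ℚ_[p]) * ν * (-yForm D x) * A.val.det⁻¹) • !![0, 1; -1, 0] =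
        (ν : ℚ_[p]) • ((-(yForm D x * ν / A.val.det)) • !![0, 1; -1, 0] :
          Matrix (Fin 2) (Fin 2) ℚ_[p]) := by
      rw [smul_smul]; congr 1; ring
    rw [hcalc2] at hcalc
    have hcalc3 := congrArg (fun M => (ν : ℚ_[p])⁻¹ • M) hcalc
    simp only [smul_smul] at hcalc3
    refine Eq.trans ?_ (hcalc3.trans (by rw [← mul_assoc, inv_mul_cancel₀ hν, one_mul]))
    congr 1
    simp only [Matrix.transpose_smul, Matrix.transpose_transpose, Matrix.mul_zero, add_zero,
      zero_add, Matrix.mul_neg, Matrix.neg_mul, Matrix.mul_sub, Matrix.sub_mul, Matrix.smul_mul,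
      Matrix.mul_smul, Matrix.mul_assoc]
    abel_nf
    try simp

/-- A shift of an integral conjugate of `ω` is integral. -/
theorem norm_shift_le_one {s : ℚ_[p]} (h : ‖s * s + coeffB p D * s - coeffA p D‖ ≤ 1) :
    ‖s‖ ≤ 1 := by
  by_contra hs
  push Not at hs
  have e : s * s = (s * s + coeffB p D * s - coeffA p D) + coeffA p D - coeffB p D * s := by ring
  have h1 : ‖s * s‖ ≤ ‖s‖ := by
    rw [e]
    apply norm_sub_le_of_le
    · exact norm_add_le_of_le (h.trans hs.le) (norm_coeffA_le.trans hs.le)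
    · rw [norm_mul]; exact mul_le_of_le_one_left (norm_nonneg _) norm_coeffB_le
  rw [norm_mul] at h1
  nlinarith

theorem actWedge_vD_mem_lattice (x : Fin 3 → ℚ_[p]) (A : GL (Fin 2) ℚ_[p]) (ν : ℚ_[p]ˣ) :
    actWedge (vD p D) (uni x * levi A ν) ∈ latticeV5 p D ↔
      IsInt (A⁻¹.val * mulMat (⟨0, 1⟩ : LAlg p D) * A.val) ∧ ‖yForm D x * ν / A.val.det‖ ≤ 1 := by
  set g := uni x * levi A ν with hg
  have hνg : nu g = ν := by rw [hg, nu_mul, nu_uni, nu_levi, one_mul]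
  have key : skew p (actWedge (vD p D) g) + (coeffB p D / 2) • J4 ℚ_[p] =
      Matrix.fromBlocks 0 (A⁻¹.val * mulMat (⟨0, 1⟩ : LAlg p D) * A.val)ᵀ
      (-(A⁻¹.val * mulMat (⟨0, 1⟩ : LAlg p D) * A.val))
      ((-(yForm D x * ν / A.val.det)) • !![0, 1; -1, 0]) := by
    rw [← conj_skew_block, ← skew_vD, Matrix.mul_add, Matrix.add_mul, Matrix.mul_smul,
      Matrix.smul_mul, J4_mat, smul_add, skew_actWedge, smul_smul, smul_smul, hνg]
    congr 2
    have := ν.ne_zero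
    field_simp
  have hlow : ∀ y : ℚ_[p], IsInt (-y • (!![0, 1; -1, 0] : Matrix (Fin 2) (Fin 2) ℚ_[p])) ↔
      ‖y‖ ≤ 1 := by
    intro y
    rw [isInt_fin_two]; simp
  set Ω' := A⁻¹.val * mulMat (⟨0, 1⟩ : LAlg p D) * A.val with hΩ'
  rw [mem_latticeV5]
  constructor
  · rintro ⟨-, t, ht, hint⟩
    have e : skew p (actWedge (vD p D) g) + (t / 2) • J4 ℚ_[p] = Matrix.fromBlocks 0
        (Ω' + ((t - coeffB p D) / 2) • 1)ᵀ (-(Ω' + ((t - coeffB p D) / 2) • 1))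
        ((-(yForm D x * ν / A.val.det)) • !![0, 1; -1, 0]) := by
      have : skew p (actWedge (vD p D) g) + (t / 2) • J4 ℚ_[p] =
          (skew p (actWedge (vD p D) g) + (coeffB p D / 2) • J4 ℚ_[p]) +
            ((t - coeffB p D) / 2) • J4 ℚ_[p] := by
        rw [add_assoc, ← add_smul]; congr 2; ring
      rw [this, key, J4, Matrix.fromBlocks_smul, Matrix.fromBlocks_add]
      congr 1
      · simp
      · rw [Matrix.transpose_add, Matrix.transpose_smul, Matrix.transpose_one]
      · rw [neg_add, smul_neg]
      · simp
    rw [e, isInt_fromBlocks] at hint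
    obtain ⟨-, h1, -, h2⟩ := hint
    rw [isInt_transpose] at h1
    refine ⟨?_, (hlow _).1 h2⟩
    -- Integrality is so far known for the shifted matrix Ω' + s. Its determinant is the monic
    -- polynomial s² + bs - a with coefficients in ℤ_p, so s is integral and the shift may be
    -- removed.
    set s := (t - coeffB p D) / 2 with hs
    have hA : A⁻¹.val * A.val = 1 := by rw [← Units.val_mul]; simp
    have hdet : (Ω' + s • 1).det = s * s + coeffB p D * s - coeffA p D := by
      have e1 : Ω' + s • 1 = A⁻¹.val * (mulMat (⟨0, 1⟩ : LAlg p D) + s • 1) * A.val := by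
        rw [Matrix.mul_add, Matrix.add_mul, Matrix.mul_smul, Matrix.mul_one, Matrix.smul_mul, hA]
      rw [e1, Matrix.det_mul, Matrix.det_mul, mul_right_comm, ← Matrix.det_mul, hA,
        Matrix.det_one, one_mul, Matrix.det_fin_two]
      simp [mulMat]; ring
    have hsn : ‖s‖ ≤ 1 := by
      apply norm_shift_le_one (D := D)
      rw [← hdet, Matrix.det_fin_two]
      exact norm_sub_le_of_le (norm_mul_le_one (h1 _ _) (h1 _ _))
        (norm_mul_le_one (h1 _ _) (h1 _ _))
    have := h1.sub (isInt_one.smul hsn)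
    rwa [add_sub_cancel_right] at this
  · rintro ⟨h1, h2⟩
    refine ⟨?_, coeffB p D, coeffB_mem_shiftSet, ?_⟩
    · have h3 := trace_J4_mul_skew (actWedge (vD p D) g)
      rw [skew_actWedge, Matrix.mul_smul, Matrix.trace_smul, ← Matrix.mul_assoc,
        Matrix.trace_mul_comm, ← Matrix.mul_assoc, ← Matrix.mul_assoc, mat_J4, Matrix.smul_mul,
        Matrix.trace_smul, trace_J4_mul_skew, skew_vD_apply_zero, ← skew_actWedge] at h3
      simp only [mul_zero, smul_zero] at h3
      linear_combination h3 / 2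
    · rw [key, isInt_fromBlocks]
      exact ⟨fun _ _ => by simp, h1.transpose, h1.neg, (hlow _).2 h2⟩

/-- A lattice stable under `ω` is principal. -/
theorem eq_mulGL_mul (hD : Squarefree D) {A : GL (Fin 2) ℚ_[p]}
    (h : IsInt (A⁻¹.val * mulMat (⟨0, 1⟩ : LAlg p D) * A.val)) :
    ∃ (t : LAlg p D) (ht : QuadraticAlgebra.norm t ≠ 0), ∃ k ∈ intGL p (Fin 2),
      A = mulGL t ht * k := by
  set Ω := mulMat (⟨0, 1⟩ : LAlg p D) with hΩ
  -- The rows of R, read as elements r_i of L, span a lattice. The equation RΩ = GR with G integral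
  -- says that this lattice is stable under ω, so `exists_generator` applies to it and Λ = tO.
  set R := A.valᵀ * gramQi p D with hR
  set G := (A⁻¹.val * Ω * A.val)ᵀ with hG
  have hGint : IsInt G := h.transpose
  have hAA : A.val * A⁻¹.val = 1 := by rw [← Units.val_mul]; simp
  have hQ := gramQ_mul_gramQi (p := p) (D := D)
  have hQ' := gramQi_mul_gramQ (p := p) (D := D)
  have hRΩ : R * Ω = G * R := by
    have h1 : Ωᵀ * gramQi p D = gramQi p D * Ω := by
      rw [hΩ, mulMat_transpose, Matrix.mul_assoc, hQ, Matrix.mul_one]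
    rw [hR, Matrix.mul_assoc, ← h1, hG, ← Matrix.mul_assoc, ← Matrix.mul_assoc,
      ← Matrix.transpose_mul, ← Matrix.transpose_mul, ← Matrix.mul_assoc, ← Matrix.mul_assoc, hAA,
      Matrix.one_mul]
  let r : Fin 2 → LAlg p D := fun i => ⟨R i 0, R i 1⟩
  have hrω : ∀ i, r i * ⟨0, 1⟩ = G i 0 • r 0 + G i 1 • r 1 := by
    intro i
    have e0 := congrFun (congrFun hRΩ i) 0
    have e1 := congrFun (congrFun hRΩ i) 1
    simp only [Matrix.mul_apply, Fin.sum_univ_two] at e0 e1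
    simp [hΩ, mulMat] at e0 e1
    ext
    · simp [r]; linear_combination e0
    · simp [r]; linear_combination e1
  have hdec : ∀ z : LAlg p D, z = z.re • 1 + z.im • (⟨0, 1⟩ : LAlg p D) := by
    intro z; ext <;> simp [re_one_L, im_one_L]
  let Λ : AddSubgroup (LAlg p D) :=
    { carrier := {w | ∃ a b : ℚ_[p], ‖a‖ ≤ 1 ∧ ‖b‖ ≤ 1 ∧ w = a • r 0 + b • r 1}
      zero_mem' := ⟨0, 0, by simp, by simp, by simp⟩
      add_mem' := by
        rintro _ _ ⟨a, b, ha, hb, rfl⟩ ⟨c, d, hc, hd, rfl⟩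
        exact ⟨a + c, b + d, norm_add_le_of_le ha hc, norm_add_le_of_le hb hd, by module⟩
      neg_mem' := by
        rintro _ ⟨a, b, ha, hb, rfl⟩
        exact ⟨-a, -b, by rwa [norm_neg], by rwa [norm_neg], by module⟩ }
  have hstab : ∀ w ∈ Λ, w * ⟨0, 1⟩ ∈ Λ := by
    rintro _ ⟨a, b, ha, hb, rfl⟩
    refine ⟨a * G 0 0 + b * G 1 0, a * G 0 1 + b * G 1 1,
      norm_add_le_of_le (norm_mul_le_one ha (hGint _ _)) (norm_mul_le_one hb (hGint _ _)),
      norm_add_le_of_le (norm_mul_le_one ha (hGint _ _)) (norm_mul_le_one hb (hGint _ _)), ?_⟩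
    rw [add_mul, smul_mul_assoc, smul_mul_assoc, hrω, hrω]
    module
  obtain ⟨c, hc, hcO⟩ := exists_smul_isO (D := D) (Matrix.of fun _ j => r j)
  have hcr : ∀ i, IsO (c • r i) := fun i => hcO 0 i
  have hdetR : R.det ≠ 0 := by
    rw [hR, Matrix.det_mul, Matrix.det_transpose]
    exact mul_ne_zero (det_ne_zero A) (by simp [gramQi, Matrix.det_fin_two_of])
  obtain ⟨t, htΛ, ht0, ht⟩ := exists_generator hD Λ (by
    refine ⟨‖c * c‖⁻¹, ?_⟩
    rintro w ⟨a, b, ha, hb, rfl⟩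
    have h1 : IsO (c • (a • r 0 + b • r 1)) := by
      rw [smul_add, smul_comm c a, smul_comm c b]
      exact ((hcr 0).smul ha).add ((hcr 1).smul hb)
    have h2 := h1.norm_le
    rw [norm_smul_L, norm_mul] at h2
    have h3 : 0 < ‖c * c‖ := norm_pos_iff.2 (mul_ne_zero hc hc)
    rw [← one_div, le_div_iff₀ h3, mul_comm]
    exact h2) (by
    have hu : R * R⁻¹ = 1 := Matrix.mul_nonsing_inv _ (Ne.isUnit hdetR)
    have hv : R⁻¹ * R = 1 := Matrix.nonsing_inv_mul _ (Ne.isUnit hdetR)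
    obtain ⟨N, hN⟩ := pow_unbounded_of_one_lt (‖R⁻¹ 0 0‖ + ‖R⁻¹ 0 1‖) (one_lt_prime_real (p := p))
    have hp := prime_cast_ne_zero (p := p)
    have key : ∀ x : ℚ_[p], ‖x‖ ≤ (p : ℝ) ^ N → ‖(p : ℚ_[p]) ^ N * x‖ ≤ 1 := by
      intro x hx
      rw [norm_mul, norm_pow, Padic.norm_p, inv_pow, ← div_eq_inv_mul]
      exact (div_le_one (pow_pos prime_real_pos _)).2 hx
    refine ⟨(p : ℚ_[p]) ^ N • 1, ⟨(p : ℚ_[p]) ^ N * R⁻¹ 0 0, (p : ℚ_[p]) ^ N * R⁻¹ 0 1,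
      key _ (by linarith [norm_nonneg (R⁻¹ 0 1)]), key _ (by linarith [norm_nonneg (R⁻¹ 0 0)]), ?_⟩,
      norm_smul_ne_zero (pow_ne_zero _ hp) (by simp)⟩
    have e0 := congrFun (congrFun hv 0) 0
    have e1 := congrFun (congrFun hv 0) 1
    simp only [Matrix.mul_apply, Fin.sum_univ_two] at e0 e1
    simp at e0 e1
    ext
    · simp [r, re_one_L]; linear_combination -(p : ℚ_[p]) ^ N * e0
    · simp [r, im_one_L]; linear_combination -(p : ℚ_[p]) ^ N * e1)
  have hti := mul_linv ht0
  have hr_mem : ∀ i, r i ∈ Λ := by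
    intro i
    fin_cases i
    · exact ⟨1, 0, by simp, by simp, by simp⟩
    · exact ⟨0, 1, by simp, by simp, by simp⟩
  let κ : Fin 2 → LAlg p D := fun i => r i * linv t
  have hκ : ∀ i, κ i * t = r i := fun i => by
    change r i * linv t * t = r i
    linear_combination r i * hti
  let K : Matrix (Fin 2) (Fin 2) ℚ_[p] := Matrix.of fun i => ![(κ i).re, (κ i).im]
  have hKint : IsInt K := by
    intro i j
    have := ht _ (hr_mem i)
    fin_cases j
    · exact this.1
    · exact this.2
  have hRK : R = K * mulMat t := by
    ext i j
    have e := hκ i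
    have e0 := congrArg QuadraticAlgebra.re e
    have e1 := congrArg QuadraticAlgebra.im e
    rw [QuadraticAlgebra.re_mul] at e0
    rw [QuadraticAlgebra.im_mul] at e1
    have f0 : (r i).re = R i 0 := rfl
    have f1 : (r i).im = R i 1 := rfl
    rw [f0] at e0
    rw [f1] at e1
    fin_cases j
    · simp [K, Matrix.mul_apply, Fin.sum_univ_two, mulMat]; linear_combination -e0
    · simp [K, Matrix.mul_apply, Fin.sum_univ_two, mulMat]; linear_combination -e1
  obtain ⟨a, b, ha, hb, hab⟩ := htΛ
  obtain ⟨a', b', ha', hb', hab'⟩ := hstab t ⟨a, b, ha, hb, hab⟩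
  -- Both t and tω lie in Λ, so `mulMat t` is an integral combination of the rows of R. Together
  -- with R = K · `mulMat t` this makes K invertible over ℤ_p.
  have hMK : mulMat t = !![a, b; a', b'] * R := by
    have e0 := congrArg QuadraticAlgebra.re hab
    have e1 := congrArg QuadraticAlgebra.im hab
    have e2 := congrArg QuadraticAlgebra.re hab'
    have e3 := congrArg QuadraticAlgebra.im hab'
    simp [r] at e0 e1 e2 e3
    ext i j
    fin_cases i <;> fin_cases j <;> simp [mulMat, Matrix.mul_apply, Fin.sum_univ_two]
    · exact e0
    · exact e1
    · exact e2
    · exact e3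
  have hdetK : ‖K.det‖ = 1 := by
    have h1 : (!![a, b; a', b'] : Matrix (Fin 2) (Fin 2) ℚ_[p]).det * K.det = 1 := by
      have h2 := congrArg Matrix.det hMK
      rw [hRK, ← Matrix.mul_assoc, Matrix.det_mul, Matrix.det_mul] at h2
      have h3 : (mulMat t).det ≠ 0 := by rwa [det_mulMat]
      exact (mul_eq_right₀ h3).1 h2.symm
    have h2 : ‖K.det‖ ≤ 1 := by
      rw [Matrix.det_fin_two]
      exact norm_sub_le_of_le (norm_mul_le_one (hKint _ _) (hKint _ _))
        (norm_mul_le_one (hKint _ _) (hKint _ _))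
    have h3 : ‖(!![a, b; a', b'] : Matrix (Fin 2) (Fin 2) ℚ_[p]).det‖ ≤ 1 := by
      rw [Matrix.det_fin_two_of]
      exact norm_sub_le_of_le (norm_mul_le_one ha hb') (norm_mul_le_one hb ha')
    have h4 := congrArg norm h1
    rw [norm_mul, norm_one] at h4
    nlinarith [norm_nonneg K.det]
  have hA : A.val = mulMat t * (gramQ p D * Kᵀ) := by
    have h1 : A.valᵀ = R * gramQ p D := by rw [hR, Matrix.mul_assoc, hQ', Matrix.mul_one]
    have h2 := congrArg Matrix.transpose h1
    rw [Matrix.transpose_transpose, hRK, Matrix.transpose_mul, Matrix.transpose_mul,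
      gramQ_transpose, mulMat_transpose] at h2
    rw [h2]
    simp only [← Matrix.mul_assoc, hQ, Matrix.one_mul]
  refine ⟨t, ht0, (mulGL t ht0)⁻¹ * A, ?_, by group⟩
  have hval : ((mulGL t ht0)⁻¹ * A).val = gramQ p D * Kᵀ := by
    rw [Units.val_mul, mulGL_inv_val, hA, ← Matrix.mul_assoc, ← mulMat_mul, mul_comm (linv t), hti,
      mulMat_one, Matrix.one_mul]
  rw [mem_intGL_fin_two, hval]
  refine ⟨isInt_gramQ.mul hKint.transpose, ?_⟩
  rw [Matrix.det_mul, Matrix.det_transpose, norm_mul, hdetK]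
  simp [gramQ, Matrix.det_fin_two_of]

end KohnenSkoruppa
end

noncomputable section
namespace KohnenSkoruppa

/-! ### The function `α_χ` -/

variable {p : ℕ} [Fact p.Prime] {D : ℤ}

theorem actWedge_vD_uni {x : Fin 3 → ℚ_[p]} (hx : yForm D x = 0) :
    actWedge (vD p D) (uni x) = vD p D := by
  apply skew_injective
  have h := conj_skew_block (D := D) x 1 1
  rw [levi_one, mul_one, ← skew_vD, hx] at h
  simp only [Units.val_one, inv_one, one_smul, Matrix.one_mul, Matrix.mul_one, zero_mul,
    zero_div, neg_zero, zero_smul] at h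
  rw [← skew_vD, Matrix.mul_add, Matrix.add_mul, Matrix.mul_smul, Matrix.smul_mul, J4_mat, nu_uni,
    one_smul] at h
  have h2 := add_right_cancel h
  rw [skew_actWedge, nu_uni, inv_one, one_smul, h2]

theorem chi_mul (ψ : AddChar ℚ_[p] ℂ) {u v : GSp4 p} (hu : u ∈ unipU p) (hv : v ∈ unipU p) :
    chi D ψ (u * v) = chi D ψ u * chi D ψ v := by
  obtain ⟨x, rfl⟩ := mem_unipU.1 hu
  obtain ⟨y, rfl⟩ := mem_unipU.1 hv
  rw [← uni_add, chi_uni, chi_uni, chi_uni, map_add, AddChar.map_add_eq_mul]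

theorem chi_unipN (ψ : AddChar ℚ_[p] ℂ) {u : GSp4 p} (hu : u ∈ unipN p D) : chi D ψ u = 1 := by
  obtain ⟨x, hx, rfl⟩ := mem_unipN.1 hu
  rw [chi_uni, hx, AddChar.map_zero_eq_one]

/-- Right translation as a measurable equivalence. -/
def translateEquiv {G : Type*} [Group G] [TopologicalSpace G] {H : Subgroup G}
    {μ : Measure (RightQuot H)} (hμ : ∀ g : G, MeasurePreserving (RightQuot.translate g) μ μ)
    (g : G) : RightQuot H ≃ᵐ RightQuot H where
  toFun := RightQuot.translate g
  invFun := RightQuot.translate g⁻¹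
  left_inv := by
    intro x
    obtain ⟨y, rfl⟩ := x.exists_mk
    rw [RightQuot.translate_mk, RightQuot.translate_mk, mul_inv_cancel_right]
  right_inv := by
    intro x
    obtain ⟨y, rfl⟩ := x.exists_mk
    rw [RightQuot.translate_mk, RightQuot.translate_mk, inv_mul_cancel_right]
  measurable_toFun := (hμ g).measurable
  measurable_invFun := (hμ g⁻¹).measurable

theorem integral_translate {G : Type*} [Group G] [TopologicalSpace G] {H : Subgroup G}
    {μ : Measure (RightQuot H)} (hμ : ∀ g : G, MeasurePreserving (RightQuot.translate g) μ μ)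
    {F : G → ℂ} (hF : ∀ h ∈ H, ∀ g, F (h * g) = F g) (g : G) :
    ∫ x : RightQuot H, F (x.rep * g) ∂μ = ∫ x : RightQuot H, F x.rep ∂μ := by
  rw [← (hμ g).integral_comp (translateEquiv hμ g).measurableEmbedding
    (fun x : RightQuot H => F x.rep)]
  refine integral_congr_ae (Filter.Eventually.of_forall fun x => ?_)
  beta_reduce
  obtain ⟨y, rfl⟩ := x.exists_mk
  rw [RightQuot.translate_mk, rep_eq_of_mk hF (y * g),
    rep_eq_of_mk (F := fun y => F (y * g)) (fun h hh z => by rw [mul_assoc, hF h hh])]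

variable (D) in
/-- The integrand of `α_χ`. -/
def alphaIntegrand (ψ : AddChar ℚ_[p] ℂ) (g : GSp4 p) (u : unipU p) : ℂ :=
  chi D ψ u * alphaFun p D (actWedge (vD p D) (u * g))

theorem alphaIntegrand_mul (ψ : AddChar ℚ_[p] ℂ) (g : GSp4 p) :
    ∀ n ∈ (unipN p D).subgroupOf (unipU p), ∀ u,
      alphaIntegrand D ψ g (n * u) = alphaIntegrand D ψ g u := by
  intro n hn u
  have hn' : (n : GSp4 p) ∈ unipN p D := hn
  unfold alphaIntegrand
  rw [Subgroup.coe_mul, chi_mul ψ n.2 u.2, chi_unipN ψ hn', one_mul]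
  obtain ⟨x, hx, e⟩ := mem_unipN.1 hn'
  rw [mul_assoc, actWedge_mul, e, actWedge_vD_uni hx]

variable {ψ : AddChar ℚ_[p] ℂ} {μ : Measure (RightQuot ((unipN p D).subgroupOf (unipU p)))}

/-- The substitution x ↦ xu in N\U. Thus α_χ transforms under U by χ⁻¹, which cancels the character
of ℓ(π(g)v₀) in the first integrand. -/
theorem alphaChi_unipU_mul
    (hμ : IsInvariantMeasure _ ((maxCompact p).subgroupOf (unipU p)) μ) {u : GSp4 p}
    (hu : u ∈ unipU p) (g : GSp4 p) : chi D ψ u * alphaChi D ψ μ (u * g) = alphaChi D ψ μ g := by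
  have h := integral_translate hμ.1 (alphaIntegrand_mul (D := D) ψ g) ⟨u, hu⟩
  change _ = alphaChi D ψ μ g at h
  rw [← h]
  unfold alphaChi
  rw [← integral_const_mul]
  refine integral_congr_ae (Filter.Eventually.of_forall fun x => ?_)
  beta_reduce
  unfold alphaIntegrand
  rw [Subgroup.coe_mul, chi_mul ψ x.rep.2 hu, mul_assoc (x.rep : GSp4 p)]
  ring

theorem alphaChi_scal_mul (z : ℚ_[p]ˣ) (g : GSp4 p) :
    alphaChi D ψ μ (scal z * g) = alphaChi D ψ μ g := by
  refine integral_congr_ae (Filter.Eventually.of_forall fun x => ?_)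
  beta_reduce
  have := Subgroup.mem_center_iff.1 (scal_mem z) (x.rep : GSp4 p)
  rw [← mul_assoc, this, mul_assoc, actWedge_mul, actWedge_scal]

theorem alphaFun_actWedge {v : Wedge2 p} {k : GSp4 p} (hk : k ∈ maxCompact p) :
    alphaFun p D (actWedge v k) = alphaFun p D v := by
  unfold alphaFun
  by_cases h : v ∈ latticeV5 p D
  · rw [Set.indicator_of_mem h, Set.indicator_of_mem ((actWedge_mem_lattice_iff hk).2 h)]; rfl
  · rw [Set.indicator_of_notMem h,
      Set.indicator_of_notMem (fun h' => h ((actWedge_mem_lattice_iff hk).1 h'))]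

theorem alphaChi_mul {k : GSp4 p} (hk : k ∈ maxCompact p) (g : GSp4 p) :
    alphaChi D ψ μ (g * k) = alphaChi D ψ μ g := by
  refine integral_congr_ae (Filter.Eventually.of_forall fun x => ?_)
  beta_reduce
  rw [← mul_assoc, actWedge_mul, alphaFun_actWedge hk]

theorem alphaFun_uni_levi (x : Fin 3 → ℚ_[p]) (A : GL (Fin 2) ℚ_[p]) (ν : ℚ_[p]ˣ) [Decidable
    (IsInt (A⁻¹.val * mulMat (⟨0, 1⟩ : LAlg p D) * A.val) ∧ ‖yForm D x * ν / A.val.det‖ ≤ 1)] :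
    alphaFun p D (actWedge (vD p D) (uni x * levi A ν)) =
      if IsInt (A⁻¹.val * mulMat (⟨0, 1⟩ : LAlg p D) * A.val) ∧
        ‖yForm D x * ν / A.val.det‖ ≤ 1 then 1 else 0 := by
  unfold alphaFun
  split_ifs with h
  · rw [Set.indicator_of_mem ((actWedge_vD_mem_lattice x A ν).2 h)]; rfl
  · rw [Set.indicator_of_notMem (fun h' => h ((actWedge_vD_mem_lattice x A ν).1 h'))]

/-- The support of `α_χ`. -/
theorem isInt_of_alphaChi_ne_zero {x : Fin 3 → ℚ_[p]} {A : GL (Fin 2) ℚ_[p]} {ν : ℚ_[p]ˣ}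
    {k : GSp4 p} (hk : k ∈ maxCompact p) (h : alphaChi D ψ μ (uni x * levi A ν * k) ≠ 0) :
    IsInt (A⁻¹.val * mulMat (⟨0, 1⟩ : LAlg p D) * A.val) := by
  classical
  by_contra hA
  apply h
  rw [alphaChi_mul hk]
  unfold alphaChi
  rw [integral_eq_zero_of_ae]
  filter_upwards with q
  obtain ⟨y, hy⟩ := mem_unipU.1 q.rep.2
  rw [hy, ← mul_assoc, ← uni_add, alphaFun_uni_levi, if_neg (fun h' => hA h'.1), mul_zero]
  rfl

variable (p D) in
/-- The homomorphism `U → ℚ_p` whose kernel is `N`. -/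
def yHom : unipU p →* Multiplicative (Fin 1 → ℚ_[p]) where
  toFun u := Multiplicative.ofAdd fun _ =>
    yForm D (symC (mat (u : GSp4 p)).toBlocks₁₂)
  map_one' := by
    have : symC ((mat (1 : GSp4 p)).toBlocks₁₂) = 0 := by
      ext i; fin_cases i <;> simp [symC, mat_one, Matrix.toBlocks₁₂]
    rw [Subgroup.coe_one, this, map_zero]; rfl
  map_mul' u v := by
    obtain ⟨x, hx⟩ := mem_unipU.1 u.2
    obtain ⟨y, hy⟩ := mem_unipU.1 v.2
    have e : ∀ z : Fin 3 → ℚ_[p], symC ((mat (uni z)).toBlocks₁₂) = z := by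
      intro z; ext i; fin_cases i <;> rfl
    rw [Subgroup.coe_mul, hx, hy, ← uni_add, e, e, e, map_add]
    rfl

theorem yHom_uni (x : Fin 3 → ℚ_[p]) :
    yHom p D ⟨uni x, uni_mem x⟩ = Multiplicative.ofAdd fun _ => yForm D x := by
  have e : symC ((mat (uni x)).toBlocks₁₂) = x := by ext i; fin_cases i <;> rfl
  change Multiplicative.ofAdd _ = _
  rw [e]

theorem yHom_surjective : Function.Surjective (yHom p D) := by
  intro y
  refine ⟨⟨uni ![0, 0, y.toAdd 0], uni_mem _⟩, ?_⟩
  rw [yHom_uni]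
  apply Multiplicative.toAdd.injective
  ext i
  simp only [yForm_apply, toAdd_ofAdd]
  rw [Subsingleton.elim i 0]; simp

variable (p D) in
/-- The subgroup of `U` where the homomorphism to `ℚ_p` is small. -/
def yBall (j : ℤ) : Subgroup (unipU p) :=
  (AddSubgroup.toSubgroup (box p (fun _ : Fin 1 => j))).comap (yHom p D)

theorem mem_yBall {j : ℤ} {x : Fin 3 → ℚ_[p]} :
    (⟨uni x, uni_mem x⟩ : unipU p) ∈ yBall p D j ↔ ‖yForm D x‖ ≤ (p : ℝ) ^ (-j) := by
  change (yHom p D ⟨uni x, uni_mem x⟩).toAdd ∈ box p (fun _ : Fin 1 => j) ↔ _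
  rw [yHom_uni, mem_box]
  simp

theorem relIndex_yBall (j : ℕ) : (yBall p D j).relIndex (yBall p D 0) = p ^ j := by
  unfold yBall
  rw [Subgroup.relIndex_comap, Subgroup.map_comap_eq_self_of_surjective yHom_surjective,
    AddSubgroup.relIndex_toSubgroup, relIndex_box]
  simp

theorem isOpen_yBall (j : ℤ) : IsOpen (yBall p D j : Set (unipU p)) := by
  have h : (yBall p D j : Set (unipU p)) = (fun u : unipU p =>
      mat (u : GSp4 p) (Sum.inl 1) (Sum.inr 1) - coeffB p D * mat (u : GSp4 p) (Sum.inl 0) (Sum.inr 1)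
        - coeffA p D * mat (u : GSp4 p) (Sum.inl 0) (Sum.inr 0)) ⁻¹'
      (Metric.closedBall 0 ((p : ℝ) ^ (-j))) := by
    ext ⟨u, hu⟩
    obtain ⟨x, rfl⟩ := mem_unipU.1 hu
    rw [SetLike.mem_coe, mem_yBall, Set.mem_preimage, mem_closedBall_zero_iff]
    rfl
  rw [h]
  apply (IsUltrametricDist.isOpen_closedBall _ (zpow_pos prime_real_pos _).ne').preimage
  have hm : ∀ i j, Continuous fun u : unipU p => mat (u : GSp4 p) i j := fun i j =>
    (continuous_apply_apply i j).comp (continuous_mat.comp continuous_subtype_val)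
  exact ((hm _ _).sub (continuous_const.mul (hm _ _))).sub (continuous_const.mul (hm _ _))

theorem unipN_le_yBall (j : ℤ) : (unipN p D).subgroupOf (unipU p) ≤ yBall p D j := by
  rintro ⟨u, hu⟩ hn
  have hn' : u ∈ unipN p D := hn
  obtain ⟨x, hx, rfl⟩ := mem_unipN.1 hn'
  rw [mem_yBall, hx, norm_zero]
  exact (zpow_pos prime_real_pos _).le

theorem norm_yForm_le {x : Fin 3 → ℚ_[p]} (hx : IsInt (symM x)) : ‖yForm D x‖ ≤ 1 := by
  rw [yForm_apply]
  exact norm_sub_le_of_le (norm_sub_le_of_le (hx 1 1) (norm_mul_le_one norm_coeffB_le (hx 0 1)))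
    (norm_mul_le_one norm_coeffA_le (hx 0 0))

theorem mk_uni_eq {x y : Fin 3 → ℚ_[p]} (h : yForm D x = yForm D y) :
    RightQuot.mk ((unipN p D).subgroupOf (unipU p)) ⟨uni x, uni_mem x⟩ =
      RightQuot.mk ((unipN p D).subgroupOf (unipU p)) ⟨uni y, uni_mem y⟩ := by
  rw [RightQuot.mk_eq_mk_iff, Subgroup.mem_subgroupOf, mem_unipN]
  refine ⟨y - x, by rw [map_sub, h, sub_self], ?_⟩
  rw [sub_eq_add_neg, uni_add, uni_neg]
  rfl

/-- `yForm` identifies N\U with ℚ_p and sends the image of U ∩ K onto ℤ_p, which has volume one. The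
ball p^jℤ_p has index p^j in it, and N lies in the preimage of every ball. -/
theorem measure_yBall (hμ : IsInvariantMeasure _ ((maxCompact p).subgroupOf (unipU p)) μ) (j : ℕ) :
    μ (orbit ((unipN p D).subgroupOf (unipU p)) (yBall p D j) 1) = ((p : ENNReal) ^ j)⁻¹ := by
  have hp : (p : ENNReal) ^ j ≠ 0 := pow_ne_zero _ (by exact_mod_cast (Fact.out : p.Prime).ne_zero)
  have hp' : (p : ENNReal) ^ j ≠ ⊤ := ENNReal.pow_ne_top (ENNReal.natCast_ne_top _)
  have h0 : μ (orbit ((unipN p D).subgroupOf (unipU p)) (yBall p D 0) 1) = 1 := by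
    refine (congrArg μ ?_).trans hμ.2
    rw [← mk_image_eq_orbit]
    apply Set.Subset.antisymm
    · rintro _ ⟨⟨u, hu⟩, hu0, rfl⟩
      obtain ⟨x, rfl⟩ := mem_unipU.1 hu
      rw [SetLike.mem_coe, mem_yBall, neg_zero, zpow_zero] at hu0
      refine ⟨⟨uni ![0, 0, yForm D x], uni_mem _⟩, ?_, ?_⟩
      · change uni _ ∈ maxCompact p
        rw [uni_mem_maxCompact, isInt_fin_two]
        simpa [symM] using hu0
      · exact mk_uni_eq (by simp [yForm_apply])
    · rintro _ ⟨⟨u, hu⟩, hu0, rfl⟩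
      obtain ⟨x, rfl⟩ := mem_unipU.1 hu
      refine ⟨_, ?_, rfl⟩
      have hu1 : uni x ∈ maxCompact p := hu0
      rw [SetLike.mem_coe, mem_yBall, neg_zero, zpow_zero]
      exact norm_yForm_le (uni_mem_maxCompact.1 hu1)
  have h1 := relIndex_mul_measure (isOpen_yBall (p := p) (D := D) j) (isOpen_yBall 0)
    (by
      rintro ⟨u, hu⟩ h
      obtain ⟨x, rfl⟩ := mem_unipU.1 hu
      rw [mem_yBall] at h ⊢
      exact h.trans (zpow_prime_le.2 (by omega)))
    (by rw [relIndex_yBall]; exact pow_ne_zero _ (Fact.out : p.Prime).ne_zero) hμ.1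
  have h2 : (yBall p D j).relIndex ((unipN p D).subgroupOf (unipU p) ⊓ yBall p D 0) = 1 :=
    Subgroup.relIndex_eq_one.2 (inf_le_left.trans (unipN_le_yBall _))
  rw [relIndex_yBall, h2, h0, Nat.cast_one, one_mul, Nat.cast_pow] at h1
  exact ENNReal.eq_inv_of_mul_eq_one_left (by rw [mul_comm]; exact h1)

/-- The values of `α_χ` at the representatives. -/
theorem alphaChi_repM (hψ : HasConductorOne ψ)
    (hμ : IsInvariantMeasure _ ((maxCompact p).subgroupOf (unipU p)) μ) (d : PrimClass p D) (j : ℕ) :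
    alphaChi D ψ μ (repM d j) = ((p : ℂ) ^ j)⁻¹ := by
  classical
  have hp := prime_cast_ne_zero (p := p)
  have hA : IsInt ((repA d j)⁻¹.val * mulMat (⟨0, 1⟩ : LAlg p D) * (repA d j).val) := by
    rw [repA, mulGL_inv_val, mulGL_val, ← mulMat_mul, ← mulMat_mul, isInt_mulMat, mul_right_comm,
      mul_comm (linv _), mul_linv (star_norm_ne d j), one_mul]
    simp [IsO]
  have hq : (repNu d j : ℚ_[p]) / (repA d j).val.det = (p : ℚ_[p]) ^ (-(j : ℤ)) := by
    change (p : ℚ_[p]) ^ (j : ℤ) * QuadraticAlgebra.norm d.elt / (mulMat _).det = _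
    rw [det_mulMat, norm_smul_L, norm_star_L, zpow_neg]
    have := d.norm_ne
    have := zpow_ne_zero (j : ℤ) hp
    field_simp
  -- Since ν/det A = p^{-j}, the translate lies in the lattice exactly when |yForm| ≤ p^{-j}. As j ≥
  -- 0, ψ is trivial there, and the integral is the volume of a ball.
  have hF : ∀ q : RightQuot ((unipN p D).subgroupOf (unipU p)),
      chi D ψ (q.rep : GSp4 p) * alphaFun p D (actWedge (vD p D) ((q.rep : GSp4 p) * repM d j)) =
      (orbit ((unipN p D).subgroupOf (unipU p)) (yBall p D j) 1).indicator 1 q := by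
    intro q
    have hq1 : q ∈ orbit ((unipN p D).subgroupOf (unipU p)) (yBall p D j) 1 ↔
        q.rep ∈ yBall p D j := by
      conv_lhs => rw [← q.mk_rep]
      rw [mk_mem_orbit]
      constructor
      · rintro ⟨h, hh, k, hk, e⟩
        rw [e, mul_one]
        exact Subgroup.mul_mem _ (unipN_le_yBall _ hh) hk
      · intro h
        exact ⟨1, Subgroup.one_mem _, _, h, by simp⟩
    obtain ⟨x, hx⟩ := mem_unipU.1 q.rep.2
    have hx' : q.rep = ⟨uni x, uni_mem x⟩ := Subtype.ext hx
    rw [hx', mem_yBall] at hq1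
    rw [hx, chi_uni, repM, alphaFun_uni_levi]
    have hn : ‖yForm D x * (repNu d j : ℚ_[p]) / (repA d j).val.det‖ ≤ 1 ↔
        ‖yForm D x‖ ≤ (p : ℝ) ^ (-(j : ℤ)) := by
      rw [mul_div_assoc, hq, norm_mul, norm_prime_zpow, neg_neg, ← le_div_iff₀
        (zpow_pos prime_real_pos _), one_div, ← zpow_neg]
    by_cases h : ‖yForm D x‖ ≤ (p : ℝ) ^ (-(j : ℤ))
    · rw [if_pos ⟨hA, hn.2 h⟩, Set.indicator_of_mem (hq1.2 h), mul_one, hψ.1]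
      · rfl
      · refine h.trans ?_
        rw [← zpow_zero (p : ℝ)]; exact zpow_prime_le.2 (by omega)
    · rw [if_neg (fun h' => h (hn.1 h'.2)), Set.indicator_of_notMem (fun h' => h (hq1.1 h')),
        mul_zero]
  unfold alphaChi
  simp_rw [hF]
  rw [integral_indicator (orbit_measurableSet (isOpen_yBall _) 1)]
  simp only [Pi.one_apply]
  rw [setIntegral_const, Measure.real, measure_yBall hμ]
  simp

end KohnenSkoruppa
end

noncomputable section
namespace KohnenSkoruppa

/-! ### Measures of orbits -/

open scoped Pointwise

/-- The measure of an orbit in `H \ G` when `H` is the product of a central subgroup and of the image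
of an additive group. -/
theorem measure_orbit_of_hom {G : Type*} [Group G] [TopologicalSpace G] [IsTopologicalGroup G]
    {H K Z : Subgroup G} (hZ : Z ≤ Subgroup.center G) {E : Type*} [AddGroup E]
    (f : Multiplicative E →* G) {m : G} (hfH : ∀ e, f e ∈ H)
    (hH : ∀ h ∈ H, ∃ e, ∃ z ∈ Z, h = f e * z) (hm : ∀ e, ∃ e', m⁻¹ * f e * m = f e')
    (hcK : ∀ e, ∀ z ∈ Z, f e * z ∈ K → z ∈ K) (LK LP : AddSubgroup E)
    (hLK : ∀ e : E, f (Multiplicative.ofAdd e) ∈ K ↔ e ∈ LK)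
    (hLP : ∀ e : E, m⁻¹ * f (Multiplicative.ofAdd e) * m ∈ K ↔ e ∈ LP)
    (hb : LK.relIndex LP ≠ 0) {r : ℝ} (hr : (LP.relIndex LK : ℝ) = LK.relIndex LP * r)
    (hK : IsOpen (K : Set G)) (hKc : IsCompact (K : Set G)) {c k : G}
    (hc : c ∈ Subgroup.center G) (hk : k ∈ K) (hmc : m⁻¹ = c * k * m * k⁻¹)
    {μ : Measure (RightQuot H)} (hμ : IsInvariantMeasure H K μ) :
    μ (orbit H K m) = ENNReal.ofReal r := by
  set P := MulAut.conj m • K with hP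
  have hPo : IsOpen (P : Set G) := by
    have : (P : Set G) = (fun x => m⁻¹ * x * m) ⁻¹' (K : Set G) := by
      ext x; exact mem_conj_smul
    rw [this]
    exact hK.preimage (by fun_prop)
  have h := relIndex_mul_measure_orbit hK m (relIndex_ne_zero_of_isCompact hKc hPo)
    (relIndex_conj_symm hc hk hmc) hμ.1
  have h1 : μ (orbit H K 1) = 1 := by rw [← mk_image_eq_orbit]; exact hμ.2
  have hcomm : ∀ z ∈ Z, m⁻¹ * z * m = z := by
    intro z hz
    have := Subgroup.mem_center_iff.1 (hZ hz) m
    rw [mul_assoc, ← this, inv_mul_cancel_left]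
  have hZP : ∀ z ∈ Z, z ∈ K → z ∈ P := by
    intro z hz hzK
    rw [hP, mem_conj_smul, hcomm z hz]; exact hzK
  -- The central part of an element of H ∩ K lies in K and hence in mKm⁻¹, so it does not contribute
  -- and the index is computed in E.
  have hK1 : P.relIndex (H ⊓ K) = LP.relIndex LK := by
    have e1 : P.relIndex (H ⊓ K) = P.relIndex ((AddSubgroup.toSubgroup LK).map f) := by
      refine relIndex_eq_of_central (Z := Z) ?_ ?_
      · rintro _ ⟨e, he, rfl⟩
        exact ⟨hfH e, (hLK _).2 he⟩
      · rintro x ⟨hxH, hxK⟩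
        obtain ⟨e, z, hz, rfl⟩ := hH x hxH
        have hzK := hcK e z hz hxK
        refine ⟨f e, ⟨e, ?_, rfl⟩, z, hz, hZP z hz hzK, rfl⟩
        have := K.mul_mem hxK (K.inv_mem hzK)
        rw [mul_inv_cancel_right] at this
        exact (hLK e.toAdd).1 this
    rw [e1, ← Subgroup.relIndex_comap, ← AddSubgroup.relIndex_toSubgroup]
    congr 1
    ext e
    rw [Subgroup.mem_comap, hP, mem_conj_smul]
    exact hLP e.toAdd
  have hK2 : K.relIndex (H ⊓ P) = LK.relIndex LP := by
    have e1 : K.relIndex (H ⊓ P) = K.relIndex ((AddSubgroup.toSubgroup LP).map f) := by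
      refine relIndex_eq_of_central (Z := Z) ?_ ?_
      · rintro _ ⟨e, he, rfl⟩
        exact ⟨hfH e, mem_conj_smul.2 ((hLP _).2 he)⟩
      · rintro x ⟨hxH, hxP⟩
        obtain ⟨e, z, hz, rfl⟩ := hH x hxH
        replace hxP : m⁻¹ * (f e * z) * m ∈ K := mem_conj_smul.1 hxP
        obtain ⟨e', he'⟩ := hm e
        have e2 : m⁻¹ * (f e * z) * m = f e' * z := by
          rw [← he']
          have := hcomm z hz
          calc m⁻¹ * (f e * z) * m = (m⁻¹ * f e * m) * (m⁻¹ * z * m) := by group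
            _ = _ := by rw [this]
        rw [e2] at hxP
        have hzK := hcK e' z hz hxP
        refine ⟨f e, ⟨e, ?_, rfl⟩, z, hz, hzK, rfl⟩
        have h3 := K.mul_mem hxP (K.inv_mem hzK)
        rw [mul_inv_cancel_right, ← he'] at h3
        exact (hLP e.toAdd).1 h3
    rw [e1, ← Subgroup.relIndex_comap, ← AddSubgroup.relIndex_toSubgroup]
    congr 1
    ext e
    exact hLK e.toAdd
  rw [h1, mul_one] at h
  rw [hK1, hK2] at h
  have hb' : (LK.relIndex LP : ENNReal) ≠ 0 := by exact_mod_cast hb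
  have hbt : (LK.relIndex LP : ENNReal) ≠ ⊤ := ENNReal.natCast_ne_top _
  have h2 : (LP.relIndex LK : ENNReal) = (LK.relIndex LP : ENNReal) * ENNReal.ofReal r := by
    rw [← ENNReal.ofReal_natCast, ← ENNReal.ofReal_natCast (n := LK.relIndex LP),
      ← ENNReal.ofReal_mul (Nat.cast_nonneg _), hr]
  rw [h2] at h
  exact ((ENNReal.mul_right_inj hb' hbt).1 h).symm

variable {p : ℕ} [Fact p.Prime] {D : ℤ}

variable (p D) in
/-- The Weyl element of `GL*_{2,L}`. -/
def weylW : GSp4 p := emb (D := D) !![0, 1; -1, 0] 1 one_ne_zero (by simp [Matrix.det_fin_two_of])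

theorem weylW_mem : weylW p D ∈ maxCompact p := by
  rw [mem_maxCompact]
  refine ⟨isInt_embM fun i j => ?_, by rw [weylW, nu_emb, norm_one]⟩
  fin_cases i <;> fin_cases j <;> simp [isO_zero, isO_one, isO_one.neg]

theorem weylW_mem_gl2L : weylW p D ∈ gl2L p D := emb_mem _ _ _ _

/-- The Weyl element interchanges the two diagonal entries p^j d̄ and d, whose product is the
similitude. This is the relation between m⁻¹ and m that `relIndex_conj_symm` asks for. -/
theorem repM_inv (d : PrimClass p D) (j : ℤ) :
    (repM d j)⁻¹ = scal (repNu d j)⁻¹ * weylW p D * repM d j * (weylW p D)⁻¹ := by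
  have h : weylW p D * repM d j = scal (repNu d j) * (repM d j)⁻¹ * weylW p D := by
    apply mat_injective
    have hinv : mat (repM d j)⁻¹ =
        embM !![linv ((p : ℚ_[p]) ^ j • star d.elt), 0; 0, (repNu d j : ℚ_[p])⁻¹ •
          ((p : ℚ_[p]) ^ j • star d.elt)] := by
      have hi := mul_linv (star_norm_ne d j)
      rw [mat_inv]
      apply Matrix.inv_eq_right_inv
      rw [mat_repM, ← embM_mul]
      have e2 : d.elt * ((repNu d j : ℚ_[p])⁻¹ • ((p : ℚ_[p]) ^ j • star d.elt)) = 1 := by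
        have h4 := repNu_linv d j
        calc _ = ((repNu d j : ℚ_[p]) • linv ((p : ℚ_[p]) ^ j • star d.elt)) *
              ((repNu d j : ℚ_[p])⁻¹ • ((p : ℚ_[p]) ^ j • star d.elt)) := by rw [h4]
          _ = 1 := by
            rw [smul_mul_smul_comm, mul_inv_cancel₀ (repNu d j).ne_zero, one_smul, mul_comm, hi]
      have e3 : (!![(p : ℚ_[p]) ^ j • star d.elt, 0; 0, d.elt] *
          !![linv ((p : ℚ_[p]) ^ j • star d.elt), 0; 0, (repNu d j : ℚ_[p])⁻¹ •
          ((p : ℚ_[p]) ^ j • star d.elt)] : Matrix (Fin 2) (Fin 2) (LAlg p D)) = 1 := by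
        rw [Matrix.mul_fin_two, hi, e2, Matrix.one_fin_two]; simp
      rw [e3]
      simp [embM, mulMat_one, mulMat_zero]
    rw [mat_mul, mat_mul, mat_mul, hinv, mat_scal, mat_repM, weylW, mat_emb, Matrix.smul_mul,
      Matrix.one_mul, Matrix.smul_mul, ← embM_mul, ← embM_mul, ← embM_smul]
    congr 1
    rw [Matrix.mul_fin_two, Matrix.mul_fin_two, Matrix.smul_of]
    have h1 := repNu_linv d j
    have h2 := (repNu d j).ne_zero
    ext1 a b
    fin_cases a <;> fin_cases b <;> simp [h1, smul_smul]
  have hz : scal (repNu d j)⁻¹ * scal (repNu d j) = 1 := by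
    apply mat_injective
    rw [mat_mul, mat_scal, mat_scal, mat_one]; simp [smul_smul]
  rw [mul_assoc (scal _), h, ← mul_assoc, ← mul_assoc, hz, one_mul, mul_inv_cancel_right]

theorem maxCompact_center {x : Fin 3 → ℚ_[p]} {z : ℚ_[p]ˣ}
    (h : uni x * scal z ∈ maxCompact p) : scal z ∈ maxCompact p := by
  rw [scal_eq_levi] at h ⊢
  exact levi_mem_maxCompact.2 (of_uni_mul_levi_mem h)

theorem uni_conj_levi (x : Fin 3 → ℚ_[p]) (A : GL (Fin 2) ℚ_[p]) (ν : ℚ_[p]ˣ) :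
    (levi A ν)⁻¹ * uni x * levi A ν = uni ((ν : ℚ_[p]) • symAct A⁻¹.val x) := by
  rw [levi_inv, levi_mul_uni, ← levi_inv, inv_mul_cancel_right, Units.val_inv_eq_inv_val, inv_inv]

theorem conj_mem_maxCompact_iff (x : Fin 3 → ℚ_[p]) (A : GL (Fin 2) ℚ_[p]) (ν : ℚ_[p]ˣ) :
    (levi A ν)⁻¹ * uni x * levi A ν ∈ maxCompact p ↔ x ∈ latM A ν := by
  rw [uni_conj_levi, uni_mem_maxCompact, mem_latM, ← symM_symAct]
  have : symM ((ν : ℚ_[p]) • symAct A⁻¹.val x) = (ν : ℚ_[p]) • symM (symAct A⁻¹.val x) := by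
    ext i j; fin_cases i <;> fin_cases j <;> rfl
  rw [this]

theorem mem_sup_centre {H : Subgroup (GSp4 p)} {g : GSp4 p} :
    g ∈ H ⊔ centre p ↔ ∃ h ∈ H, ∃ z ∈ centre p, h * z = g := by
  rw [← SetLike.mem_coe, Subgroup.mul_normal H (centre p)]
  exact Set.mem_mul

/-- Conjugation by m(d,j) scales volume on the three-dimensional space of symmetric matrices by a
power of |ν/det A| = p^j, and the third power gives p^{3j}. -/
theorem measure_orbit_I {μ : Measure (RightQuot (unipU p ⊔ centre p))}
    (hμ : IsInvariantMeasure _ (maxCompact p) μ) (d : PrimClass p D) (j : ℤ) :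
    μ (orbit (unipU p ⊔ centre p) (maxCompact p) (repM d j)) =
      ENNReal.ofReal ((p : ℝ) ^ (3 * j)) := by
  obtain ⟨hb, hr⟩ := relIndex_latM (repA d j) (repNu d j).ne_zero
  have hq : (‖(repNu d j : ℚ_[p])‖ / ‖(repA d j).val.det‖) ^ 3 = (p : ℝ) ^ (3 * j) := by
    rw [norm_repNu, norm_det_repA, ← zpow_sub₀ prime_real_pos.ne', ← zpow_natCast, ← zpow_mul]
    congr 1; push_cast; ring
  rw [hq] at hr
  have h1 : ∀ e, uniHom (p := p) e ∈ unipU p ⊔ centre p :=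
    fun e => Subgroup.mem_sup_left (uni_mem _)
  have h2 : ∀ h ∈ unipU p ⊔ centre p, ∃ e, ∃ z ∈ centre p, h = uniHom (p := p) e * z := by
    intro h hh
    obtain ⟨u, hu, z, hz, rfl⟩ := mem_sup_centre.1 hh
    obtain ⟨x, rfl⟩ := mem_unipU.1 hu
    exact ⟨Multiplicative.ofAdd x, z, hz, rfl⟩
  have h3 : ∀ e, ∃ e', (repM d j)⁻¹ * uniHom (p := p) e * repM d j = uniHom e' :=
    fun e => ⟨Multiplicative.ofAdd ((repNu d j : ℚ_[p]) • symAct (repA d j)⁻¹.val e.toAdd),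
      uni_conj_levi e.toAdd (repA d j) (repNu d j)⟩
  have h4 : ∀ e, ∀ z ∈ centre p, uniHom (p := p) e * z ∈ maxCompact p → z ∈ maxCompact p := by
    intro e z hz h
    obtain ⟨c, rfl⟩ := mem_centre.1 hz
    exact maxCompact_center (x := e.toAdd) h
  have h5 : ∀ e : Fin 3 → ℚ_[p], uniHom (p := p) (Multiplicative.ofAdd e) ∈ maxCompact p ↔
      e ∈ latM 1 (1 : ℚ_[p]) := by
    intro e
    have h := conj_mem_maxCompact_iff e 1 1
    rwa [levi_one, inv_one, one_mul, mul_one, Units.val_one] at h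
  exact measure_orbit_of_hom (Z := centre p) le_rfl uniHom h1 h2 h3 h4 (latM 1 (1 : ℚ_[p]))
    (latM (repA d j) (repNu d j)) h5 (fun e => conj_mem_maxCompact_iff e _ _) hb hr
    maxCompact_isOpen maxCompact_isCompact (scal_mem (repNu d j)⁻¹) (weylW_mem (D := D))
    (repM_inv d j) hμ

end KohnenSkoruppa
end

/-! ### Measures of the double cosets in GL*_{2,L} -/

noncomputable section
namespace KohnenSkoruppa

variable {p : ℕ} [Fact p.Prime] {D : ℤ}

theorem coordN_add (z w : LAlg p D) : coordN (z + w) = coordN z + coordN w := by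
  ext i; fin_cases i <;> simp [coordN] <;> ring

theorem symM_smul (c : ℚ_[p]) (x : Fin 3 → ℚ_[p]) : symM (c • x) = c • symM x := by
  ext i j; fin_cases i <;> fin_cases j <;> rfl

theorem uni_coordN_mem_maxCompact {z : LAlg p D} : uni (coordN z) ∈ maxCompact p ↔ IsO z := by
  rw [uni_mem_maxCompact, symM_coordN, ← isInt_mulMat]
  constructor
  · intro h
    have := h.mul (isInt_gramQi (D := D))
    rwa [Matrix.mul_assoc, gramQ_mul_gramQi, Matrix.mul_one] at this
  · exact fun h => h.mul isInt_gramQ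

/-- The multiplier by which conjugation by `repM d j` acts on `N`. -/
def repW (d : PrimClass p D) (j : ℤ) : LAlg p D := d.elt * linv ((p : ℚ_[p]) ^ j • star d.elt)

theorem norm_repW_ne (d : PrimClass p D) (j : ℤ) : QuadraticAlgebra.norm (repW d j) ≠ 0 := by
  rw [repW, map_mul, norm_linv (star_norm_ne d j)]
  exact mul_ne_zero d.norm_ne (inv_ne_zero (star_norm_ne d j))

theorem norm_norm_repW (d : PrimClass p D) (j : ℤ) :
    ‖QuadraticAlgebra.norm (repW d j)‖ = (p : ℝ) ^ (2 * j) := by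
  rw [repW, map_mul, norm_linv (star_norm_ne d j), norm_smul_L, norm_star_L, norm_mul, norm_inv,
    norm_mul, norm_mul, norm_prime_zpow, d.norm_norm, ← zpow_add₀ prime_real_pos.ne',
    ← zpow_add₀ prime_real_pos.ne', ← zpow_neg, ← zpow_add₀ prime_real_pos.ne']
  congr 1; ring

/-- Under N ≅ L, conjugation by diag(p^j d̄, d) is multiplication by d/(p^j d̄), an element whose
norm has absolute value p^{2j}. -/
theorem uni_conj_repM (d : PrimClass p D) (j : ℤ) (z : LAlg p D) :
    (repM d j)⁻¹ * uni (coordN z) * repM d j = uni (coordN (repW d j * z)) := by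
  rw [repM, uni_conj_levi]
  congr 1
  apply symM_injective
  rw [symM_smul, symM_symAct, symM_coordN, symM_coordN, repA, mulGL_inv_val]
  set l := linv ((p : ℚ_[p]) ^ j • star d.elt) with hl
  have h1 : repW d j * z = (repNu d j : ℚ_[p]) • (l * z * l) := by
    rw [repW]
    conv_lhs => rw [← repNu_linv d j, repNu_linv]
    have := repNu_linv d j
    rw [← hl] at this ⊢
    rw [← mul_smul_comm, this]; ring
  rw [h1, mulMat_smul, mulMat_mul, mulMat_mul, mulMat_transpose, Matrix.smul_mul]
  congr 1
  simp only [Matrix.mul_assoc]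
  rw [← Matrix.mul_assoc (gramQ p D) (gramQi p D), gramQ_mul_gramQi, Matrix.one_mul]

variable (p D) in
/-- The group `N` as the image of the additive group `L`. -/
def uniNHom : Multiplicative (Fin 2 → ℚ_[p]) →* gl2L p D where
  toFun x := ⟨uni (coordN (⟨x.toAdd 0, x.toAdd 1⟩ : LAlg p D)),
    unipN_le_gl2L (mem_unipN.2 ⟨_, yForm_eq_zero.2 ⟨_, rfl⟩, rfl⟩)⟩
  map_one' := by
    apply Subtype.ext
    change uni (coordN (⟨0, 0⟩ : LAlg p D)) = 1
    rw [← uni_zero]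
    congr 1
    ext i; fin_cases i <;> simp [coordN]
  map_mul' x y := by
    apply Subtype.ext
    change uni (coordN (⟨_, _⟩ : LAlg p D)) = uni _ * uni _
    rw [← uni_add, ← coordN_add]; rfl

theorem coe_uniNHom (x : Multiplicative (Fin 2 → ℚ_[p])) :
    (uniNHom p D x : GSp4 p) = uni (coordN (⟨x.toAdd 0, x.toAdd 1⟩ : LAlg p D)) := rfl

variable (p D) in
/-- The subgroup `N Z` of `GL*_{2,L}`. -/
abbrev groupNZ : Subgroup (gl2L p D) := (unipN p D ⊔ centre p).subgroupOf (gl2L p D)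

variable (p D) in
/-- The maximal compact subgroup of `GL*_{2,L}`. -/
abbrev compactL : Subgroup (gl2L p D) := (maxCompact p).subgroupOf (gl2L p D)

/-- `repM d j` as an element of `GL*_{2,L}`. -/
def repML (d : PrimClass p D) (j : ℤ) : gl2L p D := ⟨repM d j, repM_mem d j⟩

theorem compactL_isOpen : IsOpen (compactL p D : Set (gl2L p D)) :=
  maxCompact_isOpen.preimage continuous_subtype_val

variable (D) in
/-- The matrix over `L` read off from the entries of an `L`-linear matrix. -/
def unembM (M : Matrix Idx Idx ℚ_[p]) : Matrix (Fin 2) (Fin 2) (LAlg p D) :=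
  !![⟨M (.inl 0) (.inl 0), M (.inl 0) (.inl 1)⟩,
      ⟨M (.inl 0) (.inr 1) - coeffB p D * M (.inl 0) (.inr 0), M (.inl 0) (.inr 0)⟩;
    ⟨M (.inr 1) (.inl 0), M (.inr 1) (.inl 1)⟩, ⟨M (.inr 0) (.inr 0), M (.inr 1) (.inr 0)⟩]

theorem unembM_embM (h : Matrix (Fin 2) (Fin 2) (LAlg p D)) : unembM D (embM h) = h := by
  ext i j <;> fin_cases i <;> fin_cases j <;>
    simp [unembM, embM, mulMat, gramQ, gramQi, mul_comm]

/-- The entries in L can be read off from the matrix, so L-linearity and the condition det = ν are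
closed conditions. Compactness of the integral points of GL*_{2,L} then follows from that of K. -/
theorem gl2L_isClosed : IsClosed (gl2L p D : Set (GSp4 p)) := by
  have hset : (gl2L p D : Set (GSp4 p)) = (⋂ i, ⋂ j, {g | embM (unembM D (mat g)) i j = mat g i j}) ∩
      ({g | (unembM D (mat g)).det.re = nu g} ∩ {g | (unembM D (mat g)).det.im = 0}) := by
    ext g
    simp only [SetLike.mem_coe, Set.mem_inter_iff, Set.mem_iInter, Set.mem_ofPred_eq]
    rw [mem_gl2L]
    constructor
    · rintro ⟨h, hd, hm⟩
      rw [hm, unembM_embM, hd]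
      simp
    · rintro ⟨h1, h2, h3⟩
      refine ⟨unembM D (mat g), ?_, (Matrix.ext h1).symm⟩
      ext
      · simpa using h2
      · simpa using h3
  have hc : ∀ i j, Continuous fun g : GSp4 p => mat g i j := fun i j =>
    (continuous_apply_apply i j).comp continuous_mat
  rw [hset]
  refine IsClosed.inter (isClosed_iInter fun i => isClosed_iInter fun j =>
    isClosed_eq ?_ (hc i j)) (IsClosed.inter (isClosed_eq ?_ continuous_nu)
      (isClosed_eq ?_ continuous_const))
  · rcases i with i | i <;> rcases j with j | j <;> fin_cases i <;> fin_cases j <;>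
      simp [unembM, embM, mulMat, gramQ, gramQi] <;> fun_prop
  · simp only [Matrix.det_fin_two, unembM]; simp; fun_prop
  · simp only [Matrix.det_fin_two, unembM]; simp; fun_prop

theorem mem_groupNZ {g : gl2L p D} :
    g ∈ groupNZ p D ↔ ∃ x, ∃ z : ℚ_[p]ˣ, yForm D x = 0 ∧ (g : GSp4 p) = uni x * scal z := by
  rw [Subgroup.mem_subgroupOf, mem_sup_centre]
  constructor
  · rintro ⟨u, hu, c, hc, h⟩
    obtain ⟨x, hx, rfl⟩ := mem_unipN.1 hu
    obtain ⟨z, rfl⟩ := mem_centre.1 hc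
    exact ⟨x, z, hx, h.symm⟩
  · rintro ⟨x, z, hx, h⟩
    exact ⟨_, mem_unipN.2 ⟨x, hx, rfl⟩, _, scal_mem z, h.symm⟩

theorem measure_orbit_J {μ : Measure (RightQuot (groupNZ p D))}
    (hμ : IsInvariantMeasure _ (compactL p D) μ) (d : PrimClass p D) (j : ℤ) :
    μ (orbit (groupNZ p D) (compactL p D) (repML d j)) = ENNReal.ofReal ((p : ℝ) ^ (2 * j)) := by
  have hdet : ((mulMat (repW d j))ᵀ).det ≠ 0 := by
    rw [Matrix.det_transpose, det_mulMat]; exact norm_repW_ne d j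
  -- The transpose appears because `mulMat` acts on row vectors while `latV` is defined with column
  -- vectors.
  let B : GL (Fin 2) ℚ_[p] := Matrix.GeneralLinearGroup.mkOfDetNeZero _ hdet
  obtain ⟨hb, hr⟩ := relIndex_latV B
  have hq : ‖B.val.det‖ = (p : ℝ) ^ (2 * j) := by
    change ‖((mulMat (repW d j))ᵀ).det‖ = _
    rw [Matrix.det_transpose, det_mulMat, norm_norm_repW]
  rw [hq] at hr
  have hZ : (centre p).subgroupOf (gl2L p D) ≤ Subgroup.center (gl2L p D) := by
    intro z hz
    rw [Subgroup.mem_center_iff]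
    intro g
    exact Subtype.ext (Subgroup.mem_center_iff.1 (Subgroup.mem_subgroupOf.1 hz) g)
  have h1 : ∀ e, uniNHom p D e ∈ groupNZ p D := fun e =>
    mem_groupNZ.2 ⟨_, 1, yForm_eq_zero.2 ⟨_, rfl⟩, by
      rw [coe_uniNHom]
      have : (scal 1 : GSp4 p) = 1 := mat_injective (by rw [mat_scal, mat_one]; simp)
      rw [this, mul_one]⟩
  have h2 : ∀ h ∈ groupNZ p D, ∃ e, ∃ z ∈ (centre p).subgroupOf (gl2L p D),
      h = uniNHom p D e * z := by
    intro h hh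
    obtain ⟨x, z, hx, hxz⟩ := mem_groupNZ.1 hh
    obtain ⟨w, rfl⟩ := yForm_eq_zero.1 hx
    exact ⟨Multiplicative.ofAdd ![w.re, w.im], ⟨scal z, scal_mem_gl2L z⟩,
      Subgroup.mem_subgroupOf.2 (scal_mem z), Subtype.ext hxz⟩
  have h3 : ∀ e, ∃ e', (repML d j)⁻¹ * uniNHom p D e * repML d j = uniNHom p D e' := by
    intro e
    set w := repW d j * (⟨e.toAdd 0, e.toAdd 1⟩ : LAlg p D) with hw
    exact ⟨Multiplicative.ofAdd ![w.re, w.im], Subtype.ext (uni_conj_repM d j _)⟩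
  have h4 : ∀ e, ∀ z ∈ (centre p).subgroupOf (gl2L p D), uniNHom p D e * z ∈ compactL p D →
      z ∈ compactL p D := by
    intro e z hz h
    obtain ⟨c, hc⟩ := mem_centre.1 (Subgroup.mem_subgroupOf.1 hz)
    have h' := Subgroup.mem_subgroupOf.1 h
    rw [Subgroup.coe_mul, hc, coe_uniNHom] at h'
    exact Subgroup.mem_subgroupOf.2 (hc ▸ maxCompact_center h')
  have h5 : ∀ e : Fin 2 → ℚ_[p], uniNHom p D (Multiplicative.ofAdd e) ∈ compactL p D ↔
      e ∈ latV 1 := by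
    intro e
    rw [Subgroup.mem_subgroupOf, coe_uniNHom, uni_coordN_mem_maxCompact, mem_latV, Units.val_one,
      Matrix.one_mulVec, Fin.forall_fin_two]
    rfl
  have h6 : ∀ e : Fin 2 → ℚ_[p], (repML d j)⁻¹ * uniNHom p D (Multiplicative.ofAdd e) * repML d j ∈
      compactL p D ↔ e ∈ latV B := by
    intro e
    have e1 : (((repML d j)⁻¹ * uniNHom p D (Multiplicative.ofAdd e) * repML d j : gl2L p D) :
        GSp4 p) = uni (coordN (repW d j * (⟨e 0, e 1⟩ : LAlg p D))) := uni_conj_repM d j _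
    rw [Subgroup.mem_subgroupOf, e1, uni_coordN_mem_maxCompact, mem_latV, Fin.forall_fin_two]
    change _ ↔ ‖((mulMat (repW d j))ᵀ *ᵥ e) 0‖ ≤ 1 ∧ ‖((mulMat (repW d j))ᵀ *ᵥ e) 1‖ ≤ 1
    have f0 : ((mulMat (repW d j))ᵀ *ᵥ e) 0 = (repW d j * (⟨e 0, e 1⟩ : LAlg p D)).re := by
      simp [Matrix.mulVec, dotProduct, mulMat, Fin.sum_univ_two]
    have f1 : ((mulMat (repW d j))ᵀ *ᵥ e) 1 = (repW d j * (⟨e 0, e 1⟩ : LAlg p D)).im := by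
      simp [Matrix.mulVec, dotProduct, mulMat, Fin.sum_univ_two]; ring
    rw [f0, f1]; rfl
  have h7 : (⟨scal (repNu d j)⁻¹, scal_mem_gl2L _⟩ : gl2L p D) ∈ Subgroup.center (gl2L p D) :=
    hZ (Subgroup.mem_subgroupOf.2 (scal_mem _))
  have h8 : (⟨weylW p D, weylW_mem_gl2L⟩ : gl2L p D) ∈ compactL p D :=
    Subgroup.mem_subgroupOf.2 weylW_mem
  exact measure_orbit_of_hom hZ (uniNHom p D) h1 h2 h3 h4 (latV 1) (latV B) h5 h6 hb hr
    compactL_isOpen (gl2L_isClosed.isClosedEmbedding_subtypeVal.isCompact_preimage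
      maxCompact_isCompact) h7 h8 (Subtype.ext (repM_inv d j)) hμ

end KohnenSkoruppa
end

noncomputable section
namespace KohnenSkoruppa

/-! ### Coset representatives for the Hecke operators `T(p ^ n)` -/

variable {p : ℕ} [Fact p.Prime] {D : ℤ}

/-- Translating a sum over representatives of the right cosets `g K` contained in `T`. -/
theorem sum_translate {G ι M : Type*} [Group G] [Fintype ι] [AddCommMonoid M] {K : Subgroup G}
    {T : Set G} {k : G} (hT : ∀ g ∈ T, k * g ∈ T) {e : ι → G} (he : ∀ i, e i ∈ T)
    (hsurj : ∀ g ∈ T, ∃ i, ∃ k ∈ K, g = e i * k)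
    (hinj : ∀ i j, ∀ k ∈ K, e i = e j * k → i = j) {Φ : G → M}
    (hΦ : ∀ g, ∀ k ∈ K, Φ (g * k) = Φ g) :
    ∑ i, Φ (k * e i) = ∑ i, Φ (e i) := by
  choose σ κ hκ h using fun i => hsurj (k * e i) (hT _ (he i))
  have hσ : Function.Injective σ := by
    intro i j hij
    have h1 := h i
    have h2 := h j
    rw [hij] at h1
    refine hinj i j ((κ j)⁻¹ * κ i) (K.mul_mem (K.inv_mem (hκ j)) (hκ i)) ?_
    have h3 : k * e i = k * e j * ((κ j)⁻¹ * κ i) := by rw [h1, h2]; group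
    rw [mul_assoc] at h3
    exact mul_left_cancel h3
  rw [← (Finite.injective_iff_bijective.1 hσ).sum_comp fun i => Φ (e i)]
  exact Finset.sum_congr rfl fun i _ => by rw [h i, hΦ _ _ (hκ i)]

variable (p) in
/-- The integral elements with similitude of valuation `n`. -/
def heckeSet (n : ℕ) : Set (GSp4 p) := {g | IsInt (mat g) ∧ ‖nu g‖ = (p : ℝ) ^ (-(n : ℤ))}

theorem mul_mem_heckeSet_right {n : ℕ} {g k : GSp4 p} (hk : k ∈ maxCompact p)
    (hg : g ∈ heckeSet p n) : g * k ∈ heckeSet p n := by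
  rw [mem_maxCompact] at hk
  exact ⟨by rw [mat_mul]; exact hg.1.mul hk.1, by rw [nu_mul, norm_mul, hg.2, hk.2, mul_one]⟩

theorem mul_mem_heckeSet_left {n : ℕ} {g k : GSp4 p} (hk : k ∈ maxCompact p)
    (hg : g ∈ heckeSet p n) : k * g ∈ heckeSet p n := by
  rw [mem_maxCompact] at hk
  exact ⟨by rw [mat_mul]; exact hk.1.mul hg.1, by rw [nu_mul, norm_mul, hg.2, hk.2, one_mul]⟩

theorem uni_mul_levi_mem_heckeSet {n : ℕ} {x : Fin 3 → ℚ_[p]} {A : GL (Fin 2) ℚ_[p]} {ν : ℚ_[p]ˣ} :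
    uni x * levi A ν ∈ heckeSet p n ↔ (IsInt A.val ∧ IsInt ((ν : ℚ_[p]) • A⁻¹.val)) ∧
      x ∈ latI A ν ∧ ‖(ν : ℚ_[p])‖ = (p : ℝ) ^ (-(n : ℤ)) := by
  have h : IsInt ((ν : ℚ_[p]) • (A⁻¹.val)ᵀ) ↔ IsInt ((ν : ℚ_[p]) • A⁻¹.val) := by
    rw [← Matrix.transpose_smul, isInt_transpose]
  change IsInt _ ∧ _ ↔ _
  rw [mat_uni_mul_levi, nu_mul, nu_uni, nu_levi, one_mul, isInt_fromBlocks, mem_latI, h,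
    Matrix.mul_smul]
  constructor
  · rintro ⟨⟨h1, h2, -, h4⟩, h5⟩; exact ⟨⟨h1, h4⟩, h2, h5⟩
  · rintro ⟨⟨h1, h4⟩, h2, h5⟩; exact ⟨⟨h1, h2, fun _ _ => by simp, h4⟩, h5⟩

variable (p) in
/-- The Hermite matrix `(p ^ a, x; 0, p ^ b)`. -/
def hermA (r : (_ : ℕ × ℕ) × ℕ) : GL (Fin 2) ℚ_[p] :=
  gl2 ((p : ℚ_[p]) ^ r.1.1) r.2 0 ((p : ℚ_[p]) ^ r.1.2) (by
    rw [mul_zero, sub_zero]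
    exact mul_ne_zero (pow_ne_zero _ prime_cast_ne_zero) (pow_ne_zero _ prime_cast_ne_zero))

theorem hermA_val (r : (_ : ℕ × ℕ) × ℕ) :
    (hermA p r).val = !![(p : ℚ_[p]) ^ r.1.1, (r.2 : ℚ_[p]); 0, (p : ℚ_[p]) ^ r.1.2] := rfl

theorem det_hermA (r : (_ : ℕ × ℕ) × ℕ) :
    (hermA p r).val.det = (p : ℚ_[p]) ^ (r.1.1 + r.1.2) := by
  rw [hermA_val, Matrix.det_fin_two_of, mul_zero, sub_zero, pow_add]

theorem hermA_inv_val (r : (_ : ℕ × ℕ) × ℕ) :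
    (hermA p r)⁻¹.val = ((p : ℚ_[p]) ^ (r.1.1 + r.1.2))⁻¹ •
      !![(p : ℚ_[p]) ^ r.1.2, -(r.2 : ℚ_[p]); 0, (p : ℚ_[p]) ^ r.1.1] := by
  rw [inv_val_fin_two, det_hermA, hermA_val, Matrix.adjugate_fin_two_of, neg_zero]

variable (p) in
/-- The indices of the Hermite matrices that divide `p ^ n`. -/
def hermIdx (n : ℕ) : Finset ((_ : ℕ × ℕ) × ℕ) :=
  (Finset.range (n + 1) ×ˢ Finset.range (n + 1)).sigma fun ab =>
    (Finset.range (p ^ ab.1)).filter fun x => p ^ (ab.1 + ab.2) ∣ x * p ^ n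

variable (p) in
/-- The Levi element of similitude `p ^ n` attached to a Hermite matrix. -/
def hermM (n : ℕ) (r : (_ : ℕ × ℕ) × ℕ) : GSp4 p := levi (hermA p r) (pUnit p ^ n)

theorem val_pUnit_pow (n : ℕ) : ((pUnit p ^ n : ℚ_[p]ˣ) : ℚ_[p]) = (p : ℚ_[p]) ^ n := by
  rw [Units.val_pow_eq_pow_val]; rfl

theorem norm_prime_pow (n : ℕ) : ‖(p : ℚ_[p]) ^ n‖ = (p : ℝ) ^ (-(n : ℤ)) := by
  rw [← norm_prime_zpow, zpow_natCast]

theorem norm_nat_div_le_one {x n : ℕ} :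
    ‖((p : ℚ_[p]) ^ n)⁻¹ * (x : ℚ_[p])‖ ≤ 1 ↔ p ^ n ∣ x := by
  rw [norm_mul, norm_inv, norm_prime_pow, inv_mul_le_one₀ (zpow_pos prime_real_pos _)]
  exact_mod_cast Padic.norm_int_le_pow_iff_dvd (p := p) x n

/-- For A = (p^a, x; 0, p^b), integrality of p^n A⁻¹ means a, b ≤ n together with p^{a+b} | x p^n,
coming from its off-diagonal entry -x p^n / p^{a+b}. -/
theorem mem_hermIdx {n : ℕ} {r : (_ : ℕ × ℕ) × ℕ} :
    r ∈ hermIdx p n ↔ r.2 < p ^ r.1.1 ∧ levi (hermA p r) (pUnit p ^ n) ∈ heckeSet p n := by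
  have hp := prime_cast_ne_zero (p := p)
  have hpp : (0 : ℝ) < p := prime_real_pos
  have key : ∀ a b : ℕ, ‖(p : ℚ_[p]) ^ n * (((p : ℚ_[p]) ^ (a + b))⁻¹ * (p : ℚ_[p]) ^ a)‖ ≤ 1 ↔
      b ≤ n := by
    intro a b
    rw [norm_mul, norm_mul, norm_inv, norm_prime_pow, norm_prime_pow, norm_prime_pow, ← zpow_neg,
      ← zpow_add₀ hpp.ne', ← zpow_add₀ hpp.ne', ← zpow_zero (p : ℝ), zpow_prime_le]
    push_cast; omega
  rw [← one_mul (levi _ _), ← uni_zero, uni_mul_levi_mem_heckeSet, isInt_fin_two, isInt_fin_two,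
    val_pUnit_pow, hermA_inv_val, hermA_val]
  simp only [Matrix.smul_apply, Matrix.of_apply, Matrix.cons_val_zero, Matrix.cons_val_one,
    Matrix.cons_val', Matrix.cons_val_fin_one, smul_eq_mul, mul_zero, norm_zero, zero_le_one,
    true_and, zero_mem, norm_prime_pow, and_true]
  have k1 := key r.1.1 r.1.2
  have k2 := key r.1.2 r.1.1
  rw [add_comm r.1.2] at k2
  have k3 : ‖(p : ℚ_[p]) ^ n * (((p : ℚ_[p]) ^ (r.1.1 + r.1.2))⁻¹ * -(r.2 : ℚ_[p]))‖ ≤ 1 ↔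
      p ^ (r.1.1 + r.1.2) ∣ r.2 * p ^ n := by
    rw [← norm_nat_div_le_one, ← norm_neg]
    push_cast
    rw [show -((p : ℚ_[p]) ^ n * (((p : ℚ_[p]) ^ (r.1.1 + r.1.2))⁻¹ * -(r.2 : ℚ_[p]))) =
      ((p : ℚ_[p]) ^ (r.1.1 + r.1.2))⁻¹ * ((r.2 : ℚ_[p]) * (p : ℚ_[p]) ^ n) by ring]
  rw [k1, k2, k3]
  have h1 : ‖(r.2 : ℚ_[p])‖ ≤ 1 := by exact_mod_cast Padic.norm_int_le_one (p := p) r.2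
  have h2 : ∀ a : ℕ, (p : ℝ) ^ (-(a : ℤ)) ≤ 1 := fun a => by
    rw [← zpow_zero (p : ℝ), zpow_prime_le]; omega
  simp only [h1, h2, hermIdx, Finset.mem_sigma, Finset.mem_product, Finset.mem_range,
    Finset.mem_filter, true_and, and_true]
  constructor
  · rintro ⟨⟨a1, a2⟩, a3, a4⟩; exact ⟨a3, by omega, a4, by omega⟩
  · rintro ⟨a3, a1, a4, a2⟩; exact ⟨⟨by omega, by omega⟩, a3, a4⟩

/-- Every element of `heckeSet p n` lies in one of the listed cosets. -/
theorem exists_hermIdx {n : ℕ} {g : GSp4 p} (hg : g ∈ heckeSet p n) :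
    ∃ r ∈ hermIdx p n, ∃ x ∈ latI (hermA p r) (pUnit p ^ n : ℚ_[p]ˣ), ∃ k ∈ maxCompact p,
      g = uni x * hermM p n r * k := by
  have hp := prime_cast_ne_zero (p := p)
  have hpp : (0 : ℝ) < p := prime_real_pos
  obtain ⟨x, A, ν, k, hk, hA, rfl⟩ := exists_iwasawa g
  have hg' := mul_mem_heckeSet_right (inv_mem hk) hg
  rw [mul_inv_cancel_right, uni_mul_levi_mem_heckeSet] at hg'
  obtain ⟨⟨hA1, hA2⟩, -, hν⟩ := hg'
  have hdet := det_ne_zero A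
  rw [Matrix.det_fin_two, hA, mul_zero, sub_zero] at hdet
  have hα := left_ne_zero_of_mul hdet
  have hδ := right_ne_zero_of_mul hdet
  obtain ⟨a, ha⟩ := norm_eq_zpow hα
  obtain ⟨b, hb⟩ := norm_eq_zpow hδ
  have ha0 := hA1 0 0
  have hb0 := hA1 1 1
  rw [ha, ← zpow_zero (p : ℝ), zpow_prime_le] at ha0
  rw [hb, ← zpow_zero (p : ℝ), zpow_prime_le] at hb0
  lift a to ℕ using by omega
  lift b to ℕ using by omega
  set w := ((p : ℚ_[p]) ^ b)⁻¹ * A.val 1 1 with hw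
  have hw1 : ‖w‖ = 1 := by
    rw [hw, norm_mul, norm_inv, norm_prime_pow, hb, inv_mul_cancel₀ (zpow_pos hpp _).ne']
  have hw0 : w ≠ 0 := by rw [← norm_ne_zero_iff, hw1]; exact one_ne_zero
  let t : ℤ_[p] := ⟨A.val 0 1 * w⁻¹, by rw [norm_mul, norm_inv, hw1, inv_one, mul_one]; exact hA1 _ _⟩
  -- Right multiplication by an integral unipotent matrix changes the upper right entry by multiples
  -- of p^a, so it may be replaced by a natural number below p^a. The factor w has already made the
  -- lower right entry exactly p^b.
  set y := t.appr a with hy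
  have hty : ‖A.val 0 1 * w⁻¹ - (y : ℚ_[p])‖ ≤ (p : ℝ) ^ (-(a : ℤ)) := by
    have h1 := (PadicInt.norm_le_pow_iff_mem_span_pow _ _).2 (PadicInt.appr_spec a t)
    rw [PadicInt.norm_def] at h1
    push_cast at h1
    exact h1
  set r : (_ : ℕ × ℕ) × ℕ := ⟨(a, b), y⟩ with hr
  have hval : ((hermA p r)⁻¹ * A).val = !![((p : ℚ_[p]) ^ a)⁻¹ * A.val 0 0,
      ((p : ℚ_[p]) ^ a)⁻¹ * (w * (A.val 0 1 * w⁻¹ - (y : ℚ_[p]))); 0, w] := by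
    rw [Units.val_mul, hermA_inv_val]
    have e1 : w * (A.val 0 1 * w⁻¹) = A.val 0 1 := by field_simp
    ext i j
    fin_cases i <;> fin_cases j <;>
      simp [Matrix.mul_apply, Fin.sum_univ_two, hA, hr, pow_add]
    · left; field_simp
    · rw [mul_sub, e1, hw]; field_simp; ring
    · rw [hw]; field_simp
  have hint : (hermA p r)⁻¹ * A ∈ intGL p (Fin 2) := by
    rw [mem_intGL_fin_two, hval, isInt_fin_two, Matrix.det_fin_two_of]
    have e1 : ‖((p : ℚ_[p]) ^ a)⁻¹ * A.val 0 0‖ = 1 := by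
      rw [norm_mul, norm_inv, norm_prime_pow, ha, inv_mul_cancel₀ (zpow_pos hpp _).ne']
    refine ⟨⟨e1.le, ?_, by simp, hw1.le⟩, by simp [hw1, e1]⟩
    change ‖((p : ℚ_[p]) ^ a)⁻¹ * (w * (A.val 0 1 * w⁻¹ - (y : ℚ_[p])))‖ ≤ 1
    rw [norm_mul, norm_mul, hw1, one_mul, norm_inv, norm_prime_pow, inv_mul_le_one₀ (zpow_pos hpp _)]
    exact hty
  set k' := levi ((hermA p r)⁻¹ * A) ((pUnit p ^ n)⁻¹ * ν) with hk'
  have hk'K : k' ∈ maxCompact p := by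
    refine levi_mem_maxCompact.2 ⟨hint, ?_⟩
    rw [Units.val_mul, Units.val_inv_eq_inv_val, val_pUnit_pow, norm_mul, norm_inv, norm_prime_pow,
      hν, inv_mul_cancel₀ (zpow_pos hpp _).ne']
  have hfac : levi A ν = hermM p n r * k' := by
    rw [hermM, hk', ← levi_mul, mul_inv_cancel_left, mul_inv_cancel_left]
  have hmem : uni x * hermM p n r ∈ heckeSet p n := by
    have := mul_mem_heckeSet_right (inv_mem (mul_mem hk'K hk)) hg
    rwa [hfac, show uni x * (hermM p n r * k') * k * (k' * k)⁻¹ = uni x * hermM p n r by group] at this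
  have hmem' : levi (hermA p r) (pUnit p ^ n) ∈ heckeSet p n := by
    rw [← one_mul (levi _ _), ← uni_zero]
    rw [hermM, uni_mul_levi_mem_heckeSet] at hmem
    exact uni_mul_levi_mem_heckeSet.2 ⟨hmem.1, zero_mem _, hmem.2.2⟩
  refine ⟨r, mem_hermIdx.2 ⟨PadicInt.appr_lt _ _, hmem'⟩, x,
    (uni_mul_levi_mem_heckeSet.1 hmem).2.1, k' * k, mul_mem hk'K hk, ?_⟩
  rw [hfac]; group

/-- The Hermite matrix is determined by its coset. -/
theorem hermA_injective {n : ℕ} {r r' : (_ : ℕ × ℕ) × ℕ} (hr : r ∈ hermIdx p n)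
    (hr' : r' ∈ hermIdx p n) (h : (hermA p r')⁻¹ * hermA p r ∈ intGL p (Fin 2)) : r = r' := by
  have hp := prime_cast_ne_zero (p := p)
  have hpp : (0 : ℝ) < p := prime_real_pos
  obtain ⟨⟨a, b⟩, x⟩ := r
  obtain ⟨⟨a', b'⟩, x'⟩ := r'
  have hx := (mem_hermIdx.1 hr).1
  have hx' := (mem_hermIdx.1 hr').1
  dsimp only at hx hx'
  rw [mem_intGL_fin_two, Units.val_mul, Matrix.det_mul, det_hermA, hermA_inv_val, Matrix.det_smul,
    Matrix.det_fin_two_of, hermA_val, isInt_fin_two] at h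
  obtain ⟨⟨h1, h2, -, h3⟩, h4⟩ := h
  simp only [Matrix.smul_apply, Matrix.mul_apply, Fin.sum_univ_two,
    Matrix.of_apply, Matrix.cons_val_zero, Matrix.cons_val_one, Matrix.cons_val',
    Matrix.cons_val_fin_one, smul_eq_mul, mul_zero, zero_mul, add_zero, zero_add, sub_zero,
    Fintype.card_fin, norm_mul, norm_inv, norm_pow] at h1 h2 h3 h4
  simp only [← norm_pow, norm_prime_pow] at h1 h3 h4
  simp only [← zpow_natCast, ← zpow_neg, ← zpow_mul, ← zpow_add₀ hpp.ne'] at h1 h3 h4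
  rw [← zpow_zero (p : ℝ), zpow_prime_le] at h1 h3
  rw [← zpow_zero (p : ℝ), zpow_prime_inj] at h4
  push_cast at h1 h3 h4
  obtain rfl : a = a' := by omega
  obtain rfl : b = b' := by omega
  have h5 : ‖((p : ℚ_[p]) ^ a)⁻¹ * (((x : ℤ) - (x' : ℤ) : ℤ) : ℚ_[p])‖ ≤ 1 := by
    convert h2 using 1
    congr 1
    push_cast
    rw [pow_add]; field_simp; ring
  rw [norm_mul, norm_inv, norm_prime_pow, inv_mul_le_one₀ (zpow_pos hpp _),
    Padic.norm_int_le_pow_iff_dvd] at h5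
  have h6 : (x : ℤ) ≡ x' [ZMOD (p ^ a : ℕ)] := by
    apply Int.ModEq.symm
    rw [Int.modEq_iff_dvd]
    exact_mod_cast h5
  have h7 := (Int.natCast_modEq_iff.1 h6).eq_of_lt_of_lt hx hx'
  rw [h7]

end KohnenSkoruppa
end

/-! ### Hecke cosets over a fixed Hermite matrix -/

noncomputable section
namespace KohnenSkoruppa

variable {p : ℕ} [Fact p.Prime] {D : ℤ}

/-- The gcd of x and p^{min(a,b)} is the power of p with the least valuation among the entries of A.
Together with the determinant p^{a+b} this is the input of `relIndex_latM_latI`. -/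
theorem relIndex_hermA (r : (_ : ℕ × ℕ) × ℕ) {ν : ℚ_[p]} (hν : ν ≠ 0) :
    (latM (hermA p r) ν).relIndex (latI (hermA p r) ν) =
      p ^ (r.1.1 + r.1.2) * r.2.gcd (p ^ min r.1.1 r.1.2) := by
  have hpp : (0 : ℝ) < p := prime_real_pos
  obtain ⟨⟨a, b⟩, x⟩ := r
  obtain ⟨m, hm, hg⟩ := (Nat.dvd_prime_pow (Fact.out : p.Prime)).1
    (Nat.gcd_dvd_right x (p ^ min a b))
  have hnat : ∀ k : ℕ, ‖(x : ℚ_[p])‖ ≤ (p : ℝ) ^ (-(k : ℤ)) ↔ p ^ k ∣ x := fun k => by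
    exact_mod_cast Padic.norm_int_le_pow_iff_dvd (p := p) x k
  have hx : ‖(x : ℚ_[p])‖ ≤ (p : ℝ) ^ (-(m : ℤ)) := (hnat m).2 (hg ▸ Nat.gcd_dvd_left _ _)
  have hma : m ≤ a := hm.trans (min_le_left _ _)
  have hmb : m ≤ b := hm.trans (min_le_right _ _)
  have h := relIndex_latM_latI (A := hermA p ⟨(a, b), x⟩) hν (r := (p : ℝ) ^ (-(m : ℤ)))
    (by rw [← zpow_zero (p : ℝ), zpow_prime_le]; omega) (by
      intro i j
      rw [hermA_val]
      fin_cases i <;> fin_cases j <;> simp only [Fin.zero_eta, Fin.mk_one, Matrix.of_apply,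
        Matrix.cons_val_zero, Matrix.cons_val_one, Matrix.cons_val', Matrix.cons_val_fin_one]
      · rw [norm_prime_pow, zpow_prime_le]; omega
      · exact hx
      · rw [norm_zero]; positivity
      · rw [norm_prime_pow, zpow_prime_le]; omega) (by
      rw [hermA_val]
      rcases hm.lt_or_eq with h1 | h1
      · refine ⟨0, 1, le_antisymm hx ?_⟩
        by_contra h2
        push Not at h2
        have h3 : ‖(x : ℚ_[p])‖ ≤ (p : ℝ) ^ (-((m + 1 : ℕ) : ℤ)) := by
          apply norm_le_zpow_of_lt
          rwa [show -((m + 1 : ℕ) : ℤ) + 1 = -(m : ℤ) by push_cast; ring]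
        have h4 := Nat.dvd_gcd ((hnat _).1 h3) (pow_dvd_pow p (show m + 1 ≤ min a b from h1))
        rw [hg, Nat.pow_dvd_pow_iff_le_right (Fact.out : p.Prime).one_lt] at h4
        omega
      · rcases min_choice a b with h2 | h2
        · exact ⟨0, 0, by simp only [Matrix.of_apply, Matrix.cons_val_zero, Matrix.cons_val',
            Matrix.cons_val_fin_one]; rw [norm_prime_pow, h1, h2]⟩
        · exact ⟨1, 1, by simp only [Matrix.of_apply, Matrix.cons_val_one, Matrix.cons_val',
            Matrix.cons_val_fin_one]; rw [norm_prime_pow, h1, h2]⟩)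
  rw [det_hermA, norm_prime_pow] at h
  have h2 : ((p ^ (a + b) * x.gcd (p ^ min a b) : ℕ) : ℝ) =
      ((p : ℝ) ^ (-((a + b : ℕ) : ℤ)))⁻¹ * ((p : ℝ) ^ (-(m : ℤ)))⁻¹ := by
    rw [hg, zpow_neg, zpow_neg, inv_inv, inv_inv, zpow_natCast, zpow_natCast]; push_cast; rfl
  rw [← h2] at h
  exact_mod_cast h

variable (p) in
/-- The part of the index set of a Hecke operator belonging to a Hermite matrix. -/
abbrev heckeFibre (n : ℕ) (r : (_ : ℕ × ℕ) × ℕ) : Type :=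
  latI (hermA p r) ((pUnit p ^ n : ℚ_[p]ˣ) : ℚ_[p]) ⧸
    (latM (hermA p r) ((pUnit p ^ n : ℚ_[p]ˣ) : ℚ_[p])).addSubgroupOf
      (latI (hermA p r) ((pUnit p ^ n : ℚ_[p]ˣ) : ℚ_[p]))

theorem card_heckeFibre (n : ℕ) (r : (_ : ℕ × ℕ) × ℕ) :
    Nat.card (heckeFibre p n r) = p ^ (r.1.1 + r.1.2) * r.2.gcd (p ^ min r.1.1 r.1.2) :=
  relIndex_hermA r (pUnit p ^ n).ne_zero

instance (n : ℕ) (r : (_ : ℕ × ℕ) × ℕ) : Finite (heckeFibre p n r) := by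
  have hp := (Fact.out : p.Prime).pos
  apply Nat.finite_of_card_ne_zero
  rw [card_heckeFibre]
  exact mul_ne_zero (pow_ne_zero _ hp.ne') (Nat.gcd_pos_of_pos_right _ (pow_pos hp _)).ne'

instance (n : ℕ) (r : (_ : ℕ × ℕ) × ℕ) : Fintype (heckeFibre p n r) := Fintype.ofFinite _

variable (p) in
/-- The index set of the Hecke operator `T(p ^ n)`. -/
abbrev HeckeIdx (n : ℕ) : Type := Σ r : hermIdx p n, heckeFibre p n r

/-- The representatives of the cosets `g K` in `heckeSet p n`. -/
def heckeRep (n : ℕ) (h : HeckeIdx p n) : GSp4 p :=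
  uni (Quotient.out h.2 : latI (hermA p h.1.1) ((pUnit p ^ n : ℚ_[p]ˣ) : ℚ_[p])).1 *
    hermM p n h.1

theorem hermM_mem (n : ℕ) (r : hermIdx p n) : hermM p n r ∈ heckeSet p n := (mem_hermIdx.1 r.2).2

theorem uni_mul_hermM_mem {n : ℕ} (r : hermIdx p n) {x : Fin 3 → ℚ_[p]}
    (hx : x ∈ latI (hermA p r) ((pUnit p ^ n : ℚ_[p]ˣ) : ℚ_[p])) :
    uni x * hermM p n r ∈ heckeSet p n := by
  have h := hermM_mem n r
  rw [hermM, ← one_mul (levi _ _), ← uni_zero, uni_mul_levi_mem_heckeSet] at h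
  exact uni_mul_levi_mem_heckeSet.2 ⟨h.1, hx, h.2.2⟩

theorem heckeRep_mem (n : ℕ) (h : HeckeIdx p n) : heckeRep n h ∈ heckeSet p n :=
  uni_mul_hermM_mem h.1 (Quotient.out h.2).2

theorem conj_hermM_mem_iff (n : ℕ) (r : (_ : ℕ × ℕ) × ℕ) (x : Fin 3 → ℚ_[p]) :
    (hermM p n r)⁻¹ * uni x * hermM p n r ∈ maxCompact p ↔
      x ∈ latM (hermA p r) ((pUnit p ^ n : ℚ_[p]ˣ) : ℚ_[p]) := conj_mem_maxCompact_iff _ _ _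

/-- Two elements of a fibre that give the same coset. -/
theorem fibre_mk_eq {n : ℕ} {r : (_ : ℕ × ℕ) × ℕ}
    {x y : latI (hermA p r) ((pUnit p ^ n : ℚ_[p]ˣ) : ℚ_[p])} :
    (QuotientAddGroup.mk x : heckeFibre p n r) = QuotientAddGroup.mk y ↔
      ∃ k ∈ maxCompact p, uni y.1 * hermM p n r = uni x.1 * hermM p n r * k := by
  rw [QuotientAddGroup.eq, AddSubgroup.mem_addSubgroupOf]
  have e : ((-x + y : latI (hermA p r) ((pUnit p ^ n : ℚ_[p]ˣ) : ℚ_[p])) : Fin 3 → ℚ_[p]) =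
    -x.1 + y.1 := rfl
  rw [e, ← conj_hermM_mem_iff, uni_add, uni_neg]
  constructor
  · intro h
    exact ⟨_, h, by group⟩
  · rintro ⟨k, hk, h⟩
    convert hk using 1
    rw [eq_comm, ← mul_right_inj (uni x.1 * hermM p n r), ← h]; group

theorem exists_heckeRep {n : ℕ} {g : GSp4 p} (hg : g ∈ heckeSet p n) :
    ∃ h, ∃ k ∈ maxCompact p, g = heckeRep n h * k := by
  obtain ⟨r, hr, x, hx, k, hk, rfl⟩ := exists_hermIdx hg
  have h1 : (QuotientAddGroup.mk (Quotient.out (QuotientAddGroup.mk ⟨x, hx⟩ : heckeFibre p n r)) :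
      heckeFibre p n r) = QuotientAddGroup.mk ⟨x, hx⟩ := Quotient.out_eq _
  obtain ⟨k', hk', h2⟩ := fibre_mk_eq.1 h1
  refine ⟨⟨⟨r, hr⟩, QuotientAddGroup.mk ⟨x, hx⟩⟩, k' * k, mul_mem hk' hk, ?_⟩
  rw [← mul_assoc]
  exact congrArg (· * k) h2

theorem heckeRep_injective {n : ℕ} {h h' : HeckeIdx p n} {k : GSp4 p} (hk : k ∈ maxCompact p)
    (e : heckeRep n h = heckeRep n h' * k) : h = h' := by
  obtain ⟨r, q⟩ := h
  obtain ⟨r', q'⟩ := h'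
  have hA : (hermA p r')⁻¹ * hermA p r ∈ intGL p (Fin 2) := by
    refine (of_levi_eq (x := -(Quotient.out q).1 + (Quotient.out q').1) (ν := pUnit p ^ n)
      (μ := pUnit p ^ n) hk ?_).1
    rw [uni_add, uni_neg, mul_assoc, mul_assoc, eq_inv_mul_iff_mul_eq, ← mul_assoc]
    exact e
  obtain rfl : r = r' := Subtype.ext (hermA_injective r.2 r'.2 hA)
  congr 1
  rw [← Quotient.out_eq q, ← Quotient.out_eq q']
  exact (fibre_mk_eq.2 ⟨k, hk, e⟩).symm

theorem sum_heckeRep_translate {M : Type*} [AddCommMonoid M] {n : ℕ} {Φ : GSp4 p → M}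
    (hΦ : ∀ g, ∀ k ∈ maxCompact p, Φ (g * k) = Φ g) {k : GSp4 p} (hk : k ∈ maxCompact p) :
    ∑ h, Φ (k * heckeRep n h) = ∑ h, Φ (heckeRep n h) :=
  sum_translate (fun _ hg => mul_mem_heckeSet_left hk hg) (heckeRep_mem n)
    (fun _ hg => exists_heckeRep hg) (fun _ _ _ hk e => heckeRep_injective hk e) hΦ

open Classical in
-- For a fixed Hermite matrix the terms are θ(x) times a constant, with x in a finite quotient of
-- lattices. Either θ is trivial on the lattice and the sum is the order of the quotient, or
-- translation by an x with θ(x) ≠ 1 makes it zero. It is used both with θ = χ and with θ = 1.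
theorem sum_heckeRep {n : ℕ} {Φ : GSp4 p → ℂ} (hΦ : ∀ g, ∀ k ∈ maxCompact p, Φ (g * k) = Φ g)
    {θ : (Fin 3 → ℚ_[p]) → ℂ} (hθ : ∀ x g, Φ (uni x * g) = θ x * Φ g) :
    ∑ h, Φ (heckeRep n h) = ∑ r ∈ hermIdx p n,
      if ∀ x ∈ latI (hermA p r) ((pUnit p ^ n : ℚ_[p]ˣ) : ℚ_[p]), θ x = 1 then
        (p : ℂ) ^ (r.1.1 + r.1.2) * (r.2.gcd (p ^ min r.1.1 r.1.2) : ℕ) * Φ (hermM p n r) else 0 := by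
  rw [Fintype.sum_sigma, ← Finset.sum_coe_sort (hermIdx p n)]
  refine Finset.sum_congr rfl fun r _ => ?_
  have hf : ∀ x : latI (hermA p r) ((pUnit p ^ n : ℚ_[p]ˣ) : ℚ_[p]),
      Φ (heckeRep n ⟨r, QuotientAddGroup.mk x⟩) = θ x.1 * Φ (hermM p n r) := by
    intro x
    have h1 : (QuotientAddGroup.mk (Quotient.out (QuotientAddGroup.mk x : heckeFibre p n r)) :
      heckeFibre p n r) = QuotientAddGroup.mk x := Quotient.out_eq _
    obtain ⟨k', hk', h2⟩ := fibre_mk_eq.1 h1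
    rw [← hθ, h2, hΦ _ _ hk']
    rfl
  split_ifs with h
  · have h1 : ∀ q : heckeFibre p n r, Φ (heckeRep n ⟨r, q⟩) = Φ (hermM p n r) := by
      intro q
      obtain ⟨x, rfl⟩ := QuotientAddGroup.mk_surjective q
      rw [hf, h _ x.2, one_mul]
    rw [Finset.sum_congr rfl fun q _ => h1 q, Finset.sum_const, Finset.card_univ,
      ← Nat.card_eq_fintype_card, card_heckeFibre, nsmul_eq_mul]
    push_cast
    rfl
  · push Not at h
    obtain ⟨x, hx, hx1⟩ := h
    have h1 : ∑ q : heckeFibre p n r, Φ (heckeRep n ⟨r, q⟩) =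
        θ x * ∑ q : heckeFibre p n r, Φ (heckeRep n ⟨r, q⟩) := by
      rw [Finset.mul_sum, ← Equiv.sum_comp (Equiv.addLeft (QuotientAddGroup.mk ⟨x, hx⟩ :
        heckeFibre p n r)) fun q => Φ (heckeRep n ⟨r, q⟩)]
      refine Finset.sum_congr rfl fun q _ => ?_
      obtain ⟨y, rfl⟩ := QuotientAddGroup.mk_surjective q
      rw [Equiv.coe_addLeft]
      beta_reduce
      rw [← QuotientAddGroup.mk_add, hf, hf]
      have e : ((⟨x, hx⟩ + y : latI (hermA p r) ((pUnit p ^ n : ℚ_[p]ˣ) : ℚ_[p])) :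
        Fin 3 → ℚ_[p]) = x + y.1 := rfl
      rw [e, ← hθ, uni_add, mul_assoc, hθ, hθ]
    have h2 : (1 - θ x) * ∑ q : heckeFibre p n r, Φ (heckeRep n ⟨r, q⟩) = 0 := by
      linear_combination h1
    exact (mul_eq_zero.1 h2).resolve_left (sub_ne_zero.2 (Ne.symm hx1))

end KohnenSkoruppa
end

noncomputable section
namespace KohnenSkoruppa

/-! ### Cosets on which the character is trivial -/

variable {p : ℕ} [Fact p.Prime] {D : ℤ}

theorem PrimClass.norm_le_of_smul (d : PrimClass p D) {y : ℚ_[p]} (h : IsO (y • d.elt)) :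
    ‖y‖ ≤ 1 := by
  by_contra hy
  push Not at hy
  have hy0 : y ≠ 0 := by rintro rfl; simp at hy; linarith
  obtain ⟨c, hc, hyc⟩ := norm_lt_one_iff_exists (c := y⁻¹) (by
    rw [norm_inv]; exact inv_lt_one_of_one_lt₀ hy)
  apply d.prim
  have e : (p : ℚ_[p])⁻¹ = c * y := by
    have hp := prime_cast_ne_zero (p := p)
    field_simp at hyc ⊢
    linear_combination hyc
  rw [e, ← smul_smul]
  exact h.smul hc

theorem isO_star_smul {c : ℚ_[p]} {z : LAlg p D} : IsO (c • star z) ↔ IsO (c • z) := by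
  constructor
  · intro h
    have := h.star
    rwa [star_smul_L, star_star] at this
  · intro h
    have := h.star
    rwa [star_smul_L] at this

theorem isInt_repM (d : PrimClass p D) (j : ℕ) : IsInt (mat (repM d j)) := by
  rw [mat_repM]
  refine isInt_embM fun i k => ?_
  fin_cases i <;> fin_cases k
  · exact IsO.smul (by rw [norm_prime_zpow, ← zpow_zero (p : ℝ), zpow_prime_le]; omega) d.isO.star
  · exact isO_zero
  · exact isO_zero
  · exact d.isO

theorem repM_mem_heckeSet (d : PrimClass p D) (j : ℕ) : repM d j ∈ heckeSet p (j + d.cond) :=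
  ⟨isInt_repM d j, by rw [repM, nu_levi, norm_repNu]; push_cast; rfl⟩

theorem symM_single_mul_transpose (y : ℚ_[p]) (t : LAlg p D) :
    symM ![0, 0, y] * (mulMat t)ᵀ = !![0, 0; y * t.im, y * (t.re + coeffB p D * t.im)] := by
  ext i j
  fin_cases i <;> fin_cases j <;> simp [symM, mulMat, Matrix.mul_apply, Fin.sum_univ_two]

/-- Split X into its N-part, given by z ∈ L, and y = `yForm` in the last corner. The top row of the
upper right block forces zd to be integral; subtracting it leaves yd integral, and primitivity of d
makes y integral. Hence χ is trivial on the cosets of the representatives. -/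
theorem isInt_uni_mul_repM {d : PrimClass p D} {j : ℤ} {x : Fin 3 → ℚ_[p]}
    (h : IsInt (mat (uni x * repM d j))) : ‖yForm D x‖ ≤ 1 := by
  set z : LAlg p D := ⟨x 1 - coeffB p D * x 0, x 0⟩ with hz
  have e1 : symM x * (mulMat d.elt)ᵀ = mulMat (z * d.elt) * gramQ p D +
      !![0, 0; yForm D x * d.elt.im, yForm D x * (d.elt.re + coeffB p D * d.elt.im)] := by
    conv_lhs => rw [coord_decomp (D := D) x, ← hz]
    rw [symM_add, Matrix.add_mul, symM_single_mul_transpose, symM_coordN, mulMat_transpose,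
      mulMat_mul]
    simp only [Matrix.mul_assoc]
    rw [← Matrix.mul_assoc (gramQ p D) (gramQi p D), gramQ_mul_gramQi, Matrix.one_mul]
  rw [mat_mul, mat_uni, mat_repM, embM, Matrix.fromBlocks_multiply, isInt_fromBlocks] at h
  have h1 := h.2.1
  simp only [Matrix.of_apply, Matrix.cons_val_zero, Matrix.cons_val_one, Matrix.cons_val',
    Matrix.cons_val_fin_one, mulMat_zero, Matrix.zero_mul, Matrix.mul_zero, zero_add, e1] at h1
  have h00 := h1 0 0
  have h01 := h1 0 1
  simp [mulMat, gramQ] at h00 h01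
  have hO : IsO (z * d.elt) := by
    refine ⟨?_, by simpa using h00⟩
    have := norm_sub_le_of_le h01 (norm_mul_le_one (norm_coeffB_le (D := D)) h00)
    convert this using 2
    simp; ring
  have h2 : IsInt (!![0, 0; yForm D x * d.elt.im, yForm D x * (d.elt.re + coeffB p D * d.elt.im)]) := by
    intro i k
    have := norm_sub_le_of_le (h1 i k) (((isInt_mulMat.2 hO).mul (isInt_gramQ (D := D))) i k)
    rwa [Matrix.add_apply, add_sub_cancel_left] at this
  have h10 : ‖yForm D x * d.elt.im‖ ≤ 1 := h2 1 0
  have h11 : ‖yForm D x * (d.elt.re + coeffB p D * d.elt.im)‖ ≤ 1 := h2 1 1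
  apply d.norm_le_of_smul
  refine ⟨?_, h10⟩
  have := norm_sub_le_of_le h11 (norm_mul_le_one (norm_coeffB_le (D := D)) h10)
  convert this using 2
  rw [QuadraticAlgebra.re_smul, smul_eq_mul]; ring

/-- If the form `yForm` is integral on `latI A ν`, then the row lattice of `A⁻¹` is stable under the
integers of `L`. -/
theorem isInt_conj_of_yForm (hD : Squarefree D) {A : GL (Fin 2) ℚ_[p]} {ν : ℚ_[p]ˣ}
    (hB : IsInt ((ν : ℚ_[p]) • A⁻¹.val)) (h : ∀ x ∈ latI A ν, ‖yForm D x‖ ≤ 1) :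
    IsInt (A⁻¹.val * mulMat (⟨0, 1⟩ : LAlg p D) * A.val) := by
  set B := (ν : ℚ_[p]) • A⁻¹.val with hBdef
  have hν := ν.ne_zero
  have hdet : B.det ≠ 0 := by
    rw [hBdef, Matrix.det_smul]
    exact mul_ne_zero (pow_ne_zero _ hν) (det_ne_zero _)
  set β : LAlg p D := ⟨B 0 0, B 0 1⟩ with hβ
  set σ : LAlg p D := ⟨B 1 0, B 1 1⟩ with hσ
  have hmem : ∀ x, IsInt (symM x * Bᵀ) → ‖yForm D x‖ ≤ 1 := by
    intro x hx
    apply h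
    rw [mem_latI, ← Matrix.mul_smul, ← Matrix.transpose_smul]
    exact hx
  have hΔ : B.det = B 0 0 * B 1 1 - B 0 1 * B 1 0 := Matrix.det_fin_two B
  set Δ := B.det with hΔd
  -- The form is tested on three matrices: ᵗv v/Δ with v orthogonal to one row of B, hence pairing
  -- to ±Δ with the other, and their polarization. The products with ᵗB are integral because B is.
  -- With β, σ the rows of B as elements of L, the values are N(β)/Δ, N(σ)/Δ and Tr(βσ̄)/Δ up to
  -- sign.
  have h1 : ‖Δ⁻¹ * QuadraticAlgebra.norm β‖ ≤ 1 := by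
    have := hmem (Δ⁻¹ • ![B 0 1 * B 0 1, -(B 0 0 * B 0 1), B 0 0 * B 0 0]) (by
      have e : symM (Δ⁻¹ • ![B 0 1 * B 0 1, -(B 0 0 * B 0 1), B 0 0 * B 0 0]) * Bᵀ =
          !![0, -B 0 1; 0, B 0 0] := by
        ext i j
        fin_cases i <;> fin_cases j <;>
          simp [symM, Matrix.mul_apply, Fin.sum_univ_two] <;> field_simp <;>
          first | ring1 | (rw [hΔ]; ring1)
      rw [e, isInt_fin_two]
      simpa using ⟨hB 0 1, hB 0 0⟩)
    rw [yForm_smul, yForm_apply] at this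
    rw [QuadraticAlgebra.norm_def]
    convert this using 3
    simp [hβ]; ring
  have h2 : ‖Δ⁻¹ * QuadraticAlgebra.norm σ‖ ≤ 1 := by
    have := hmem (Δ⁻¹ • ![B 1 1 * B 1 1, -(B 1 0 * B 1 1), B 1 0 * B 1 0]) (by
      have e : symM (Δ⁻¹ • ![B 1 1 * B 1 1, -(B 1 0 * B 1 1), B 1 0 * B 1 0]) * Bᵀ =
          !![B 1 1, 0; -B 1 0, 0] := by
        ext i j
        fin_cases i <;> fin_cases j <;>
          simp [symM, Matrix.mul_apply, Fin.sum_univ_two] <;> field_simp <;>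
          first | ring1 | (rw [hΔ]; ring1)
      rw [e, isInt_fin_two]
      simpa using ⟨hB 1 1, hB 1 0⟩)
    rw [yForm_smul, yForm_apply] at this
    rw [QuadraticAlgebra.norm_def]
    convert this using 3
    simp [hσ]; ring
  have h3 : ‖Δ⁻¹ * QuadraticAlgebra.trace (β * star σ)‖ ≤ 1 := by
    have := hmem (Δ⁻¹ • ![2 * (B 0 1 * B 1 1), -(B 0 1 * B 1 0 + B 0 0 * B 1 1),
        2 * (B 0 0 * B 1 0)]) (by
      have e : symM (Δ⁻¹ • ![2 * (B 0 1 * B 1 1), -(B 0 1 * B 1 0 + B 0 0 * B 1 1),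
        2 * (B 0 0 * B 1 0)]) * Bᵀ = !![B 0 1, -B 1 1; -B 0 0, B 1 0] := by
        ext i j
        fin_cases i <;> fin_cases j <;>
          simp [symM, Matrix.mul_apply, Fin.sum_univ_two] <;> field_simp <;>
          first | ring1 | (rw [hΔ]; ring1)
      rw [e, isInt_fin_two]
      simpa using ⟨hB 0 1, hB 1 1, hB 0 0, hB 1 0⟩)
    rw [yForm_smul, yForm_apply] at this
    rw [QuadraticAlgebra.trace_def]
    convert this using 3
    simp [hβ, hσ]; ring
  -- Norm and trace of βσ̄/Δ are integral, so it lies in the maximal order. The entries of A⁻¹ΩA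
  -- are, up to sign, N(β)/Δ, N(σ)/Δ, the rational part of this element, and b minus that part.
  have hz : IsO (Δ⁻¹ • (β * star σ)) := by
    apply isO_of_norm_trace hD
    · rw [norm_smul_L, map_mul, norm_star_L]
      convert norm_mul_le_one h1 h2 using 2; ring
    · convert h3 using 2
      rw [QuadraticAlgebra.trace_def, QuadraticAlgebra.trace_def, QuadraticAlgebra.re_smul,
        QuadraticAlgebra.im_smul, smul_eq_mul, smul_eq_mul]; ring
  set z := Δ⁻¹ • (β * star σ) with hzd
  have hA1 : A⁻¹.val = (ν : ℚ_[p])⁻¹ • B := by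
    rw [hBdef, smul_smul, inv_mul_cancel₀ hν, one_smul]
  have hA2 : A.val = (ν : ℚ_[p]) • (Δ⁻¹ • B.adjugate) := by
    have h5 : A⁻¹.val * A.val = 1 := by rw [← Units.val_mul]; simp
    have h6 : A⁻¹.val * ((ν : ℚ_[p]) • (Δ⁻¹ • B.adjugate)) = 1 := by
      rw [hA1, Matrix.smul_mul, Matrix.mul_smul, Matrix.mul_smul, Matrix.mul_adjugate, smul_smul,
        smul_smul, smul_smul, inv_mul_cancel₀ hν, one_mul, inv_mul_cancel₀ hdet, one_smul]
    have h7 : A.val * A⁻¹.val = 1 := by rw [← Units.val_mul]; simp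
    calc A.val = A.val * (A⁻¹.val * ((ν : ℚ_[p]) • (Δ⁻¹ • B.adjugate))) := by
          rw [h6, Matrix.mul_one]
      _ = _ := by rw [← Matrix.mul_assoc, h7, Matrix.one_mul]
  have e : A⁻¹.val * mulMat (⟨0, 1⟩ : LAlg p D) * A.val =
      !![coeffB p D - z.re, Δ⁻¹ * QuadraticAlgebra.norm β;
        -(Δ⁻¹ * QuadraticAlgebra.norm σ), z.re] := by
    have e1 : A⁻¹.val * mulMat (⟨0, 1⟩ : LAlg p D) * A.val =
        Δ⁻¹ • (B * mulMat (⟨0, 1⟩ : LAlg p D) * B.adjugate) := by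
      rw [hA1, hA2]
      simp only [Matrix.smul_mul, Matrix.mul_smul, smul_smul]
      congr 1; field_simp
    rw [e1, Matrix.adjugate_fin_two]
    have hb : Δ⁻¹ * (B 0 0 * B 1 1 - B 0 1 * B 1 0) = 1 := by
      rw [← hΔ, inv_mul_cancel₀ hdet]
    ext i j
    fin_cases i <;> fin_cases j <;>
      simp [Matrix.mul_apply, Fin.sum_univ_two, mulMat, QuadraticAlgebra.norm_def, hzd, hβ, hσ]
    · linear_combination coeffB p D * hb
    · left; ring
    · ring
    · left; ring
  rw [e, isInt_fin_two]
  exact ⟨norm_sub_le_of_le norm_coeffB_le hz.1, h1, by simpa using h2, hz.1⟩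

/-- The cosets on which the character is trivial. -/
theorem exists_eq_repM_mul (hD : Squarefree D) {n : ℕ} {A : GL (Fin 2) ℚ_[p]} {ν : ℚ_[p]ˣ}
    (hm : levi A ν ∈ heckeSet p n) (h : ∀ x ∈ latI A ν, ‖yForm D x‖ ≤ 1) :
    ∃ (d : PrimClass p D) (j : ℕ), j + d.cond = n ∧ ∃ k ∈ maxCompact p,
      repM d j = levi A ν * k := by
  have hp := prime_cast_ne_zero (p := p)
  have hm' := hm
  rw [← one_mul (levi A ν), ← uni_zero, uni_mul_levi_mem_heckeSet] at hm'
  obtain ⟨⟨hA, hB⟩, -, hν⟩ := hm'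
  obtain ⟨t, ht, k₁, hk₁, rfl⟩ := eq_mulGL_mul hD (isInt_conj_of_yForm hD hB h)
  obtain ⟨d, j, c, k₂, hk₂, -, e⟩ := levi_eq_repM t ht ν
  have hk₁' : levi k₁ 1 ∈ maxCompact p := levi_mem_maxCompact.2 ⟨hk₁, by simp⟩
  have e2 : levi (mulGL t ht * k₁) ν = scal c * repM d j * (k₂ * levi k₁ 1) := by
    rw [← mul_one ν, levi_mul, e]; group
  have hk := mul_mem hk₂ hk₁'
  set k := k₂ * levi k₁ 1 with hkd
  have hint : scal c * repM d j ∈ heckeSet p n := by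
    have := mul_mem_heckeSet_right (inv_mem hk) hm
    rwa [e2, mul_inv_cancel_right] at this
  have hint' := hint.1
  rw [mat_mul, mat_scal, Matrix.smul_mul, Matrix.one_mul, mat_repM, ← embM_smul, embM,
    isInt_fromBlocks] at hint'
  obtain ⟨i1, -, -, i4⟩ := hint'
  rw [isInt_transpose] at i4
  rw [isInt_mulMat] at i1 i4
  have hc1 : ‖(c : ℚ_[p])‖ ≤ 1 := d.norm_le_of_smul i4
  -- If p divided c, an entry p⁻¹ in the last corner of X would leave the product integral while
  -- `yForm` takes the non-integral value p⁻¹.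
  have hc : ‖(c : ℚ_[p])‖ = 1 := by
    refine le_antisymm hc1 (not_lt.1 fun hlt => ?_)
    obtain ⟨c', hc', hcc⟩ := norm_lt_one_iff_exists hlt
    have h1 : IsInt (mat (uni ![0, 0, (p : ℚ_[p])⁻¹] * (scal c * repM d j))) := by
      rw [mat_mul, mat_uni, mat_mul, mat_scal, Matrix.smul_mul, Matrix.one_mul, mat_repM,
        ← embM_smul, embM, Matrix.fromBlocks_multiply, isInt_fromBlocks]
      have e3 : (c : ℚ_[p]) • !![(p : ℚ_[p]) ^ j • star d.elt, 0; 0, d.elt] =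
          !![(c : ℚ_[p]) • (p : ℚ_[p]) ^ j • star d.elt, 0; 0, (c : ℚ_[p]) • d.elt] := by
        ext1 a b; fin_cases a <;> fin_cases b <;> simp
      rw [e3]
      simp only [Matrix.of_apply, Matrix.cons_val_zero, Matrix.cons_val_one, Matrix.cons_val',
        Matrix.cons_val_fin_one, mulMat_zero, Matrix.zero_mul, Matrix.mul_zero, zero_add, add_zero,
        Matrix.one_mul]
      refine ⟨isInt_mulMat.2 i1, ?_, fun _ _ => by simp, (isInt_mulMat.2 i4).transpose⟩
      rw [symM_single_mul_transpose, isInt_fin_two]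
      have e4 : ∀ y : ℚ_[p], (p : ℚ_[p])⁻¹ * ((c : ℚ_[p]) * y) = c' * y := by
        intro y; rw [hcc]; field_simp
      simp only [Matrix.of_apply, Matrix.cons_val_zero, Matrix.cons_val_one, Matrix.cons_val',
        Matrix.cons_val_fin_one, QuadraticAlgebra.re_smul, QuadraticAlgebra.im_smul, smul_eq_mul,
        norm_zero, zero_le_one, true_and]
      rw [show (c : ℚ_[p]) * d.elt.re + coeffB p D * (c * d.elt.im) =
        c * (d.elt.re + coeffB p D * d.elt.im) by ring, e4, e4]
      exact ⟨norm_mul_le_one hc' d.isO.2, norm_mul_le_one hc'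
        (norm_add_le_of_le d.isO.1 (norm_mul_le_one norm_coeffB_le d.isO.2))⟩
    have h2 : uni ![0, 0, (p : ℚ_[p])⁻¹] * levi (mulGL t ht * k₁) ν ∈ heckeSet p n := by
      rw [e2, ← mul_assoc]
      refine mul_mem_heckeSet_right hk ⟨h1, ?_⟩
      rw [nu_mul, nu_uni, one_mul]
      exact hint.2
    have h3 := h _ (uni_mul_levi_mem_heckeSet.1 h2).2.1
    have h4 : yForm D ![0, 0, (p : ℚ_[p])⁻¹] = (p : ℚ_[p])⁻¹ := by simp [yForm_apply]
    rw [h4, norm_inv, Padic.norm_p, inv_inv] at h3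
    have := one_lt_prime_real (p := p)
    linarith
  have hj : 0 ≤ j := by
    have h1 : IsO ((c : ℚ_[p]) • ((p : ℚ_[p]) ^ j • star d.elt)) := i1
    rw [smul_smul, isO_star_smul] at h1
    have h2 := d.norm_le_of_smul h1
    rw [norm_mul, hc, one_mul, norm_prime_zpow, ← zpow_zero (p : ℝ), zpow_prime_le] at h2
    omega
  lift j to ℕ using hj
  refine ⟨d, j, ?_, k⁻¹ * scal c⁻¹, mul_mem (inv_mem hk) (scal_mem_maxCompact (by
    rw [Units.val_inv_eq_inv_val, norm_inv, hc, inv_one])), ?_⟩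
  · have h1 := nu_levi (mulGL t ht * k₁) ν
    rw [e2, nu_mul, nu_mul, nu_scal, repM, nu_levi] at h1
    rw [← h1, norm_mul, norm_mul, norm_mul, hc, (mem_maxCompact.1 hk).2, norm_repNu] at hν
    simp only [one_mul, mul_one, zpow_prime_inj] at hν
    omega
  · rw [e2, ← mul_assoc, mul_inv_cancel_right, mul_assoc, Subgroup.mem_center_iff.1 (scal_mem c⁻¹),
      ← mul_assoc]
    have : scal c * scal c⁻¹ = 1 := by
      apply mat_injective
      rw [mat_mul, mat_scal, mat_scal, mat_one]; simp [smul_smul]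
    rw [this, one_mul]

end KohnenSkoruppa
end

noncomputable section
namespace KohnenSkoruppa

/-! ### Hecke sums of spherical Whittaker functions -/

variable {p : ℕ} [Fact p.Prime] {D : ℤ}

/-- Spherical functions with trivial central character that transform by `χ` under `U`. -/
structure IsSphericalWhittaker (D : ℤ) (ψ : AddChar ℚ_[p] ℂ) (W : GSp4 p → ℂ) : Prop where
  unip : ∀ x g, W (uni x * g) = ψ (yForm D x) * W g
  cent : ∀ c g, W (scal c * g) = W g
  right : ∀ g, ∀ k ∈ maxCompact p, W (g * k) = W g

/-- If |t| > 1, then ℤ_p t contains p⁻¹ℤ_p and so the element x with ψ(x) ≠ 1. -/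
theorem HasConductorOne.norm_le {ψ : AddChar ℚ_[p] ℂ} (hψ : HasConductorOne ψ) {t : ℚ_[p]}
    (h : ∀ c : ℚ_[p], ‖c‖ ≤ 1 → ψ (c * t) = 1) : ‖t‖ ≤ 1 := by
  by_contra ht
  push Not at ht
  have ht0 : t ≠ 0 := by rintro rfl; simp at ht; linarith
  obtain ⟨x, hx, hx1⟩ := hψ.2
  obtain ⟨m, hm⟩ := norm_eq_zpow ht0
  rw [hm, ← zpow_zero (p : ℝ), zpow_lt_zpow_iff_right₀ one_lt_prime_real] at ht
  apply hx1
  have h1 := h (x * t⁻¹) (by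
    rw [norm_mul, norm_inv, hm, mul_inv_le_iff₀ (zpow_pos prime_real_pos _), one_mul]
    refine hx.trans ?_
    conv_lhs => rw [← zpow_one (p : ℝ)]
    rw [zpow_prime_le]; omega)
  rwa [inv_mul_cancel_right₀ ht0] at h1

theorem smul_mem_latI {A : GL (Fin 2) ℚ_[p]} {ν c : ℚ_[p]} {x : Fin 3 → ℚ_[p]} (hc : ‖c‖ ≤ 1)
    (hx : x ∈ latI A ν) : c • x ∈ latI A ν := by
  rw [mem_latI] at *
  rw [symM_smul, Matrix.smul_mul, smul_comm]
  exact hx.smul hc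

/-- The lattice is a ℤ_p-module, so triviality of ψ at a value of `yForm` holds on all ℤ_p-multiples
of it. -/
theorem trivial_on_latI_iff {ψ : AddChar ℚ_[p] ℂ} (hψ : HasConductorOne ψ)
    {A : GL (Fin 2) ℚ_[p]} {ν : ℚ_[p]} :
    (∀ x ∈ latI A ν, ψ (yForm D x) = 1) ↔ ∀ x ∈ latI A ν, ‖yForm D x‖ ≤ 1 := by
  constructor
  · intro h x hx
    refine hψ.norm_le fun c hc => ?_
    rw [← yForm_smul]
    exact h _ (smul_mem_latI hc hx)
  · exact fun h x hx => hψ.1 _ (h x hx)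

theorem levi_coset {x : Fin 3 → ℚ_[p]} {A B : GL (Fin 2) ℚ_[p]} {ν μ : ℚ_[p]ˣ} {k : GSp4 p}
    (hk : k ∈ maxCompact p) (h : levi A ν = uni x * levi B μ * k) :
    ∃ k' ∈ maxCompact p, levi A ν = levi B μ * k' := by
  obtain ⟨h1, h2⟩ := of_levi_eq hk h
  refine ⟨levi (B⁻¹ * A) (μ⁻¹ * ν), levi_mem_maxCompact.2 ⟨h1, ?_⟩, ?_⟩
  · rw [Units.val_mul, Units.val_inv_eq_inv_val, norm_mul, norm_inv, h2,
      inv_mul_cancel₀ (norm_ne_zero_iff.2 μ.ne_zero)]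
  · rw [← levi_mul, mul_inv_cancel_left, mul_inv_cancel_left]

variable (p D) in
/-- The representatives with similitude of valuation `n`. -/
abbrev RepIdx (n : ℕ) : Type := {x : PrimClass p D × ℕ // x.2 + x.1.cond = n}

theorem exists_hermIdx_repM {n : ℕ} (x : RepIdx p D n) :
    ∃ r : hermIdx p n, ∃ k ∈ maxCompact p, repM x.1.1 x.1.2 = hermM p n r * k := by
  have h := repM_mem_heckeSet x.1.1 x.1.2
  rw [x.2] at h
  obtain ⟨r, hr, y, -, k, hk, e⟩ := exists_hermIdx h
  obtain ⟨k', hk', e'⟩ := levi_coset hk e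
  exact ⟨⟨r, hr⟩, k', hk', e'⟩

/-- The index of the Hermite matrix in the coset of a representative. -/
def repHerm {n : ℕ} (x : RepIdx p D n) : hermIdx p n := (exists_hermIdx_repM x).choose

theorem repHerm_spec {n : ℕ} (x : RepIdx p D n) :
    ∃ k ∈ maxCompact p, repM x.1.1 x.1.2 = hermM p n (repHerm x) * k :=
  (exists_hermIdx_repM x).choose_spec

theorem repHerm_injective {n : ℕ} :
    Function.Injective (repHerm : RepIdx p D n → hermIdx p n) := by
  intro x y h
  obtain ⟨k, hk, e⟩ := repHerm_spec x
  obtain ⟨k', hk', e'⟩ := repHerm_spec y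
  rw [← h] at e'
  have h1 : repM x.1.1 x.1.2 = uni 0 * scal 1 * repM y.1.1 y.1.2 * (k'⁻¹ * k) := by
    have : (scal 1 : GSp4 p) = 1 := mat_injective (by rw [mat_scal, mat_one]; simp)
    rw [e, e', uni_zero, this]; group
  obtain ⟨h2, h3⟩ := repM_disjoint (mul_mem (inv_mem hk') hk) h1
  exact Subtype.ext (Prod.ext h2 (by exact_mod_cast h3))

instance (n : ℕ) : Finite (RepIdx p D n) := Finite.of_injective _ repHerm_injective

instance (n : ℕ) : Fintype (RepIdx p D n) := Fintype.ofFinite _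

/-- A crude count of Hermite matrices: at most (n + 1)² pairs (a, b), and x < p^a ≤ p^n. Any
exponential bound suffices for convergence. -/
theorem card_RepIdx_le (n : ℕ) : Fintype.card (RepIdx p D n) ≤ (n + 1) ^ 2 * p ^ n := by
  refine (Fintype.card_le_of_injective _ repHerm_injective).trans ?_
  rw [Fintype.card_coe, hermIdx, Finset.card_sigma]
  refine (Finset.sum_le_card_nsmul _ _ (p ^ n) fun ab hab => ?_).trans ?_
  · refine (Finset.card_filter_le _ _).trans ?_
    rw [Finset.card_range]
    rw [Finset.mem_product, Finset.mem_range] at hab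
    exact Nat.pow_le_pow_right (Fact.out : p.Prime).pos (by omega)
  · rw [Finset.card_product, Finset.card_range, smul_eq_mul, sq]

/-- Both lattices attached to a Levi element depend only on its coset modulo `K`. -/
theorem lat_congr {n : ℕ} {A B : GL (Fin 2) ℚ_[p]} {ν μ : ℚ_[p]ˣ} {k : GSp4 p}
    (hk : k ∈ maxCompact p) (h : levi A ν = levi B μ * k) (hA : levi A ν ∈ heckeSet p n) :
    latM A (ν : ℚ_[p]) = latM B μ ∧ latI A (ν : ℚ_[p]) = latI B μ := by
  have hB : levi B μ ∈ heckeSet p n := by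
    have := mul_mem_heckeSet_right (inv_mem hk) hA
    rwa [h, mul_inv_cancel_right] at this
  have key : ∀ {A : GL (Fin 2) ℚ_[p]} {ν : ℚ_[p]ˣ} (_ : levi A ν ∈ heckeSet p n) (x),
      x ∈ latI A (ν : ℚ_[p]) ↔ uni x * levi A ν ∈ heckeSet p n := by
    intro A ν hA x
    rw [← one_mul (levi A ν), ← uni_zero, uni_mul_levi_mem_heckeSet] at hA
    rw [uni_mul_levi_mem_heckeSet]
    exact ⟨fun h => ⟨hA.1, h, hA.2.2⟩, fun h => h.2.1⟩
  constructor
  · ext x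
    rw [← conj_mem_maxCompact_iff, ← conj_mem_maxCompact_iff, h]
    rw [show (levi B μ * k)⁻¹ * uni x * (levi B μ * k) = k⁻¹ * ((levi B μ)⁻¹ * uni x * levi B μ) * k
      by group, Subgroup.mul_mem_cancel_right _ hk, Subgroup.mul_mem_cancel_left _ (inv_mem hk)]
  · ext x
    rw [key hA, key hB, h, ← mul_assoc]
    constructor
    · intro h1
      have := mul_mem_heckeSet_right (inv_mem hk) h1
      rwa [mul_inv_cancel_right] at this
    · exact fun h1 => mul_mem_heckeSet_right hk h1

/-- The largest entry of the matrix of p^j d̄ has norm p^{-j} by primitivity and the determinant has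
norm p^{-(2j+c)}, where c = `d.cond`. With n = j + c the exponent 3j + c is the n + 2j of the Hecke
sum. -/
theorem relIndex_repA (d : PrimClass p D) (j : ℕ) :
    ((latM (repA d j) (repNu d j : ℚ_[p])).relIndex (latI (repA d j) (repNu d j : ℚ_[p])) : ℝ) =
      (p : ℝ) ^ (3 * j + d.cond) := by
  have hpp : (0 : ℝ) < p := prime_real_pos
  have hv : (repA d j).val = (p : ℚ_[p]) ^ (j : ℤ) • mulMat (star d.elt) := by
    rw [repA, mulGL_val, mulMat_smul]
  have hnorm : ∀ i k, ‖(repA d j).val i k‖ = (p : ℝ) ^ (-(j : ℤ)) * ‖mulMat (star d.elt) i k‖ := by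
    intro i k
    rw [hv, Matrix.smul_apply, smul_eq_mul, norm_mul, norm_prime_zpow]
  have hint := isInt_mulMat.2 d.isO.star
  have hpj : (0 : ℝ) < (p : ℝ) ^ (-(j : ℤ)) := zpow_pos hpp _
  rw [relIndex_latM_latI (repNu d j).ne_zero (r := (p : ℝ) ^ (-(j : ℤ)))
    (by rw [← zpow_zero (p : ℝ), zpow_prime_le]; omega)
    (fun i k => by rw [hnorm]; exact mul_le_of_le_one_right hpj.le (hint i k)) (by
      by_contra hne
      push Not at hne
      have h1 : ∀ i k, ‖mulMat (star d.elt) i k‖ < 1 := fun i k =>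
        lt_of_le_of_ne (hint i k) fun h => hne i k (by rw [hnorm, h, mul_one])
      have h2 : ∀ x : ℚ_[p], ‖x‖ < 1 → ‖(p : ℚ_[p])⁻¹ * x‖ ≤ 1 := by
        intro x hx
        obtain ⟨c, hc, rfl⟩ := norm_lt_one_iff_exists hx
        rwa [inv_mul_cancel_left₀ prime_cast_ne_zero]
      exact d.prim (isO_star_smul.1 ⟨h2 _ (h1 0 0), h2 _ (h1 0 1)⟩)), norm_det_repA, ← zpow_neg,
    ← zpow_neg, ← zpow_add₀ hpp.ne', ← zpow_natCast]
  congr 1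
  push_cast; ring

/-- The Hecke sum of a spherical Whittaker function. -/
theorem IsSphericalWhittaker.sum_heckeRep (hD : Squarefree D) {ψ : AddChar ℚ_[p] ℂ}
    (hψ : HasConductorOne ψ) {W : GSp4 p → ℂ} (hW : IsSphericalWhittaker D ψ W) (n : ℕ) :
    ∑ h, W (heckeRep n h) =
      ∑ x : RepIdx p D n, (p : ℂ) ^ (n + 2 * x.1.2) * W (repM x.1.1 x.1.2) := by
  classical
  rw [KohnenSkoruppa.sum_heckeRep hW.right hW.unip, ← Finset.sum_filter, ← Finset.sum_coe_sort]
  symm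
  have hgood : ∀ x : RepIdx p D n, ∀ y ∈ latI (hermA p (repHerm x)) ((pUnit p ^ n : ℚ_[p]ˣ) : ℚ_[p]),
      ψ (yForm D y) = 1 := by
    intro x
    rw [trivial_on_latI_iff hψ]
    intro y hy
    obtain ⟨k, hk, e⟩ := repHerm_spec x
    apply isInt_uni_mul_repM (d := x.1.1) (j := x.1.2)
    rw [e, ← mul_assoc]
    exact (mul_mem_heckeSet_right hk (uni_mul_hermM_mem _ hy)).1
  -- The Hermite matrices on whose lattice χ is trivial correspond to the representatives with j +
  -- c(d) = n: `hgood` gives one direction and `exists_eq_repM_mul` the other.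
  refine Finset.sum_bij (fun x _ => (⟨repHerm x, Finset.mem_filter.2 ⟨(repHerm x).2, hgood x⟩⟩ :
    {r // r ∈ (hermIdx p n).filter _})) (fun _ _ => Finset.mem_univ _) ?_ ?_ ?_
  · intro x _ y _ h
    exact repHerm_injective (Subtype.ext (congrArg (fun r => r.1) h))
  · rintro ⟨r, hr⟩ -
    obtain ⟨hr1, hr2⟩ := Finset.mem_filter.1 hr
    rw [trivial_on_latI_iff hψ] at hr2
    obtain ⟨d, j, hdj, k, hk, e⟩ := exists_eq_repM_mul hD (hermM_mem n ⟨r, hr1⟩) hr2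
    refine ⟨⟨(d, j), hdj⟩, Finset.mem_univ _, Subtype.ext ?_⟩
    obtain ⟨k', hk', e'⟩ := repHerm_spec (⟨(d, j), hdj⟩ : RepIdx p D n)
    refine hermA_injective (repHerm _).2 hr1 ?_
    have e2 : hermM p n (repHerm ⟨(d, j), hdj⟩) = uni 0 * hermM p n r * (k * k'⁻¹) := by
      rw [uni_zero, one_mul, eq_comm, ← mul_assoc, mul_inv_eq_iff_eq_mul, ← e']
      exact e.symm
    exact (of_levi_eq (mul_mem hk (inv_mem hk')) e2).1
  · intro x _
    obtain ⟨k, hk, e⟩ := repHerm_spec x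
    have hmem := repM_mem_heckeSet x.1.1 x.1.2
    obtain ⟨e1, e2⟩ := lat_congr hk e hmem
    have h1 := relIndex_repA x.1.1 x.1.2
    rw [e1, e2, relIndex_hermA _ (pUnit p ^ n).ne_zero] at h1
    have h2 : p ^ ((repHerm x).1.1.1 + (repHerm x).1.1.2) *
        (repHerm x).1.2.gcd (p ^ min (repHerm x).1.1.1 (repHerm x).1.1.2) = p ^ (n + 2 * x.1.2) := by
      have h3 : n + 2 * x.1.2 = 3 * x.1.2 + x.1.1.cond := by have := x.2; omega
      rw [h3]
      exact_mod_cast h1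
    rw [e, hW.right _ _ hk]
    congr 1
    exact_mod_cast h2.symm

end KohnenSkoruppa
end

noncomputable section
namespace KohnenSkoruppa

/-! ### Generating series -/

/-- A series whose terms satisfy a linear recurrence with a summable inhomogeneity. -/
theorem hasSum_of_recurrence {f g : ℕ → ℂ} {r : ℂ} (hr : ‖r‖ < 1) (s : ℕ)
    (h0 : ∀ n < s, f n = g n) (hs : ∀ n, f (n + s) = r * f n + g (n + s))
    (hg : Summable fun n => ‖g n‖) :
    (Summable fun n => ‖f n‖) ∧ HasSum f ((∑' n, g n) / (1 - r)) := by
  have h1r : 0 < 1 - ‖r‖ := by linarith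
  have hsum : Summable fun n => ‖f (n + s)‖ := by
    -- The N-th partial sum S of the shifted series satisfies S ≤ |r| (head + S) + const, which can
    -- be solved for S because |r| < 1.
    refine summable_of_sum_range_le (c := (‖r‖ * ∑ n ∈ Finset.range s, ‖f n‖ + ∑' n, ‖g (n + s)‖) /
      (1 - ‖r‖)) (fun n => norm_nonneg _) fun N => ?_
    rw [le_div_iff₀ h1r]
    have a1 : ∑ n ∈ Finset.range N, ‖f (n + s)‖ ≤
        ‖r‖ * ∑ n ∈ Finset.range N, ‖f n‖ + ∑ n ∈ Finset.range N, ‖g (n + s)‖ := by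
      rw [Finset.mul_sum, ← Finset.sum_add_distrib]
      refine Finset.sum_le_sum fun n _ => ?_
      rw [hs, ← norm_mul]
      exact norm_add_le _ _
    have a2 : ∑ n ∈ Finset.range N, ‖g (n + s)‖ ≤ ∑' n, ‖g (n + s)‖ :=
      ((summable_nat_add_iff s).2 hg).sum_le_tsum _ fun n _ => norm_nonneg _
    have a3 : ∑ n ∈ Finset.range N, ‖f n‖ ≤ ∑ n ∈ Finset.range s, ‖f n‖ +
        ∑ n ∈ Finset.range N, ‖f (n + s)‖ := by
      refine (Finset.sum_le_sum_of_subset_of_nonneg (Finset.range_subset_range.2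
        (Nat.le_add_left N s)) fun _ _ _ => norm_nonneg _).trans ?_
      rw [Finset.sum_range_add]
      simp only [add_comm s, le_refl]
    have a4 := mul_le_mul_of_nonneg_left a3 (norm_nonneg r)
    linarith
  have hf : Summable fun n => ‖f n‖ := (summable_nat_add_iff s).1 hsum
  refine ⟨hf, ?_⟩
  have hf' : Summable f := hf.of_norm
  have hg' : Summable g := hg.of_norm
  have e1 := hf'.sum_add_tsum_nat_add s
  have e2 := hg'.sum_add_tsum_nat_add s
  have e3 : ∑' n, f (n + s) = r * ∑' n, f n + ∑' n, g (n + s) := by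
    rw [tsum_congr hs, Summable.tsum_add (hf'.mul_left r) ((summable_nat_add_iff s).2 hg'),
      tsum_mul_left]
  have e4 : ∑ n ∈ Finset.range s, f n = ∑ n ∈ Finset.range s, g n :=
    Finset.sum_congr rfl fun n hn => h0 n (Finset.mem_range.1 hn)
  have hne : 1 - r ≠ 0 := by
    intro h
    rw [sub_eq_zero] at h
    rw [← h, norm_one] at hr
    exact lt_irrefl _ hr
  have e5 : ∑' n, f n = (∑' n, g n) / (1 - r) := by
    rw [eq_div_iff hne]
    linear_combination -e1 + e2 + e3 + e4
  rw [← e5]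
  exact hf'.hasSum

/-- For the partial sums U_n, V_n of the two geometric series, U_{n+1} = 1 + xU_n gives
U_{n+1}V_{n+1} = xy U_nV_n + U_{n+1} + V_{n+1} - 1, a linear recurrence of ratio xyY after weighting
by Y^n. -/
theorem geometric_pair {x y Y : ℂ} (hY : ‖Y‖ < 1) (hx : ‖x * Y‖ < 1) (hy : ‖y * Y‖ < 1)
    (hxy : ‖x * y * Y‖ < 1) :
    (Summable fun n : ℕ => ‖(∑ a ∈ Finset.range (n + 1), x ^ a) *
      (∑ b ∈ Finset.range (n + 1), y ^ b) * Y ^ n‖) ∧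
    HasSum (fun n : ℕ => (∑ a ∈ Finset.range (n + 1), x ^ a) *
      (∑ b ∈ Finset.range (n + 1), y ^ b) * Y ^ n) ((1 - x * y * Y ^ 2) *
        ((1 - Y)⁻¹ * (1 - x * Y)⁻¹ * (1 - y * Y)⁻¹ * (1 - x * y * Y)⁻¹)) := by
  have hne : ∀ {r : ℂ}, ‖r‖ < 1 → 1 - r ≠ 0 := by
    intro r hr h
    rw [sub_eq_zero] at h
    rw [← h, norm_one] at hr
    exact lt_irrefl _ hr
  have hgeo : ∀ {r : ℂ}, ‖r‖ < 1 → Summable fun n : ℕ => ‖r ^ n‖ := fun {r} hr => by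
    simpa using summable_geometric_of_lt_one (norm_nonneg r) hr
  have hU : ∀ x : ℂ, ‖x * Y‖ < 1 →
      (Summable fun n : ℕ => ‖(∑ a ∈ Finset.range (n + 1), x ^ a) * Y ^ n‖) ∧
      HasSum (fun n : ℕ => (∑ a ∈ Finset.range (n + 1), x ^ a) * Y ^ n)
        ((1 - x * Y)⁻¹ / (1 - Y)) := by
    intro x hx
    rw [← tsum_geometric_of_norm_lt_one hx]
    refine hasSum_of_recurrence hY 1 ?_ ?_ (hgeo hx)
    · intro n hn
      obtain rfl : n = 0 := by omega
      simp
    · intro n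
      rw [Finset.sum_range_succ _ (n + 1)]
      ring
  obtain ⟨u1, u2⟩ := hU x hx
  obtain ⟨v1, v2⟩ := hU y hy
  have hg : HasSum (fun n : ℕ => (∑ a ∈ Finset.range (n + 1), x ^ a) * Y ^ n +
      (∑ a ∈ Finset.range (n + 1), y ^ a) * Y ^ n - Y ^ n) _ :=
    (u2.add v2).sub (hasSum_geometric_of_norm_lt_one hY)
  have hgn : Summable fun n : ℕ => ‖(∑ a ∈ Finset.range (n + 1), x ^ a) * Y ^ n +
      (∑ a ∈ Finset.range (n + 1), y ^ a) * Y ^ n - Y ^ n‖ :=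
    Summable.of_nonneg_of_le (fun n => norm_nonneg _) (fun n => (norm_sub_le _ _).trans
      (add_le_add (norm_add_le _ _) le_rfl)) ((u1.add v1).add (hgeo hY))
  have key := hasSum_of_recurrence (f := fun n : ℕ => (∑ a ∈ Finset.range (n + 1), x ^ a) *
    (∑ b ∈ Finset.range (n + 1), y ^ b) * Y ^ n) hxy 1 (by
      intro n hn
      obtain rfl : n = 0 := by omega
      simp) (by
      intro n
      have ex := Finset.sum_range_succ' (fun a => x ^ a) (n + 1)
      have ey := Finset.sum_range_succ' (fun a => y ^ a) (n + 1)
      simp only [pow_succ, pow_zero, ← Finset.sum_mul] at ex ey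
      simp only [pow_succ, ex, ey]
      ring) hgn
  refine ⟨key.1, ?_⟩
  have h2 := key.2
  rw [hg.tsum_eq] at h2
  convert h2 using 1
  have a1 := hne hY
  have a2 := hne hx
  have a3 := hne hy
  have a4 := hne hxy
  field_simp
  ring

/-- The distance of `(a, b)` from the boundary of the square `[0, n]²`. -/
def boundaryDist (n a b : ℕ) : ℕ := min (min a b) (min (n - a) (n - b))

/-- The boundary of the square contributes nothing. Its interior is a square with side shorter by
two, where the distance to the boundary is one less. -/
theorem sum_boundaryDist_succ_succ (x y : ℂ) (n : ℕ) :
    ∑ a ∈ Finset.range (n + 3), ∑ b ∈ Finset.range (n + 3), x ^ a * y ^ b * boundaryDist (n + 2) a b =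
      x * y * ∑ a ∈ Finset.range (n + 1), ∑ b ∈ Finset.range (n + 1),
        x ^ a * y ^ b * (boundaryDist n a b + 1) := by
  rw [Finset.sum_range_succ, Finset.sum_range_succ', Finset.mul_sum]
  have e1 : ∑ b ∈ Finset.range (n + 3), x ^ (n + 2) * y ^ b *
      (boundaryDist (n + 2) (n + 2) b : ℂ) = 0 :=
    Finset.sum_eq_zero fun b _ => by simp [boundaryDist]
  have e2 : ∑ b ∈ Finset.range (n + 3), x ^ 0 * y ^ b * (boundaryDist (n + 2) 0 b : ℂ) = 0 :=
    Finset.sum_eq_zero fun b _ => by simp [boundaryDist]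
  rw [e1, e2, add_zero, add_zero]
  refine Finset.sum_congr rfl fun a ha => ?_
  rw [Finset.sum_range_succ, Finset.sum_range_succ', Finset.mul_sum]
  have e3 : boundaryDist (n + 2) (a + 1) (n + 2) = 0 := by simp [boundaryDist]
  have e4 : boundaryDist (n + 2) (a + 1) 0 = 0 := by simp [boundaryDist]
  rw [e3, e4, Nat.cast_zero, mul_zero, mul_zero, add_zero, add_zero]
  refine Finset.sum_congr rfl fun b hb => ?_
  rw [Finset.mem_range] at ha hb
  have e5 : boundaryDist (n + 2) (a + 1) (b + 1) = boundaryDist n a b + 1 := by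
    unfold boundaryDist; omega
  rw [e5]
  push_cast
  ring

/-- Let d and m be the series without and with the weight `boundaryDist`. By the previous lemma
m_{n+2} = xyY²(d_n + m_n), so Σ(d + m) = Σd / (1 - xyY²). The numerator 1 - xyY² of Σd cancels, and
Σ(d + cm) has numerator 1 - (1 - c)xyY². -/
theorem hasSum_boundaryDist {x y Y c : ℂ} (hY : ‖Y‖ < 1) (hx : ‖x * Y‖ < 1) (hy : ‖y * Y‖ < 1)
    (hxy : ‖x * y * Y‖ < 1) :
    HasSum (fun n : ℕ => (∑ a ∈ Finset.range (n + 1), ∑ b ∈ Finset.range (n + 1),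
      x ^ a * y ^ b * (1 + c * boundaryDist n a b)) * Y ^ n) ((1 - (1 - c) * (x * y * Y ^ 2)) *
        ((1 - Y)⁻¹ * (1 - x * Y)⁻¹ * (1 - y * Y)⁻¹ * (1 - x * y * Y)⁻¹)) := by
  obtain ⟨d1, d2⟩ := geometric_pair hY hx hy hxy
  have hr : ‖x * y * Y ^ 2‖ < 1 := by
    rw [sq, ← mul_assoc, norm_mul]
    exact mul_lt_one_of_nonneg_of_lt_one_left (norm_nonneg _) hxy hY.le
  have hne : 1 - x * y * Y ^ 2 ≠ 0 := by
    intro h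
    rw [sub_eq_zero] at h
    rw [← h, norm_one] at hr
    exact lt_irrefl _ hr
  set d : ℕ → ℂ := fun n => (∑ a ∈ Finset.range (n + 1), x ^ a) *
      (∑ b ∈ Finset.range (n + 1), y ^ b) * Y ^ n with hd
  have hdsum : ∀ n, d n = (∑ a ∈ Finset.range (n + 1), ∑ b ∈ Finset.range (n + 1), x ^ a * y ^ b) *
      Y ^ n := fun n => by rw [hd]; simp only [Finset.sum_mul_sum]
  set m : ℕ → ℂ := fun n => (∑ a ∈ Finset.range (n + 1), ∑ b ∈ Finset.range (n + 1),
    x ^ a * y ^ b * boundaryDist n a b) * Y ^ n with hm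
  have hm0 : ∀ n < 2, m n = 0 := by
    intro n hn
    rw [hm]
    dsimp only
    rw [Finset.sum_eq_zero, zero_mul]
    intro a ha
    refine Finset.sum_eq_zero fun b hb => ?_
    rw [Finset.mem_range] at ha hb
    have : boundaryDist n a b = 0 := by unfold boundaryDist; omega
    rw [this]; simp
  have key := hasSum_of_recurrence (f := fun n => d n + m n) (g := d) hr 2
    (fun n hn => by rw [hm0 n hn, add_zero]) (fun n => by
      have h1 : m (n + 2) = x * y * Y ^ 2 * (d n + m n) := by
        rw [hdsum n]
        simp only [hm]
        rw [sum_boundaryDist_succ_succ, ← add_mul, ← Finset.sum_add_distrib]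
        simp only [← Finset.sum_add_distrib, mul_add, mul_one]
        simp only [add_comm (x ^ _ * y ^ _)]
        ring
      rw [h1]; ring) d1
  have hms := d2.add ((key.2.sub d2).mul_left c)
  rw [d2.tsum_eq] at hms
  convert hms using 1
  · funext n
    rw [add_sub_cancel_left, hdsum]
    simp only [hm]
    rw [← mul_assoc, ← add_mul, Finset.mul_sum, ← Finset.sum_add_distrib]
    refine congrArg (· * Y ^ n) (Finset.sum_congr rfl fun a _ => ?_)
    rw [Finset.mul_sum, ← Finset.sum_add_distrib]
    exact Finset.sum_congr rfl fun b _ => by ring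
  · rw [mul_div_cancel_left₀ _ hne]
    ring

end KohnenSkoruppa
end

noncomputable section
namespace KohnenSkoruppa

/-! ### The Hecke eigenvalues -/

variable {p : ℕ} [Fact p.Prime] {D : ℤ}

theorem card_multiples_range {m a : ℕ} (hm : m ≤ a) :
    ((Finset.range (p ^ a)).filter fun x => p ^ m ∣ x).card = p ^ (a - m) := by
  have hp := (Fact.out : p.Prime).pos
  have h : (Finset.range (p ^ a)).filter (fun x => p ^ m ∣ x) =
      (Finset.range (p ^ (a - m))).image fun y => p ^ m * y := by
    ext x
    simp only [Finset.mem_filter, Finset.mem_range, Finset.mem_image]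
    have e : p ^ a = p ^ m * p ^ (a - m) := by rw [← pow_add, Nat.add_sub_cancel' hm]
    constructor
    · rintro ⟨h1, y, rfl⟩
      rw [e] at h1
      exact ⟨y, Nat.lt_of_mul_lt_mul_left h1, rfl⟩
    · rintro ⟨y, h1, rfl⟩
      rw [e]
      exact ⟨Nat.mul_lt_mul_of_pos_left h1 (pow_pos hp m), dvd_mul_right _ _⟩
  rw [h, Finset.card_image_of_injective _ (fun x y hxy => Nat.eq_of_mul_eq_mul_left
    (pow_pos hp m) hxy), Finset.card_range]

theorem gcd_prime_pow_succ (x l : ℕ) :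
    (x.gcd (p ^ (l + 1)) : ℂ) = x.gcd (p ^ l) +
      if p ^ (l + 1) ∣ x then (p : ℂ) ^ (l + 1) - (p : ℂ) ^ l else 0 := by
  have hp := (Fact.out : p.Prime)
  split_ifs with h
  · rw [Nat.gcd_eq_right h, Nat.gcd_eq_right ((pow_dvd_pow p (Nat.le_succ l)).trans h)]
    push_cast; ring
  · rw [add_zero]
    congr 1
    apply Nat.dvd_antisymm
    · obtain ⟨m, hm, e⟩ := (Nat.dvd_prime_pow hp).1 (Nat.gcd_dvd_right x (p ^ (l + 1)))
      have h1 : m ≠ l + 1 := by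
        rintro rfl
        exact h (e ▸ Nat.gcd_dvd_left x (p ^ (l + 1)))
      exact Nat.dvd_gcd (Nat.gcd_dvd_left _ _) (e ▸ pow_dvd_pow p (by omega))
    · exact Nat.gcd_dvd_gcd_of_dvd_right _ (pow_dvd_pow p (Nat.le_succ l))

/-- Raising the exponent from l to l + 1 increases the gcd by p^{l+1} - p^l exactly on the multiples
of p^{l+1}, of which there are p^{a-l-1}; each step adds p^a(1 - 1/p). -/
theorem sum_gcd_prime_pow {k a : ℕ} (m : ℕ) (hm : k + m ≤ a) :
    ∑ x ∈ (Finset.range (p ^ a)).filter (fun x => p ^ k ∣ x), (x.gcd (p ^ (k + m)) : ℂ) =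
      (p : ℂ) ^ a * (1 + (1 - (p : ℂ)⁻¹) * m) := by
  have hp0 : (p : ℂ) ≠ 0 := by exact_mod_cast (Fact.out : p.Prime).ne_zero
  induction m with
  | zero =>
    have : ∀ x ∈ (Finset.range (p ^ a)).filter (fun x => p ^ k ∣ x),
        (x.gcd (p ^ (k + 0)) : ℂ) = (p : ℂ) ^ k := by
      intro x hx
      rw [add_zero, Nat.gcd_eq_right (Finset.mem_filter.1 hx).2]
      push_cast; rfl
    rw [Finset.sum_congr rfl this, Finset.sum_const, card_multiples_range (by omega), nsmul_eq_mul]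
    push_cast
    rw [← pow_add, Nat.sub_add_cancel (by omega)]
    ring
  | succ m ih =>
    simp only [← add_assoc, gcd_prime_pow_succ]
    rw [Finset.sum_add_distrib, ih (by omega), ← Finset.sum_filter, Finset.filter_filter]
    have : (Finset.range (p ^ a)).filter (fun x => p ^ k ∣ x ∧ p ^ (k + m + 1) ∣ x) =
        (Finset.range (p ^ a)).filter fun x => p ^ (k + m + 1) ∣ x := by
      apply Finset.filter_congr
      intro x _
      exact ⟨fun h => h.2, fun h => ⟨(pow_dvd_pow p (by omega)).trans h, h⟩⟩
    rw [this, Finset.sum_const, card_multiples_range (by omega), nsmul_eq_mul]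
    push_cast
    have e : (p : ℂ) ^ a = (p : ℂ) ^ (a - (k + m + 1)) * (p : ℂ) ^ (k + m + 1) := by
      rw [← pow_add, Nat.sub_add_cancel (by omega)]
    rw [e, pow_succ _ (k + m)]
    field_simp
    ring

theorem pow_dvd_mul_pow_iff {n s x : ℕ} : p ^ s ∣ x * p ^ n ↔ p ^ (s - n) ∣ x := by
  rcases le_total s n with h | h
  · rw [Nat.sub_eq_zero_of_le h, pow_zero]
    exact ⟨fun _ => one_dvd _, fun _ => (pow_dvd_pow p h).trans (dvd_mul_left _ _)⟩
  · conv_lhs => rw [← Nat.sub_add_cancel h, pow_add]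
    exact Nat.mul_dvd_mul_iff_right (pow_pos (Fact.out : p.Prime).pos n)

/-- The condition means p^{a+b-n} | x with truncated subtraction, and min(a, b) exceeds this
exponent by the distance of (a, b) from the boundary of [0, n]². This is where `boundaryDist` enters
the eigenvalue. -/
theorem sum_gcd_hermite {n a b : ℕ} (ha : a ≤ n) (hb : b ≤ n) :
    ∑ x ∈ (Finset.range (p ^ a)).filter (fun x => p ^ (a + b) ∣ x * p ^ n),
      (x.gcd (p ^ min a b) : ℂ) = (p : ℂ) ^ a * (1 + (1 - (p : ℂ)⁻¹) * boundaryDist n a b) := by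
  have e : min a b = a + b - n + boundaryDist n a b := by unfold boundaryDist; omega
  simp only [pow_dvd_mul_pow_iff]
  rw [e]
  exact sum_gcd_prime_pow _ (by unfold boundaryDist; omega)

theorem diagB_mul (x y c x' y' c' : ℚ_[p]ˣ) :
    diagB (x * x') (y * y') (c * c') = diagB x y c * diagB x' y' c' := by
  apply Subtype.ext
  apply mat_injective
  change Matrix.diagonal _ = Matrix.diagonal _ * Matrix.diagonal _
  rw [Matrix.diagonal_mul_diagonal]
  congr 1
  ext i
  rcases i with i | i <;> fin_cases i <;> simp <;> ring

theorem UnramifiedCharacter.toHom_diagB_mul (α : UnramifiedCharacter p) (x y c x' y' c' : ℚ_[p]ˣ) :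
    α.toHom (diagB (x * x') (y * y') (c * c')) =
      α.toHom (diagB x y c) * α.toHom (diagB x' y' c') := by
  rw [diagB_mul, map_mul]

/-- The values of an unramified character on the standard generators of the torus. -/
def UnramifiedCharacter.param (α : UnramifiedCharacter p) : Fin 3 → ℂ :=
  ![(α.toHom (diagB 1 1 (pUnit p)) : ℂ), (α.toHom (diagB (pUnit p) 1 1) : ℂ),
    (α.toHom (diagB 1 (pUnit p) 1) : ℂ)]

theorem UnramifiedCharacter.toHom_diagB (α : UnramifiedCharacter p) (a b n : ℕ) :
    (α.toHom (diagB (pUnit p ^ a) (pUnit p ^ b) (pUnit p ^ n)) : ℂ) =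
      α.param 0 ^ n * α.param 1 ^ a * α.param 2 ^ b := by
  let f : ℚ_[p]ˣ × ℚ_[p]ˣ × ℚ_[p]ˣ →* ℂˣ :=
    MonoidHom.mk' (fun t => α.toHom (diagB t.1 t.2.1 t.2.2)) fun s t =>
      α.toHom_diagB_mul _ _ _ _ _ _
  have h : f (pUnit p ^ a, pUnit p ^ b, pUnit p ^ n) =
      f (1, 1, pUnit p) ^ n * f (pUnit p, 1, 1) ^ a * f (1, pUnit p, 1) ^ b := by
    rw [← map_pow, ← map_pow, ← map_pow, ← map_mul, ← map_mul]
    congr 1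
    simp
  have h2 := congrArg (Units.val) h
  rw [Units.val_mul, Units.val_mul, Units.val_pow_eq_pow_val, Units.val_pow_eq_pow_val,
    Units.val_pow_eq_pow_val] at h2
  exact h2

theorem hermM_mem_borelB (n : ℕ) (r : (_ : ℕ × ℕ) × ℕ) : hermM p n r ∈ borelB p := by
  have := uni_mul_levi_mem_borelB 0 (A := hermA p r) (pUnit p ^ n) (by rw [hermA_val]; rfl)
  rwa [uni_zero, one_mul] at this

theorem UnramifiedCharacter.toHom_hermM (α : UnramifiedCharacter p) (n : ℕ)
    (r : (_ : ℕ × ℕ) × ℕ) :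
    (α.toHom ⟨hermM p n r, hermM_mem_borelB n r⟩ : ℂ) =
      α.param 0 ^ n * α.param 1 ^ r.1.1 * α.param 2 ^ r.1.2 := by
  rw [← α.toHom_diagB]
  have hp := prime_cast_ne_zero (p := p)
  let U : GL (Fin 2) ℚ_[p] := gl2 1 ((r.2 : ℚ_[p]) * ((p : ℚ_[p]) ^ r.1.2)⁻¹) 0 1 (by simp)
  have hU : levi U 1 ∈ borelB p := by
    have := uni_mul_levi_mem_borelB 0 (A := U) 1 rfl
    rwa [uni_zero, one_mul] at this
  have e : (⟨hermM p n r, hermM_mem_borelB n r⟩ : borelB p) = ⟨levi U 1, hU⟩ *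
      diagB (pUnit p ^ r.1.1) (pUnit p ^ r.1.2) (pUnit p ^ n) := by
    apply Subtype.ext
    have h1 : (diagB (pUnit p ^ r.1.1) (pUnit p ^ r.1.2) (pUnit p ^ n)).1 =
        levi (gl2 ((p : ℚ_[p]) ^ r.1.1) 0 0 ((p : ℚ_[p]) ^ r.1.2) (by
          rw [zero_mul, sub_zero]
          exact mul_ne_zero (pow_ne_zero _ hp) (pow_ne_zero _ hp))) (pUnit p ^ n) := by
      apply mat_injective
      rw [mat_levi, inv_val_fin_two, gl2_val]
      change Matrix.diagonal _ = _
      ext i j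
      rcases i with i | i <;> rcases j with j | j <;> fin_cases i <;> fin_cases j <;>
        simp [Matrix.adjugate_fin_two, Matrix.det_fin_two, pUnit] <;> left <;> field_simp
    change hermM p n r = levi U 1 * (diagB (pUnit p ^ r.1.1) (pUnit p ^ r.1.2) (pUnit p ^ n)).1
    rw [h1, ← levi_mul, one_mul, hermM]
    congr 1
    apply Units.ext
    rw [Units.val_mul, gl2_val, gl2_val, hermA_val]
    ext i j
    fin_cases i <;> fin_cases j <;> simp [Matrix.mul_apply, Fin.sum_univ_two]
    field_simp
  rw [e, map_mul, α.unipotent ⟨levi U 1, hU⟩ (by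
    intro i
    rw [mat_levi, inv_val_fin_two, gl2_val]
    rcases i with i | i <;> fin_cases i <;>
      simp [Matrix.adjugate_fin_two, Matrix.det_fin_two]), one_mul]

theorem deltaB_hermM (n : ℕ) (r : (_ : ℕ × ℕ) × ℕ) :
    Real.sqrt (deltaB (hermM p n r)) =
      Real.sqrt p ^ (3 * n) * ((p : ℝ) ^ (2 * r.1.1 + r.1.2))⁻¹ := by
  have hpp : (0 : ℝ) < p := prime_real_pos
  have hp := prime_cast_ne_zero (p := p)
  have h00 : mat (hermM p n r) (Sum.inl 0) (Sum.inl 0) = (p : ℚ_[p]) ^ r.1.1 := rfl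
  have h11 : mat (hermM p n r) (Sum.inl 1) (Sum.inl 1) = (p : ℚ_[p]) ^ r.1.2 := rfl
  have h33 : mat (hermM p n r) (Sum.inr 1) (Sum.inr 1) =
      (p : ℚ_[p]) ^ n * ((p : ℚ_[p]) ^ r.1.2)⁻¹ := by
    rw [hermM, mat_levi, hermA_inv_val, val_pUnit_pow]
    simp [pow_add]
    left
    field_simp
  have hs : Real.sqrt p ^ 2 = p := Real.sq_sqrt hpp.le
  have : deltaB (hermM p n r) =
      (Real.sqrt p ^ (3 * n) * ((p : ℝ) ^ (2 * r.1.1 + r.1.2))⁻¹) ^ 2 := by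
    rw [deltaB, h00, h11, h33, mul_pow, ← pow_mul, mul_comm (3 * n) 2, pow_mul, hs]
    have hne := hpp.ne'
    simp only [norm_div, norm_mul, norm_inv, norm_pow, Padic.norm_p, inv_pow]
    field_simp
    ring
  rw [this, Real.sqrt_sq (by positivity)]

/-- The eigenvalue of the Hecke operator `T(p ^ n)` on a spherical vector. -/
def heckeEig (α : UnramifiedCharacter p) (n : ℕ) : ℂ :=
  (Real.sqrt p ^ 3 * α.param 0) ^ n * ∑ a ∈ Finset.range (n + 1), ∑ b ∈ Finset.range (n + 1),
    α.param 1 ^ a * α.param 2 ^ b * (1 + (1 - (p : ℂ)⁻¹) * boundaryDist n a b)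

/-- The Hecke sum of a function in an unramified principal series. -/
theorem sum_heckeRep_of_equivariant (α : UnramifiedCharacter p) {φ : GSp4 p → ℂ}
    (hB : ∀ (b : borelB p) (g : GSp4 p),
      φ ((b : GSp4 p) * g) = (Real.sqrt (deltaB (b : GSp4 p)) : ℂ) * (α.toHom b : ℂ) * φ g)
    (hK : ∀ g, ∀ k ∈ maxCompact p, φ (g * k) = φ g) (n : ℕ) :
    ∑ h, φ (heckeRep n h) = heckeEig α n * φ 1 := by
  have hp0 : (p : ℂ) ≠ 0 := by exact_mod_cast (Fact.out : p.Prime).ne_zero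
  have huni : ∀ x g, φ (uni x * g) = 1 * φ g := by
    intro x g
    have hm : uni x ∈ borelB p := by
      have := uni_mul_levi_mem_borelB x (A := 1) 1 (by simp)
      rwa [levi_one, mul_one] at this
    have hd : ∀ i, mat (uni x) i i = 1 := by
      intro i
      rw [mat_uni]
      rcases i with i | i <;> simp
    have h1 := hB ⟨uni x, hm⟩ g
    rw [α.unipotent ⟨uni x, hm⟩ hd] at h1
    have h2 : deltaB (uni x) = 1 := by simp [deltaB, hd]
    change φ (uni x * g) = (Real.sqrt (deltaB (uni x)) : ℂ) * _ * φ g at h1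
    rw [h1, h2]
    simp
  rw [sum_heckeRep hK (θ := fun _ => 1) huni]
  simp only [implies_true, if_true]
  rw [hermIdx, Finset.sum_sigma, Finset.sum_product, heckeEig, mul_assoc, Finset.sum_mul,
    Finset.mul_sum]
  refine Finset.sum_congr rfl fun a ha => ?_
  rw [Finset.sum_mul, Finset.mul_sum]
  refine Finset.sum_congr rfl fun b hb => ?_
  rw [Finset.mem_range] at ha hb
  dsimp only
  have hval : ∀ x : ℕ, φ (hermM p n ⟨(a, b), x⟩) = (Real.sqrt p : ℂ) ^ (3 * n) *
      ((p : ℂ) ^ (2 * a + b))⁻¹ * (α.param 0 ^ n * α.param 1 ^ a * α.param 2 ^ b) * φ 1 := by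
    intro x
    have h1 := hB ⟨hermM p n ⟨(a, b), x⟩, hermM_mem_borelB n _⟩ 1
    rw [mul_one, α.toHom_hermM] at h1
    rw [h1]
    change (Real.sqrt (deltaB (hermM p n ⟨(a, b), x⟩)) : ℂ) * _ * _ = _
    rw [deltaB_hermM]
    push_cast
    rfl
  simp only [hval]
  -- The factor p^{a+b} of the coset count and p^a of the gcd sum cancel the p^{-(2a+b)} of
  -- δ_B^{1/2}.
  rw [← Finset.sum_mul, ← Finset.mul_sum, sum_gcd_hermite (by omega) (by omega), mul_pow, ← pow_mul]
  rw [two_mul, pow_add, pow_add, pow_add]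
  field_simp

end KohnenSkoruppa
end

/-! ### The spherical vector as a Hecke eigenvector -/

noncomputable section
namespace KohnenSkoruppa

variable {p : ℕ} [Fact p.Prime] {D : ℤ}

theorem UnramifiedCharacter.equivariant_scal (α : UnramifiedCharacter p) {φ : GSp4 p → ℂ}
    (hB : ∀ (b : borelB p) (g : GSp4 p),
      φ ((b : GSp4 p) * g) = (Real.sqrt (deltaB (b : GSp4 p)) : ℂ) * (α.toHom b : ℂ) * φ g)
    (g : GSp4 p) :
    φ (scal (pUnit p) * g) = α.param 0 ^ 2 * α.param 1 * α.param 2 * φ g := by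
  have hp := prime_cast_ne_zero (p := p)
  have e : (diagB (pUnit p ^ 1) (pUnit p ^ 1) (pUnit p ^ 2)).1 = scal (pUnit p) := by
    apply mat_injective
    rw [mat_scal]
    change Matrix.diagonal _ = _
    ext i j
    rcases i with i | i <;> rcases j with j | j <;> fin_cases i <;> fin_cases j <;>
      simp [pUnit] <;> field_simp
  have h := hB (diagB (pUnit p ^ 1) (pUnit p ^ 1) (pUnit p ^ 2)) g
  have hd : deltaB (scal (pUnit p)) = 1 := by
    simp [deltaB, mat_scal]
  rw [α.toHom_diagB] at h
  rw [e, hd] at h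
  simpa using h

/-- A function in an unramified principal series that is right `K`-invariant is an eigenfunction of
the Hecke operators. -/
theorem sum_heckeRep_mul_of_equivariant (α : UnramifiedCharacter p) {φ : GSp4 p → ℂ}
    (hB : ∀ (b : borelB p) (g : GSp4 p),
      φ ((b : GSp4 p) * g) = (Real.sqrt (deltaB (b : GSp4 p)) : ℂ) * (α.toHom b : ℂ) * φ g)
    (hK : ∀ g, ∀ k ∈ maxCompact p, φ (g * k) = φ g) (n : ℕ) (g : GSp4 p) :
    ∑ h, φ (g * heckeRep n h) = heckeEig α n * φ g := by
  obtain ⟨x, A, ν, k, hk, hA, rfl⟩ := exists_iwasawa g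
  have hb := uni_mul_levi_mem_borelB x ν hA
  set b : borelB p := ⟨_, hb⟩ with hbd
  -- Write g = bk. Left multiplication by k permutes the cosets and b factors out by equivariance,
  -- which reduces to g = 1.
  have h1 := sum_heckeRep_translate (n := n) (Φ := fun g => φ ((b : GSp4 p) * g))
    (fun g k hk => by rw [← mul_assoc, hK _ _ hk]) hk
  change ∑ h, φ ((b : GSp4 p) * k * heckeRep n h) = _ * φ ((b : GSp4 p) * k)
  simp only [mul_assoc] at h1 ⊢
  rw [h1, hK _ _ hk]
  conv_rhs => rw [← mul_one (b : GSp4 p)]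
  simp only [hB]
  rw [← Finset.mul_sum, sum_heckeRep_of_equivariant α hB hK]
  ring

/-- The spherical vector of an unramified representation is a Hecke eigenvector. -/
theorem sum_heckeRep_spherical {V : Type*} [AddCommGroup V] [Module ℂ V]
    {π : Representation ℂ (GSp4 p) V} {α : UnramifiedCharacter p} (hα : IsSubquotientOfInduced π α)
    (hcentral : ∀ z ∈ centre p, π z = 1) {v₀ : V} (hv₀ : v₀ ≠ 0)
    (hsph : ∀ k ∈ maxCompact p, π k v₀ = v₀) :
    (∀ n, ∑ h, π (heckeRep n h) v₀ = heckeEig α n • v₀) ∧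
      α.param 0 ^ 2 * α.param 1 * α.param 2 = 1 := by
  obtain ⟨S, hS, hSinv, F, hFs, hF⟩ := hα
  obtain ⟨φ', hφ'⟩ := hFs v₀
  obtain ⟨K', hK'⟩ := (hS φ'.2).2
  let ρ : GSp4 p → (S →ₗ[ℂ] S) := fun g => (rightTranslation p g).restrict (hSinv g)
  have hρ : ∀ g (φ : S) x, (ρ g φ).1 x = φ.1 (x * g) := fun _ _ _ => rfl
  have hρF : ∀ g (φ : S), F (ρ g φ) = π g (F φ) := hF
  have hρm : ∀ g h (φ : S), ρ (g * h) φ = ρ g (ρ h φ) := by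
    intro g h φ
    apply Subtype.ext
    funext x
    rw [hρ, hρ, hρ, mul_assoc]
  let P : Subgroup (maxCompact p) := K'.toSubgroup.subgroupOf (maxCompact p)
  have : CompactSpace (maxCompact p) := isCompact_iff_compactSpace.1 maxCompact_isCompact
  have hP : IsOpen (P : Set (maxCompact p)) := K'.isOpen.preimage continuous_subtype_val
  have : Finite (maxCompact p ⧸ P) := Subgroup.quotient_finite_of_isOpen _ hP
  have : Fintype (maxCompact p ⧸ P) := Fintype.ofFinite _
  let Φ : maxCompact p → S := fun k => ρ k φ'
  have hΦ : ∀ g, ∀ k ∈ P, Φ (g * k) = Φ g := by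
    intro g k hk
    change ρ ((g : GSp4 p) * k) φ' = ρ g φ'
    rw [hρm]
    congr 1
    apply Subtype.ext
    funext x
    exact hK' _ (Subgroup.mem_subgroupOf.1 hk) x
  set φ : S := ∑ q : maxCompact p ⧸ P, Φ q.out with hφ
  have hφK : ∀ k ∈ maxCompact p, ρ k φ = φ := by
    intro k hk
    have h1 := sum_translate (K := P) (T := Set.univ) (k := (⟨k, hk⟩ : maxCompact p))
      (e := fun q : maxCompact p ⧸ P => q.out) (fun _ _ => trivial) (fun _ => trivial)
      (fun g _ => by
        obtain ⟨h, hh⟩ := QuotientGroup.mk_out_eq_mul P g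
        exact ⟨QuotientGroup.mk g, h⁻¹, P.inv_mem h.2, by rw [hh, mul_inv_cancel_right]⟩)
      (fun i j k hk e => by
        rw [← QuotientGroup.out_eq' i, ← QuotientGroup.out_eq' j, e]
        exact QuotientGroup.mk_mul_of_mem _ hk) hΦ
    rw [hφ, map_sum, ← h1]
    exact Finset.sum_congr rfl fun q _ => (hρm _ _ _).symm
  have hFφ : F φ = (Fintype.card (maxCompact p ⧸ P) : ℂ) • v₀ := by
    rw [hφ, map_sum]
    have : ∀ q : maxCompact p ⧸ P, F (Φ q.out) = v₀ := by
      intro q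
      change F (ρ _ φ') = v₀
      rw [hρF, hφ', hsph _ q.out.2]
    rw [Finset.sum_congr rfl fun q _ => this q, Finset.sum_const, Finset.card_univ,
      Nat.cast_smul_eq_nsmul]
  have hcard : (Fintype.card (maxCompact p ⧸ P) : ℂ) ≠ 0 := by
    exact_mod_cast Fintype.card_ne_zero
  have hB := (hS φ.2).1
  have hK : ∀ g, ∀ k ∈ maxCompact p, φ.1 (g * k) = φ.1 g := fun g k hk => by
    rw [← hρ, hφK k hk]
  constructor
  · intro n
    have h1 : ∑ h, ρ (heckeRep n h) φ = heckeEig α n • φ := by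
      apply Subtype.ext
      funext x
      rw [AddSubmonoidClass.coe_finsetSum, Finset.sum_apply]
      exact sum_heckeRep_mul_of_equivariant α hB hK n x
    have h2 := congrArg F h1
    rw [map_sum, map_smul, hFφ, smul_comm] at h2
    simp only [hρF, hFφ, map_smul] at h2
    rw [← Finset.smul_sum] at h2
    exact smul_right_injective V hcard h2
  -- The scalar p acts on φ through α, and trivially on v₀; comparing the images in V shows that α
  -- is trivial on p.
  · have h1 : ρ (scal (pUnit p)) φ = (α.param 0 ^ 2 * α.param 1 * α.param 2) • φ := by
      apply Subtype.ext
      funext x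
      rw [hρ, Subgroup.mem_center_iff.1 (scal_mem (pUnit p))]
      exact α.equivariant_scal hB x
    have h2 := congrArg F h1
    rw [hρF, hcentral _ (scal_mem _), map_smul, hFφ] at h2
    have h3 : (1 - α.param 0 ^ 2 * α.param 1 * α.param 2) •
        ((Fintype.card (maxCompact p ⧸ P) : ℂ) • v₀) = 0 := by
      rw [sub_smul, one_smul, sub_eq_zero]
      exact h2
    rw [smul_eq_zero] at h3
    exact (sub_eq_zero.1 (h3.resolve_right (smul_ne_zero hcard hv₀))).symm

end KohnenSkoruppa
end

noncomputable section
namespace KohnenSkoruppa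

/-! ### Integrals over shells -/

theorem countable_of_finite_fibres {ι : Type*} (e : ι → ℕ) [∀ n, Finite {i // e i = n}] :
    Countable ι :=
  (show Function.Injective fun i : ι => (⟨e i, i, rfl⟩ : Σ n, {i // e i = n}) from
    fun _ _ h => congrArg (fun x : Σ n, {i // e i = n} => (x.2 : ι)) h).countable

/-- The shell integrals of a function that is constant on the pieces of a countable family, where
each shell consists of finitely many pieces. -/
theorem hasShellIntegral_of_pieces {X ι : Type*} [MeasurableSpace X] {e : ι → ℕ}
    [∀ n, Fintype {i // e i = n}] {μ : Measure X} {τ : X → ℝ} {q : ℝ} (hq : 1 < q)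
    (hτm : ∀ c, MeasurableSet {x | τ x = c}) {O : ι → Set X} (hO : ∀ i, MeasurableSet (O i))
    (hd : Pairwise (Function.onFun Disjoint O)) (hfin : ∀ i, μ (O i) ≠ ⊤) {F : X → ℂ} {c : ι → ℂ}
    (hF : ∀ i, ∀ x ∈ O i, F x = c i) (hsupp : ∀ x, F x ≠ 0 → ∃ i, x ∈ O i)
    (hτ : ∀ i, ∀ x ∈ O i, τ x = q ^ (-(e i : ℤ))) {A : ℂ}
    (hA : HasSum (fun n : ℕ => ∑ i : {i // e i = n}, ((μ (O i)).toReal : ℂ) * c i) A) :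
    HasShellIntegral μ τ q F A ∧ (Integrable F μ → ∫ x, F x ∂μ = A) := by
  have hinj : ∀ {m n : ℤ}, q ^ m = q ^ n ↔ m = n := fun {m n} =>
    zpow_right_inj₀ (by linarith) hq.ne'
  have hshell : ∀ x, F x ≠ 0 → ∃ i, x ∈ O i ∧ τ x = q ^ (-(e i : ℤ)) := fun x hx => by
    obtain ⟨i, hi⟩ := hsupp x hx
    exact ⟨i, hi, hτ i x hi⟩
  have h1 : ∀ n : ℕ, IntegrableOn F {x | τ x = q ^ (-(n : ℤ))} μ ∧
      ∫ x in {x | τ x = q ^ (-(n : ℤ))}, F x ∂μ =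
        ∑ i : {i // e i = n}, ((μ (O i)).toReal : ℂ) * c i := by
    intro n
    obtain ⟨h2, h3⟩ := integrable_and_hasSum_of_countable_pieces (ι := {i // e i = n})
      (O := fun i => O i) (F := {x | τ x = q ^ (-(n : ℤ))}.indicator F) (c := fun i => c i)
      (μ := μ) (fun i => hO i) (fun i j hij => hd fun h => hij (Subtype.ext h)) (by
        intro i x hx
        rw [Set.indicator_of_mem, hF _ x hx]
        rw [Set.mem_ofPred_eq, hτ _ x hx, i.2]) (by
        intro x hx
        obtain ⟨hx1, hx2⟩ := Set.indicator_apply_ne_zero.1 hx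
        obtain ⟨i, hi, hi2⟩ := hshell x hx2
        rw [Set.mem_ofPred_eq, hi2, hinj] at hx1
        exact ⟨⟨i, by omega⟩, hi⟩) (fun i => hfin i) (hasSum_fintype _).summable
    rw [integrable_indicator_iff (hτm _)] at h2
    rw [integral_indicator (hτm _)] at h3
    exact ⟨h2, h3.unique (hasSum_fintype _)⟩
  have h0 : ∀ k : ℤ, k ∉ Set.range (fun n : ℕ => -(n : ℤ)) → ∀ x ∈ {x | τ x = q ^ k}, F x = 0 := by
    intro k hk x hx
    by_contra hx0
    obtain ⟨i, -, hi⟩ := hshell x hx0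
    rw [Set.mem_ofPred_eq, hi, hinj] at hx
    exact hk ⟨e i, hx⟩
  have hint : ∀ k : ℤ, IntegrableOn F {x | τ x = q ^ k} μ := by
    intro k
    by_cases hk : k ∈ Set.range (fun n : ℕ => -(n : ℤ))
    · obtain ⟨n, rfl⟩ := hk
      exact (h1 n).1
    · exact integrableOn_zero.congr_fun (fun x hx => (h0 k hk x hx).symm) (hτm _)
  have hsum : HasSum (fun k : ℤ => ∫ x in {x | τ x = q ^ k}, F x ∂μ) A := by
    have hi : Function.Injective (fun n : ℕ => -(n : ℤ)) := fun m n h => by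
      have : -(m : ℤ) = -(n : ℤ) := h
      omega
    rw [← hi.hasSum_iff]
    · convert hA using 1
      funext n
      exact (h1 n).2
    · intro k hk
      exact setIntegral_eq_zero_of_forall_eq_zero (h0 k hk)
  refine ⟨⟨hint, hsum⟩, fun hFi => ?_⟩
  have h3 := hasSum_integral_iUnion (f := F) (μ := μ) (s := fun k : ℤ => {x | τ x = q ^ k})
    (fun k => hτm _) (by
      intro k l hkl
      refine Set.disjoint_left.2 fun x hx hx' => hkl ?_
      rw [Set.mem_ofPred_eq] at hx hx'
      rwa [hx, hinj] at hx') hFi.integrableOn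
  rw [setIntegral_eq_integral_of_forall_compl_eq_zero (fun x hx => by
    by_contra hx0
    obtain ⟨i, -, hi⟩ := hshell x hx0
    exact hx (Set.mem_iUnion.2 ⟨_, hi⟩))] at h3
  exact h3.unique hsum

variable {p : ℕ} [Fact p.Prime] {D : ℤ}

theorem isSphericalWhittaker {ψ : AddChar ℚ_[p] ℂ} {V : Type*} [AddCommGroup V] [Module ℂ V]
    {π : Representation ℂ (GSp4 p) V} (hcentral : ∀ z ∈ centre p, π z = 1) {v₀ : V}
    (hsph : ∀ k ∈ maxCompact p, π k v₀ = v₀) {l : V →ₗ[ℂ] ℂ} (hl : IsUChiFunctional D ψ π l) :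
    IsSphericalWhittaker D ψ fun g => l (π g v₀) where
  unip x g := by rw [map_mul, Module.End.mul_apply, hl _ (uni_mem x), chi_uni]
  cent c g := by rw [map_mul, hcentral _ (scal_mem c), one_mul]
  right g k hk := by rw [map_mul, Module.End.mul_apply, hsph k hk]

namespace IsSphericalWhittaker

variable {ψ : AddChar ℚ_[p] ℂ} {W : GSp4 p → ℂ}

/-- Take x₀ with |x₀| ≤ p and ψ(x₀) ≠ 1. For j ≤ -1 the entry p^{-j}x₀ in the last corner is
integral, so this element of U ∩ K fixes v₀, while conjugation by m(d,j) turns its value under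
`yForm` into x₀. -/
theorem eq_zero_of_neg (hW : IsSphericalWhittaker D ψ W) (hψ : HasConductorOne ψ)
    (d : PrimClass p D) {j : ℤ} (hj : j < 0) : W (repM d j) = 0 := by
  have hp := prime_cast_ne_zero (p := p)
  obtain ⟨x₀, hx, hx1⟩ := hψ.2
  have hu : ‖(p : ℚ_[p]) ^ (-j) * x₀‖ ≤ 1 := by
    rw [norm_mul, norm_prime_zpow, neg_neg]
    calc (p : ℝ) ^ j * ‖x₀‖ ≤ (p : ℝ) ^ (-1 : ℤ) * p := by
          gcongr
          · exact one_lt_prime_real.le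
          · omega
      _ = 1 := by rw [zpow_neg_one, inv_mul_cancel₀ prime_real_pos.ne']
  set y : Fin 3 → ℚ_[p] := ![0, 0, (p : ℚ_[p]) ^ (-j) * x₀] with hy
  have hyK : KohnenSkoruppa.uni y ∈ maxCompact p := by
    rw [uni_mem_maxCompact, isInt_fin_two]
    simpa [symM, hy] using hu
  have h1 := levi_mul_uni (repA d j) (repNu d j) y
  have h2 : yForm D ((repNu d j : ℚ_[p])⁻¹ • symAct (repA d j).val y) = x₀ := by
    rw [yForm_smul, repA, mulGL_val, yForm_symAct, norm_smul_L, norm_star_L, yForm_apply]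
    change ((p : ℚ_[p]) ^ j * QuadraticAlgebra.norm d.elt)⁻¹ * _ = _
    have := d.norm_ne
    simp [hy]
    field_simp
  have h3 := hW.unip ((repNu d j : ℚ_[p])⁻¹ • symAct (repA d j).val y) (repM d j)
  rw [repM, ← h1, hW.right _ _ hyK, h2] at h3
  have h4 : (1 - ψ x₀) * W (levi (repA d j) (repNu d j)) = 0 := by linear_combination h3
  exact (mul_eq_zero.1 h4).resolve_left (sub_ne_zero.2 (Ne.symm hx1))

end IsSphericalWhittaker

/-- The contribution of a double coset to both integrals. -/
def coeffW (W : GSp4 p → ℂ) (s : ℂ) (x : PrimClass p D × ℕ) : ℂ :=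
  zetaFactor p s * ((((p : ℝ) ^ (-((x.2 + x.1.cond : ℕ) : ℤ)) : ℝ) : ℂ) ^ (2 * s)) *
    ((p : ℂ) ^ (2 * x.2) * W (repM x.1 x.2))

theorem fPhi_repM (d : PrimClass p D) (j : ℕ) {s : ℂ} (hs : 0 < s.re) :
    fPhi (repM d j) s =
      zetaFactor p s * (((p : ℝ) ^ (-((j + d.cond : ℕ) : ℤ)) : ℝ) : ℂ) ^ (2 * s) := by
  rw [fPhi_eq _ hs, tau_repM]; push_cast; rfl

section orbits

variable {ψ : AddChar ℚ_[p] ℂ} {W : GSp4 p → ℂ}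
  {μNU : Measure (RightQuot ((unipN p D).subgroupOf (unipU p)))}

theorem tau_left {g h : GSp4 p} (hh : h ∈ unipU p ⊔ centre p) : tau (h * g) = tau g := by
  obtain ⟨u, hu, z, hz, rfl⟩ := mem_sup_centre.1 hh
  obtain ⟨x, rfl⟩ := mem_unipU.1 hu
  obtain ⟨c, rfl⟩ := mem_centre.1 hz
  rw [mul_assoc, tau_uni_mul, tau_scal_mul]

/-- The integrand of the first integral as a function on the group. -/
theorem integrandI_left (hμ : IsInvariantMeasure _ ((maxCompact p).subgroupOf (unipU p)) μNU)
    (hW : IsSphericalWhittaker D ψ W) {s : ℂ} (hs : 0 < s.re) {h : GSp4 p}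
    (hh : h ∈ unipU p ⊔ centre p) (g : GSp4 p) :
    fPhi (h * g) s * alphaChi D ψ μNU (h * g) * W (h * g) = fPhi g s * alphaChi D ψ μNU g * W g := by
  rw [fPhi_eq _ hs, fPhi_eq _ hs, tau_left hh]
  obtain ⟨u, hu, z, hz, rfl⟩ := mem_sup_centre.1 hh
  obtain ⟨c, rfl⟩ := mem_centre.1 hz
  rw [mul_assoc u]
  have h1 := alphaChi_unipU_mul (ψ := ψ) hμ hu (scal c * g)
  rw [alphaChi_scal_mul] at h1
  obtain ⟨x, rfl⟩ := mem_unipU.1 hu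
  rw [hW.unip, hW.cent, ← h1, chi_uni]
  ring

theorem integrandI_right (hW : IsSphericalWhittaker D ψ W) {s : ℂ} (hs : 0 < s.re) {k : GSp4 p}
    (hk : k ∈ maxCompact p) (g : GSp4 p) :
    fPhi (g * k) s * alphaChi D ψ μNU (g * k) * W (g * k) = fPhi g s * alphaChi D ψ μNU g * W g := by
  rw [fPhi_eq _ hs, fPhi_eq _ hs, tau_mul hk, alphaChi_mul hk, hW.right _ _ hk]

/-- Nonvanishing of α_χ makes the Levi part a multiplication by an element of L, up to K;
nonvanishing of W excludes negative j. -/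
theorem mem_orbit_of_alphaChi_ne_zero (hD : Squarefree D) (hψ : HasConductorOne ψ)
    (hW : IsSphericalWhittaker D ψ W) {g : GSp4 p} (hα : alphaChi D ψ μNU g ≠ 0) (hg : W g ≠ 0) :
    ∃ x : PrimClass p D × ℕ,
      RightQuot.mk _ g ∈ orbit (unipU p ⊔ centre p) (maxCompact p) (repM x.1 x.2) := by
  obtain ⟨x, A, ν, k, hk, -, rfl⟩ := exists_iwasawa g
  obtain ⟨t, ht, k₁, hk₁, rfl⟩ := eq_mulGL_mul hD (isInt_of_alphaChi_ne_zero hk hα)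
  obtain ⟨d, j, c, k₂, hk₂, -, e⟩ := levi_eq_repM t ht ν
  have hk₁' : levi k₁ 1 ∈ maxCompact p := levi_mem_maxCompact.2 ⟨hk₁, by simp⟩
  have e2 : uni x * levi (mulGL t ht * k₁) ν * k =
      uni x * scal c * repM d j * (k₂ * levi k₁ 1 * k) := by
    rw [← mul_one ν, levi_mul, e]; group
  have hk' := mul_mem (mul_mem hk₂ hk₁') hk
  have hj : 0 ≤ j := by
    by_contra hj
    apply hg
    rw [e2, hW.right _ _ hk', mul_assoc, hW.unip, hW.cent, hW.eq_zero_of_neg hψ d (by omega),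
      mul_zero]
  lift j to ℕ using hj
  exact ⟨(d, j), mk_mem_orbit.2 ⟨_, mem_sup_centre.2 ⟨_, uni_mem x, _, scal_mem c, rfl⟩, _, hk', e2⟩⟩

theorem repM_mem_of_orbit {x y : PrimClass p D × ℕ} {h k : GSp4 p} (hh : h ∈ unipU p ⊔ centre p)
    (hk : k ∈ maxCompact p) (e : repM x.1 x.2 = h * repM y.1 y.2 * k) : x = y := by
  obtain ⟨u, hu, z, hz, rfl⟩ := mem_sup_centre.1 hh
  obtain ⟨a, rfl⟩ := mem_unipU.1 hu
  obtain ⟨c, rfl⟩ := mem_centre.1 hz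
  obtain ⟨h1, h2⟩ := repM_disjoint hk e
  exact Prod.ext h1 (by exact_mod_cast h2)

theorem orbit_I_disjoint : Pairwise (Function.onFun Disjoint fun x : PrimClass p D × ℕ =>
    orbit (unipU p ⊔ centre p) (maxCompact p) (repM x.1 x.2)) := by
  intro x y hxy
  refine Set.disjoint_left.2 ?_
  rintro _ ⟨k, hk, rfl⟩ h2
  obtain ⟨h, hh, k', hk', e⟩ := mk_mem_orbit.1 h2
  refine hxy (repM_mem_of_orbit hh (mul_mem hk' (inv_mem hk)) ?_)
  rw [← mul_assoc, ← e, mul_inv_cancel_right]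

/-- Disjointness already holds for the larger groups UZ and K in GSp₄. -/
theorem orbit_J_disjoint : Pairwise (Function.onFun Disjoint fun x : PrimClass p D × ℕ =>
    orbit (groupNZ p D) (compactL p D) (repML x.1 x.2)) := by
  intro x y hxy
  refine Set.disjoint_left.2 ?_
  rintro _ ⟨k, hk, rfl⟩ h2
  obtain ⟨h, hh, k', hk', e⟩ := mk_mem_orbit.1 h2
  have hh' : (h : GSp4 p) ∈ unipU p ⊔ centre p :=
    sup_le_sup_right unipN_le_unipU _ (Subgroup.mem_subgroupOf.1 hh)
  refine hxy (repM_mem_of_orbit hh' (mul_mem (Subgroup.mem_subgroupOf.1 hk')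
    (inv_mem (Subgroup.mem_subgroupOf.1 hk))) ?_)
  have e' : repM x.1 x.2 * (k : GSp4 p) = h * repM y.1 y.2 * k' := congrArg Subtype.val e
  rw [← mul_assoc, ← e', mul_inv_cancel_right]

/-- Here the Iwasawa decomposition of GL*_{2,L} takes the place of the support condition on α_χ:
every diagonal element is a representative up to centre and integral points. -/
theorem mem_orbit_J (hD : Squarefree D) (hψ : HasConductorOne ψ) (hW : IsSphericalWhittaker D ψ W)
    {g : gl2L p D} (hg : W g ≠ 0) :
    ∃ x : PrimClass p D × ℕ,
      RightQuot.mk _ g ∈ orbit (groupNZ p D) (compactL p D) (repML x.1 x.2) := by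
  obtain ⟨x, z, hz, ν, k, hk, hkL, hx, e⟩ := exists_iwasawa_gl2L hD g.2
  obtain ⟨d, j, c, k₂, hk₂, hk₂L, e'⟩ := levi_eq_repM z hz ν
  have e2 : (g : GSp4 p) = uni x * scal c * repM d j * (k₂ * k) := by rw [e, e']; group
  have hj : 0 ≤ j := by
    by_contra hj
    apply hg
    rw [e2, hW.right _ _ (mul_mem hk₂ hk), mul_assoc, hW.unip, hW.cent,
      hW.eq_zero_of_neg hψ d (by omega), mul_zero]
  lift j to ℕ using hj
  have hux : uni x ∈ gl2L p D := unipN_le_gl2L (mem_unipN.2 ⟨x, hx, rfl⟩)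
  refine ⟨(d, j), mk_mem_orbit.2 ⟨⟨uni x * scal c, mul_mem hux (scal_mem_gl2L c)⟩,
    mem_groupNZ.2 ⟨x, c, hx, rfl⟩, ⟨k₂ * k, mul_mem hk₂L hkL⟩,
    Subgroup.mem_subgroupOf.2 (mul_mem hk₂ hk), Subtype.ext e2⟩⟩

end orbits

end KohnenSkoruppa
end

noncomputable section
namespace KohnenSkoruppa

/-! ### The two integrals as sums over double cosets -/

variable {p : ℕ} [Fact p.Prime] {D : ℤ} {ψ : AddChar ℚ_[p] ℂ} {W : GSp4 p → ℂ}
  {μNU : Measure (RightQuot ((unipN p D).subgroupOf (unipU p)))}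

instance : Countable (PrimClass p D × ℕ) :=
  have : ∀ n, Finite {x : PrimClass p D × ℕ // x.2 + x.1.cond = n} := fun n =>
    inferInstanceAs (Finite (RepIdx p D n))
  countable_of_finite_fibres fun x : PrimClass p D × ℕ => x.2 + x.1.cond

/-- The orbit has measure p^{3j} and α_χ has the value p^{-j} on its representative; their product
p^{2j} is the weight in `coeffW`. -/
theorem integralI_of_coeffW (hD : Squarefree D) (hψ : HasConductorOne ψ)
    (hμNU : IsInvariantMeasure _ ((maxCompact p).subgroupOf (unipU p)) μNU)
    {μ : Measure (RightQuot (unipU p ⊔ centre p))} (hμ : IsInvariantMeasure _ (maxCompact p) μ)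
    (hW : IsSphericalWhittaker D ψ W) {s : ℂ} (hs : 0 < s.re) {F : RightQuot (unipU p ⊔ centre p) → ℂ}
    (hFW : F = fun x => fPhi x.rep s * alphaChi D ψ μNU x.rep * W x.rep) :
    (∀ A, HasSum (fun n => ∑ x : RepIdx p D n, coeffW W s x.1) A →
      HasShellIntegral μ (fun x => tau x.rep) p F A ∧ (Integrable F μ → ∫ x, F x ∂μ = A)) ∧
    (Summable (fun x : PrimClass p D × ℕ => ‖coeffW W s x‖) → Integrable F μ) := by
  have hrep : ∀ g, F (RightQuot.mk _ g) = fPhi g s * alphaChi D ψ μNU g * W g := fun g => by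
    rw [hFW]
    exact rep_eq_of_mk (F := fun g => fPhi g s * alphaChi D ψ μNU g * W g)
      (fun h hh g => integrandI_left hμNU hW hs hh g) g
  have hm : ∀ x : PrimClass p D × ℕ, (((μ (orbit (unipU p ⊔ centre p) (maxCompact p)
      (repM x.1 x.2))).toReal : ℝ) : ℂ) = (p : ℂ) ^ (3 * x.2) := fun x => by
    rw [measure_orbit_I hμ, ENNReal.toReal_ofReal (zpow_pos prime_real_pos _).le]
    norm_cast
  have hc : ∀ x : PrimClass p D × ℕ, (p : ℂ) ^ (3 * x.2) *
      (fPhi (repM x.1 x.2) s * ((p : ℂ) ^ x.2)⁻¹ * W (repM x.1 x.2)) = coeffW W s x := fun x => by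
    have hp : (p : ℂ) ≠ 0 := by exact_mod_cast (Fact.out : p.Prime).ne_zero
    rw [fPhi_repM _ _ hs, coeffW]
    field_simp
    ring
  have hO := fun x : PrimClass p D × ℕ => orbit_measurableSet (H := unipU p ⊔ centre p)
    (maxCompact_isOpen (p := p)) (repM x.1 x.2)
  have hfin : ∀ x : PrimClass p D × ℕ, μ (orbit (unipU p ⊔ centre p) (maxCompact p)
      (repM x.1 x.2)) ≠ ⊤ := fun x => by
    rw [measure_orbit_I hμ]; exact ENNReal.ofReal_ne_top
  have hF : ∀ x : PrimClass p D × ℕ, ∀ y ∈ orbit (unipU p ⊔ centre p) (maxCompact p)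
      (repM x.1 x.2), F y = fPhi (repM x.1 x.2) s * ((p : ℂ) ^ x.2)⁻¹ * W (repM x.1 x.2) := by
    rintro x _ ⟨k, hk, rfl⟩
    rw [hrep, integrandI_right hW hs hk, alphaChi_repM hψ hμNU]
  have hsupp : ∀ y, F y ≠ 0 → ∃ x : PrimClass p D × ℕ,
      y ∈ orbit (unipU p ⊔ centre p) (maxCompact p) (repM x.1 x.2) := by
    intro y hy
    obtain ⟨g, rfl⟩ := Quotient.exists_rep y
    change F (RightQuot.mk _ g) ≠ 0 at hy
    rw [hrep] at hy
    exact mem_orbit_of_alphaChi_ne_zero hD hψ hW (right_ne_zero_of_mul (left_ne_zero_of_mul hy))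
      (right_ne_zero_of_mul hy)
  refine ⟨fun A hA => ?_, fun hA => ?_⟩
  · refine hasShellIntegral_of_pieces (e := fun x : PrimClass p D × ℕ => x.2 + x.1.cond)
      (by exact_mod_cast (Fact.out : p.Prime).one_lt)
      (measurableSet_rep_real maxCompact_isOpen (fun h hh g => tau_left hh)
        fun k hk g => tau_mul hk g) hO orbit_I_disjoint hfin hF hsupp ?_ ?_
    · rintro x _ ⟨k, hk, rfl⟩
      rw [rep_eq_of_mk_real (fun h hh g => tau_left hh), tau_mul hk, tau_repM]
      push_cast; rfl
    · convert hA using 3 with n x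
      rw [hm, hc]
  · refine (integrable_and_hasSum_of_countable_pieces hO orbit_I_disjoint hF hsupp hfin ?_).1
    refine hA.congr fun x => ?_
    rw [← hc, norm_mul, ← hm, Complex.norm_real, Real.norm_of_nonneg ENNReal.toReal_nonneg]

/-- There is no factor α_χ, but the orbit has measure only p^{2j}, so the contributions agree with
those of the first integral. -/
theorem integralJ_of_coeffW (hD : Squarefree D) (hψ : HasConductorOne ψ)
    {μ : Measure (RightQuot (groupNZ p D))} (hμ : IsInvariantMeasure _ (compactL p D) μ)
    (hW : IsSphericalWhittaker D ψ W) {s : ℂ} (hs : 0 < s.re) {F : RightQuot (groupNZ p D) → ℂ}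
    (hFW : F = fun x => fPhi (x.rep : GSp4 p) s * W x.rep) :
    (∀ A, HasSum (fun n => ∑ x : RepIdx p D n, coeffW W s x.1) A →
      HasShellIntegral μ (fun x => tau (x.rep : GSp4 p)) p F A ∧
        (Integrable F μ → ∫ x, F x ∂μ = A)) ∧
    (Summable (fun x : PrimClass p D × ℕ => ‖coeffW W s x‖) → Integrable F μ) := by
  have htau : ∀ h ∈ groupNZ p D, ∀ g : gl2L p D, tau ((h * g : gl2L p D) : GSp4 p) = tau g.1 :=
    fun h hh g => tau_left (sup_le_sup_right unipN_le_unipU _ (Subgroup.mem_subgroupOf.1 hh))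
  have hrep : ∀ g, F (RightQuot.mk _ g) = fPhi (g : GSp4 p) s * W g := fun g => by
    rw [hFW]
    refine rep_eq_of_mk (F := fun g : gl2L p D => fPhi (g : GSp4 p) s * W g) (fun h hh g => ?_) g
    rw [fPhi_eq _ hs, fPhi_eq _ hs, htau h hh]
    obtain ⟨x, z, hx, e⟩ := mem_groupNZ.1 hh
    rw [Subgroup.coe_mul, e, mul_assoc (uni x), hW.unip, hW.cent, hx, AddChar.map_zero_eq_one, one_mul]
  have hm : ∀ x : PrimClass p D × ℕ, (((μ (orbit (groupNZ p D) (compactL p D)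
      (repML x.1 x.2))).toReal : ℝ) : ℂ) = (p : ℂ) ^ (2 * x.2) := fun x => by
    rw [measure_orbit_J hμ, ENNReal.toReal_ofReal (zpow_pos prime_real_pos _).le]
    norm_cast
  have hc : ∀ x : PrimClass p D × ℕ, (p : ℂ) ^ (2 * x.2) *
      (fPhi (repM x.1 x.2) s * W (repM x.1 x.2)) = coeffW W s x := fun x => by
    rw [fPhi_repM _ _ hs, coeffW]
    ring
  have hO := fun x : PrimClass p D × ℕ => orbit_measurableSet (H := groupNZ p D)
    (compactL_isOpen (p := p) (D := D)) (repML x.1 x.2)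
  have hfin : ∀ x : PrimClass p D × ℕ, μ (orbit (groupNZ p D) (compactL p D)
      (repML x.1 x.2)) ≠ ⊤ := fun x => by
    rw [measure_orbit_J hμ]; exact ENNReal.ofReal_ne_top
  have hF : ∀ x : PrimClass p D × ℕ, ∀ y ∈ orbit (groupNZ p D) (compactL p D)
      (repML x.1 x.2), F y = fPhi (repM x.1 x.2) s * W (repM x.1 x.2) := by
    rintro x _ ⟨k, hk, rfl⟩
    rw [hrep, Subgroup.coe_mul, fPhi_eq _ hs, fPhi_eq _ hs, tau_mul (Subgroup.mem_subgroupOf.1 hk),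
      hW.right _ _ (Subgroup.mem_subgroupOf.1 hk)]
    rfl
  have hsupp : ∀ y, F y ≠ 0 → ∃ x : PrimClass p D × ℕ,
      y ∈ orbit (groupNZ p D) (compactL p D) (repML x.1 x.2) := by
    intro y hy
    obtain ⟨g, rfl⟩ := Quotient.exists_rep y
    change F (RightQuot.mk _ g) ≠ 0 at hy
    rw [hrep] at hy
    exact mem_orbit_J hD hψ hW (right_ne_zero_of_mul hy)
  refine ⟨fun A hA => ?_, fun hA => ?_⟩
  · refine hasShellIntegral_of_pieces (e := fun x : PrimClass p D × ℕ => x.2 + x.1.cond)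
      (by exact_mod_cast (Fact.out : p.Prime).one_lt)
      (measurableSet_rep_real (F := fun g : gl2L p D => tau (g : GSp4 p)) compactL_isOpen htau
        fun k hk g => tau_mul hk g) hO orbit_J_disjoint hfin hF hsupp ?_ ?_
    · rintro x _ ⟨k, hk, rfl⟩
      rw [rep_eq_of_mk_real (F := fun g : gl2L p D => tau (g : GSp4 p)) htau, Subgroup.coe_mul,
        tau_mul (Subgroup.mem_subgroupOf.1 hk)]
      exact (tau_repM _ _).trans (by push_cast; rfl)
    · convert hA using 3 with n x
      rw [hm, hc]
  · refine (integrable_and_hasSum_of_countable_pieces hO orbit_J_disjoint hF hsupp hfin ?_).1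
    refine hA.congr fun x => ?_
    rw [← hc, norm_mul, ← hm, Complex.norm_real, Real.norm_of_nonneg ENNReal.toReal_nonneg]

/-! ### The generating series -/

/-- On the shell j + c(d) = n one has p^{-2sn} p^{2j} = (p^{-2s}p⁻¹)^n p^{n+2j}, and p^{n+2j} is the
multiplicity in the Hecke sum. -/
theorem sum_coeffW (hD : Squarefree D) (hψ : HasConductorOne ψ) (hW : IsSphericalWhittaker D ψ W)
    (s : ℂ) (n : ℕ) :
    ∑ x : RepIdx p D n, coeffW W s x.1 =
      zetaFactor p s * (((p : ℂ) ^ (2 * s))⁻¹ * (p : ℂ)⁻¹) ^ n * ∑ h, W (heckeRep n h) := by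
  have hp : (p : ℂ) ≠ 0 := by exact_mod_cast (Fact.out : p.Prime).ne_zero
  rw [hW.sum_heckeRep hD hψ, Finset.mul_sum]
  refine Finset.sum_congr rfl fun x _ => ?_
  rw [coeffW, x.2, prime_zpow_cpow, zpow_neg, zpow_natCast, mul_pow, inv_pow, inv_pow, pow_add]
  field_simp

theorem exists_norm_mul_prime_cpow_lt_one (p : ℕ) [Fact p.Prime] (C : ℝ) :
    ∃ s₀ : ℝ, 0 ≤ s₀ ∧ ∀ s : ℂ, s₀ < s.re → ∀ a : ℂ, ‖a‖ ≤ C →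
      ‖a * (p : ℂ) ^ (-(2 * s - 1 / 2))‖ < 1 := by
  obtain ⟨m, hm⟩ := pow_unbounded_of_one_lt C (one_lt_prime_real (p := p))
  refine ⟨m + 1, by positivity, fun s hs a ha => ?_⟩
  rw [norm_mul, Complex.norm_natCast_cpow_of_pos (Fact.out : p.Prime).pos]
  have h1 : (p : ℝ) ^ (-(2 * s - 1 / 2)).re ≤ (p : ℝ) ^ (-(m : ℝ)) := by
    apply Real.rpow_le_rpow_of_exponent_le one_lt_prime_real.le
    have : (-(2 * s - 1 / 2)).re = -(2 * s.re - 1 / 2) := by simp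
    rw [this]
    have : (0 : ℝ) ≤ m := by positivity
    linarith
  rw [Real.rpow_neg prime_real_pos.le, Real.rpow_natCast] at h1
  have hpm : (0 : ℝ) < (p : ℝ) ^ m := pow_pos prime_real_pos m
  calc _ ≤ ‖a‖ * ((p : ℝ) ^ m)⁻¹ := by gcongr
    _ < (p : ℝ) ^ m * ((p : ℝ) ^ m)⁻¹ := by
        apply mul_lt_mul_of_pos_right (ha.trans_lt hm) (inv_pos.2 hpm)
    _ = 1 := mul_inv_cancel₀ hpm.ne'

/-- The generating series of the Hecke eigenvalues is the Spin `L`-function. -/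
theorem hasSum_heckeEig {α : UnramifiedCharacter p} (hα : α.param 0 ^ 2 * α.param 1 * α.param 2 = 1) :
    ∃ s₀ : ℝ, 0 ≤ s₀ ∧ ∀ s : ℂ, s₀ < s.re →
      HasSum (fun n : ℕ => zetaFactor p s * (((p : ℂ) ^ (2 * s))⁻¹ * (p : ℂ)⁻¹) ^ n * heckeEig α n)
        (spinL α (2 * s - 1 / 2)) := by
  set A := α.param with hA
  obtain ⟨s₀, h0, hs₀⟩ := exists_norm_mul_prime_cpow_lt_one p
    (‖A 0‖ + ‖A 1 * A 0‖ + ‖A 2 * A 0‖ + ‖A 1 * A 2 * A 0‖)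
  refine ⟨s₀, h0, fun s hs => ?_⟩
  have hsre : 0 < s.re := h0.trans_lt hs
  have hp : (p : ℂ) ≠ 0 := by exact_mod_cast (Fact.out : p.Prime).ne_zero
  set q := (p : ℂ) ^ (-(2 * s - 1 / 2)) with hq
  have hn1 := norm_nonneg (A 0)
  have hn2 := norm_nonneg (A 1 * A 0)
  have hn3 := norm_nonneg (A 2 * A 0)
  have hn4 := norm_nonneg (A 1 * A 2 * A 0)
  have hsq : ((Real.sqrt p : ℝ) : ℂ) = (p : ℂ) ^ (1 / 2 : ℂ) := by
    rw [Real.sqrt_eq_rpow, Complex.ofReal_cpow prime_real_pos.le]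
    norm_num
  -- The p^{3/2} of δ_B^{1/2} and the p^{-2s-1} of the shell sum combine to p^{-(2s-1/2)}, the point
  -- at which the L-function is evaluated.
  have hX : ((Real.sqrt p : ℝ) : ℂ) ^ 3 * (((p : ℂ) ^ (2 * s))⁻¹ * (p : ℂ)⁻¹) = q := by
    rw [hsq, ← Complex.cpow_nat_mul, ← Complex.cpow_neg, ← Complex.cpow_neg_one,
      ← Complex.cpow_add _ _ hp, ← Complex.cpow_add _ _ hp, hq]
    congr 1
    push_cast
    ring
  have hq2 : (p : ℂ)⁻¹ * q ^ 2 = (p : ℂ) ^ (-(4 * s)) := by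
    rw [hq, ← Complex.cpow_nat_mul, ← Complex.cpow_neg_one, ← Complex.cpow_add _ _ hp]
    congr 1
    push_cast
    ring
  have hz : 1 - (p : ℂ) ^ (-(4 * s)) ≠ 0 := by
    have := norm_prime_cpow_lt_one (p := p) (w := 4 * s) (by simpa using hsre)
    intro h
    rw [sub_eq_zero] at h
    rw [← h] at this
    simp at this
  have key := (hasSum_boundaryDist (x := A 1) (y := A 2) (Y := A 0 * q) (c := 1 - (p : ℂ)⁻¹)
    (hs₀ s hs _ (by linarith)) (by rw [← mul_assoc]; exact hs₀ s hs _ (by linarith))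
    (by rw [← mul_assoc]; exact hs₀ s hs _ (by linarith))
    (by rw [← mul_assoc]; exact hs₀ s hs _ (by linarith))).mul_left (zetaFactor p s)
  -- Since α is trivial on the scalar p, the numerator 1 - p⁻¹A₁A₂(A₀q)² equals 1 - p^{-4s}, which
  -- `zetaFactor` cancels.
  have h1 : 1 - (1 - (1 - (p : ℂ)⁻¹)) * (A 1 * A 2 * (A 0 * q) ^ 2) = 1 - (p : ℂ) ^ (-(4 * s)) := by
    rw [← hq2]
    linear_combination (-(p : ℂ)⁻¹ * q ^ 2) * hα
  rw [h1, zetaFactor, inv_mul_cancel_left₀ hz] at key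
  have h2 := α.toHom_diagB 1 1 1
  have h3 := α.toHom_diagB 1 0 1
  have h4 := α.toHom_diagB 0 1 1
  have h5 := α.toHom_diagB 0 0 1
  simp only [pow_one, pow_zero, mul_one] at h2 h3 h4 h5
  have hL : spinL α (2 * s - 1 / 2) = (1 - A 0 * q)⁻¹ * (1 - A 1 * (A 0 * q))⁻¹ *
      (1 - A 2 * (A 0 * q))⁻¹ * (1 - A 1 * A 2 * (A 0 * q))⁻¹ := by
    rw [spinL, h2, h3, h4, h5, ← hA, ← hq]
    ring
  rw [hL]
  refine (congrArg (fun f => HasSum f _) (funext fun n => ?_)).mp key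
  rw [heckeEig, ← hX, zetaFactor]
  simp only [mul_pow]
  ring

/-! ### Absolute convergence -/

theorem summable_of_fibres {ι : Type*} {e : ι → ℕ} [∀ n, Fintype {i // e i = n}] {f : ι → ℝ}
    (hf : ∀ i, 0 ≤ f i) {b : ℕ → ℝ} (hb : ∀ n, ∑ i : {i // e i = n}, f i ≤ b n)
    (hs : Summable b) : Summable f := by
  rw [← (Equiv.sigmaFiberEquiv e).summable_iff]
  refine (summable_sigma_of_nonneg fun x => hf _).2 ⟨fun n => (hasSum_fintype _).summable, ?_⟩
  refine Summable.of_nonneg_of_le (fun n => tsum_nonneg fun _ => hf _) (fun n => ?_) hs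
  rw [tsum_fintype]
  exact hb n

/-- The shell of index n has at most (n + 1)²p^n terms, each at most a constant times (p²E p^{-2Re
s})^n. So summability holds once p³E p^{-2Re s} < 1. -/
theorem summable_coeffW {C E : ℝ} (hE : 0 ≤ E)
    (hWb : ∀ (d : PrimClass p D) (j : ℕ), ‖W (repM d j)‖ ≤ C * E ^ (j + d.cond)) :
    ∃ s₁ : ℝ, ∀ s : ℂ, s₁ < s.re → Summable fun x : PrimClass p D × ℕ => ‖coeffW W s x‖ := by
  obtain ⟨m, hm⟩ := pow_unbounded_of_one_lt ((p : ℝ) ^ 3 * E) (one_lt_prime_real (p := p))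
  refine ⟨m, fun s hs => ?_⟩
  have hp0 := prime_real_pos (p := p)
  set q : ℝ := (p : ℝ) ^ (-(2 * s.re)) with hq
  have hq0 : 0 < q := Real.rpow_pos_of_pos hp0 _
  set r : ℝ := (p : ℝ) ^ 3 * E * q with hr
  have hr0 : 0 ≤ r := by positivity
  have hr1 : r < 1 := by
    have h1 : q ≤ ((p : ℝ) ^ m)⁻¹ := by
      rw [← Real.rpow_natCast, ← Real.rpow_neg hp0.le]
      apply Real.rpow_le_rpow_of_exponent_le one_lt_prime_real.le
      have : (0 : ℝ) ≤ m := by positivity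
      linarith
    have hpm : (0 : ℝ) < (p : ℝ) ^ m := pow_pos hp0 m
    calc r ≤ (p : ℝ) ^ 3 * E * ((p : ℝ) ^ m)⁻¹ := by rw [hr]; gcongr
      _ < (p : ℝ) ^ m * ((p : ℝ) ^ m)⁻¹ := mul_lt_mul_of_pos_right hm (inv_pos.2 hpm)
      _ = 1 := mul_inv_cancel₀ hpm.ne'
  have hb : ∀ n, ∀ x : RepIdx p D n,
      ‖coeffW W s x.1‖ ≤ ‖zetaFactor p s‖ * |C| * ((p : ℝ) ^ 2 * E * q) ^ n := by
    intro n x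
    have hj : x.1.2 ≤ n := by have := x.2; omega
    have hx := hWb x.1.1 x.1.2
    rw [x.2] at hx
    rw [coeffW, x.2, prime_zpow_cpow, norm_mul, norm_mul, norm_mul, norm_zpow,
      Complex.norm_natCast_cpow_of_pos (Fact.out : p.Prime).pos, norm_pow, Complex.norm_natCast,
      zpow_neg, ← inv_zpow, ← Real.rpow_neg hp0.le, zpow_natCast]
    have h1 : (p : ℝ) ^ (-(2 * s).re) = q := by rw [hq]; simp
    rw [h1]
    calc _ ≤ ‖zetaFactor p s‖ * q ^ n * ((p : ℝ) ^ (2 * n) * (|C| * E ^ n)) := by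
          gcongr
          · exact one_lt_prime_real.le
          · exact hx.trans (by gcongr; exact le_abs_self C)
      _ = _ := by rw [mul_pow, mul_pow, pow_mul]; ring
  have hsum : ∀ n, ∑ x : RepIdx p D n, ‖coeffW W s x.1‖ ≤
      ‖zetaFactor p s‖ * |C| * (((n : ℝ) + 1) ^ 2 * r ^ n) := by
    intro n
    refine (Finset.sum_le_card_nsmul _ _ _ fun x _ => hb n x).trans ?_
    rw [nsmul_eq_mul, Finset.card_univ]
    have hcard : (Fintype.card (RepIdx p D n) : ℝ) ≤ ((n : ℝ) + 1) ^ 2 * (p : ℝ) ^ n := by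
      exact_mod_cast card_RepIdx_le (p := p) (D := D) n
    calc _ ≤ (((n : ℝ) + 1) ^ 2 * (p : ℝ) ^ n) *
          (‖zetaFactor p s‖ * |C| * ((p : ℝ) ^ 2 * E * q) ^ n) := by gcongr
      _ = _ := by
          rw [hr, show (p : ℝ) ^ 3 * E * q = p * ((p : ℝ) ^ 2 * E * q) by ring, mul_pow (p : ℝ)]
          ring
  refine summable_of_fibres (fun _ => norm_nonneg _) hsum ?_
  have hrn : ‖r‖ < 1 := by rwa [Real.norm_of_nonneg hr0]
  refine Summable.mul_left _ ?_
  have h2 := summable_pow_mul_geometric_of_norm_lt_one 2 hrn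
  have h1 := summable_pow_mul_geometric_of_norm_lt_one 1 hrn
  have h0 := summable_pow_mul_geometric_of_norm_lt_one 0 hrn
  refine ((h2.add (h1.mul_left 2)).add h0).congr fun n => ?_
  ring

end KohnenSkoruppa
end

noncomputable section
namespace KohnenSkoruppa

/-! ### Growth of spherical Whittaker functions: moderate growth -/

variable {p : ℕ} [Fact p.Prime] {D : ℤ}

theorem height_repM (d : PrimClass p D) (j : ℕ) :
    ‖(fun ij : Idx × Idx => mat (repM d j) ij.1 ij.2)‖ ^ 2 / ‖nu (repM d j)‖ =
      (p : ℝ) ^ (j + d.cond) := by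
  have h1 : ‖(fun ij : Idx × Idx => mat (repM d j) ij.1 ij.2)‖ = 1 := by
    refine le_antisymm ((pi_norm_le_iff_of_nonneg zero_le_one).2 fun ij => isInt_repM d j _ _) ?_
    rw [← d.norm_bottom j]
    refine (pi_norm_le_iff_of_nonneg (norm_nonneg _)).2 fun i => ?_
    rw [basisF, Matrix.single_one_vecMul]
    exact norm_le_pi_norm (fun ij : Idx × Idx => mat (repM d j) ij.1 ij.2) (Sum.inr 1, i)
  rw [h1, repM, nu_levi, norm_repNu, zpow_neg, one_pow, one_div, inv_inv]
  exact_mod_cast rfl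

theorem HasModerateGrowth.exists_bound {V : Type*} [AddCommGroup V] [Module ℂ V]
    {π : Representation ℂ (GSp4 p) V} {l : V →ₗ[ℂ] ℂ} {v : V} (h : HasModerateGrowth π l v) :
    ∃ C E : ℝ, 0 ≤ E ∧
      ∀ (d : PrimClass p D) (j : ℕ), ‖l (π (repM d j) v)‖ ≤ C * E ^ (j + d.cond) := by
  obtain ⟨C, A, hCA⟩ := h
  refine ⟨C, (p : ℝ) ^ A, Real.rpow_nonneg prime_real_pos.le _, fun d j => ?_⟩
  refine (hCA (repM d j)).trans_eq ?_
  rw [height_repM, ← Real.rpow_natCast, ← Real.rpow_natCast, ← Real.rpow_mul prime_real_pos.le,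
    ← Real.rpow_mul prime_real_pos.le, mul_comm A]

/-! ### Growth of spherical Whittaker functions: the anisotropic case -/

theorem norm_ne_zero_of_not_isSquare (hD : ¬ IsSquare (D : ℚ_[p])) {z : LAlg p D} (hz : z ≠ 0) :
    QuadraticAlgebra.norm z ≠ 0 := by
  intro h
  rw [QuadraticAlgebra.norm_def] at h
  have h2 : (2 : ℚ_[p]) ≠ 0 := two_ne_zero
  have him : z.im ≠ 0 := by
    intro him
    rw [him] at h
    exact hz (QuadraticAlgebra.ext (by simpa using h) him)
  apply hD
  by_cases h4 : D % 4 = 1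
  · refine ⟨(2 * z.re - z.im) / z.im, ?_⟩
    simp only [coeffA, coeffB, h4, if_true] at h
    field_simp
    linear_combination -4 * h
  · refine ⟨z.re / z.im, ?_⟩
    simp only [coeffA, coeffB, h4, if_false] at h
    field_simp
    linear_combination -h

/-- A primitive element has coordinates on the unit sphere of ℚ_p², which is compact. The norm form
does not vanish there when D is not a square, so its absolute value is bounded below. -/
theorem exists_cond_le (hD : ¬ IsSquare (D : ℚ_[p])) : ∃ M : ℕ, ∀ d : PrimClass p D, d.cond ≤ M := by
  have hcont : Continuous fun x : ℚ_[p] × ℚ_[p] =>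
      ‖QuadraticAlgebra.norm (⟨x.1, x.2⟩ : LAlg p D)‖ := by
    simp only [QuadraticAlgebra.norm_def]
    fun_prop
  have hprim : ∀ d : PrimClass p D, (d.elt.re, d.elt.im) ∈ Metric.sphere (0 : ℚ_[p] × ℚ_[p]) 1 := by
    intro d
    rw [mem_sphere_zero_iff_norm]
    refine le_antisymm (max_le d.isO.1 d.isO.2) ?_
    by_contra h
    push Not at h
    obtain ⟨h1, h2⟩ := max_lt_iff.1 h
    obtain ⟨a, ha, ha'⟩ := norm_lt_one_iff_exists h1
    obtain ⟨b, hb, hb'⟩ := norm_lt_one_iff_exists h2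
    apply d.prim
    have hp := prime_cast_ne_zero (p := p)
    constructor
    · rw [QuadraticAlgebra.re_smul, show d.elt.re = (p : ℚ_[p]) * a from ha', smul_eq_mul,
        inv_mul_cancel_left₀ hp]
      exact ha
    · rw [QuadraticAlgebra.im_smul, show d.elt.im = (p : ℚ_[p]) * b from hb', smul_eq_mul,
        inv_mul_cancel_left₀ hp]
      exact hb
  rcases isEmpty_or_nonempty (PrimClass p D) with hE | ⟨⟨d₀⟩⟩
  · exact ⟨0, fun d => (hE.false d).elim⟩
  obtain ⟨x, hx, hmin⟩ := (isCompact_sphere (0 : ℚ_[p] × ℚ_[p]) 1).exists_isMinOn ⟨_, hprim d₀⟩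
    hcont.continuousOn
  have hx0 : (⟨x.1, x.2⟩ : LAlg p D) ≠ 0 := by
    intro h
    have h1 : x.1 = 0 := congrArg QuadraticAlgebra.re h
    have h2 : x.2 = 0 := congrArg QuadraticAlgebra.im h
    rw [show x = 0 from Prod.ext h1 h2] at hx
    simp at hx
  obtain ⟨M, hM⟩ := norm_eq_zpow (norm_ne_zero_of_not_isSquare hD hx0)
  refine ⟨M.toNat, fun d => ?_⟩
  have h := hmin (hprim d)
  change ‖QuadraticAlgebra.norm (⟨x.1, x.2⟩ : LAlg p D)‖ ≤ ‖QuadraticAlgebra.norm d.elt‖ at h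
  rw [hM, d.norm_norm, zpow_prime_le] at h
  omega

theorem finite_primClass (hD : ¬ IsSquare (D : ℚ_[p])) : Finite (PrimClass p D) := by
  obtain ⟨M, hM⟩ := exists_cond_le hD
  refine Finite.of_injective (β := Σ n : Fin (M + 1), RepIdx p D n)
    (fun d => ⟨⟨d.cond, Nat.lt_succ_of_le (hM d)⟩, (d, 0), by simp⟩) fun d e h => ?_
  exact congrArg (fun x : Σ n : Fin (M + 1), RepIdx p D n => x.2.1.1) h

theorem norm_smul_star_ne_zero {t : LAlg p D} (ht : QuadraticAlgebra.norm t ≠ 0) (j : ℤ) :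
    QuadraticAlgebra.norm ((p : ℚ_[p]) ^ j • star t) ≠ 0 :=
  norm_smul_ne_zero (zpow_ne_zero _ prime_cast_ne_zero) (by rwa [norm_star_L])

/-- The element `diag(p ^ j t̄, t)` of `GL*_{2,L}`. -/
def torM (t : LAlg p D) (ht : QuadraticAlgebra.norm t ≠ 0) (j : ℤ) : GSp4 p :=
  levi (mulGL ((p : ℚ_[p]) ^ j • star t) (norm_smul_star_ne_zero ht j))
    (Units.mk0 ((p : ℚ_[p]) ^ j * QuadraticAlgebra.norm t)
      (mul_ne_zero (zpow_ne_zero _ prime_cast_ne_zero) ht))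

theorem mat_torM (t : LAlg p D) (ht : QuadraticAlgebra.norm t ≠ 0) (j : ℤ) :
    mat (torM t ht j) = embM !![(p : ℚ_[p]) ^ j • star t, 0; 0, t] := by
  have h1 := mul_linv (norm_smul_star_ne_zero ht j)
  have h2 := QuadraticAlgebra.algebraMap_norm_eq_mul_star t
  have h3 : ((p : ℚ_[p]) ^ j • star t) * t =
      algebraMap ℚ_[p] (LAlg p D) ((p : ℚ_[p]) ^ j * QuadraticAlgebra.norm t) := by
    rw [map_mul, h2, ← Algebra.smul_def, smul_mul_assoc, mul_comm]
  have h4 : ((p : ℚ_[p]) ^ j * QuadraticAlgebra.norm t) • linv ((p : ℚ_[p]) ^ j • star t) = t := by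
    rw [Algebra.smul_def, ← h3]
    linear_combination t * h1
  rw [torM, mat_levi_mulGL, Units.val_mk0, h4]

theorem repM_eq_torM (d : PrimClass p D) (j : ℤ) : repM d j = torM d.elt d.norm_ne j := rfl

theorem norm_mul_ne_zero {s t : LAlg p D} (hs : QuadraticAlgebra.norm s ≠ 0)
    (ht : QuadraticAlgebra.norm t ≠ 0) : QuadraticAlgebra.norm (s * t) ≠ 0 := by
  rw [map_mul]; exact mul_ne_zero hs ht

theorem torM_mul {s t : LAlg p D} (hs : QuadraticAlgebra.norm s ≠ 0)
    (ht : QuadraticAlgebra.norm t ≠ 0) (i j : ℤ) :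
    torM s hs i * torM t ht j = torM (s * t) (norm_mul_ne_zero hs ht) (i + j) := by
  apply mat_injective
  rw [mat_mul, mat_torM, mat_torM, mat_torM, ← embM_mul]
  congr 1
  have : (p : ℚ_[p]) ^ i • star s * (p : ℚ_[p]) ^ j • star t = (p : ℚ_[p]) ^ (i + j) • star (s * t) := by
    rw [star_mul, smul_mul_smul_comm, zpow_add₀ prime_cast_ne_zero, mul_comm (star t)]
  ext1 a b
  fin_cases a <;> fin_cases b <;> simp [Matrix.mul_apply, this]

theorem torM_congr {s t : LAlg p D} (h : s = t) (hs : QuadraticAlgebra.norm s ≠ 0)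
    (ht : QuadraticAlgebra.norm t ≠ 0) (j : ℤ) : torM s hs j = torM t ht j := by
  subst h; rfl

theorem scal_mul_torM (c : ℚ_[p]ˣ) {t : LAlg p D} (ht : QuadraticAlgebra.norm t ≠ 0) (j : ℤ) :
    scal c * torM t ht j = torM ((c : ℚ_[p]) • t) (norm_smul_ne_zero c.ne_zero ht) j := by
  apply mat_injective
  rw [mat_mul, mat_torM, mat_torM, mat_scal, smul_mul_assoc, one_mul, ← embM_smul]
  congr 1
  ext1 a b
  fin_cases a <;> fin_cases b <;> simp [star_smul_L, smul_comm (c : ℚ_[p])]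

theorem torM_mem_maxCompact {ε : LAlg p D} (hε : IsUnitO ε) : torM ε hε.norm_ne 0 ∈ maxCompact p := by
  have h1 : IsUnitO ((p : ℚ_[p]) ^ (0 : ℤ) • star ε) := by rw [zpow_zero, one_smul]; exact hε.star
  exact levi_mem_maxCompact.2 ⟨h1.mulGL_mem, by
    rw [Units.val_mk0, zpow_zero, one_mul]; exact hε.2⟩

namespace IsSphericalWhittaker

variable {ψ : AddChar ℚ_[p] ℂ} {W : GSp4 p → ℂ}

/-- Conjugation by diag(t̄, t) scales `yForm` by ν⁻¹N(t̄) = 1, so it fixes χ. The Hecke identity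
therefore also holds for translates of W by this torus. -/
theorem translate_torM (hW : IsSphericalWhittaker D ψ W) {t : LAlg p D}
    (ht : QuadraticAlgebra.norm t ≠ 0) : IsSphericalWhittaker D ψ fun g => W (torM t ht 0 * g) where
  unip x g := by
    rw [← mul_assoc, torM, levi_mul_uni, mul_assoc, hW.unip, yForm_smul, mulGL_val, yForm_symAct,
      norm_smul_L, norm_star_L, Units.val_mk0]
    congr 2
    rw [zpow_zero, one_mul, one_mul, one_mul, inv_mul_cancel_left₀ ht]
  cent c g := by
    have h := Subgroup.mem_center_iff.1 (scal_mem c) (torM t ht 0)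
    rw [← mul_assoc, h, mul_assoc, hW.cent]
  right g k hk := by rw [← mul_assoc, hW.right _ _ hk]

theorem exists_eq_repM (hW : IsSphericalWhittaker D ψ W) {t : LAlg p D}
    (ht : QuadraticAlgebra.norm t ≠ 0) :
    ∃ d : PrimClass p D, W (torM t ht 0) = W (repM d 0) := by
  obtain ⟨d, k, ε, hε, h⟩ := PrimClass.exists_eq ht
  refine ⟨d, ?_⟩
  let c : ℚ_[p]ˣ := Units.mk0 ((p : ℚ_[p]) ^ k) (zpow_ne_zero _ prime_cast_ne_zero)
  have e : torM t ht 0 = scal c * (repM d 0 * torM ε hε.norm_ne 0) := by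
    rw [repM_eq_torM, torM_mul, scal_mul_torM]
    exact torM_congr (by rw [h, mul_comm ε]; rfl) _ _ _
  rw [e, hW.cent, hW.right _ _ (torM_mem_maxCompact hε)]

end IsSphericalWhittaker

theorem PrimClass.eq_of_cond_eq_zero {d e : PrimClass p D} (hd : d.cond = 0) (he : e.cond = 0) :
    d = e := by
  have hu : ∀ d : PrimClass p D, d.cond = 0 → IsUnitO d.elt := fun d hd =>
    ⟨d.isO, by rw [d.norm_norm, hd]; simp⟩
  refine (PrimClass.eq_of_smul (c := 1) ((hu d hd).mul (hu e he).linv) ?_).1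
  have := mul_linv (hu e he).norm_ne
  rw [one_smul]
  linear_combination -d.elt * this

theorem exists_cond_eq_zero (p : ℕ) [Fact p.Prime] (D : ℤ) : ∃ d : PrimClass p D, d.cond = 0 := by
  have hp := prime_cast_ne_zero (p := p)
  obtain ⟨d, k, ε, hε, h⟩ := PrimClass.exists_eq (p := p) (D := D) (t := 1) (by simp)
  refine ⟨d, ?_⟩
  have hN := congrArg (fun z => ‖QuadraticAlgebra.norm z‖) h
  simp only [norm_smul_L, map_mul, norm_mul, hε.2, d.norm_norm, norm_prime_zpow, map_one,
    norm_one, one_mul] at hN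
  rw [← zpow_add₀ prime_real_pos.ne', ← zpow_add₀ prime_real_pos.ne', ← zpow_zero (p : ℝ),
    zpow_prime_inj] at hN
  by_contra hc
  apply d.prim
  have e : d.elt = (p : ℚ_[p]) ^ (-k) • linv ε := by
    have h1 := mul_linv hε.norm_ne
    have h2 : linv ε = (p : ℚ_[p]) ^ k • d.elt := by
      calc linv ε = linv ε * 1 := (mul_one _).symm
        _ = (p : ℚ_[p]) ^ k • (ε * linv ε * d.elt) := by
            rw [h, mul_smul_comm]; congr 1; ring
        _ = _ := by rw [h1, one_mul]
    rw [h2, smul_smul, ← zpow_add₀ hp, neg_add_cancel, zpow_zero, one_smul]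
  rw [e, smul_smul, ← zpow_neg_one, ← zpow_add₀ hp]
  refine hε.linv.1.smul ?_
  rw [norm_prime_zpow, ← zpow_zero (p : ℝ), zpow_prime_le]
  omega

/-- Induction on n. The Hecke identity of degree n, applied to a torus translate of W, contains a
single term with j = n; the other terms, at most as many as there are classes d, have smaller j. The
case n = 0 takes finitely many values because W on the torus depends only on the class of t. -/
theorem IsSphericalWhittaker.exists_bound (hsq : Squarefree D) {ψ : AddChar ℚ_[p] ℂ}
    (hψ : HasConductorOne ψ) {W : GSp4 p → ℂ} (hW : IsSphericalWhittaker D ψ W)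
    (hD : ¬ IsSquare (D : ℚ_[p])) {c : ℕ → ℂ} (hc : ∀ g n, ∑ h, W (g * heckeRep n h) = c n * W g)
    {C Λ : ℝ} (hC : 0 ≤ C) (hΛ : 0 ≤ Λ) (hcn : ∀ n, ‖c n‖ ≤ C * Λ ^ n) :
    ∃ B E : ℝ, 0 ≤ E ∧
      ∀ (d : PrimClass p D) (j : ℕ), ‖W (repM d j)‖ ≤ B * E ^ (j + d.cond) := by
  classical
  have hfin := finite_primClass hD
  let := Fintype.ofFinite (PrimClass p D)
  obtain ⟨u, hu⟩ := exists_cond_eq_zero p D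
  set P : ℝ := ((Fintype.card (PrimClass p D) : ℕ) : ℝ) with hP
  set B : ℝ := ∑ d : PrimClass p D, ‖W (repM d 0)‖ with hB
  have hP0 : 0 ≤ P := by positivity
  have hB0 : 0 ≤ B := by positivity
  -- Chosen so that Cλ + P ≤ E with λ = Λ closes the recursion, and Λ ≤ E lets Λ^n be bounded by Λ
  -- E^{n-1}.
  set E : ℝ := C * Λ + Λ + P + 1 with hE
  have hCΛ : 0 ≤ C * Λ := by positivity
  have hE1 : 1 ≤ E := by linarith
  have hEΛ : Λ ≤ E := by linarith
  have hEC : C * Λ + P ≤ E := by linarith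
  have hp1 : (1 : ℝ) ≤ p := one_lt_prime_real.le
  -- On a fixed shell j is determined by d, so there are no more terms than classes, uniformly in n.
  have hcard : ∀ n, (Fintype.card (RepIdx p D n) : ℝ) ≤ P := by
    intro n
    have : Function.Injective fun x : RepIdx p D n => x.1.1 := by
      intro x y h
      have hx := x.2
      have hy := y.2
      have h' : x.1.1 = y.1.1 := h
      rw [h'] at hx
      exact Subtype.ext (Prod.ext h' (by omega))
    exact Nat.cast_le.2 (Fintype.card_le_of_injective _ this)
  have h0 : ∀ (t : LAlg p D) (ht : QuadraticAlgebra.norm t ≠ 0), ‖W (torM t ht 0)‖ ≤ B := by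
    intro t ht
    obtain ⟨d, hd⟩ := hW.exists_eq_repM ht
    rw [hd]
    exact Finset.single_le_sum (f := fun d : PrimClass p D => ‖W (repM d 0)‖)
      (fun _ _ => norm_nonneg _) (Finset.mem_univ d)
  have main : ∀ (n : ℕ) (t : LAlg p D) (ht : QuadraticAlgebra.norm t ≠ 0),
      ‖W (torM t ht n)‖ ≤ B * E ^ n := by
    intro n
    induction n using Nat.strong_induction_on with
    | _ n ih =>
    intro t ht
    rcases n.eq_zero_or_pos with rfl | hn
    · simpa using h0 t ht
    have hlu : QuadraticAlgebra.norm (linv u.elt) ≠ 0 := by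
      rw [norm_linv u.norm_ne]; exact inv_ne_zero u.norm_ne
    have ht' := norm_mul_ne_zero ht hlu
    have hsum := (hW.translate_torM ht').sum_heckeRep hsq hψ n
    rw [hc] at hsum
    have hmul : ∀ x : RepIdx p D n, torM (t * linv u.elt) ht' 0 * repM x.1.1 x.1.2 =
        torM (t * linv u.elt * x.1.1.elt) (norm_mul_ne_zero ht' x.1.1.norm_ne) x.1.2 := by
      intro x
      rw [repM_eq_torM, torM_mul, zero_add]
    simp only [hmul] at hsum
    -- The index of the class u of units with j = n. Translating by t u⁻¹ makes its term W(diag(p^n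
    -- t̄, t)), the quantity to be bounded.
    let x₀ : RepIdx p D n := ⟨(u, n), by simp [hu]⟩
    rw [← Finset.add_sum_erase _ _ (Finset.mem_univ x₀)] at hsum
    have hx₀ : torM (t * linv u.elt * x₀.1.1.elt) (norm_mul_ne_zero ht' x₀.1.1.norm_ne) x₀.1.2 =
        torM t ht n := torM_congr (by
      have := mul_linv u.norm_ne
      change t * linv u.elt * u.elt = t
      linear_combination t * this) _ _ _
    rw [hx₀] at hsum
    change _ = (p : ℂ) ^ (n + 2 * n) * W (torM t ht n) + _ at hsum
    have hrest : ∀ x ∈ Finset.univ.erase x₀, ‖(p : ℂ) ^ (n + 2 * x.1.2) *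
        W (torM (t * linv u.elt * x.1.1.elt) (norm_mul_ne_zero ht' x.1.1.norm_ne) x.1.2)‖ ≤
        (p : ℝ) ^ (n + 2 * n) * (B * E ^ (n - 1)) := by
      intro x hx
      have hlt : x.1.2 < n := by
        have hx2 := x.2
        by_contra hge
        have hj : x.1.2 = n := by omega
        have hcond : x.1.1.cond = 0 := by omega
        exact (Finset.mem_erase.1 hx).1
          (Subtype.ext (Prod.ext (PrimClass.eq_of_cond_eq_zero hcond hu) hj))
      rw [norm_mul, norm_pow, Complex.norm_natCast]
      gcongr
      exact (ih _ hlt _ _).trans (by gcongr; omega)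
    have hS := (_root_.norm_sum_le_of_le _ hrest).trans_eq (Finset.sum_const _)
    rw [nsmul_eq_mul] at hS
    have hcard' : ((Finset.univ.erase x₀).card : ℝ) ≤ P :=
      le_trans (by exact_mod_cast Finset.card_le_card (Finset.erase_subset _ _)) (hcard n)
    have hpn : (1 : ℝ) ≤ (p : ℝ) ^ (n + 2 * n) := one_le_pow₀ hp1
    have hW1 := h0 _ ht'
    have hkey : (p : ℝ) ^ (n + 2 * n) * ‖W (torM t ht n)‖ ≤
        (p : ℝ) ^ (n + 2 * n) * (B * E ^ n) := by
      have e1 : (p : ℂ) ^ (n + 2 * n) * W (torM t ht n) = c n * W (torM (t * linv u.elt) ht' 0) -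
          ∑ x ∈ Finset.univ.erase x₀, (p : ℂ) ^ (n + 2 * x.1.2) *
          W (torM (t * linv u.elt * x.1.1.elt) (norm_mul_ne_zero ht' x.1.1.norm_ne) x.1.2) := by
        rw [hsum]; ring
      have e2 : (p : ℝ) ^ (n + 2 * n) * ‖W (torM t ht n)‖ =
          ‖(p : ℂ) ^ (n + 2 * n) * W (torM t ht n)‖ := by
        rw [norm_mul, norm_pow, Complex.norm_natCast]
      have hEn : 0 ≤ E ^ (n - 1) := by positivity
      have hsucc : E ^ n = E * E ^ (n - 1) := by rw [← pow_succ', Nat.sub_add_cancel hn]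
      have hΛn : Λ ^ n ≤ Λ * E ^ (n - 1) := by
        rw [← Nat.sub_add_cancel hn, pow_succ', Nat.add_sub_cancel]
        gcongr
      rw [e2, e1]
      calc _ ≤ ‖c n * W (torM (t * linv u.elt) ht' 0)‖ + _ := norm_sub_le _ _
        _ ≤ (C * (Λ * E ^ (n - 1))) * B + P * ((p : ℝ) ^ (n + 2 * n) * (B * E ^ (n - 1))) := by
            rw [norm_mul]
            refine add_le_add (mul_le_mul ((hcn n).trans (by gcongr)) hW1 (norm_nonneg _)
              (by positivity)) (hS.trans (by gcongr))
        _ ≤ (p : ℝ) ^ (n + 2 * n) * ((C * (Λ * E ^ (n - 1))) * B) +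
            P * ((p : ℝ) ^ (n + 2 * n) * (B * E ^ (n - 1))) := by
            refine add_le_add_left (le_mul_of_one_le_left ?_ hpn) _
            positivity
        _ = (p : ℝ) ^ (n + 2 * n) * (B * ((C * Λ + P) * E ^ (n - 1))) := by ring
        _ ≤ _ := by rw [hsucc]; gcongr
    exact le_of_mul_le_mul_left hkey (by linarith)
  refine ⟨B, E, by linarith, fun d j => ?_⟩
  rw [repM_eq_torM]
  exact (main j _ _).trans (by gcongr; omega)

/-- The Hecke eigenvalues grow at most exponentially. -/
theorem exists_norm_heckeEig_le {α : UnramifiedCharacter p}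
    (hα : α.param 0 ^ 2 * α.param 1 * α.param 2 = 1) :
    ∃ C Λ : ℝ, 0 ≤ C ∧ 0 ≤ Λ ∧ ∀ n, ‖heckeEig α n‖ ≤ C * Λ ^ n := by
  obtain ⟨s₀, h0, h⟩ := hasSum_heckeEig hα
  have hp : (p : ℂ) ≠ 0 := by exact_mod_cast (Fact.out : p.Prime).ne_zero
  set s : ℂ := ((s₀ + 1 : ℝ) : ℂ) with hs
  have hsre : s.re = s₀ + 1 := Complex.ofReal_re _
  -- At one real point of convergence the terms of the generating series are bounded, which bounds
  -- the eigenvalues exponentially.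
  have h1 := (h s (by rw [hsre]; linarith)).summable.tendsto_atTop_zero
  obtain ⟨K, hK⟩ := (Metric.isBounded_range_of_tendsto _ h1).exists_norm_le
  have hz : zetaFactor p s ≠ 0 := by
    have h2 := norm_prime_cpow_lt_one (p := p) (w := 4 * s) (by simp [hsre]; linarith)
    rw [zetaFactor]
    refine inv_ne_zero fun h3 => ?_
    rw [sub_eq_zero] at h3
    rw [← h3] at h2
    simp at h2
  set X : ℂ := ((p : ℂ) ^ (2 * s))⁻¹ * (p : ℂ)⁻¹ with hX
  have hX0 : X ≠ 0 := mul_ne_zero (inv_ne_zero (by simp [Complex.cpow_eq_zero_iff, hp]))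
    (inv_ne_zero hp)
  refine ⟨|K| * ‖zetaFactor p s‖⁻¹, ‖X‖⁻¹, by positivity, by positivity, fun n => ?_⟩
  have h3 := (hK _ ⟨n, rfl⟩).trans (le_abs_self K)
  rw [norm_mul, norm_mul, norm_pow] at h3
  have h4 : 0 < ‖zetaFactor p s‖ := norm_pos_iff.2 hz
  have h5 : 0 < ‖X‖ ^ n := pow_pos (norm_pos_iff.2 hX0) n
  rw [inv_pow, mul_assoc, ← mul_inv, ← div_eq_mul_inv, le_div_iff₀ (by positivity)]
  linarith

end KohnenSkoruppa
end

theorem theorem3p2 (p : ℕ) [Fact p.Prime] (D : ℤ) (hD : Squarefree D)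
    (ψ : AddChar ℚ_[p] ℂ) (hψ : HasConductorOne ψ)
    -- the invariant measures on `N \ U`, on `U Z \ GSp₄` and on `N Z \ GL*_{2,L}`
    (μNU : Measure (RightQuot ((unipN p D).subgroupOf (unipU p))))
    (hμNU : IsInvariantMeasure _ ((maxCompact p).subgroupOf (unipU p)) μNU)
    (μI : Measure (RightQuot (unipU p ⊔ centre p)))
    (hμI : IsInvariantMeasure _ (maxCompact p) μI)
    (μJ : Measure (RightQuot ((unipN p D ⊔ centre p).subgroupOf (gl2L p D))))
    (hμJ : IsInvariantMeasure _ ((maxCompact p).subgroupOf (gl2L p D)) μJ)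
    -- `π` is the unramified irreducible subquotient of `ind_B^G(δ_B^{1/2} α)`, with trivial
    -- central character, and `v₀` is a nonzero spherical vector
    {V : Type*} [AddCommGroup V] [Module ℂ V] (π : Representation ℂ (GSp4 p) V)
    (hirr : π.IsIrreducible) (α : UnramifiedCharacter p) (hα : IsSubquotientOfInduced π α)
    (hcentral : ∀ z ∈ centre p, π z = 1)
    (v₀ : V) (hv₀ : v₀ ≠ 0) (hsph : ∀ k ∈ maxCompact p, π k v₀ = v₀) :
    ∃ s₀ : ℝ, ∀ l : V →ₗ[ℂ] ℂ, IsUChiFunctional D ψ π l →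
      (∀ s : ℂ, s₀ < s.re →
        HasShellIntegral μI (fun x => tau x.rep) p
          (fun x => integrandI D ψ μNU π l v₀ s x.rep) (l v₀ * spinL α (2 * s - 1 / 2)) ∧
        HasShellIntegral μJ (fun x => tau (x.rep : GSp4 p)) p
          (fun x => integrandJ π l v₀ s (x.rep : GSp4 p)) (l v₀ * spinL α (2 * s - 1 / 2)) ∧
        (Integrable (fun x => integrandI D ψ μNU π l v₀ s x.rep) μI →
          ∫ x, integrandI D ψ μNU π l v₀ s x.rep ∂μI = l v₀ * spinL α (2 * s - 1 / 2)) ∧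
        (Integrable (fun x => integrandJ π l v₀ s (x.rep : GSp4 p)) μJ →
          ∫ x, integrandJ π l v₀ s (x.rep : GSp4 p) ∂μJ = l v₀ * spinL α (2 * s - 1 / 2))) ∧
      ((¬ IsSquare (D : ℚ_[p]) ∨ HasModerateGrowth π l v₀) →
        ∃ s₁ : ℝ, ∀ s : ℂ, s₁ < s.re →
          Integrable (fun x => integrandI D ψ μNU π l v₀ s x.rep) μI ∧
          Integrable (fun x => integrandJ π l v₀ s (x.rep : GSp4 p)) μJ) := by
  obtain ⟨heig, hparam⟩ := sum_heckeRep_spherical hα hcentral hv₀ hsph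
  obtain ⟨s₀, h0, hL⟩ := hasSum_heckeEig hparam
  refine ⟨s₀, fun l hl => ?_⟩
  have hW := isSphericalWhittaker hcentral hsph hl
  have hc : ∀ g n, ∑ h, l (π (g * heckeRep n h) v₀) = heckeEig α n * l (π g v₀) := fun g n => by
    have := congrArg (fun v => l (π g v)) (heig n)
    simpa only [map_sum, map_smul, smul_eq_mul, ← Module.End.mul_apply, ← map_mul] using this
  have hI := fun s hs => integralI_of_coeffW (s := s) hD hψ hμNU hμI hW hs rfl
  have hJ := fun s hs => integralJ_of_coeffW (s := s) hD hψ hμJ hW hs rfl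
  refine ⟨fun s hs => ?_, fun h => ?_⟩
  · have hs0 : 0 < s.re := h0.trans_lt hs
    -- By the Hecke eigenvalue relation at g = 1, the n-th shell sum is ℓ(v₀) times the n-th term of
    -- the generating series of the Spin L-function.
    have hsum : HasSum (fun n => ∑ x : RepIdx p D n, coeffW (fun g => l (π g v₀)) s x.1)
        (l v₀ * spinL α (2 * s - 1 / 2)) := by
      refine (congrArg (fun f => HasSum f _) (funext fun n => ?_)).mp ((hL s hs).mul_left (l v₀))
      rw [sum_coeffW hD hψ hW]
      have := hc 1 n
      simp only [one_mul, map_one, Module.End.one_apply] at this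
      rw [this]
      ring
    exact ⟨((hI s hs0).1 _ hsum).1, ((hJ s hs0).1 _ hsum).1, ((hI s hs0).1 _ hsum).2,
      ((hJ s hs0).1 _ hsum).2⟩
  · obtain ⟨C, E, hE, hb⟩ : ∃ C E : ℝ, 0 ≤ E ∧ ∀ (d : PrimClass p D) (j : ℕ),
        ‖l (π (repM d j) v₀)‖ ≤ C * E ^ (j + d.cond) := by
      rcases h with h | h
      · obtain ⟨C, Λ, hC, hΛ, hle⟩ := exists_norm_heckeEig_le hparam
        exact hW.exists_bound hD hψ h hc hC hΛ hle
      · exact h.exists_bound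
    obtain ⟨s₁, hs₁⟩ := summable_coeffW (W := fun g => l (π g v₀)) hE hb
    refine ⟨max s₁ 0, fun s hs => ?_⟩
    obtain ⟨h1, h2⟩ := max_lt_iff.1 hs
    exact ⟨(hI s h2).2 (hs₁ s h1), (hJ s h2).2 (hs₁ s h1)⟩
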